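/- **Theorem.** Let $\mathfrak g$ be a finite-dimensional real Lie algebra with an invariant, non-degenerate, symmetric bilinear form $B$. Let $e_a$ be a basis of $\mathfrak g$, let $e^a$ be the basis with $B(e^a,e_b)=\delta^a_b$, and put $f_{abc}=B(e_a,[e_b,e_c])$. We sum over repeated indices. *Weil algebra.* $W\mathfrak g=S\mathfrak g\otimes\wedge\mathfrak g$, with $L_\xi$ the derivation extension of the adjoint representation, $\iota_\xi=1\otimes\iota_\xi$ where $\iota_\xi\eta=B(\xi,\eta)$ for $\eta\in\mathfrak g\subset\wedge\mathfrak g$, and $d^W$ the odd derivation with $$d^W(1\otimes\xi)=\xi\otimes 1+1\otimes\tfrac12\, e^a\wedge[e_a,\xi],\qquad d^W(\xi\otimes 1)=[e_a,\xi]\otimes e^a .$$ *Non-commutative Weil algebra.* $\mathcal W\mathfrak g=U\mathfrak g\otimes \mathrm{Cl}(\mathfrak g)$, where $\mathrm{Cl}(\mathfrak g)$ has the relations $\xi\eta+\eta\xi=B(\xi,\eta)$. Here $L_\xi$ is the derivation extension of the adjoint representation, $\iota_\xi=[1\otimes\xi,\cdot\,]$ and $d^{\mathcal W}=[\mathcal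 D,\cdot\,]$ (graded commutators) with $\mathcal D=e_a\otimes e^a-1\otimes\tfrac16 f_{abc}e^ae^be^c$. *Quantization map.* Let $j(z)=\frac{\sinh(z/2)}{z/2}$, $f=(\ln j)'$, $J(\xi)=\det j(\mathrm{ad}_\xi)$, and $$\mathcal S^{\mathfrak g}(\xi)=J^{1/2}(\xi)\,\exp\!\big(\tfrac12\, B(e_a,f(\mathrm{ad}_\xi)e_b)\,e^a\wedge e^b\big)\in\wedge\mathfrak g ,$$ taken as a Taylor series at $\xi=0$, where $J^{1/2}(0)=1$. Let $\iota(\widehat{\mathcal S^{\mathfrak g}})$ be the operator on $W\mathfrak g$ in which the $\wedge\mathfrak g$-coefficients act on $\wedge\mathfrak g$ by contraction (through the algebra homomorphism $\wedge\mathfrak g\to\mathrm{End}(\wedge\mathfrak g)$ extending $\xi\mapsto\iota_\xi$), and the coordinates $\xi^a$ act on $S\mathfrak g\subset C^\infty(\mathfrak g^*)$ as the partial derivatives $\partial/\partial e_a$. Put $$\mathcal Q=(\mathrm{sym}\otimes q)\circ\iota(\widehat{\mathcal S^{\mathfrak g}}):\ W\mathfrak g\to\mathcal W\mathfrak g,$$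 where $\mathrm{sym}:S\mathfrak g\to U\mathfrak g$ is symmetrization and $q:\wedge\mathfrak g\to\mathrm{Cl}(\mathfrak g)$ is antisymmetrization. *Equivariant cohomology.* A $\mathfrak g$-differential algebra is a $\mathbb Z/2$-graded associative unital real algebra $\mathcal A$ with odd derivations $d$ and $\iota_\xi$ and even derivations $L_\xi$ ($\xi\in\mathfrak g$; $\iota_\xi$ and $L_\xi$ linear in $\xi$) satisfying $$d^2=0,\quad [\iota_\xi,\iota_\eta]=0,\quad [L_\xi,L_\eta]=L_{[\xi,\eta]},\quad [L_\xi,\iota_\eta]=\iota_{[\xi,\eta]},\quad [L_\xi,d]=0,\quad [\iota_\xi,d]=L_\xi$$ (graded commutators). Let $H_{\mathfrak g}(\mathcal A)$ and $\mathcal H_{\mathfrak g}(\mathcal A)$ be the cohomology algebras of the basic subcomplexes (the elements annihilated by all total $\iota_\xi$ and $L_\xi$) of the $\mathbb Z/2$-graded tensor products $W\mathfrak g\otimes\mathcal A$ and $\mathcal W\mathfrak g\otimes\mathcal A$, with the total differential. Then for every $\mathfrak g$-differential algebra $\mathcal A$, the map $\mathcal Q\otimes 1$ sends basic cocycles of $W\mathfrak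 g\otimes\mathcal A$ to basic cocycles of $\mathcal W\mathfrak g\otimes\mathcal A$, and the induced map $$\mathcal Q: H_{\mathfrak g}(\mathcal A)\to\mathcal H_{\mathfrak g}(\mathcal A)$$ is well defined, a vector space isomorphism, and in fact an isomorphism of algebras. Moreover (Duflo's theorem for quadratic Lie algebras, the case of trivial $\mathcal A$), the map $\mathrm{sym}\circ\widehat{J^{1/2}}:S\mathfrak g\to U\mathfrak g$ restricts to an algebra isomorphism from the invariants $(S\mathfrak g)^{\mathfrak g}$ onto the center of $U\mathfrak g$. -/

import Mathlib

open scoped TensorProduct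

noncomputable section

namespace WeilQuant

theorem zmod_two (i : ZMod 2) : i = 0 ∨ i = 1 := by
  revert i
  decide

section Super

variable {A : Type*} [Ring A] [Algebra ℝ A] (𝒜 : ZMod 2 → Submodule ℝ A) [GradedAlgebra 𝒜]

/-- The parity operator of a `ℤ/2`-graded algebra: `x ↦ (-1) ^ |x| x`, that is, `+1` on the even
part `𝒜 0` and `-1` on the odd part `𝒜 1`. -/
def parity : A →ₗ[ℝ] A := GradedAlgebra.proj 𝒜 0 - GradedAlgebra.proj 𝒜 1

variable {𝒜}

theorem parity_even {x : A} (h : x ∈ 𝒜 0) : parity 𝒜 x = x := by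
  simp [parity, GradedAlgebra.proj_apply, DirectSum.decompose_of_mem_same 𝒜 h,
    DirectSum.decompose_of_mem_ne 𝒜 h (show (0 : ZMod 2) ≠ 1 by decide)]

theorem parity_odd {x : A} (h : x ∈ 𝒜 1) : parity 𝒜 x = -x := by
  simp [parity, GradedAlgebra.proj_apply, DirectSum.decompose_of_mem_same 𝒜 h,
    DirectSum.decompose_of_mem_ne 𝒜 h (show (1 : ZMod 2) ≠ 0 by decide)]

variable (𝒜)

theorem super_induction {p : A → Prop} (he : ∀ x ∈ 𝒜 0, p x) (ho : ∀ x ∈ 𝒜 1, p x)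
    (hadd : ∀ x y, p x → p y → p (x + y)) (x : A) : p x := by
  refine DirectSum.Decomposition.inductionOn 𝒜 ?_ ?_ hadd x
  · exact he 0 (zero_mem _)
  · intro i m
    fin_cases i
    · exact he _ m.2
    · exact ho _ m.2

theorem parity_mul (x y : A) : parity 𝒜 (x * y) = parity 𝒜 x * parity 𝒜 y := by
  induction x using super_induction 𝒜 with
  | hadd a b ha hb => simp only [add_mul, map_add, ha, hb]
  | he x hx =>
    induction y using super_induction 𝒜 with
    | hadd a b ha hb => simp only [mul_add, map_add, ha, hb]
    | he y hy =>
      have : x * y ∈ 𝒜 0 := by simpa using SetLike.mul_mem_graded hx hy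
      rw [parity_even this, parity_even hx, parity_even hy]
    | ho y hy =>
      have : x * y ∈ 𝒜 1 := by simpa using SetLike.mul_mem_graded hx hy
      rw [parity_odd this, parity_even hx, parity_odd hy, mul_neg]
  | ho x hx =>
    induction y using super_induction 𝒜 with
    | hadd a b ha hb => simp only [mul_add, map_add, ha, hb]
    | he y hy =>
      have : x * y ∈ 𝒜 1 := by simpa using SetLike.mul_mem_graded hx hy
      rw [parity_odd this, parity_odd hx, parity_even hy, neg_mul]
    | ho y hy =>
      have : x * y ∈ 𝒜 0 := by
        have := SetLike.mul_mem_graded hx hy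
        rwa [show (1 : ZMod 2) + 1 = 0 by decide] at this
      rw [parity_even this, parity_odd hx, parity_odd hy, neg_mul_neg]

theorem parity_one : parity 𝒜 1 = 1 := parity_even (SetLike.one_mem_graded 𝒜)

theorem parity_parity (x : A) : parity 𝒜 (parity 𝒜 x) = x := by
  induction x using super_induction 𝒜 with
  | hadd a b ha hb => simp only [map_add, ha, hb]
  | he x hx => rw [parity_even hx, parity_even hx]
  | ho x hx => rw [parity_odd hx, map_neg, parity_odd hx, neg_neg]

theorem mem_even_iff {x : A} : x ∈ 𝒜 0 ↔ parity 𝒜 x = x := by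
  refine ⟨parity_even, fun h => ?_⟩
  have key : x + parity 𝒜 x ∈ 𝒜 0 := by
    clear h
    induction x using super_induction 𝒜 with
    | hadd a b ha hb =>
      rw [map_add, add_add_add_comm]
      exact add_mem ha hb
    | he x hx =>
      rw [parity_even hx]
      exact add_mem hx hx
    | ho x hx =>
      rw [parity_odd hx, add_neg_cancel]
      exact zero_mem _
  rw [h, ← two_smul ℝ x] at key
  simpa using (𝒜 0).smul_mem (2⁻¹ : ℝ) key

theorem mem_odd_iff {x : A} : x ∈ 𝒜 1 ↔ parity 𝒜 x = -x := by
  refine ⟨parity_odd, fun h => ?_⟩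
  have key : x - parity 𝒜 x ∈ 𝒜 1 := by
    clear h
    induction x using super_induction 𝒜 with
    | hadd a b ha hb =>
      rw [map_add, add_sub_add_comm]
      exact add_mem ha hb
    | he x hx =>
      rw [parity_even hx, sub_self]
      exact zero_mem _
    | ho x hx =>
      rw [parity_odd hx, sub_neg_eq_add]
      exact add_mem hx hx
  rw [h, sub_neg_eq_add, ← two_smul ℝ x] at key
  simpa using (𝒜 1).smul_mem (2⁻¹ : ℝ) key

end Super

section Involution

variable {A : Type*} [Ring A] [Algebra ℝ A]

/-- The `ℤ/2`-grading defined by an involutive automorphism `σ`: the even elements are those with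
`σ x = x`, the odd ones those with `σ x = -x`. -/
def involGrading (σ : A →ₐ[ℝ] A) (i : ZMod 2) : Submodule ℝ A :=
  LinearMap.ker (σ.toLinearMap - (-1 : ℝ) ^ i.val • LinearMap.id)

theorem mem_involGrading_zero {σ : A →ₐ[ℝ] A} {x : A} : x ∈ involGrading σ 0 ↔ σ x = x := by
  simp [involGrading, sub_eq_zero]

theorem mem_involGrading_one {σ : A →ₐ[ℝ] A} {x : A} : x ∈ involGrading σ 1 ↔ σ x = -x := by
  simp [involGrading, add_eq_zero_iff_eq_neg, ZMod.val_one]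

/-- The projection of `A` onto the even part. -/
def involProjEven (σ : A →ₐ[ℝ] A) (hσ : ∀ x, σ (σ x) = x) : A →ₗ[ℝ] involGrading σ 0 :=
  LinearMap.codRestrict _ ((2⁻¹ : ℝ) • (LinearMap.id + σ.toLinearMap)) fun x =>
    mem_involGrading_zero.2 (by simp [hσ, add_comm])

/-- The projection of `A` onto the odd part. -/
def involProjOdd (σ : A →ₐ[ℝ] A) (hσ : ∀ x, σ (σ x) = x) : A →ₗ[ℝ] involGrading σ 1 :=
  LinearMap.codRestrict _ ((2⁻¹ : ℝ) • (LinearMap.id - σ.toLinearMap)) fun x =>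
    mem_involGrading_one.2 (by simp [hσ, ← smul_neg])

/-- The grading of an involution is an algebra grading. -/
@[reducible] def involGradedAlgebra (σ : A →ₐ[ℝ] A) (hσ : ∀ x, σ (σ x) = x) :
    GradedAlgebra (involGrading σ) where
  one_mem := mem_involGrading_zero.2 (map_one σ)
  mul_mem := by
    intro i j x y hx hy
    rcases zmod_two i with rfl | rfl <;> rcases zmod_two j with rfl | rfl
    · rw [add_zero]
      exact mem_involGrading_zero.2 (by
        rw [map_mul, mem_involGrading_zero.1 hx, mem_involGrading_zero.1 hy])
    · rw [zero_add]
      exact mem_involGrading_one.2 (by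
        rw [map_mul, mem_involGrading_zero.1 hx, mem_involGrading_one.1 hy, mul_neg])
    · rw [add_zero]
      exact mem_involGrading_one.2 (by
        rw [map_mul, mem_involGrading_one.1 hx, mem_involGrading_zero.1 hy, neg_mul])
    · rw [show (1 : ZMod 2) + 1 = 0 by decide]
      exact mem_involGrading_zero.2 (by
        rw [map_mul, mem_involGrading_one.1 hx, mem_involGrading_one.1 hy, neg_mul_neg])
  toDecomposition := DirectSum.Decomposition.ofLinearMap (involGrading σ)
    (DirectSum.lof ℝ (ZMod 2) (fun i => involGrading σ i) 0 ∘ₗ involProjEven σ hσ +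
      DirectSum.lof ℝ (ZMod 2) (fun i => involGrading σ i) 1 ∘ₗ involProjOdd σ hσ)
    (by
      ext x
      simp only [LinearMap.comp_apply, LinearMap.add_apply, map_add, DirectSum.coeLinearMap_lof,
        involProjEven, involProjOdd, LinearMap.codRestrict_apply, LinearMap.smul_apply,
        LinearMap.sub_apply, LinearMap.id_apply]
      rw [← smul_add, add_add_sub_cancel, ← two_smul ℝ x, smul_smul]
      norm_num)
    (by
      have h2 : ∀ y : A, (2⁻¹ : ℝ) • (y + y) = y := fun y => by
        rw [← two_smul ℝ y, smul_smul]; norm_num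
      refine DirectSum.linearMap_ext _ fun i => LinearMap.ext fun x => ?_
      simp only [LinearMap.comp_apply, LinearMap.add_apply, DirectSum.coeLinearMap_lof,
        LinearMap.id_apply]
      rcases zmod_two i with rfl | rfl
      · have hx := mem_involGrading_zero.1 x.2
        have h0 : involProjEven σ hσ x = x := Subtype.ext (by simp [involProjEven, hx, -smul_add, h2])
        have h1 : involProjOdd σ hσ x = 0 := Subtype.ext (by simp [involProjOdd, hx])
        rw [h0, h1, map_zero, add_zero]
      · have hx := mem_involGrading_one.1 x.2
        have h0 : involProjEven σ hσ x = 0 := Subtype.ext (by simp [involProjEven, hx])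
        have h1 : involProjOdd σ hσ x = x := Subtype.ext (by simp [involProjOdd, hx, h2])
        rw [h0, h1, map_zero, zero_add])

theorem parity_invol (σ : A →ₐ[ℝ] A) [GradedAlgebra (involGrading σ)] (x : A) :
    parity (involGrading σ) x = σ x := by
  induction x using super_induction (involGrading σ) with
  | hadd a b ha hb => simp only [map_add, ha, hb]
  | he x hx => rw [parity_even hx, mem_involGrading_zero.1 hx]
  | ho x hx => rw [parity_odd hx, mem_involGrading_one.1 hx]

end Involution


section GDiff

/-- A `ℤ/2`-graded algebra with the three families of (graded) derivations of a `𝔤`-differential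
algebra: an odd derivation `d`, odd derivations `contr ξ` and even derivations `lie ξ`, the last two
depending linearly on `ξ`. -/
structure GDerivations (𝔤 : Type*) [LieRing 𝔤] [LieAlgebra ℝ 𝔤] {A : Type*} [Ring A] [Algebra ℝ A]
    (𝒜 : ZMod 2 → Submodule ℝ A) [GradedAlgebra 𝒜] where
  d : A →ₗ[ℝ] A
  contr : 𝔤 →ₗ[ℝ] A →ₗ[ℝ] A
  lie : 𝔤 →ₗ[ℝ] A →ₗ[ℝ] A
  d_odd : ∀ x, d (parity 𝒜 x) = -parity 𝒜 (d x)
  contr_odd : ∀ ξ x, contr ξ (parity 𝒜 x) = -parity 𝒜 (contr ξ x)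
  lie_even : ∀ ξ x, lie ξ (parity 𝒜 x) = parity 𝒜 (lie ξ x)
  d_mul : ∀ x y, d (x * y) = d x * y + parity 𝒜 x * d y
  contr_mul : ∀ ξ x y, contr ξ (x * y) = contr ξ x * y + parity 𝒜 x * contr ξ y
  lie_mul : ∀ ξ x y, lie ξ (x * y) = lie ξ x * y + x * lie ξ y

/-- A `𝔤`-differential algebra: the derivations satisfy the relations of the de Rham differential,
the contractions and the Lie derivatives on a manifold with an action of `𝔤`. -/
structure GDifferentialAlgebra (𝔤 : Type*) [LieRing 𝔤] [LieAlgebra ℝ 𝔤] {A : Type*} [Ring A]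
    [Algebra ℝ A] (𝒜 : ZMod 2 → Submodule ℝ A) [GradedAlgebra 𝒜]
    extends GDerivations 𝔤 𝒜 where
  d_d : ∀ x, d (d x) = 0
  contr_contr : ∀ ξ η x, contr ξ (contr η x) + contr η (contr ξ x) = 0
  lie_lie : ∀ ξ η x, lie ξ (lie η x) - lie η (lie ξ x) = lie ⁅ξ, η⁆ x
  lie_contr : ∀ ξ η x, lie ξ (contr η x) - contr η (lie ξ x) = contr ⁅ξ, η⁆ x
  lie_d : ∀ ξ x, lie ξ (d x) - d (lie ξ x) = 0
  contr_d : ∀ ξ x, contr ξ (d x) + d (contr ξ x) = lie ξ x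

variable {𝔤 : Type*} [LieRing 𝔤] [LieAlgebra ℝ 𝔤] {A : Type*} [Ring A] [Algebra ℝ A]
  {𝒜 : ZMod 2 → Submodule ℝ A} [GradedAlgebra 𝒜]

theorem GDerivations.d_one (D : GDerivations 𝔤 𝒜) : D.d 1 = 0 := by
  have := D.d_mul 1 1
  simpa [parity_one] using this

theorem GDerivations.contr_one (D : GDerivations 𝔤 𝒜) (ξ : 𝔤) : D.contr ξ 1 = 0 := by
  have := D.contr_mul ξ 1 1
  simpa [parity_one] using this

theorem GDerivations.lie_one (D : GDerivations 𝔤 𝒜) (ξ : 𝔤) : D.lie ξ 1 = 0 := by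
  have := D.lie_mul ξ 1 1
  simpa using this

/-- The basic subalgebra: the elements annihilated by all contractions and all Lie derivatives. -/
def GDerivations.basic (D : GDerivations 𝔤 𝒜) : Subalgebra ℝ A where
  carrier := {x | ∀ ξ, D.contr ξ x = 0 ∧ D.lie ξ x = 0}
  mul_mem' := fun {x y} hx hy ξ => by
    rw [D.contr_mul, D.lie_mul, (hx ξ).1, (hx ξ).2, (hy ξ).1, (hy ξ).2]
    simp
  add_mem' := fun {x y} hx hy ξ => by
    rw [map_add, map_add, (hx ξ).1, (hx ξ).2, (hy ξ).1, (hy ξ).2]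
    simp
  algebraMap_mem' := fun r ξ => by
    rw [Algebra.algebraMap_eq_smul_one, map_smul, map_smul, D.contr_one, D.lie_one]
    simp

/-- The algebra of basic cocycles. -/
def GDerivations.cocycles (D : GDerivations 𝔤 𝒜) : Subalgebra ℝ A where
  carrier := {x | x ∈ D.basic ∧ D.d x = 0}
  mul_mem' := fun {x y} hx hy => ⟨mul_mem hx.1 hy.1, by
    rw [D.d_mul, hx.2, hy.2]
    simp⟩
  add_mem' := fun {x y} hx hy => ⟨add_mem hx.1 hy.1, by
    rw [map_add, hx.2, hy.2, add_zero]⟩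
  algebraMap_mem' := fun r => ⟨D.basic.algebraMap_mem r, by
    rw [Algebra.algebraMap_eq_smul_one, map_smul, D.d_one, smul_zero]⟩

theorem GDerivations.parity_mem_basic (D : GDerivations 𝔤 𝒜) {x : A} (hx : x ∈ D.basic) :
    parity 𝒜 x ∈ D.basic := fun ξ => by
  rw [D.contr_odd, D.lie_even, (hx ξ).1, (hx ξ).2]
  simp

/-- The basic coboundaries: the elements `d y` with `y` basic. (In a `𝔤`-differential algebra `d`
preserves the basic elements and `d d = 0`, so that every such `d y` is a basic cocycle.) -/
def GDerivations.coboundaries (D : GDerivations 𝔤 𝒜) : Ideal D.cocycles where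
  carrier := {z | ∃ y ∈ D.basic, D.d y = z}
  zero_mem' := ⟨0, zero_mem _, by simp⟩
  add_mem' := by
    rintro z z' ⟨y, hy, h⟩ ⟨y', hy', h'⟩
    exact ⟨y + y', add_mem hy hy', by simp [h, h']⟩
  smul_mem' := by
    rintro z z' ⟨y, hy, h⟩
    refine ⟨parity 𝒜 z * y, mul_mem (D.parity_mem_basic z.2.1) hy, ?_⟩
    rw [D.d_mul, D.d_odd, z.2.2, parity_parity, h]
    simp

instance (D : GDerivations 𝔤 𝒜) : D.coboundaries.IsTwoSided where
  mul_mem_of_left := by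
    rintro z z' ⟨y, hy, h⟩
    refine ⟨y * z', mul_mem hy z'.2.1, ?_⟩
    rw [D.d_mul, z'.2.2, h]
    simp

/-- The cohomology algebra of the basic subcomplex. -/
abbrev GDerivations.BasicCohomology (D : GDerivations 𝔤 𝒜) : Type _ :=
  D.cocycles ⧸ D.coboundaries

end GDiff

section Tensor

open GradedTensorProduct

variable {𝔤 : Type*} [LieRing 𝔤] [LieAlgebra ℝ 𝔤]
  {X : Type*} [Ring X] [Algebra ℝ X] (𝒳 : ZMod 2 → Submodule ℝ X) [GradedAlgebra 𝒳]
  {Y : Type*} [Ring Y] [Algebra ℝ Y] (𝒴 : ZMod 2 → Submodule ℝ Y) [GradedAlgebra 𝒴]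

/-- The linear map `f ⊗ g` between graded tensor products (without signs). -/
def gmap {X' : Type*} [Ring X'] [Algebra ℝ X'] (𝒳' : ZMod 2 → Submodule ℝ X') [GradedAlgebra 𝒳']
    {Y' : Type*} [Ring Y'] [Algebra ℝ Y'] (𝒴' : ZMod 2 → Submodule ℝ Y') [GradedAlgebra 𝒴']
    (f : X →ₗ[ℝ] X') (g : Y →ₗ[ℝ] Y') : 𝒳 ᵍ⊗[ℝ] 𝒴 →ₗ[ℝ] 𝒳' ᵍ⊗[ℝ] 𝒴' :=
  (of ℝ 𝒳' 𝒴').toLinearMap ∘ₗ TensorProduct.map f g ∘ₗ (of ℝ 𝒳 𝒴).symm.toLinearMap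

theorem gmap_tmul {X' : Type*} [Ring X'] [Algebra ℝ X'] (𝒳' : ZMod 2 → Submodule ℝ X')
    [GradedAlgebra 𝒳'] {Y' : Type*} [Ring Y'] [Algebra ℝ Y'] (𝒴' : ZMod 2 → Submodule ℝ Y')
    [GradedAlgebra 𝒴'] (f : X →ₗ[ℝ] X') (g : Y →ₗ[ℝ] Y') (x : X) (y : Y) :
    gmap 𝒳 𝒴 𝒳' 𝒴' f g (x ᵍ⊗ₜ[ℝ] y) = f x ᵍ⊗ₜ[ℝ] g y := rfl

variable {𝒳 𝒴}

theorem gtensor_induction {p : 𝒳 ᵍ⊗[ℝ] 𝒴 → Prop} (he : ∀ x ∈ 𝒳 0, ∀ y, p (x ᵍ⊗ₜ[ℝ] y))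
    (ho : ∀ x ∈ 𝒳 1, ∀ y, p (x ᵍ⊗ₜ[ℝ] y)) (hadd : ∀ u v, p u → p v → p (u + v))
    (u : 𝒳 ᵍ⊗[ℝ] 𝒴) : p u := by
  have : ∀ t : X ⊗[ℝ] Y, p (of ℝ 𝒳 𝒴 t) := by
    intro t
    induction t using TensorProduct.induction_on with
    | zero =>
      have := he 0 (zero_mem _) 0
      rwa [tmul, TensorProduct.tmul_zero] at this
    | tmul x y =>
      induction x using super_induction 𝒳 with
      | he x hx => exact he x hx y
      | ho x hx => exact ho x hx y
      | hadd a b ha hb =>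
        rw [TensorProduct.add_tmul, map_add]
        exact hadd _ _ ha hb
    | add a b ha hb =>
      rw [map_add]
      exact hadd _ _ ha hb
  exact this ((of ℝ 𝒳 𝒴).symm u)

theorem gmul_even (x : X) (y : Y) {x' : X} (hx' : x' ∈ 𝒳 0) (y' : Y) :
    (x ᵍ⊗ₜ[ℝ] y * x' ᵍ⊗ₜ[ℝ] y' : 𝒳 ᵍ⊗[ℝ] 𝒴) = (x * x') ᵍ⊗ₜ[ℝ] (y * y') := by
  induction y using super_induction 𝒴 with
  | he y hy => exact tmul_coe_mul_zero_coe_tmul 𝒳 𝒴 x ⟨y, hy⟩ ⟨x', hx'⟩ y'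
  | ho y hy => exact tmul_coe_mul_zero_coe_tmul 𝒳 𝒴 x ⟨y, hy⟩ ⟨x', hx'⟩ y'
  | hadd a b ha hb =>
    simp only [tmul, TensorProduct.tmul_add, map_add, add_mul] at ha hb ⊢
    rw [ha, hb]

theorem gmul_odd (x : X) (y : Y) {x' : X} (hx' : x' ∈ 𝒳 1) (y' : Y) :
    (x ᵍ⊗ₜ[ℝ] y * x' ᵍ⊗ₜ[ℝ] y' : 𝒳 ᵍ⊗[ℝ] 𝒴) = (x * x') ᵍ⊗ₜ[ℝ] (parity 𝒴 y * y') := by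
  induction y using super_induction 𝒴 with
  | he y hy =>
    rw [parity_even hy]
    exact tmul_zero_coe_mul_coe_tmul 𝒳 𝒴 x ⟨y, hy⟩ ⟨x', hx'⟩ y'
  | ho y hy =>
    rw [parity_odd hy]
    have := tmul_coe_mul_coe_tmul 𝒳 𝒴 x ⟨y, hy⟩ ⟨x', hx'⟩ y'
    rw [this, mul_one, uzpow_one, neg_mul, tmul, tmul, TensorProduct.tmul_neg, map_neg,
      Units.neg_smul, one_smul]
  | hadd a b ha hb =>
    simp only [tmul, TensorProduct.tmul_add, map_add, add_mul] at ha hb ⊢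
    rw [ha, hb]

variable (𝒳 𝒴)

/-- The parity automorphism of a graded tensor product. -/
def gparity : 𝒳 ᵍ⊗[ℝ] 𝒴 →ₐ[ℝ] 𝒳 ᵍ⊗[ℝ] 𝒴 :=
  AlgHom.ofLinearMap (gmap 𝒳 𝒴 𝒳 𝒴 (parity 𝒳) (parity 𝒴))
    (by
      change gmap 𝒳 𝒴 𝒳 𝒴 (parity 𝒳) (parity 𝒴) ((1 : X) ᵍ⊗ₜ[ℝ] (1 : Y)) = _
      rw [gmap_tmul, parity_one, parity_one]
      rfl)
    (by
      intro u v
      induction u using gtensor_induction with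
      | hadd a b ha hb => simp only [add_mul, map_add, ha, hb]
      | he x hx y | ho x hx y =>
        all_goals
        induction v using gtensor_induction with
        | hadd a b ha hb => simp only [mul_add, map_add, ha, hb]
        | he x' hx' y' =>
          rw [gmul_even _ _ hx', gmap_tmul, gmap_tmul, gmap_tmul, parity_even hx',
            gmul_even _ _ hx', parity_mul, parity_mul, parity_even hx']
        | ho x' hx' y' =>
          rw [gmul_odd _ _ hx', gmap_tmul, gmap_tmul, gmap_tmul,
            gmul_odd _ _ (by rw [parity_odd hx']; exact neg_mem hx'), parity_mul, parity_mul])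

theorem gparity_tmul (x : X) (y : Y) :
    gparity 𝒳 𝒴 (x ᵍ⊗ₜ[ℝ] y) = parity 𝒳 x ᵍ⊗ₜ[ℝ] parity 𝒴 y := rfl

theorem gparity_gparity (u : 𝒳 ᵍ⊗[ℝ] 𝒴) : gparity 𝒳 𝒴 (gparity 𝒳 𝒴 u) = u := by
  induction u using gtensor_induction with
  | hadd a b ha hb => simp only [map_add, ha, hb]
  | he x hx y | ho x hx y => rw [gparity_tmul, gparity_tmul, parity_parity, parity_parity]

/-- The total `ℤ/2`-grading of the graded tensor product: `x ⊗ y` has degree `|x| + |y|`. -/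
abbrev gtensorGrading : ZMod 2 → Submodule ℝ (𝒳 ᵍ⊗[ℝ] 𝒴) := involGrading (gparity 𝒳 𝒴)

instance : GradedAlgebra (gtensorGrading 𝒳 𝒴) :=
  involGradedAlgebra (gparity 𝒳 𝒴) (gparity_gparity 𝒳 𝒴)

/-- `D ⊗ 1 + 1 ⊗ E` for odd operators `D` and `E`, with the sign rule
`(1 ⊗ E) (x ⊗ y) = (-1) ^ |x| x ⊗ E y`. -/
def oddSum (D : X →ₗ[ℝ] X) (E : Y →ₗ[ℝ] Y) : 𝒳 ᵍ⊗[ℝ] 𝒴 →ₗ[ℝ] 𝒳 ᵍ⊗[ℝ] 𝒴 :=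
  gmap 𝒳 𝒴 𝒳 𝒴 D LinearMap.id + gmap 𝒳 𝒴 𝒳 𝒴 (parity 𝒳) E

/-- `D ⊗ 1 + 1 ⊗ E` for even operators `D` and `E`. -/
def evenSum (D : X →ₗ[ℝ] X) (E : Y →ₗ[ℝ] Y) : 𝒳 ᵍ⊗[ℝ] 𝒴 →ₗ[ℝ] 𝒳 ᵍ⊗[ℝ] 𝒴 :=
  gmap 𝒳 𝒴 𝒳 𝒴 D LinearMap.id + gmap 𝒳 𝒴 𝒳 𝒴 LinearMap.id E

theorem oddSum_tmul (D : X →ₗ[ℝ] X) (E : Y →ₗ[ℝ] Y) (x : X) (y : Y) :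
    oddSum 𝒳 𝒴 D E (x ᵍ⊗ₜ[ℝ] y) = D x ᵍ⊗ₜ[ℝ] y + parity 𝒳 x ᵍ⊗ₜ[ℝ] E y := rfl

theorem evenSum_tmul (D : X →ₗ[ℝ] X) (E : Y →ₗ[ℝ] Y) (x : X) (y : Y) :
    evenSum 𝒳 𝒴 D E (x ᵍ⊗ₜ[ℝ] y) = D x ᵍ⊗ₜ[ℝ] y + x ᵍ⊗ₜ[ℝ] E y := rfl

variable {𝒳 𝒴}

theorem oddSum_mul {D : X →ₗ[ℝ] X} {E : Y →ₗ[ℝ] Y}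
    (hD : ∀ x, D (parity 𝒳 x) = -parity 𝒳 (D x))
    (hDm : ∀ x y, D (x * y) = D x * y + parity 𝒳 x * D y)
    (hE : ∀ x, E (parity 𝒴 x) = -parity 𝒴 (E x))
    (hEm : ∀ x y, E (x * y) = E x * y + parity 𝒴 x * E y) (u v : 𝒳 ᵍ⊗[ℝ] 𝒴) :
    oddSum 𝒳 𝒴 D E (u * v) = oddSum 𝒳 𝒴 D E u * v + gparity 𝒳 𝒴 u * oddSum 𝒳 𝒴 D E v := by
  induction u using gtensor_induction with
  | hadd a b ha hb =>
    simp only [add_mul, map_add, ha, hb]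
    abel
  | he x hx y | ho x hx y =>
    all_goals
    clear hx
    induction v using gtensor_induction with
    | hadd a b ha hb =>
      simp only [mul_add, map_add, ha, hb]
      abel
    | he x' hx' y' =>
      have h1 : D x' ∈ 𝒳 1 := (mem_odd_iff _).2 (by rw [← neg_eq_iff_eq_neg, ← hD, parity_even hx'])
      rw [gmul_even _ _ hx', oddSum_tmul, oddSum_tmul, oddSum_tmul, gparity_tmul, add_mul, mul_add,
        parity_even hx', gmul_even _ _ hx', gmul_even _ _ hx', gmul_odd _ _ h1, gmul_even _ _ hx',
        hDm, hEm, parity_mul, parity_parity, parity_even hx']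
      simp only [tmul, TensorProduct.tmul_add, TensorProduct.add_tmul, map_add]
      abel
    | ho x' hx' y' =>
      have h1 : D x' ∈ 𝒳 0 := (mem_even_iff _).2 (by
        rw [← neg_inj, ← hD, parity_odd hx', map_neg])
      have h2 : -x' ∈ 𝒳 1 := neg_mem hx'
      rw [gmul_odd _ _ hx', oddSum_tmul, oddSum_tmul, oddSum_tmul, gparity_tmul, add_mul, mul_add,
        parity_odd hx', gmul_odd _ _ hx', gmul_odd _ _ hx', gmul_even _ _ h1, gmul_odd _ _ h2,
        hDm, hEm, parity_mul, parity_parity, parity_odd hx', hE]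
      simp only [tmul, TensorProduct.tmul_add, TensorProduct.add_tmul, map_add, mul_neg, neg_mul,
        TensorProduct.tmul_neg, TensorProduct.neg_tmul, map_neg, neg_neg]
      abel

theorem evenSum_mul {D : X →ₗ[ℝ] X} {E : Y →ₗ[ℝ] Y}
    (hD : ∀ x, D (parity 𝒳 x) = parity 𝒳 (D x))
    (hDm : ∀ x y, D (x * y) = D x * y + x * D y)
    (hE : ∀ x, E (parity 𝒴 x) = parity 𝒴 (E x))
    (hEm : ∀ x y, E (x * y) = E x * y + x * E y) (u v : 𝒳 ᵍ⊗[ℝ] 𝒴) :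
    evenSum 𝒳 𝒴 D E (u * v) = evenSum 𝒳 𝒴 D E u * v + u * evenSum 𝒳 𝒴 D E v := by
  induction u using gtensor_induction with
  | hadd a b ha hb =>
    simp only [add_mul, map_add, ha, hb]
    abel
  | he x hx y | ho x hx y =>
    all_goals
    clear hx
    induction v using gtensor_induction with
    | hadd a b ha hb =>
      simp only [mul_add, map_add, ha, hb]
      abel
    | he x' hx' y' =>
      have h1 : D x' ∈ 𝒳 0 := (mem_even_iff _).2 (by rw [← hD, parity_even hx'])
      rw [gmul_even _ _ hx', evenSum_tmul, evenSum_tmul, evenSum_tmul, add_mul, mul_add,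
        gmul_even _ _ hx', gmul_even _ _ hx', gmul_even _ _ h1, gmul_even _ _ hx', hDm, hEm]
      simp only [tmul, TensorProduct.tmul_add, TensorProduct.add_tmul, map_add]
      abel
    | ho x' hx' y' =>
      have h1 : D x' ∈ 𝒳 1 := (mem_odd_iff _).2 (by rw [← hD, parity_odd hx', map_neg])
      rw [gmul_odd _ _ hx', evenSum_tmul, evenSum_tmul, evenSum_tmul, add_mul, mul_add,
        gmul_odd _ _ hx', gmul_odd _ _ hx', gmul_odd _ _ h1, gmul_odd _ _ hx', hDm, hEm, hE]
      simp only [tmul, TensorProduct.tmul_add, TensorProduct.add_tmul, map_add]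
      abel

theorem oddSum_odd {D : X →ₗ[ℝ] X} {E : Y →ₗ[ℝ] Y}
    (hD : ∀ x, D (parity 𝒳 x) = -parity 𝒳 (D x))
    (hE : ∀ x, E (parity 𝒴 x) = -parity 𝒴 (E x)) (u : 𝒳 ᵍ⊗[ℝ] 𝒴) :
    oddSum 𝒳 𝒴 D E (gparity 𝒳 𝒴 u) = -gparity 𝒳 𝒴 (oddSum 𝒳 𝒴 D E u) := by
  induction u using gtensor_induction with
  | hadd a b ha hb =>
    simp only [map_add, ha, hb]
    abel
  | he x hx y | ho x hx y =>
    all_goals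
    rw [gparity_tmul, oddSum_tmul, oddSum_tmul, map_add, gparity_tmul, gparity_tmul, hD, hE]
    simp only [tmul, TensorProduct.tmul_neg, TensorProduct.neg_tmul, map_neg]
    abel

theorem evenSum_even {D : X →ₗ[ℝ] X} {E : Y →ₗ[ℝ] Y}
    (hD : ∀ x, D (parity 𝒳 x) = parity 𝒳 (D x))
    (hE : ∀ x, E (parity 𝒴 x) = parity 𝒴 (E x)) (u : 𝒳 ᵍ⊗[ℝ] 𝒴) :
    evenSum 𝒳 𝒴 D E (gparity 𝒳 𝒴 u) = gparity 𝒳 𝒴 (evenSum 𝒳 𝒴 D E u) := by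
  induction u using gtensor_induction with
  | hadd a b ha hb => simp only [map_add, ha, hb]
  | he x hx y | ho x hx y =>
    all_goals
    rw [gparity_tmul, evenSum_tmul, evenSum_tmul, map_add, gparity_tmul, gparity_tmul, hD, hE]

/-- The derivations `d ⊗ 1 + 1 ⊗ d`, `ι_ξ ⊗ 1 + 1 ⊗ ι_ξ` and `L_ξ ⊗ 1 + 1 ⊗ L_ξ` of the graded
tensor product. -/
def GDerivations.tensor (D : GDerivations 𝔤 𝒳) (E : GDerivations 𝔤 𝒴) :
    GDerivations 𝔤 (gtensorGrading 𝒳 𝒴) where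
  d := oddSum 𝒳 𝒴 D.d E.d
  contr :=
    { toFun := fun ξ => oddSum 𝒳 𝒴 (D.contr ξ) (E.contr ξ)
      map_add' := fun ξ η => by
        simp only [oddSum, gmap, map_add, TensorProduct.map_add_left, TensorProduct.map_add_right,
          LinearMap.add_comp, LinearMap.comp_add]
        abel
      map_smul' := fun r ξ => by
        simp only [oddSum, gmap, map_smul, TensorProduct.map_smul_left,
          TensorProduct.map_smul_right, LinearMap.smul_comp, LinearMap.comp_smul, smul_add,
          RingHom.id_apply] }
  lie :=
    { toFun := fun ξ => evenSum 𝒳 𝒴 (D.lie ξ) (E.lie ξ)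
      map_add' := fun ξ η => by
        simp only [evenSum, gmap, map_add, TensorProduct.map_add_left, TensorProduct.map_add_right,
          LinearMap.add_comp, LinearMap.comp_add]
        abel
      map_smul' := fun r ξ => by
        simp only [evenSum, gmap, map_smul, TensorProduct.map_smul_left,
          TensorProduct.map_smul_right, LinearMap.smul_comp, LinearMap.comp_smul, smul_add,
          RingHom.id_apply] }
  d_odd u := by
    simp only [parity_invol]
    exact oddSum_odd D.d_odd E.d_odd u
  contr_odd ξ u := by
    simp only [parity_invol]
    exact oddSum_odd (D.contr_odd ξ) (E.contr_odd ξ) u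
  lie_even ξ u := by
    simp only [parity_invol]
    exact evenSum_even (D.lie_even ξ) (E.lie_even ξ) u
  d_mul u v := by
    simp only [parity_invol]
    exact oddSum_mul D.d_odd D.d_mul E.d_odd E.d_mul u v
  contr_mul ξ u v := by
    simp only [parity_invol]
    exact oddSum_mul (D.contr_odd ξ) (D.contr_mul ξ) (E.contr_odd ξ) (E.contr_mul ξ) u v
  lie_mul ξ u v :=
    evenSum_mul (D.lie_even ξ) (D.lie_mul ξ) (E.lie_even ξ) (E.lie_mul ξ) u v

end Tensor

section Symmetrization

variable {V : Type*} [AddCommGroup V] [Module ℝ V] {U : Type*} [Ring U] [Algebra ℝ U]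

/-- The multilinear map `(v₁, …, v_k) ↦ f v₁ ⋯ f v_k`. -/
def prodMap (f : V →ₗ[ℝ] U) (k : ℕ) : MultilinearMap ℝ (fun _ : Fin k => V) U :=
  (MultilinearMap.mkPiAlgebraFin ℝ k U).compLinearMap fun _ => f

theorem prodMap_apply (f : V →ₗ[ℝ] U) (k : ℕ) (v : Fin k → V) :
    prodMap f k v = (List.ofFn fun i => f (v i)).prod := by
  simp [prodMap, MultilinearMap.mkPiAlgebraFin_apply]

/-- `(v₁, …, v_k) ↦ (1 / k!) ∑_σ f v_{σ 1} ⋯ f v_{σ k}`. -/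
def symProd (f : V →ₗ[ℝ] U) (k : ℕ) : MultilinearMap ℝ (fun _ : Fin k => V) U :=
  (k.factorial : ℝ)⁻¹ • ∑ σ : Equiv.Perm (Fin k), (prodMap f k).domDomCongr σ

theorem symProd_apply (f : V →ₗ[ℝ] U) (k : ℕ) (v : Fin k → V) :
    symProd f k v = (k.factorial : ℝ)⁻¹ •
      ∑ σ : Equiv.Perm (Fin k), (List.ofFn fun i => f (v (σ i))).prod := by
  simp [symProd, prodMap_apply]

theorem symProd_perm (f : V →ₗ[ℝ] U) (k : ℕ) (v : Fin k → V) (τ : Equiv.Perm (Fin k)) :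
    symProd f k (fun i => v (τ i)) = symProd f k v := by
  rw [symProd_apply, symProd_apply]
  congr 1
  exact Fintype.sum_equiv (Equiv.mulLeft τ) _ _ fun σ => rfl

/-- The linear map on the tensor algebra with
`v₁ ⊗ ⋯ ⊗ v_k ↦ (1 / k!) ∑_σ f v_{σ 1} ⋯ f v_{σ k}`. -/
def symTensor (f : V →ₗ[ℝ] U) : TensorAlgebra ℝ V →ₗ[ℝ] U :=
  DirectSum.toModule ℝ ℕ U (fun k => PiTensorProduct.lift (symProd f k)) ∘ₗ
    TensorAlgebra.toDirectSum.toLinearMap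

theorem symTensor_prod (f : V →ₗ[ℝ] U) (k : ℕ) (v : Fin k → V) :
    symTensor f (List.ofFn fun i => TensorAlgebra.ι ℝ (v i)).prod = symProd f k v := by
  rw [symTensor, LinearMap.comp_apply, AlgHom.toLinearMap_apply, ← TensorAlgebra.tprod_apply,
    TensorAlgebra.toDirectSum_tensorPower_tprod, ← DirectSum.lof_eq_of ℝ, DirectSum.toModule_lof,
    PiTensorProduct.lift.tprod]

theorem symTensor_list (f : V →ₗ[ℝ] U) (l : List V) :
    symTensor f (l.map (TensorAlgebra.ι ℝ)).prod = symProd f l.length l.get := by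
  rw [← symTensor_prod]
  congr 2
  conv_lhs => rw [← List.ofFn_get l, List.map_ofFn]
  rfl

theorem list_perm_get {α : Type*} {l l' : List α} (h : l.Perm l') :
    ∃ e : Fin l'.length ≃ Fin l.length, ∀ i, l'.get i = l.get (e i) := by
  induction h with
  | nil => exact ⟨Equiv.refl _, fun i => rfl⟩
  | cons a _ ih =>
    obtain ⟨e, he⟩ := ih
    refine ⟨(finSuccEquiv _).trans ((Equiv.optionCongr e).trans (finSuccEquiv _).symm), ?_⟩
    intro i
    refine Fin.cases ?_ (fun j => ?_) i
    · simp
    · simpa using he j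
  | swap a b l =>
    refine ⟨Equiv.swap (0 : Fin (l.length + 2)) 1, ?_⟩
    intro i
    refine Fin.cases ?_ (fun j => Fin.cases ?_ (fun m => ?_) j) i
    · simp
    · simp
    · have : Equiv.swap (0 : Fin (l.length + 2)) 1 m.succ.succ = m.succ.succ :=
        Equiv.swap_apply_of_ne_of_ne (Fin.succ_ne_zero _) (by
          intro hm
          exact Fin.succ_ne_zero _ (Fin.succ_injective _ hm))
      rw [this]
      rfl
  | trans _ _ ih₁ ih₂ =>
    obtain ⟨e, he⟩ := ih₁
    obtain ⟨e', he'⟩ := ih₂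
    exact ⟨e'.trans e, fun i => by rw [he', he]; rfl⟩

theorem symProd_list_perm (f : V →ₗ[ℝ] U) {l l' : List V} (h : l.Perm l') :
    symProd f l.length l.get = symProd f l'.length l'.get := by
  obtain ⟨e, he⟩ := list_perm_get h
  have key : ∀ (k k' : ℕ) (v : Fin k → V) (v' : Fin k' → V) (e : Fin k' ≃ Fin k),
      (∀ i, v' i = v (e i)) → symProd f k v = symProd f k' v' := by
    intro k k' v v' e he
    obtain rfl : k' = k := by simpa using Fintype.card_congr e
    rw [← symProd_perm f k' v e]
    congr 1
    exact (funext he).symm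
  exact key _ _ _ _ e he

theorem symTensor_list_perm (f : V →ₗ[ℝ] U) {l l' : List V} (h : l.Perm l') :
    symTensor f (l.map (TensorAlgebra.ι ℝ)).prod =
      symTensor f (l'.map (TensorAlgebra.ι ℝ)).prod := by
  rw [symTensor_list, symTensor_list, symProd_list_perm f h]

theorem tensor_list_induction {p : TensorAlgebra ℝ V → Prop}
    (hl : ∀ l : List V, p (l.map (TensorAlgebra.ι ℝ)).prod)
    (hadd : ∀ x y, p x → p y → p (x + y)) (hsmul : ∀ (r : ℝ) x, p x → p (r • x))
    (x : TensorAlgebra ℝ V) : p x := by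
  suffices h : x ∈ Submodule.span ℝ
      (Set.range fun l : List V => (l.map (TensorAlgebra.ι ℝ)).prod) by
    induction h using Submodule.span_induction with
    | mem x hx =>
      obtain ⟨l, rfl⟩ := hx
      exact hl l
    | zero => simpa using hsmul 0 _ (hl [])
    | add x y _ _ hx hy => exact hadd x y hx hy
    | smul r x _ hx => exact hsmul r x hx
  induction x using TensorAlgebra.induction with
  | algebraMap r =>
    rw [Algebra.algebraMap_eq_smul_one]
    exact Submodule.smul_mem _ _ (Submodule.subset_span ⟨[], rfl⟩)
  | ι v => exact Submodule.subset_span ⟨[v], by simp⟩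
  | add x y hx hy => exact add_mem hx hy
  | mul x y hx hy =>
    have := Submodule.mul_mem_mul hx hy
    rw [Submodule.span_mul_span] at this
    refine Submodule.span_mono ?_ this
    rintro _ ⟨_, ⟨l, rfl⟩, _, ⟨l', rfl⟩, rfl⟩
    exact ⟨l ++ l', by simp⟩

/-- The congruence of tensors with the same image under `symTensor` in every context. -/
def symCon (f : V →ₗ[ℝ] U) : RingCon (TensorAlgebra ℝ V) where
  r x y := ∀ a b, symTensor f (a * x * b) = symTensor f (a * y * b)
  iseqv := ⟨fun _ _ _ => rfl, fun h a b => (h a b).symm, fun h h' a b => (h a b).trans (h' a b)⟩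
  add' := fun {w x y z} h h' a b => by
    rw [mul_add, add_mul, mul_add, add_mul, map_add, map_add, h, h']
  mul' := fun {w x y z} h h' a b => by
    rw [← mul_assoc, mul_assoc (a * w), h, ← mul_assoc, h', mul_assoc a x z]

theorem symRingCon_le (f : V →ₗ[ℝ] U) : TensorAlgebra.symRingCon ℝ V ≤ symCon f := by
  refine RingCon.ringConGen_le.2 ?_
  rintro _ _ ⟨x, y⟩ a b
  induction a using tensor_list_induction with
  | hadd a a' h h' => simp only [add_mul, map_add, h, h']
  | hsmul r a h => simp only [smul_mul_assoc, map_smul, h]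
  | hl l =>
    induction b using tensor_list_induction with
    | hadd b b' h h' => simp only [mul_add, map_add, h, h']
    | hsmul r b h => simp only [mul_smul_comm, map_smul, h]
    | hl l' =>
      have key := symTensor_list_perm f
        (((List.Perm.swap y x l').append_left l) : (l ++ x :: y :: l').Perm (l ++ y :: x :: l'))
      simpa [mul_assoc] using key

/-- The symmetrization map `S(V) → U` of a linear map `f` from `V` to an associative algebra `U`:
the linear map with `v₁ ⋯ v_k ↦ (1 / k!) ∑_σ f v_{σ 1} ⋯ f v_{σ k}`. -/
def symmetrize (f : V →ₗ[ℝ] U) : SymmetricAlgebra ℝ V →ₗ[ℝ] U where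
  toFun := Quotient.lift (symTensor f) fun x y h => by
    simpa using symRingCon_le f h 1 1
  map_add' := by
    rintro ⟨x⟩ ⟨y⟩
    exact map_add (symTensor f) x y
  map_smul' := by
    rintro r ⟨x⟩
    exact map_smul (symTensor f) r x

theorem symmetrize_prod (f : V →ₗ[ℝ] U) (k : ℕ) (v : Fin k → V) :
    symmetrize f (List.ofFn fun i => SymmetricAlgebra.ι ℝ V (v i)).prod =
      (k.factorial : ℝ)⁻¹ •
        ∑ σ : Equiv.Perm (Fin k), (List.ofFn fun i => f (v (σ i))).prod := by
  rw [← symProd_apply, ← symTensor_prod]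
  have : (List.ofFn fun i => SymmetricAlgebra.ι ℝ V (v i)).prod =
      SymmetricAlgebra.algHom ℝ V (List.ofFn fun i => TensorAlgebra.ι ℝ (v i)).prod := by
    rw [map_list_prod, List.map_ofFn]
    rfl
  rw [this]
  rfl

/-- The antisymmetrization map `Λ(V) → U` of a linear map `f` from `V` to an associative algebra
`U`: the linear map with
`v₁ ∧ ⋯ ∧ v_k ↦ (1 / k!) ∑_σ sign(σ) f v_{σ 1} ⋯ f v_{σ k}`. -/
def antisymmetrize (f : V →ₗ[ℝ] U) : ExteriorAlgebra ℝ V →ₗ[ℝ] U :=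
  ExteriorAlgebra.liftAlternating fun k =>
    (k.factorial : ℝ)⁻¹ • MultilinearMap.alternatization (prodMap f k)

theorem antisymmetrize_prod (f : V →ₗ[ℝ] U) (k : ℕ) (v : Fin k → V) :
    antisymmetrize f (ExteriorAlgebra.ιMulti ℝ k v) =
      (k.factorial : ℝ)⁻¹ • ∑ σ : Equiv.Perm (Fin k),
        Equiv.Perm.sign σ • (List.ofFn fun i => f (v (σ i))).prod := by
  rw [antisymmetrize, ExteriorAlgebra.liftAlternating_apply_ιMulti, AlternatingMap.smul_apply,
    MultilinearMap.alternatization_apply]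
  simp [prodMap_apply]

end Symmetrization

section Derivations

variable {V : Type*} [AddCommGroup V] [Module ℝ V]

/-- The algebra homomorphism `x ↦ x + ε D x` on the symmetric algebra, for the derivation `D`
extending `f`. -/
def symDerHom (f : V →ₗ[ℝ] V) :
    SymmetricAlgebra ℝ V →ₐ[ℝ] TrivSqZeroExt (SymmetricAlgebra ℝ V) (SymmetricAlgebra ℝ V) :=
  SymmetricAlgebra.lift
    ((TrivSqZeroExt.inlAlgHom ℝ (SymmetricAlgebra ℝ V) (SymmetricAlgebra ℝ V)).toLinearMap ∘ₗ
        SymmetricAlgebra.ι ℝ V +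
      (TrivSqZeroExt.inrHom (SymmetricAlgebra ℝ V) (SymmetricAlgebra ℝ V)).restrictScalars ℝ ∘ₗ
        SymmetricAlgebra.ι ℝ V ∘ₗ f)

/-- The derivation of the symmetric algebra extending a linear map `f : V → V`. -/
def symDer (f : V →ₗ[ℝ] V) : SymmetricAlgebra ℝ V →ₗ[ℝ] SymmetricAlgebra ℝ V :=
  (TrivSqZeroExt.sndHom (SymmetricAlgebra ℝ V) (SymmetricAlgebra ℝ V)).restrictScalars ℝ ∘ₗ
    (symDerHom f).toLinearMap

theorem symDerHom_fst (f : V →ₗ[ℝ] V) (x : SymmetricAlgebra ℝ V) : (symDerHom f x).fst = x := by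
  have : (TrivSqZeroExt.fstHom ℝ _ _).comp (symDerHom f) =
      AlgHom.id ℝ (SymmetricAlgebra ℝ V) := by
    ext v
    simp [symDerHom]
  exact DFunLike.congr_fun this x

theorem symDer_mul (f : V →ₗ[ℝ] V) (x y : SymmetricAlgebra ℝ V) :
    symDer f (x * y) = symDer f x * y + x * symDer f y := by
  simp only [symDer, LinearMap.comp_apply, AlgHom.toLinearMap_apply, map_mul,
    LinearMap.restrictScalars_apply, TrivSqZeroExt.sndHom_apply, TrivSqZeroExt.snd_mul,
    symDerHom_fst, smul_eq_mul, MulOpposite.smul_eq_mul_unop, MulOpposite.unop_op]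
  ring

theorem symDer_ι (f : V →ₗ[ℝ] V) (v : V) :
    symDer f (SymmetricAlgebra.ι ℝ V v) = SymmetricAlgebra.ι ℝ V (f v) := by
  simp [symDer, symDerHom]

variable {Q : QuadraticForm ℝ V}

/-- The algebra homomorphism `x ↦ x + ε D x` on the Clifford algebra, for the derivation `D`
extending a linear map `f` that is skew with respect to the quadratic form. -/
def cliffordDerHom (f : V →ₗ[ℝ] V) (hf : ∀ v, QuadraticMap.polar Q v (f v) = 0) :
    CliffordAlgebra Q →ₐ[ℝ] TrivSqZeroExt (CliffordAlgebra Q) (CliffordAlgebra Q) :=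
  CliffordAlgebra.lift Q
    ⟨(TrivSqZeroExt.inlAlgHom ℝ (CliffordAlgebra Q) (CliffordAlgebra Q)).toLinearMap ∘ₗ
        CliffordAlgebra.ι Q +
      (TrivSqZeroExt.inrHom (CliffordAlgebra Q) (CliffordAlgebra Q)).restrictScalars ℝ ∘ₗ
        CliffordAlgebra.ι Q ∘ₗ f, by
      intro v
      have := CliffordAlgebra.ι_mul_ι_add_swap (Q := Q) v (f v)
      rw [hf, map_zero] at this
      ext
      · simp [CliffordAlgebra.ι_sq_scalar, TrivSqZeroExt.algebraMap_eq_inl']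
      · simpa [TrivSqZeroExt.algebraMap_eq_inl'] using this⟩

/-- The derivation of the Clifford algebra extending a linear map `f : V → V` that is skew with
respect to the quadratic form. -/
def cliffordDer (f : V →ₗ[ℝ] V) (hf : ∀ v, QuadraticMap.polar Q v (f v) = 0) :
    CliffordAlgebra Q →ₗ[ℝ] CliffordAlgebra Q :=
  (TrivSqZeroExt.sndHom (CliffordAlgebra Q) (CliffordAlgebra Q)).restrictScalars ℝ ∘ₗ
    (cliffordDerHom f hf).toLinearMap

theorem cliffordDerHom_fst (f : V →ₗ[ℝ] V) (hf : ∀ v, QuadraticMap.polar Q v (f v) = 0)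
    (x : CliffordAlgebra Q) : (cliffordDerHom f hf x).fst = x := by
  have : (TrivSqZeroExt.fstHom ℝ _ _).comp (cliffordDerHom f hf) =
      AlgHom.id ℝ (CliffordAlgebra Q) := by
    ext v
    simp [cliffordDerHom]
  exact DFunLike.congr_fun this x

theorem cliffordDer_mul (f : V →ₗ[ℝ] V) (hf : ∀ v, QuadraticMap.polar Q v (f v) = 0)
    (x y : CliffordAlgebra Q) :
    cliffordDer f hf (x * y) = cliffordDer f hf x * y + x * cliffordDer f hf y := by
  simp only [cliffordDer, LinearMap.comp_apply, AlgHom.toLinearMap_apply, map_mul,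
    LinearMap.restrictScalars_apply, TrivSqZeroExt.sndHom_apply, TrivSqZeroExt.snd_mul,
    cliffordDerHom_fst, smul_eq_mul, MulOpposite.smul_eq_mul_unop, MulOpposite.unop_op]
  abel

theorem cliffordDer_ι (f : V →ₗ[ℝ] V) (hf : ∀ v, QuadraticMap.polar Q v (f v) = 0) (v : V) :
    cliffordDer f hf (CliffordAlgebra.ι Q v) = CliffordAlgebra.ι Q (f v) := by
  simp [cliffordDer, cliffordDerHom]

/-- Derivations of the Clifford algebra induced by skew maps commute with the parity. -/
theorem cliffordDer_involute (f : V →ₗ[ℝ] V) (hf : ∀ v, QuadraticMap.polar Q v (f v) = 0)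
    (x : CliffordAlgebra Q) :
    cliffordDer f hf (CliffordAlgebra.involute x) = CliffordAlgebra.involute (cliffordDer f hf x) := by
  induction x using CliffordAlgebra.induction with
  | algebraMap r =>
    rw [AlgHom.commutes, Algebra.algebraMap_eq_smul_one, map_smul]
    have : cliffordDer f hf 1 = 0 := by simpa using cliffordDer_mul f hf 1 1
    rw [this, smul_zero, map_zero]
  | ι v =>
    rw [CliffordAlgebra.involute_ι, map_neg, cliffordDer_ι, CliffordAlgebra.involute_ι]
  | mul x y hx hy => simp only [map_mul, cliffordDer_mul, map_add, hx, hy]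
  | add x y hx hy => simp only [map_add, hx, hy]

theorem symDer_one (f : V →ₗ[ℝ] V) : symDer f 1 = 0 := by simpa using symDer_mul f 1 1

theorem cliffordDer_one (f : V →ₗ[ℝ] V) (hf : ∀ v, QuadraticMap.polar Q v (f v) = 0) :
    cliffordDer (Q := Q) f hf 1 = 0 := by simpa using cliffordDer_mul f hf 1 1

/-- Two derivations of the symmetric algebra that agree on `V` are equal. -/
theorem symDer_unique {D E : SymmetricAlgebra ℝ V →ₗ[ℝ] SymmetricAlgebra ℝ V}
    (hD : ∀ x y, D (x * y) = D x * y + x * D y) (hE : ∀ x y, E (x * y) = E x * y + x * E y)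
    (h : ∀ v, D (SymmetricAlgebra.ι ℝ V v) = E (SymmetricAlgebra.ι ℝ V v)) : D = E := by
  have hD1 : D 1 = 0 := by simpa using hD 1 1
  have hE1 : E 1 = 0 := by simpa using hE 1 1
  ext x
  induction x using SymmetricAlgebra.induction with
  | algebraMap r => rw [Algebra.algebraMap_eq_smul_one, map_smul, map_smul, hD1, hE1]
  | ι v => exact h v
  | mul x y hx hy => rw [hD, hE, hx, hy]
  | add x y hx hy => rw [map_add, map_add, hx, hy]

/-- Two derivations of a Clifford algebra that agree on `V` are equal. -/
theorem cliffordDer_unique {D E : CliffordAlgebra Q →ₗ[ℝ] CliffordAlgebra Q}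
    (hD : ∀ x y, D (x * y) = D x * y + x * D y) (hE : ∀ x y, E (x * y) = E x * y + x * E y)
    (h : ∀ v, D (CliffordAlgebra.ι Q v) = E (CliffordAlgebra.ι Q v)) : D = E := by
  have hD1 : D 1 = 0 := by simpa using hD 1 1
  have hE1 : E 1 = 0 := by simpa using hE 1 1
  refine LinearMap.ext fun x => ?_
  induction x using CliffordAlgebra.induction with
  | algebraMap r => rw [Algebra.algebraMap_eq_smul_one, map_smul, map_smul, hD1, hE1]
  | ι v => exact h v
  | mul x y hx hy => rw [hD, hE, hx, hy]
  | add x y hx hy => rw [map_add, map_add, hx, hy]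

end Derivations

/-- An invariant, non-degenerate, symmetric bilinear form on a real Lie algebra. A quadratic Lie
algebra is a finite-dimensional Lie algebra with such a form. -/
structure InvariantForm (𝔤 : Type*) [LieRing 𝔤] [LieAlgebra ℝ 𝔤] where
  form : LinearMap.BilinForm ℝ 𝔤
  symm : form.IsSymm
  nondegenerate : form.Nondegenerate
  invariant : form.lieInvariant 𝔤

section Weil

variable {𝔤 : Type*} [LieRing 𝔤] [LieAlgebra ℝ 𝔤]

/-- The action of `𝔤` on `S(𝔤)` by derivations extending the adjoint representation. -/
def symLie : 𝔤 →ₗ[ℝ] SymmetricAlgebra ℝ 𝔤 →ₗ[ℝ] SymmetricAlgebra ℝ 𝔤 where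
  toFun ξ := symDer (LieAlgebra.ad ℝ 𝔤 ξ)
  map_add' ξ η := symDer_unique (symDer_mul _)
    (fun x y => by simp only [LinearMap.add_apply, symDer_mul, add_mul, mul_add]; abel)
    (fun v => by simp [symDer_ι])
  map_smul' r ξ := symDer_unique (symDer_mul _)
    (fun x y => by simp [LinearMap.smul_apply, symDer_mul])
    (fun v => by simp [symDer_ι])

theorem symLie_ι (ξ η : 𝔤) :
    symLie ξ (SymmetricAlgebra.ι ℝ 𝔤 η) = SymmetricAlgebra.ι ℝ 𝔤 ⁅ξ, η⁆ := symDer_ι _ _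

theorem symLie_mul (ξ : 𝔤) (x y : SymmetricAlgebra ℝ 𝔤) :
    symLie ξ (x * y) = symLie ξ x * y + x * symLie ξ y := symDer_mul _ _ _

/-- The action of `𝔤` on the Clifford algebra of an invariant quadratic form by derivations
extending the adjoint representation. -/
def cliffordLie (Q : QuadraticForm ℝ 𝔤) (hQ : ∀ ξ η : 𝔤, QuadraticMap.polar Q η (LieAlgebra.ad ℝ 𝔤 ξ η) = 0) :
    𝔤 →ₗ[ℝ] CliffordAlgebra Q →ₗ[ℝ] CliffordAlgebra Q where
  toFun ξ := cliffordDer (LieAlgebra.ad ℝ 𝔤 ξ) (hQ ξ)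
  map_add' ξ η := cliffordDer_unique (cliffordDer_mul _ _)
    (fun x y => by simp only [LinearMap.add_apply, cliffordDer_mul, add_mul, mul_add]; abel)
    (fun v => by simp [cliffordDer_ι])
  map_smul' r ξ := cliffordDer_unique (cliffordDer_mul _ _)
    (fun x y => by simp [LinearMap.smul_apply, cliffordDer_mul])
    (fun v => by simp [cliffordDer_ι])

/-- The action of `𝔤` on `Λ(𝔤)` by derivations extending the adjoint representation. -/
def extLie : 𝔤 →ₗ[ℝ] ExteriorAlgebra ℝ 𝔤 →ₗ[ℝ] ExteriorAlgebra ℝ 𝔤 :=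
  cliffordLie 0 fun _ _ => by simp [QuadraticMap.polar]

theorem extLie_ι (ξ η : 𝔤) :
    extLie ξ (ExteriorAlgebra.ι ℝ η) = ExteriorAlgebra.ι ℝ ⁅ξ, η⁆ := cliffordDer_ι _ _ _

theorem extLie_mul (ξ : 𝔤) (x y : ExteriorAlgebra ℝ 𝔤) :
    extLie ξ (x * y) = extLie ξ x * y + x * extLie ξ y := cliffordDer_mul _ _ _ _

theorem extLie_involute (ξ : 𝔤) (x : ExteriorAlgebra ℝ 𝔤) :
    extLie ξ (CliffordAlgebra.involute x) = CliffordAlgebra.involute (extLie ξ x) :=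
  cliffordDer_involute _ _ _

namespace InvariantForm

variable (B : InvariantForm 𝔤)

/-- The contraction of `Λ(𝔤)` by `ξ`, the odd derivation with `ι_ξ η = B(ξ, η)`. -/
def extContr : 𝔤 →ₗ[ℝ] ExteriorAlgebra ℝ 𝔤 →ₗ[ℝ] ExteriorAlgebra ℝ 𝔤 :=
  CliffordAlgebra.contractLeft ∘ₗ B.form

theorem extContr_ι_mul (ξ η : 𝔤) (x : ExteriorAlgebra ℝ 𝔤) :
    B.extContr ξ (ExteriorAlgebra.ι ℝ η * x) =
      B.form ξ η • x - ExteriorAlgebra.ι ℝ η * B.extContr ξ x :=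
  CliffordAlgebra.contractLeft_ι_mul _ _ _

theorem extContr_mul (ξ : 𝔤) (x y : ExteriorAlgebra ℝ 𝔤) :
    B.extContr ξ (x * y) = B.extContr ξ x * y + CliffordAlgebra.involute x * B.extContr ξ y := by
  induction x using CliffordAlgebra.induction generalizing y with
  | algebraMap r =>
    have h1 : B.extContr ξ 1 = 0 := CliffordAlgebra.contractLeft_one _ _
    simp [Algebra.algebraMap_eq_smul_one, h1]
  | ι v =>
    have h1 : B.extContr ξ (ExteriorAlgebra.ι ℝ v) = algebraMap ℝ _ (B.form ξ v) :=
      CliffordAlgebra.contractLeft_ι _ _ _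
    have h2 := B.extContr_ι_mul ξ v y
    rw [CliffordAlgebra.involute_ι]
    change B.extContr ξ (ExteriorAlgebra.ι ℝ v * y) = B.extContr ξ (ExteriorAlgebra.ι ℝ v) * y +
      -ExteriorAlgebra.ι ℝ v * B.extContr ξ y
    rw [h1, h2, neg_mul, sub_eq_add_neg, Algebra.smul_def]
  | mul x z hx hz =>
    rw [mul_assoc, hx, hz, hx, map_mul]
    simp only [mul_add, add_mul, mul_assoc, add_assoc]
  | add x z hx hz =>
    simp only [add_mul, map_add, hx, hz]
    abel

theorem extContr_involute (ξ : 𝔤) (x : ExteriorAlgebra ℝ 𝔤) :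
    B.extContr ξ (CliffordAlgebra.involute x) = -CliffordAlgebra.involute (B.extContr ξ x) := by
  induction x using CliffordAlgebra.induction with
  | algebraMap r =>
    have h1 : B.extContr ξ 1 = 0 := CliffordAlgebra.contractLeft_one _ _
    simp [Algebra.algebraMap_eq_smul_one, h1]
  | ι v =>
    have h1 : B.extContr ξ (CliffordAlgebra.ι 0 v) = algebraMap ℝ _ (B.form ξ v) :=
      CliffordAlgebra.contractLeft_ι _ _ _
    rw [CliffordAlgebra.involute_ι, map_neg, h1, AlgHom.commutes]
  | mul x z hx hz =>
    rw [map_mul, extContr_mul, extContr_mul, hx, hz]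
    simp only [map_add, map_mul, neg_mul, mul_neg, neg_add]
  | add x z hx hz =>
    simp only [map_add, hx, hz, neg_add]

/-- The algebra homomorphism `Λ(𝔤) → End(Λ(𝔤))` extending the contractions. -/
def extContrHom : ExteriorAlgebra ℝ 𝔤 →ₐ[ℝ] Module.End ℝ (ExteriorAlgebra ℝ 𝔤) :=
  ExteriorAlgebra.lift ℝ ⟨B.extContr, fun ξ =>
    LinearMap.ext fun x => CliffordAlgebra.contractLeft_contractLeft (B.form ξ) x⟩

/-- The quadratic form `ξ ↦ B(ξ, ξ) / 2`. -/
def quadratic : QuadraticForm ℝ 𝔤 := (2⁻¹ : ℝ) • B.form.toQuadraticMap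

/-- The Clifford algebra of `𝔤`, with the relations `ξ η + η ξ = B(ξ, η)`. -/
abbrev Cl : Type _ := CliffordAlgebra B.quadratic

theorem polar_quadratic (ξ η : 𝔤) : QuadraticMap.polar B.quadratic ξ η = B.form ξ η := by
  simp only [quadratic, QuadraticMap.polar, smul_apply,
    LinearMap.BilinMap.toQuadraticMap_apply, map_add, LinearMap.add_apply, smul_eq_mul]
  have h : B.form η ξ = B.form ξ η := B.symm.eq _ _
  rw [h]
  ring

theorem form_lie_self (ξ η : 𝔤) : B.form η ⁅ξ, η⁆ = 0 := by
  have h1 := B.invariant ξ η η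
  have h2 : B.form ⁅ξ, η⁆ η = B.form η ⁅ξ, η⁆ := B.symm.eq _ _
  linarith

/-- The action of `𝔤` on `Cl(𝔤)` by derivations extending the adjoint representation. -/
def clLie : 𝔤 →ₗ[ℝ] B.Cl →ₗ[ℝ] B.Cl :=
  cliffordLie B.quadratic fun ξ η => by
    rw [polar_quadratic, LieAlgebra.ad_apply, form_lie_self]

end InvariantForm

end Weil

section WeilAlgebras

variable (𝔤 : Type*) [LieRing 𝔤] [LieAlgebra ℝ 𝔤]

/-- The Weil algebra `W𝔤 = S𝔤 ⊗ Λ𝔤`. -/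
abbrev Weil : Type _ := SymmetricAlgebra ℝ 𝔤 ⊗[ℝ] ExteriorAlgebra ℝ 𝔤

/-- The parity automorphism of `W𝔤`: `+1` on `S𝔤 ⊗ Λ^{even}` and `-1` on `S𝔤 ⊗ Λ^{odd}`. -/
def weilParity : Weil 𝔤 →ₐ[ℝ] Weil 𝔤 :=
  Algebra.TensorProduct.map (AlgHom.id ℝ _) CliffordAlgebra.involute

theorem weilParity_weilParity (x : Weil 𝔤) : weilParity 𝔤 (weilParity 𝔤 x) = x := by
  induction x using TensorProduct.induction_on with
  | zero => simp
  | tmul s ω => simp [weilParity]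
  | add x y hx hy => rw [map_add, map_add, hx, hy]

/-- The `ℤ/2`-grading of `W𝔤`. -/
abbrev weilGrading : ZMod 2 → Submodule ℝ (Weil 𝔤) := involGrading (weilParity 𝔤)

instance : GradedAlgebra (weilGrading 𝔤) :=
  involGradedAlgebra (weilParity 𝔤) (weilParity_weilParity 𝔤)

variable {𝔤} (B : InvariantForm 𝔤)

/-- The non-commutative Weil algebra `𝒲𝔤 = U𝔤 ⊗ Cl(𝔤)`. -/
abbrev NCWeil : Type _ := UniversalEnvelopingAlgebra ℝ 𝔤 ⊗[ℝ] B.Cl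

/-- The parity automorphism of `𝒲𝔤`: `+1` on `U𝔤 ⊗ Cl^{even}` and `-1` on `U𝔤 ⊗ Cl^{odd}`. -/
def ncWeilParity : NCWeil B →ₐ[ℝ] NCWeil B :=
  Algebra.TensorProduct.map (AlgHom.id ℝ _) CliffordAlgebra.involute

theorem ncWeilParity_ncWeilParity (x : NCWeil B) : ncWeilParity B (ncWeilParity B x) = x := by
  induction x using TensorProduct.induction_on with
  | zero => simp
  | tmul s ω => simp [ncWeilParity]
  | add x y hx hy => rw [map_add, map_add, hx, hy]

/-- The `ℤ/2`-grading of `𝒲𝔤`. -/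
abbrev ncWeilGrading : ZMod 2 → Submodule ℝ (NCWeil B) := involGrading (ncWeilParity B)

instance : GradedAlgebra (ncWeilGrading B) :=
  involGradedAlgebra (ncWeilParity B) (ncWeilParity_ncWeilParity B)

end WeilAlgebras

section Derivatives

variable {𝔤 : Type*} [LieRing 𝔤] [LieAlgebra ℝ 𝔤] (B : InvariantForm 𝔤)
  {ι : Type*} [Fintype ι] [DecidableEq ι] (b : Module.Basis ι ℝ 𝔤)

/-- The basis `e^a` with `B(e^a, e_b) = δ^a_b`. -/
def InvariantForm.dual : Module.Basis ι ℝ 𝔤 := B.form.dualBasis B.nondegenerate b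

open InvariantForm

theorem weil_ext {D E : Weil 𝔤 →ₗ[ℝ] Weil 𝔤} (h : ∀ s ω, D (s ⊗ₜ ω) = E (s ⊗ₜ ω)) : D = E :=
  TensorProduct.ext' h

/-- The property of being an odd derivation of `W𝔤`. -/
def IsOddWeilDer (D : Weil 𝔤 →ₗ[ℝ] Weil 𝔤) : Prop :=
  (∀ x, D (weilParity 𝔤 x) = -weilParity 𝔤 (D x)) ∧
    ∀ x y, D (x * y) = D x * y + weilParity 𝔤 x * D y

theorem IsOddWeilDer.add {D E : Weil 𝔤 →ₗ[ℝ] Weil 𝔤} (hD : IsOddWeilDer D) (hE : IsOddWeilDer E) :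
    IsOddWeilDer (D + E) :=
  ⟨fun x => by
    simp only [LinearMap.add_apply, hD.1, hE.1, map_add, neg_add], fun x y => by
    simp only [LinearMap.add_apply, hD.2, hE.2, add_mul, mul_add]
    abel⟩

theorem IsOddWeilDer.sum {κ : Type*} (s : Finset κ) {D : κ → Weil 𝔤 →ₗ[ℝ] Weil 𝔤}
    (hD : ∀ k, IsOddWeilDer (D k)) : IsOddWeilDer (∑ k ∈ s, D k) := by
  classical
  induction s using Finset.induction_on with
  | empty => exact ⟨fun x => by simp, fun x y => by simp⟩
  | insert k s hk ih =>
    rw [Finset.sum_insert hk]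
    exact (hD k).add ih

theorem isOddWeilDer_map {f : SymmetricAlgebra ℝ 𝔤 →ₗ[ℝ] SymmetricAlgebra ℝ 𝔤}
    {g : ExteriorAlgebra ℝ 𝔤 →ₗ[ℝ] ExteriorAlgebra ℝ 𝔤}
    (hg : ∀ ω, g (CliffordAlgebra.involute ω) = -CliffordAlgebra.involute (g ω))
    (h : ∀ s s' ω ω', f (s * s') ⊗ₜ[ℝ] g (ω * ω') = (f s * s') ⊗ₜ[ℝ] (g ω * ω') +
      (s * f s') ⊗ₜ[ℝ] (CliffordAlgebra.involute ω * g ω')) :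
    IsOddWeilDer (TensorProduct.map f g) := by
  constructor
  · intro x
    induction x using TensorProduct.induction_on with
    | zero => simp
    | tmul s ω => simp [weilParity, hg, TensorProduct.tmul_neg]
    | add x y hx hy => simp only [map_add, hx, hy, neg_add]
  · intro x y
    induction x using TensorProduct.induction_on with
    | zero => simp
    | add x x' hx hx' =>
      simp only [map_add, add_mul, hx, hx']
      abel
    | tmul s ω =>
      induction y using TensorProduct.induction_on with
      | zero => simp
      | add y y' hy hy' =>
        simp only [map_add, mul_add, hy, hy']
        abel
      | tmul s' ω' => simp [weilParity, h]

/-- The Lie algebra (Chevalley-Eilenberg) differential of `Λ𝔤`,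
`d ω = (1 / 2) ∑_a e^a ∧ L_{e_a} ω`. -/
def extD : ExteriorAlgebra ℝ 𝔤 →ₗ[ℝ] ExteriorAlgebra ℝ 𝔤 :=
  (2⁻¹ : ℝ) • ∑ a, LinearMap.mulLeft ℝ (ExteriorAlgebra.ι ℝ (B.dual b a)) ∘ₗ extLie (b a)

theorem ext_ι_mul (v : 𝔤) (x : ExteriorAlgebra ℝ 𝔤) :
    ExteriorAlgebra.ι ℝ v * x = CliffordAlgebra.involute x * ExteriorAlgebra.ι ℝ v := by
  induction x using CliffordAlgebra.induction with
  | algebraMap r => rw [AlgHom.commutes, Algebra.commutes]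
  | ι w =>
    rw [CliffordAlgebra.involute_ι, neg_mul, eq_neg_iff_add_eq_zero]
    exact ExteriorAlgebra.ι_add_mul_swap v w
  | mul x y hx hy => rw [← mul_assoc, hx, mul_assoc, hy, map_mul, mul_assoc]
  | add x y hx hy => rw [mul_add, hx, hy, map_add, add_mul]

theorem extD_involute (ω : ExteriorAlgebra ℝ 𝔤) :
    extD B b (CliffordAlgebra.involute ω) = -CliffordAlgebra.involute (extD B b ω) := by
  have h : ∀ v : 𝔤, CliffordAlgebra.involute (ExteriorAlgebra.ι ℝ v) = -ExteriorAlgebra.ι ℝ v :=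
    fun v => CliffordAlgebra.involute_ι v
  simp [extD, LinearMap.sum_apply, extLie_involute, h]

theorem extD_mul (ω ω' : ExteriorAlgebra ℝ 𝔤) :
    extD B b (ω * ω') = extD B b ω * ω' + CliffordAlgebra.involute ω * extD B b ω' := by
  simp only [extD, LinearMap.smul_apply, LinearMap.sum_apply, LinearMap.comp_apply,
    LinearMap.mulLeft_apply, extLie_mul, smul_mul_assoc, mul_smul_comm, ← smul_add,
    Finset.sum_mul, Finset.mul_sum, ← Finset.sum_add_distrib]
  congr 1
  refine Finset.sum_congr rfl fun a _ => ?_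
  rw [mul_add, ← mul_assoc, ← mul_assoc, ext_ι_mul _ ω, mul_assoc (CliffordAlgebra.involute ω)]

/-- The Weil differential. In terms of the generators `ξ ⊗ 1` and `1 ⊗ ξ` of `W𝔤`, it is the odd
derivation with `d (1 ⊗ ξ) = ξ ⊗ 1 + 1 ⊗ (1 / 2) ∑_a e^a ∧ [e_a, ξ]` and
`d (ξ ⊗ 1) = ∑_a [e_a, ξ] ⊗ e^a`. -/
def weilD : Weil 𝔤 →ₗ[ℝ] Weil 𝔤 :=
  ∑ a, TensorProduct.map (symLie (b a))
      (LinearMap.mulLeft ℝ (ExteriorAlgebra.ι ℝ (B.dual b a))) +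
    ∑ a, TensorProduct.map (LinearMap.mulLeft ℝ (SymmetricAlgebra.ι ℝ 𝔤 (b a)))
      (B.extContr (B.dual b a)) +
    TensorProduct.map LinearMap.id (extD B b)

theorem weilD_isOddDer : IsOddWeilDer (weilD B b) := by
  have h : ∀ v : 𝔤, CliffordAlgebra.involute (ExteriorAlgebra.ι ℝ v) = -ExteriorAlgebra.ι ℝ v :=
    fun v => CliffordAlgebra.involute_ι v
  refine ((IsOddWeilDer.sum _ fun a => ?_).add (IsOddWeilDer.sum _ fun a => ?_)).add ?_
  · refine isOddWeilDer_map (fun ω => ?_) fun s s' ω ω' => ?_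
    · simp [h]
    · rw [symLie_mul, TensorProduct.add_tmul]
      simp only [LinearMap.mulLeft_apply]
      rw [← mul_assoc, ← mul_assoc, ext_ι_mul _ ω]
  · refine isOddWeilDer_map (B.extContr_involute _) fun s s' ω ω' => ?_
    rw [B.extContr_mul, TensorProduct.tmul_add]
    simp only [LinearMap.mulLeft_apply]
    rw [mul_assoc, mul_left_comm s]
  · refine isOddWeilDer_map (extD_involute B b) fun s s' ω ω' => ?_
    rw [extD_mul, TensorProduct.tmul_add]
    rfl

/-- The contractions `ι_ξ = 1 ⊗ ι_ξ` of `W𝔤`. -/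
def weilContr : 𝔤 →ₗ[ℝ] Weil 𝔤 →ₗ[ℝ] Weil 𝔤 :=
  LinearMap.lTensorHom (SymmetricAlgebra ℝ 𝔤) ∘ₗ B.extContr

variable (𝔤) in
/-- The action `L_ξ = L_ξ ⊗ 1 + 1 ⊗ L_ξ` of `𝔤` on `W𝔤`. -/
def weilLie : 𝔤 →ₗ[ℝ] Weil 𝔤 →ₗ[ℝ] Weil 𝔤 :=
  LinearMap.rTensorHom (ExteriorAlgebra ℝ 𝔤) ∘ₗ symLie +
    LinearMap.lTensorHom (SymmetricAlgebra ℝ 𝔤) ∘ₗ extLie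

/-- The Weil algebra `W𝔤` with its derivations. -/
def weil : GDerivations 𝔤 (weilGrading 𝔤) where
  d := weilD B b
  contr := weilContr B
  lie := weilLie 𝔤
  d_odd x := by
    rw [parity_invol, parity_invol]
    exact (weilD_isOddDer B b).1 x
  d_mul x y := by
    rw [parity_invol]
    exact (weilD_isOddDer B b).2 x y
  contr_odd ξ x := by
    rw [parity_invol, parity_invol]
    exact (isOddWeilDer_map (f := LinearMap.id) (B.extContr_involute ξ) fun s s' ω ω' => by
      rw [B.extContr_mul, TensorProduct.tmul_add]; rfl).1 x
  contr_mul ξ x y := by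
    rw [parity_invol]
    exact (isOddWeilDer_map (f := LinearMap.id) (B.extContr_involute ξ) fun s s' ω ω' => by
      rw [B.extContr_mul, TensorProduct.tmul_add]; rfl).2 x y
  lie_even ξ x := by
    rw [parity_invol, parity_invol]
    induction x using TensorProduct.induction_on with
    | zero => simp
    | tmul s ω => simp [weilLie, weilParity, extLie_involute]
    | add x y hx hy => simp only [map_add, hx, hy]
  lie_mul ξ x y := by
    induction x using TensorProduct.induction_on with
    | zero => simp
    | add x x' hx hx' =>
      simp only [map_add, add_mul, hx, hx']
      abel
    | tmul s ω =>
      induction y using TensorProduct.induction_on with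
      | zero => simp
      | add y y' hy hy' =>
        simp only [map_add, mul_add, hy, hy']
        abel
      | tmul s' ω' =>
        simp only [weilLie, LinearMap.add_apply, LinearMap.comp_apply, LinearMap.rTensorHom,
          LinearMap.lTensorHom, LinearMap.coe_mk, AddHom.coe_mk, LinearMap.rTensor_tmul,
          LinearMap.lTensor_tmul, Algebra.TensorProduct.tmul_mul_tmul, symLie_mul, extLie_mul,
          TensorProduct.add_tmul, TensorProduct.tmul_add, add_mul, mul_add]
        abel


/-- The graded commutator `[x, y] = x y - (-1) ^ |y| y x` with an odd element `x`. -/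
def oddAd {A : Type*} [Ring A] [Algebra ℝ A] (𝒜 : ZMod 2 → Submodule ℝ A) [GradedAlgebra 𝒜]
    (x : A) : A →ₗ[ℝ] A :=
  LinearMap.mulLeft ℝ x - LinearMap.mulRight ℝ x ∘ₗ parity 𝒜

section OddAd

variable {A : Type*} [Ring A] [Algebra ℝ A] (𝒜 : ZMod 2 → Submodule ℝ A) [GradedAlgebra 𝒜]

theorem oddAd_apply (x y : A) : oddAd 𝒜 x y = x * y - parity 𝒜 y * x := rfl

theorem oddAd_mul (x y z : A) :
    oddAd 𝒜 x (y * z) = oddAd 𝒜 x y * z + parity 𝒜 y * oddAd 𝒜 x z := by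
  simp only [oddAd_apply, parity_mul]
  noncomm_ring

theorem oddAd_odd {x : A} (hx : parity 𝒜 x = -x) (y : A) :
    oddAd 𝒜 x (parity 𝒜 y) = -parity 𝒜 (oddAd 𝒜 x y) := by
  simp only [oddAd_apply, map_sub, parity_mul, parity_parity, hx]
  noncomm_ring

end OddAd

/-- The cubic element `(1 / 6) f_{abc} e^a e^b e^c` of `Cl(𝔤)`, with `f_{abc} = B(e_a, [e_b, e_c])`. -/
def cubicElement : B.Cl :=
  (6⁻¹ : ℝ) • ∑ i, ∑ j, ∑ k, B.form (b i) ⁅b j, b k⁆ •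
    (CliffordAlgebra.ι B.quadratic (B.dual b i) * CliffordAlgebra.ι B.quadratic (B.dual b j) *
      CliffordAlgebra.ι B.quadratic (B.dual b k))

/-- The cubic Dirac operator `∑_a e_a ⊗ e^a - 1 ⊗ C`. -/
def cubicDirac : NCWeil B :=
  ∑ a, UniversalEnvelopingAlgebra.ι ℝ (b a) ⊗ₜ[ℝ] CliffordAlgebra.ι B.quadratic (B.dual b a) -
    1 ⊗ₜ[ℝ] cubicElement B b

theorem cubicDirac_odd : parity (ncWeilGrading B) (cubicDirac B b) = -cubicDirac B b := by
  rw [parity_invol]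
  have h : CliffordAlgebra.involute (cubicElement B b) = -cubicElement B b := by
    simp [cubicElement]
  simp only [cubicDirac, ncWeilParity, map_sub, map_sum, Algebra.TensorProduct.map_tmul, h,
    CliffordAlgebra.involute_ι, TensorProduct.tmul_neg, map_one, Finset.sum_neg_distrib,
    AlgHom.id_apply]
  abel

/-- The contractions `ι_ξ = [1 ⊗ ξ, ·]` (graded commutator) of `𝒲𝔤`. -/
def ncWeilContr : 𝔤 →ₗ[ℝ] NCWeil B →ₗ[ℝ] NCWeil B where
  toFun ξ := oddAd (ncWeilGrading B) (1 ⊗ₜ[ℝ] CliffordAlgebra.ι B.quadratic ξ)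
  map_add' ξ η := LinearMap.ext fun x => by
    simp only [oddAd_apply, LinearMap.add_apply, map_add, TensorProduct.tmul_add, add_mul, mul_add]
    abel
  map_smul' r ξ := LinearMap.ext fun x => by
    simp only [oddAd_apply, LinearMap.smul_apply, map_smul, TensorProduct.tmul_smul,
      smul_mul_assoc, mul_smul_comm, smul_sub, RingHom.id_apply]

variable (𝔤) in
/-- The inclusion `𝔤 → U𝔤` as a linear map. -/
def envι : 𝔤 →ₗ[ℝ] UniversalEnvelopingAlgebra ℝ 𝔤 where
  toFun ξ := UniversalEnvelopingAlgebra.ι ℝ ξ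
  map_add' ξ η := map_add (UniversalEnvelopingAlgebra.ι ℝ) ξ η
  map_smul' r ξ := map_smul (UniversalEnvelopingAlgebra.ι ℝ) r ξ

variable (𝔤) in
/-- The action of `𝔤` on `U𝔤` by derivations extending the adjoint representation: the commutator
with `ξ`. -/
def envLie : 𝔤 →ₗ[ℝ] UniversalEnvelopingAlgebra ℝ 𝔤 →ₗ[ℝ] UniversalEnvelopingAlgebra ℝ 𝔤 :=
  (LinearMap.mul ℝ (UniversalEnvelopingAlgebra ℝ 𝔤) -
    (LinearMap.mul ℝ (UniversalEnvelopingAlgebra ℝ 𝔤)).flip) ∘ₗ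
      envι 𝔤

theorem envLie_apply (ξ : 𝔤) (x : UniversalEnvelopingAlgebra ℝ 𝔤) :
    envLie 𝔤 ξ x =
      UniversalEnvelopingAlgebra.ι ℝ ξ * x - x * UniversalEnvelopingAlgebra.ι ℝ ξ := rfl

theorem envLie_mul (ξ : 𝔤) (x y : UniversalEnvelopingAlgebra ℝ 𝔤) :
    envLie 𝔤 ξ (x * y) = envLie 𝔤 ξ x * y + x * envLie 𝔤 ξ y := by
  simp only [envLie_apply]
  noncomm_ring

/-- The action `L_ξ = L_ξ ⊗ 1 + 1 ⊗ L_ξ` of `𝔤` on `𝒲𝔤`. -/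
def ncWeilLie : 𝔤 →ₗ[ℝ] NCWeil B →ₗ[ℝ] NCWeil B :=
  LinearMap.rTensorHom B.Cl ∘ₗ envLie 𝔤 +
    LinearMap.lTensorHom (UniversalEnvelopingAlgebra ℝ 𝔤) ∘ₗ B.clLie

/-- The non-commutative Weil algebra `𝒲𝔤` with its derivations; the differential is the graded
commutator with the cubic Dirac operator. -/
def ncWeil : GDerivations 𝔤 (ncWeilGrading B) where
  d := oddAd (ncWeilGrading B) (cubicDirac B b)
  contr := ncWeilContr B
  lie := ncWeilLie B
  d_odd := oddAd_odd _ (cubicDirac_odd B b)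
  d_mul := oddAd_mul _ _
  contr_odd ξ := oddAd_odd _ (by
    rw [parity_invol]
    simp [ncWeilParity, TensorProduct.tmul_neg])
  contr_mul ξ := oddAd_mul _ _
  lie_even ξ x := by
    rw [parity_invol, parity_invol]
    have h : ∀ ω, B.clLie ξ (CliffordAlgebra.involute ω) =
        CliffordAlgebra.involute (B.clLie ξ ω) := cliffordDer_involute _ _
    induction x using TensorProduct.induction_on with
    | zero => simp
    | tmul s ω => simp [ncWeilLie, ncWeilParity, h]
    | add x y hx hy => simp only [map_add, hx, hy]
  lie_mul ξ x y := by
    have h : ∀ ω ω', B.clLie ξ (ω * ω') = B.clLie ξ ω * ω' + ω * B.clLie ξ ω' :=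
      cliffordDer_mul _ _
    induction x using TensorProduct.induction_on with
    | zero => simp
    | add x x' hx hx' =>
      simp only [map_add, add_mul, hx, hx']
      abel
    | tmul s ω =>
      induction y using TensorProduct.induction_on with
      | zero => simp
      | add y y' hy hy' =>
        simp only [map_add, mul_add, hy, hy']
        abel
      | tmul s' ω' =>
        simp only [ncWeilLie, LinearMap.add_apply, LinearMap.comp_apply, LinearMap.rTensorHom,
          LinearMap.lTensorHom, LinearMap.coe_mk, AddHom.coe_mk, LinearMap.rTensor_tmul,
          LinearMap.lTensor_tmul, Algebra.TensorProduct.tmul_mul_tmul, envLie_mul, h,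
          TensorProduct.add_tmul, TensorProduct.tmul_add, add_mul, mul_add]
        abel

end Derivatives

section Quantization

/-- The Taylor series at `0` of `j(z) = sinh(z / 2) / (z / 2)`. -/
def jSeries : PowerSeries ℝ :=
  PowerSeries.mk fun n => if Even n then ((2 : ℝ) ^ n * (n + 1).factorial)⁻¹ else 0

/-- The Taylor series at `0` of `f(z) = (ln j)'(z) = coth(z / 2) / 2 - 1 / z`. -/
def fSeries : PowerSeries ℝ := PowerSeries.derivative ℝ jSeries * jSeries⁻¹

variable {ι : Type*} [Fintype ι] [DecidableEq ι]

/-- The matrix `p(A) = ∑_k p_k A ^ k`, for a matrix `A` of formal power series without constant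
term (only the terms with `k ≤ |α|` contribute to the coefficient of a monomial `α`). -/
def matrixSubst (p : PowerSeries ℝ) (A : Matrix ι ι (MvPowerSeries ι ℝ)) :
    Matrix ι ι (MvPowerSeries ι ℝ) :=
  Matrix.of fun i j α => ∑ k ∈ Finset.range (α.degree + 1),
    PowerSeries.coeff k p * MvPowerSeries.coeff α ((A ^ k) i j)

variable {𝔤 : Type*} [LieRing 𝔤] [LieAlgebra ℝ 𝔤] (B : InvariantForm 𝔤) (b : Module.Basis ι ℝ 𝔤)

/-- The matrix of `ad_ξ` in the basis `b`, for the generic element `ξ = ∑_a ξ^a e_a`, whose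
coordinates `ξ^a` are the variables of the ring of formal power series. -/
def adMatrix : Matrix ι ι (MvPowerSeries ι ℝ) :=
  Matrix.of fun i j => ∑ c, MvPowerSeries.C (b.repr ⁅b c, b j⁆ i) * MvPowerSeries.X c

/-- The Taylor series at `0` of `J(ξ) = det(j(ad_ξ))`. -/
def jDet : MvPowerSeries ι ℝ := (matrixSubst jSeries (adMatrix b)).det

/-- The Taylor series at `0` of `J ^ (1 / 2)`, the square root with constant term `1`. -/
def jDetSqrt : MvPowerSeries ι ℝ :=
  PowerSeries.subst (jDet b - 1) (PowerSeries.binomialSeries ℝ (2⁻¹ : ℝ))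

/-- The power series `(1 / 2) f(ad_ξ)_{ac} e^a ∧ e^c` with coefficients in `Λ𝔤`, where
`f(ad_ξ)_{ac} = B(e_a, f(ad_ξ) e_c)`. -/
def rSeries : MvPowerSeries ι (ExteriorAlgebra ℝ 𝔤) :=
  ∑ a, ∑ c, MvPowerSeries.map (algebraMap ℝ (ExteriorAlgebra ℝ 𝔤))
      (∑ m, MvPowerSeries.C (B.form (b a) (b m)) * matrixSubst fSeries (adMatrix b) m c) *
    MvPowerSeries.C ((2⁻¹ : ℝ) •
      (ExteriorAlgebra.ι ℝ (B.dual b a) * ExteriorAlgebra.ι ℝ (B.dual b c)))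

/-- The Taylor series at `0` of the function
`S(ξ) = det^{1/2}(j(ad_ξ)) exp((1 / 2) f(ad_ξ)_{ac} e^a ∧ e^c)` with values in `Λ𝔤`. The exponential
series terminates, since products of more than `dim 𝔤` elements of `𝔤` vanish in `Λ𝔤`. -/
def sSeries : MvPowerSeries ι (ExteriorAlgebra ℝ 𝔤) :=
  MvPowerSeries.map (algebraMap ℝ (ExteriorAlgebra ℝ 𝔤)) (jDetSqrt b) *
    ∑ k ∈ Finset.range (Fintype.card ι + 1), (k.factorial : ℝ)⁻¹ • rSeries B b ^ k

/-- The partial derivative `∂^α` of polynomials: `∂^α X^m = m! / (m - α)! X^{m - α}`, which is `0`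
unless `α ≤ m`. -/
def polyPartial (α : ι →₀ ℕ) : MvPolynomial ι ℝ →ₗ[ℝ] MvPolynomial ι ℝ :=
  (MvPolynomial.basisMonomials ι ℝ).constr ℝ fun m =>
    MvPolynomial.monomial (m - α) (∏ a, ((m a).descFactorial (α a) : ℝ))

/-- The partial derivative `∂^α` on `S(𝔤)`, regarded as the algebra of polynomials in the basis
elements `e_a`, that is, as the algebra of polynomial functions on `𝔤*`. -/
def symPartial (α : ι →₀ ℕ) : SymmetricAlgebra ℝ 𝔤 →ₗ[ℝ] SymmetricAlgebra ℝ 𝔤 :=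
  (SymmetricAlgebra.equivMvPolynomial b).symm.toLinearMap ∘ₗ polyPartial α ∘ₗ
    (SymmetricAlgebra.equivMvPolynomial b).toLinearMap

theorem symPartial_finite (s : SymmetricAlgebra ℝ 𝔤) :
    (Function.support fun α => symPartial b α s).Finite := by
  suffices h : ∀ p : MvPolynomial ι ℝ, (Function.support fun α => polyPartial α p).Finite by
    refine (h (SymmetricAlgebra.equivMvPolynomial b s)).subset fun α hα h0 => hα ?_
    have h0' : polyPartial α (SymmetricAlgebra.equivMvPolynomial b s) = 0 := h0
    simp [symPartial, h0']
  intro p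
  induction p using MvPolynomial.induction_on' with
  | monomial m r =>
    refine (Set.finite_Iic m).subset fun α hα => ?_
    by_contra hm
    refine hα ?_
    have h1 : MvPolynomial.monomial m r = r • MvPolynomial.basisMonomials ι ℝ m := by
      rw [MvPolynomial.coe_basisMonomials, MvPolynomial.smul_monomial, smul_eq_mul, mul_one]
    have h2 : ∏ a, ((m a).descFactorial (α a) : ℝ) = 0 := by
      have : ∃ a, m a < α a := by
        by_contra! h
        exact hm h
      obtain ⟨a, ha⟩ := this
      refine Finset.prod_eq_zero (Finset.mem_univ a) ?_
      rw [Nat.descFactorial_eq_zero_iff_lt.2 ha, Nat.cast_zero]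
    change polyPartial α (MvPolynomial.monomial m r) = 0
    rw [h1, map_smul, polyPartial, Module.Basis.constr_basis, h2, map_zero, smul_zero]
  | add p q hp hq =>
    refine (hp.union hq).subset fun α hα => ?_
    by_contra hm
    simp only [Set.mem_union, Function.mem_support, not_or, not_not] at hm
    exact hα (by
      change polyPartial α (p + q) = 0
      rw [map_add, hm.1, hm.2, add_zero])

theorem weilDiffOp_finite (F : (ι →₀ ℕ) → Module.End ℝ (ExteriorAlgebra ℝ 𝔤)) (x : Weil 𝔤) :
    (Function.support fun α => TensorProduct.map (symPartial b α) (F α) x).Finite := by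
  induction x using TensorProduct.induction_on with
  | zero => simp
  | tmul s ω =>
    refine (symPartial_finite b s).subset fun α hα h0 => hα ?_
    have h0' : symPartial b α s = 0 := h0
    simp [h0']
  | add x y hx hy =>
    refine (hx.union hy).subset fun α hα => ?_
    by_contra hm
    simp only [Set.mem_union, Function.mem_support, not_or, not_not] at hm
    exact hα (by
      change TensorProduct.map (symPartial b α) (F α) (x + y) = 0
      rw [map_add, hm.1, hm.2, add_zero])

/-- The operator `∑_α ∂^α ⊗ ι(F_α)` on `W𝔤 = S𝔤 ⊗ Λ𝔤` defined by a formal power series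
`F = ∑_α F_α ξ^α` with coefficients in `Λ𝔤`: the variables `ξ^a` act as partial derivatives on `S𝔤`
and the coefficients by contraction on `Λ𝔤`. The sum is finite on each element. -/
def weilDiffOp (F : MvPowerSeries ι (ExteriorAlgebra ℝ 𝔤)) : Weil 𝔤 →ₗ[ℝ] Weil 𝔤 where
  toFun x := ∑ᶠ α, TensorProduct.map (symPartial b α) (B.extContrHom (MvPowerSeries.coeff α F)) x
  map_add' x y := by
    rw [← finsum_add_distrib (weilDiffOp_finite b _ x) (weilDiffOp_finite b _ y)]
    exact finsum_congr fun α => map_add _ x y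
  map_smul' r x := by
    rw [RingHom.id_apply, smul_finsum]
    exact finsum_congr fun α => map_smul _ r x

/-- The operator `∑_α F_α ∂^α` on `S𝔤` defined by a formal power series `F = ∑_α F_α ξ^α`; the sum
is finite on each element. -/
def symDiffOp (F : MvPowerSeries ι ℝ) : SymmetricAlgebra ℝ 𝔤 →ₗ[ℝ] SymmetricAlgebra ℝ 𝔤 where
  toFun s := ∑ᶠ α, MvPowerSeries.coeff α F • symPartial b α s
  map_add' x y := by
    have h : ∀ s, (Function.support fun α =>
        MvPowerSeries.coeff α F • symPartial b α s).Finite := fun s =>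
      (symPartial_finite b s).subset fun α hα h0 => hα (by
        have h0' : symPartial b α s = 0 := h0
        simp [h0'])
    rw [← finsum_add_distrib (h x) (h y)]
    exact finsum_congr fun α => by rw [map_add, smul_add]
  map_smul' r x := by
    rw [RingHom.id_apply, smul_finsum]
    exact finsum_congr fun α => by rw [map_smul, smul_comm]

variable (𝔤) in
/-- The symmetrization map `sym : S𝔤 → U𝔤`. -/
def symmetrization : SymmetricAlgebra ℝ 𝔤 →ₗ[ℝ] UniversalEnvelopingAlgebra ℝ 𝔤 :=
  symmetrize (envι 𝔤)

/-- The quantization map `q : Λ𝔤 → Cl(𝔤)`. -/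
def cliffordQuantization : ExteriorAlgebra ℝ 𝔤 →ₗ[ℝ] B.Cl :=
  antisymmetrize (CliffordAlgebra.ι B.quadratic)

/-- The quantization map `𝒬 = (sym ⊗ q) ∘ ι(Ŝ) : W𝔤 → 𝒲𝔤`. -/
def quantization : Weil 𝔤 →ₗ[ℝ] NCWeil B :=
  TensorProduct.map (symmetrization 𝔤) (cliffordQuantization B) ∘ₗ weilDiffOp B b (sSeries B b)

variable (𝔤) in
/-- The algebra `(S𝔤)^𝔤` of invariants. -/
def symInvariants : Subalgebra ℝ (SymmetricAlgebra ℝ 𝔤) where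
  carrier := {p | ∀ ξ : 𝔤, symLie ξ p = 0}
  mul_mem' := fun {p q} hp hq ξ => by rw [symLie_mul, hp, hq, zero_mul, mul_zero, add_zero]
  add_mem' := fun {p q} hp hq ξ => by rw [map_add, hp, hq, add_zero]
  algebraMap_mem' := fun r ξ => by
    rw [Algebra.algebraMap_eq_smul_one, map_smul]
    have : symLie ξ (1 : SymmetricAlgebra ℝ 𝔤) = 0 := symDer_one _
    rw [this, smul_zero]

end Quantization

section Cohomology

variable {𝔤 : Type*} [LieRing 𝔤] [LieAlgebra ℝ 𝔤] (B : InvariantForm 𝔤)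
  {ι : Type*} [Fintype ι] [DecidableEq ι] (b : Module.Basis ι ℝ 𝔤)
  {A : Type*} [Ring A] [Algebra ℝ A] {𝒜 : ZMod 2 → Submodule ℝ A} [GradedAlgebra 𝒜]
  (D : GDifferentialAlgebra 𝔤 𝒜)

/-- The `𝔤`-derivations of `W𝔤 ⊗ A`. -/
abbrev weilTensor : GDerivations 𝔤 (gtensorGrading (weilGrading 𝔤) 𝒜) :=
  (weil B b).tensor D.toGDerivations

/-- The `𝔤`-derivations of `𝒲𝔤 ⊗ A`. -/
abbrev ncWeilTensor : GDerivations 𝔤 (gtensorGrading (ncWeilGrading B) 𝒜) :=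
  (ncWeil B b).tensor D.toGDerivations

/-- The equivariant cohomology algebra `H_𝔤(A) = H((W𝔤 ⊗ A)_basic)`. -/
abbrev EquivariantCohomology : Type _ := (weilTensor B b D).BasicCohomology

/-- The algebra `ℋ_𝔤(A) = H((𝒲𝔤 ⊗ A)_basic)`. -/
abbrev NCEquivariantCohomology : Type _ := (ncWeilTensor B b D).BasicCohomology

variable (𝒜) in
/-- The map `𝒬 ⊗ 1 : W𝔤 ⊗ A → 𝒲𝔤 ⊗ A`. -/
def quantizationTensor : weilGrading 𝔤 ᵍ⊗[ℝ] 𝒜 →ₗ[ℝ] ncWeilGrading B ᵍ⊗[ℝ] 𝒜 :=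
  gmap (weilGrading 𝔤) 𝒜 (ncWeilGrading B) 𝒜 (quantization B b) LinearMap.id

end Cohomology

end WeilQuant

end

/-!
The quantization map `𝒬 : W𝔤 → 𝒲𝔤` is a bijection that commutes with `d`, `ι_ξ` and `L_ξ`, so
`𝒬 ⊗ 1` is an isomorphism of the basic complexes. It is not an algebra homomorphism, but on basic
cocycles it is one up to basic coboundaries.

*`𝒬` commutes with `d`.* On the divided powers, `𝒬(v^n / n! ⊗ ω)` is the coefficient of `t^n` in
`exp(t v) ⊗ q(Θ(t) ω)`, where `Θ(t) = ι(S(t v))`. The function `f` satisfies the Riccati equation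
`z f' + 2 f + z f^2 = z / 4` (`fSeries_riccati`); with the logarithmic derivative of `J^{1/2}` it
gives a differential equation for `Θ` (`quantSeries_ode`). This equation says that `𝒬` intertwines
the Euler operator `d h + h d` of `W𝔤`, where `h = ∑ (1 ⊗ e_a) ∂_{e^a}`, with the analogous
expression in `𝒲𝔤` (`quantization_weilEuler`). Hence the defect `d 𝒬 - 𝒬 d` satisfies a homogeneous
recursion and vanishes (`quantDefect_eq_zero`). The contractions commute with the coefficients of
`S`, and the Lie derivatives follow by Cartan's formula.

*`𝒬` is bijective.* The differential operator `ι(Ŝ)` is unipotent for the filtration by the symmetric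
degree, and `q` is the linear isomorphism that changes the quadratic form of a Clifford algebra
(`cliffordQuantization_eq`). Symmetrization is onto because permuting the factors of a product in
`U𝔤` changes it by shorter products. It is injective because `U𝔤` acts on formal power series by
left-invariant vector fields in exponential coordinates, which are defined by the matrix
`(1 - exp (-ad_x)) / ad_x` and satisfy the bracket relations by the Maurer-Cartan equation
(`mcForm_flat`); the lines through the origin are integral curves, and so the symmetrization of a
polynomial acts at the origin as the constant coefficient operator of this polynomial.

*Multiplicativity.* Let `Y` be an algebra with a connection `θ`. On `W𝔤 ⊗ Y` the operator
`h = ∑ τ_a ∂_{e^a}`, `τ_ξ = 1 ⊗ ξ ⊗ 1 - 1 ⊗ θ_ξ`, commutes with `L_ξ` and anticommutes with `ι_ξ`,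
and `d h + h d` counts the generators `τ_ξ`, `d τ_ξ` of `W𝔤 ⊗ Y` over `Y`. So a morphism that vanishes
on `1 ⊗ Y` maps basic cocycles to basic coboundaries
(`GDerivations.IsMorphism.exact_of_connection`). For `Y = W𝔤 ⊗ A` the two morphisms
`w ⊗ y ↦ (𝒬(w) ⊗ 1) (𝒬 ⊗ 1)(y)` and `w ⊗ y ↦ (𝒬 ⊗ 1)((w ⊗ 1) y)` agree on `1 ⊗ Y`, which gives
`quantizationTensor_mul`.

*Duflo's isomorphism.* For `p` in `S𝔤` one has `𝒬(p ⊗ 1) = sym(Ĵ^{1/2} p) ⊗ 1`. For trivial `A` the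
defect of multiplicativity on invariants has the form `𝒬((q - p p') ⊗ 1)` and is the image of the
differential of a basic element of `W𝔤`; the augmentation of `Λ𝔤` kills such differentials
(`augmentation_weilD`), so the defect is zero. By equivariance, the invariants correspond to the
center of `U𝔤`.
-/


noncomputable section

namespace WeilQuant

set_option linter.unusedSectionVars false

/-! ### Dual bases -/

section DualBases

variable {𝔤 : Type*} [LieRing 𝔤] [LieAlgebra ℝ 𝔤] (B : InvariantForm 𝔤)
  {ι : Type*} [Fintype ι] [DecidableEq ι] (b : Module.Basis ι ℝ 𝔤)

theorem InvariantForm.form_comm (u v : 𝔤) : B.form u v = B.form v u := B.symm.eq u v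

theorem InvariantForm.form_lie_left (ξ u v : 𝔤) : B.form ⁅ξ, u⁆ v = -B.form u ⁅ξ, v⁆ :=
  B.invariant ξ u v

theorem InvariantForm.form_lie_swap (ξ u v : 𝔤) : B.form ξ ⁅u, v⁆ = -B.form u ⁅ξ, v⁆ := by
  rw [← lie_skew u v, map_neg, B.form_comm, B.form_lie_left, ← lie_skew v ξ, map_neg, neg_neg]

theorem form_dual_left (i j : ι) : B.form (B.dual b i) (b j) = if j = i then 1 else 0 :=
  LinearMap.BilinForm.apply_dualBasis_left ..

theorem form_dual_right (i j : ι) : B.form (b j) (B.dual b i) = if j = i then 1 else 0 := by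
  rw [B.form_comm, form_dual_left]

theorem sum_form_dual_smul (v : 𝔤) : ∑ a, B.form (B.dual b a) v • b a = v := by
  conv_rhs => rw [← b.sum_repr v]
  refine Finset.sum_congr rfl fun a _ => ?_
  congr 1
  conv_lhs => rw [← b.sum_repr v]
  simp [form_dual_left, -Module.Basis.sum_repr]

theorem sum_form_smul_dual (v : 𝔤) : ∑ a, B.form (b a) v • B.dual b a = v := by
  conv_rhs => rw [← (B.dual b).sum_repr v]
  refine Finset.sum_congr rfl fun a _ => ?_
  congr 1
  conv_lhs => rw [← (B.dual b).sum_repr v]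
  simp [form_dual_right, -Module.Basis.sum_repr]

variable {M : Type*} [AddCommGroup M] [Module ℝ M]

/-- The tensor `∑ e^a ⊗ e_a` is symmetric. -/
theorem sum_dual_comm (F : 𝔤 →ₗ[ℝ] 𝔤 →ₗ[ℝ] M) :
    ∑ a, F (B.dual b a) (b a) = ∑ a, F (b a) (B.dual b a) := by
  have h1 : ∀ a, F (B.dual b a) (b a) =
      ∑ c, B.form (B.dual b c) (B.dual b a) • F (b c) (b a) := fun a => by
    conv_lhs => rw [← sum_form_dual_smul B b (B.dual b a)]
    simp
  have h2 : ∀ c, F (b c) (B.dual b c) =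
      ∑ a, B.form (B.dual b a) (B.dual b c) • F (b c) (b a) := fun c => by
    conv_lhs => enter [2]; rw [← sum_form_dual_smul B b (B.dual b c)]
    simp
  simp only [h1, h2]
  rw [Finset.sum_comm]
  refine Finset.sum_congr rfl fun c _ => Finset.sum_congr rfl fun a _ => ?_
  rw [B.form_comm]

/-- The tensor `∑ e^a ⊗ e_a` transfers a map from one factor to its adjoint on the other. -/
theorem sum_dual_adjoint (F : 𝔤 →ₗ[ℝ] 𝔤 →ₗ[ℝ] M) {T T' : 𝔤 →ₗ[ℝ] 𝔤}
    (hT : ∀ u v, B.form (T u) v = B.form u (T' v)) :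
    ∑ a, F (B.dual b a) (T (b a)) = ∑ a, F (T' (B.dual b a)) (b a) := by
  have h1 : ∀ a, F (B.dual b a) (T (b a)) =
      ∑ c, B.form (B.dual b c) (T (b a)) • F (B.dual b a) (b c) := fun a => by
    conv_lhs => rw [← sum_form_dual_smul B b (T (b a))]
    simp
  have h2 : ∀ c, F (T' (B.dual b c)) (b c) =
      ∑ a, B.form (b a) (T' (B.dual b c)) • F (B.dual b a) (b c) := fun c => by
    conv_lhs => rw [← sum_form_smul_dual B b (T' (B.dual b c))]
    simp
  simp only [h1, h2]
  rw [Finset.sum_comm]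
  refine Finset.sum_congr rfl fun c _ => Finset.sum_congr rfl fun a _ => ?_
  rw [← hT, B.form_comm]

theorem sum_dual_lie (F : 𝔤 →ₗ[ℝ] 𝔤 →ₗ[ℝ] M) (ξ : 𝔤) :
    ∑ a, F (B.dual b a) ⁅ξ, b a⁆ = -∑ a, F ⁅ξ, B.dual b a⁆ (b a) := by
  have := sum_dual_adjoint B b F (T := LieAlgebra.ad ℝ 𝔤 ξ) (T' := -LieAlgebra.ad ℝ 𝔤 ξ)
    (fun u v => by simp [B.form_lie_left, -lie_skew])
  simpa [-lie_skew] using this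

variable {A : Type*} [Ring A] [Algebra ℝ A]

theorem sum_dual_mul_comm (f g : 𝔤 →ₗ[ℝ] A) :
    ∑ a, f (B.dual b a) * g (b a) = ∑ a, f (b a) * g (B.dual b a) :=
  sum_dual_comm B b ((LinearMap.mul ℝ A).compl₁₂ f g)

theorem sum_dual_mul_lie (f g : 𝔤 →ₗ[ℝ] A) (ξ : 𝔤) :
    ∑ a, f (B.dual b a) * g ⁅ξ, b a⁆ = -∑ a, f ⁅ξ, B.dual b a⁆ * g (b a) :=
  sum_dual_lie B b ((LinearMap.mul ℝ A).compl₁₂ f g) ξ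

theorem sum_dual_mul_lie' (f g : 𝔤 →ₗ[ℝ] A) (ξ : 𝔤) :
    ∑ a, f (b a) * g ⁅ξ, B.dual b a⁆ = -∑ a, f ⁅ξ, b a⁆ * g (B.dual b a) := by
  have h1 := sum_dual_comm B b ((LinearMap.mul ℝ A).compl₁₂ f (g ∘ₗ LieAlgebra.ad ℝ 𝔤 ξ))
  have h2 := sum_dual_comm B b ((LinearMap.mul ℝ A).compl₁₂ (f ∘ₗ LieAlgebra.ad ℝ 𝔤 ξ) g)
  simp only [LinearMap.compl₁₂_apply, LinearMap.mul_apply', LinearMap.comp_apply,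
    LieAlgebra.ad_apply] at h1 h2
  rw [← h1, ← h2, sum_dual_mul_lie]

variable {N : Type*} [AddCommGroup N] [Module ℝ N]

theorem sum_dual_tmul_lie (f : 𝔤 →ₗ[ℝ] M) (g : 𝔤 →ₗ[ℝ] N) (ξ : 𝔤) :
    ∑ a, f (B.dual b a) ⊗ₜ[ℝ] g ⁅ξ, b a⁆ = -∑ a, f ⁅ξ, B.dual b a⁆ ⊗ₜ[ℝ] g (b a) :=
  sum_dual_lie B b ((TensorProduct.mk ℝ M N).compl₁₂ f g) ξ

theorem sum_dual_tmul_comm (f : 𝔤 →ₗ[ℝ] M) (g : 𝔤 →ₗ[ℝ] N) :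
    ∑ a, f (B.dual b a) ⊗ₜ[ℝ] g (b a) = ∑ a, f (b a) ⊗ₜ[ℝ] g (B.dual b a) :=
  sum_dual_comm B b ((TensorProduct.mk ℝ M N).compl₁₂ f g)

theorem sum_dual_tmul_lie' (f : 𝔤 →ₗ[ℝ] M) (g : 𝔤 →ₗ[ℝ] N) (ξ : 𝔤) :
    ∑ a, f (b a) ⊗ₜ[ℝ] g ⁅ξ, B.dual b a⁆ = -∑ a, f ⁅ξ, b a⁆ ⊗ₜ[ℝ] g (B.dual b a) := by
  have h1 := sum_dual_tmul_comm B b f (g ∘ₗ LieAlgebra.ad ℝ 𝔤 ξ)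
  have h2 := sum_dual_tmul_comm B b (f ∘ₗ LieAlgebra.ad ℝ 𝔤 ξ) g
  simp only [LinearMap.comp_apply, LieAlgebra.ad_apply] at h1 h2
  rw [← h1, ← h2, sum_dual_tmul_lie]

end DualBases

/-! ### The Weil differential on generators -/

section WeilRelations

variable {𝔤 : Type*} [LieRing 𝔤] [LieAlgebra ℝ 𝔤] (B : InvariantForm 𝔤)
  {ι : Type*} [Fintype ι] [DecidableEq ι] (b : Module.Basis ι ℝ 𝔤)

/-- Derivations of the Weil algebra are determined by their values on the generators. -/
theorem weilDer_unique {D E : Weil 𝔤 →ₗ[ℝ] Weil 𝔤}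
    (hD : ∀ x y, D (x * y) = D x * y + x * D y) (hE : ∀ x y, E (x * y) = E x * y + x * E y)
    (h0 : ∀ v, D (SymmetricAlgebra.ι ℝ 𝔤 v ⊗ₜ 1) = E (SymmetricAlgebra.ι ℝ 𝔤 v ⊗ₜ 1))
    (h1 : ∀ v, D (1 ⊗ₜ ExteriorAlgebra.ι ℝ v) = E (1 ⊗ₜ ExteriorAlgebra.ι ℝ v)) : D = E := by
  have hD1 : D 1 = 0 := by simpa using hD 1 1
  have hE1 : E 1 = 0 := by simpa using hE 1 1
  have hS : ∀ s : SymmetricAlgebra ℝ 𝔤, D (s ⊗ₜ 1) = E (s ⊗ₜ 1) := fun s => by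
    induction s using SymmetricAlgebra.induction with
    | algebraMap r =>
      rw [Algebra.algebraMap_eq_smul_one, ← TensorProduct.smul_tmul', map_smul, map_smul]
      rw [← Algebra.TensorProduct.one_def, hD1, hE1]
    | ι v => exact h0 v
    | mul x y hx hy =>
      have : (x * y) ⊗ₜ[ℝ] (1 : ExteriorAlgebra ℝ 𝔤) = x ⊗ₜ 1 * y ⊗ₜ 1 := by simp
      rw [this, hD, hE, hx, hy]
    | add x y hx hy => rw [TensorProduct.add_tmul, map_add, map_add, hx, hy]
  have hL : ∀ ω : ExteriorAlgebra ℝ 𝔤, D (1 ⊗ₜ ω) = E (1 ⊗ₜ ω) := fun ω => by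
    induction ω using CliffordAlgebra.induction with
    | algebraMap r =>
      rw [Algebra.algebraMap_eq_smul_one, TensorProduct.tmul_smul, map_smul, map_smul]
      rw [← Algebra.TensorProduct.one_def, hD1, hE1]
    | ι v => exact h1 v
    | mul x y hx hy =>
      have : (1 : SymmetricAlgebra ℝ 𝔤) ⊗ₜ[ℝ] (x * y) = 1 ⊗ₜ x * 1 ⊗ₜ y := by simp
      rw [this, hD, hE, hx, hy]
    | add x y hx hy => rw [TensorProduct.tmul_add, map_add, map_add, hx, hy]
  refine weil_ext fun s ω => ?_
  have : s ⊗ₜ[ℝ] ω = s ⊗ₜ 1 * 1 ⊗ₜ ω := by simp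
  rw [this, hD, hE, hS, hL]

theorem extContr_ι (ξ v : 𝔤) :
    B.extContr ξ (ExteriorAlgebra.ι ℝ v) = algebraMap ℝ _ (B.form ξ v) :=
  CliffordAlgebra.contractLeft_ι _ _ _

theorem extContr_one (ξ : 𝔤) : B.extContr ξ 1 = 0 := CliffordAlgebra.contractLeft_one _ _

theorem extD_ι (v : 𝔤) : extD B b (ExteriorAlgebra.ι ℝ v) =
    (2⁻¹ : ℝ) • ∑ a, ExteriorAlgebra.ι ℝ (B.dual b a) * ExteriorAlgebra.ι ℝ ⁅b a, v⁆ := by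
  simp [extD, extLie_ι]

theorem extContr_extD_ι (ξ v : 𝔤) :
    B.extContr ξ (extD B b (ExteriorAlgebra.ι ℝ v)) = ExteriorAlgebra.ι ℝ ⁅ξ, v⁆ := by
  have h1 : ∑ a, B.form ξ (B.dual b a) • ExteriorAlgebra.ι ℝ ⁅b a, v⁆ =
      ExteriorAlgebra.ι ℝ ⁅ξ, v⁆ := by
    conv_rhs => rw [← sum_form_dual_smul B b ξ]
    simp [sum_lie, B.form_comm ξ]
  have h2 : ∑ a, ExteriorAlgebra.ι ℝ (B.dual b a) * algebraMap ℝ (ExteriorAlgebra ℝ 𝔤)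
      (B.form ξ ⁅b a, v⁆) = - ExteriorAlgebra.ι ℝ ⁅ξ, v⁆ := by
    conv_rhs => rw [← sum_form_smul_dual B b ⁅ξ, v⁆]
    simp [B.form_lie_swap ξ, ← Algebra.commutes, ← Algebra.smul_def]
  rw [extD_ι, map_smul, map_sum]
  simp only [B.extContr_ι_mul, extContr_ι, Finset.sum_sub_distrib, h1, h2]
  rw [sub_neg_eq_add, ← two_smul ℝ (ExteriorAlgebra.ι ℝ ⁅ξ, v⁆), smul_smul]
  norm_num

theorem weilD_tmul (s : SymmetricAlgebra ℝ 𝔤) (ω : ExteriorAlgebra ℝ 𝔤) :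
    weilD B b (s ⊗ₜ ω) = ∑ a, symLie (b a) s ⊗ₜ (ExteriorAlgebra.ι ℝ (B.dual b a) * ω) +
      ∑ a, (SymmetricAlgebra.ι ℝ 𝔤 (b a) * s) ⊗ₜ B.extContr (B.dual b a) ω +
      s ⊗ₜ extD B b ω := by
  simp [weilD, LinearMap.sum_apply]

theorem extD_one : extD B b 1 = 0 := by
  have : ∀ ξ : 𝔤, extLie ξ (1 : ExteriorAlgebra ℝ 𝔤) = 0 := fun ξ => cliffordDer_one _ _
  simp [extD, LinearMap.sum_apply, this]

theorem weilD_sym (v : 𝔤) : weilD B b (SymmetricAlgebra.ι ℝ 𝔤 v ⊗ₜ 1) =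
    ∑ a, SymmetricAlgebra.ι ℝ 𝔤 ⁅b a, v⁆ ⊗ₜ ExteriorAlgebra.ι ℝ (B.dual b a) := by
  simp [weilD_tmul, symLie_ι, extContr_one, extD_one]

theorem weilD_ext (v : 𝔤) : weilD B b (1 ⊗ₜ ExteriorAlgebra.ι ℝ v) =
    SymmetricAlgebra.ι ℝ 𝔤 v ⊗ₜ 1 + 1 ⊗ₜ extD B b (ExteriorAlgebra.ι ℝ v) := by
  have : ∀ ξ : 𝔤, symLie ξ (1 : SymmetricAlgebra ℝ 𝔤) = 0 := fun ξ => symDer_one _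
  simp only [weilD_tmul, this, TensorProduct.zero_tmul, Finset.sum_const_zero, extContr_ι,
    Algebra.algebraMap_eq_smul_one, TensorProduct.tmul_smul, mul_one, zero_add]
  congr 1
  conv_rhs => rw [← sum_form_dual_smul B b v]
  simp [TensorProduct.sum_tmul, TensorProduct.smul_tmul']

theorem ext_anticomm (u v : 𝔤) : ExteriorAlgebra.ι ℝ u * ExteriorAlgebra.ι ℝ v =
    -(ExteriorAlgebra.ι ℝ v * ExteriorAlgebra.ι ℝ u) :=
  eq_neg_of_add_eq_zero_left (ExteriorAlgebra.ι_add_mul_swap u v)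

end WeilRelations

/-! ### The relations of the Weil algebra -/

section OddDerivations

variable {A : Type*} [Ring A] [Algebra ℝ A] {p D E : A →ₗ[ℝ] A}

/-- The anticommutator of two odd derivations is an even derivation. -/
theorem odd_anticomm_mul (hp : ∀ x, p (p x) = x)
    (hD : ∀ x, D (p x) = -p (D x)) (hDm : ∀ x y, D (x * y) = D x * y + p x * D y)
    (hE : ∀ x, E (p x) = -p (E x)) (hEm : ∀ x y, E (x * y) = E x * y + p x * E y) (x y : A) :
    D (E (x * y)) + E (D (x * y)) = (D (E x) + E (D x)) * y + x * (D (E y) + E (D y)) := by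
  simp only [hDm, hEm, hD, hE, hp, map_add, add_mul, mul_add, neg_mul]
  abel

/-- The square of an odd derivation is an even derivation. -/
theorem odd_sq_mul (hp : ∀ x, p (p x) = x)
    (hD : ∀ x, D (p x) = -p (D x)) (hDm : ∀ x y, D (x * y) = D x * y + p x * D y) (x y : A) :
    D (D (x * y)) = D (D x) * y + x * D (D y) := by
  simp only [hDm, hD, hp, map_add, neg_mul]
  abel

end OddDerivations

section WeilRelations

variable {𝔤 : Type*} [LieRing 𝔤] [LieAlgebra ℝ 𝔤] (B : InvariantForm 𝔤)
  {ι : Type*} [Fintype ι] [DecidableEq ι] (b : Module.Basis ι ℝ 𝔤)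

variable {M : Type*} [AddCommGroup M] [Module ℝ M]

theorem self_eq_neg_real {x : M} (h : x = -x) : x = 0 := by
  have : (2 : ℝ) • x = 0 := by
    rw [two_smul]
    nth_rewrite 2 [h]
    exact add_neg_cancel x
  simpa using this

/-- Antisymmetrization of a double bracket, by the Jacobi identity. -/
theorem two_smul_sum_tmul_lie_lie (G : 𝔤 →ₗ[ℝ] M) (v : 𝔤) :
    (2 : ℝ) • ∑ a, ∑ c, G ⁅b c, ⁅b a, v⁆⁆ ⊗ₜ[ℝ]
        (ExteriorAlgebra.ι ℝ (B.dual b c) * ExteriorAlgebra.ι ℝ (B.dual b a)) =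
      ∑ a, ∑ c, G ⁅⁅b c, b a⁆, v⁆ ⊗ₜ[ℝ]
        (ExteriorAlgebra.ι ℝ (B.dual b c) * ExteriorAlgebra.ι ℝ (B.dual b a)) := by
  rw [two_smul]
  conv_lhs => enter [2]; rw [Finset.sum_comm]
  rw [← Finset.sum_add_distrib]
  refine Finset.sum_congr rfl fun a _ => ?_
  rw [← Finset.sum_add_distrib]
  refine Finset.sum_congr rfl fun c _ => ?_
  rw [ext_anticomm (B.dual b a), TensorProduct.tmul_neg, ← sub_eq_add_neg,
    ← TensorProduct.sub_tmul, ← map_sub, lie_lie]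

/-- The invariance of the cubic form `B(u, [v, w])`, written as an identity in `Λ³`. -/
theorem sum_ext_lie_lie (v : 𝔤) :
    ∑ a, ∑ c, ExteriorAlgebra.ι ℝ ⁅⁅b c, b a⁆, v⁆ *
      (ExteriorAlgebra.ι ℝ (B.dual b c) * ExteriorAlgebra.ι ℝ (B.dual b a)) = 0 := by
  set e : 𝔤 →ₗ[ℝ] ExteriorAlgebra ℝ 𝔤 := ExteriorAlgebra.ι ℝ with he
  have hanti : ∀ u w, e u * e w = -(e w * e u) := ext_anticomm
  set P := ∑ a, ∑ c, e ⁅⁅b c, b a⁆, v⁆ * (e (B.dual b c) * e (B.dual b a)) with hP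
  have hPv : ∑ a, ∑ c, e ⁅v, ⁅b c, b a⁆⁆ * (e (B.dual b c) * e (B.dual b a)) = -P := by
    rw [hP, ← Finset.sum_neg_distrib]
    refine Finset.sum_congr rfl fun a _ => ?_
    rw [← Finset.sum_neg_distrib]
    refine Finset.sum_congr rfl fun c _ => ?_
    rw [← lie_skew, map_neg, neg_mul]
  -- the two terms of the Leibniz rule for `[v, [e_c, e_a]]`
  have h2 : ∑ c, ∑ a, e ⁅b c, ⁅v, b a⁆⁆ * (e (B.dual b c) * e (B.dual b a)) = P := by
    have hc : ∀ c, ∑ a, e ⁅b c, ⁅v, b a⁆⁆ * (e (B.dual b c) * e (B.dual b a)) =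
        -∑ a, e ⁅v, ⁅b c, b a⁆⁆ * (e (B.dual b c) * e (B.dual b a)) := fun c => by
      have e1 := sum_dual_mul_lie' B b (e ∘ₗ LieAlgebra.ad ℝ 𝔤 (b c))
        (LinearMap.mulLeft ℝ (e (B.dual b c)) ∘ₗ e) v
      have e2 := sum_dual_mul_lie' B b e
        (LinearMap.mulLeft ℝ (e (B.dual b c)) ∘ₗ e ∘ₗ LieAlgebra.ad ℝ 𝔤 v) (b c)
      have e3 := sum_dual_mul_comm B b (e ∘ₗ LieAlgebra.ad ℝ 𝔤 v ∘ₗ LieAlgebra.ad ℝ 𝔤 (b c))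
        (LinearMap.mulRight ℝ (e (B.dual b c)) ∘ₗ e)
      simp only [LinearMap.comp_apply, LieAlgebra.ad_apply, LinearMap.mulLeft_apply,
        LinearMap.mulRight_apply] at e1 e2 e3
      have e4 : ∑ a, e (b a) * (e (B.dual b c) * e ⁅v, ⁅b c, B.dual b a⁆⁆) =
          ∑ a, e ⁅v, ⁅b c, B.dual b a⁆⁆ * (e (b a) * e (B.dual b c)) :=
        Finset.sum_congr rfl fun a _ => by
          rw [hanti (B.dual b c), mul_neg, ← mul_assoc, hanti (b a), neg_mul, neg_neg, mul_assoc]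
      have e5 : ∑ a, e ⁅v, ⁅b c, b a⁆⁆ * (e (B.dual b a) * e (B.dual b c)) =
          -∑ a, e ⁅v, ⁅b c, b a⁆⁆ * (e (B.dual b c) * e (B.dual b a)) := by
        rw [← Finset.sum_neg_distrib]
        exact Finset.sum_congr rfl fun a _ => by rw [hanti (B.dual b a), mul_neg]
      rw [← neg_eq_iff_eq_neg] at e1
      rw [← e1, ← e2, e4, e3, e5]
    simp only [hc, Finset.sum_neg_distrib]
    rw [Finset.sum_comm, hPv, neg_neg]
  have h1 : ∑ a, ∑ c, e ⁅⁅v, b c⁆, b a⁆ * (e (B.dual b c) * e (B.dual b a)) = P := by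
    rw [← h2]
    refine Finset.sum_congr rfl fun a _ => Finset.sum_congr rfl fun c _ => ?_
    rw [← lie_skew, map_neg, hanti (B.dual b c), neg_mul_neg]
  have h3 : -P = P + P := by
    rw [Finset.sum_comm] at h2
    calc -P = ∑ a, ∑ c, (e ⁅⁅v, b c⁆, b a⁆ * (e (B.dual b c) * e (B.dual b a)) +
          e ⁅b c, ⁅v, b a⁆⁆ * (e (B.dual b c) * e (B.dual b a))) := by
          rw [← hPv]
          refine Finset.sum_congr rfl fun a _ => Finset.sum_congr rfl fun c _ => ?_
          rw [← add_mul, ← map_add, leibniz_lie]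
      _ = P + P := by simp only [Finset.sum_add_distrib, h1, h2]
  have h4 : (3 : ℝ) • P = 0 := by
    have : (3 : ℝ) • P = P + P - -P := by module
    rw [this, h3, sub_self]
  simpa using h4

/-- The term `G [e_a, v] ⊗ d e^a` is minus the term with the double bracket: this is the cancellation
in `d ^ 2 = 0` on `S𝔤 ⊗ 1`. -/
theorem sum_lie_tmul_extD (G : 𝔤 →ₗ[ℝ] M) (v : 𝔤) :
    ∑ a, G ⁅b a, v⁆ ⊗ₜ[ℝ] extD B b (ExteriorAlgebra.ι ℝ (B.dual b a)) =
      -∑ a, ∑ c, G ⁅b c, ⁅b a, v⁆⁆ ⊗ₜ[ℝ]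
        (ExteriorAlgebra.ι ℝ (B.dual b c) * ExteriorAlgebra.ι ℝ (B.dual b a)) := by
  have h : ∀ c, ∑ a, G ⁅b a, v⁆ ⊗ₜ[ℝ]
      (ExteriorAlgebra.ι ℝ (B.dual b c) * ExteriorAlgebra.ι ℝ ⁅b c, B.dual b a⁆) =
      -∑ a, G ⁅⁅b c, b a⁆, v⁆ ⊗ₜ[ℝ]
        (ExteriorAlgebra.ι ℝ (B.dual b c) * ExteriorAlgebra.ι ℝ (B.dual b a)) := fun c => by
    have := sum_dual_tmul_lie' B b (G ∘ₗ (-LieAlgebra.ad ℝ 𝔤 v))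
      (LinearMap.mulLeft ℝ (ExteriorAlgebra.ι ℝ (B.dual b c)) ∘ₗ ExteriorAlgebra.ι ℝ) (b c)
    simpa only [LinearMap.comp_apply, LinearMap.neg_apply, lie_skew,
      LieAlgebra.ad_apply, LinearMap.mulLeft_apply] using this
  have h2 := two_smul_sum_tmul_lie_lie B b G v
  simp only [extD_ι, TensorProduct.tmul_smul, TensorProduct.tmul_sum, ← Finset.smul_sum]
  rw [Finset.sum_comm]
  simp only [h, Finset.sum_neg_distrib]
  rw [Finset.sum_comm, ← h2, smul_neg, smul_smul]
  norm_num

theorem extD_extD_ι (v : 𝔤) : extD B b (extD B b (ExteriorAlgebra.ι ℝ v)) = 0 := by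
  have hX : ∑ a, ∑ c, ExteriorAlgebra.ι ℝ ⁅b c, ⁅b a, v⁆⁆ *
      (ExteriorAlgebra.ι ℝ (B.dual b c) * ExteriorAlgebra.ι ℝ (B.dual b a)) = 0 := by
    have h := congrArg (LinearMap.mul' ℝ (ExteriorAlgebra ℝ 𝔤))
      (two_smul_sum_tmul_lie_lie B b (ExteriorAlgebra.ι ℝ) v)
    simp only [map_smul, map_sum, LinearMap.mul'_apply, sum_ext_lie_lie] at h
    simpa using h
  have h1 : ∑ a, ExteriorAlgebra.ι ℝ ⁅b a, v⁆ *
      extD B b (ExteriorAlgebra.ι ℝ (B.dual b a)) = 0 := by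
    have h := congrArg (LinearMap.mul' ℝ (ExteriorAlgebra ℝ 𝔤))
      (sum_lie_tmul_extD B b (ExteriorAlgebra.ι ℝ) v)
    simpa only [map_neg, map_sum, LinearMap.mul'_apply, hX, neg_zero] using h
  have h2 : ∑ a, ExteriorAlgebra.ι ℝ (B.dual b a) *
      extD B b (ExteriorAlgebra.ι ℝ ⁅b a, v⁆) = 0 := by
    have : ∀ a, ExteriorAlgebra.ι ℝ (B.dual b a) * extD B b (ExteriorAlgebra.ι ℝ ⁅b a, v⁆) =
        (2⁻¹ : ℝ) • ∑ c, ExteriorAlgebra.ι ℝ ⁅b c, ⁅b a, v⁆⁆ *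
          (ExteriorAlgebra.ι ℝ (B.dual b a) * ExteriorAlgebra.ι ℝ (B.dual b c)) := fun a => by
      rw [extD_ι, mul_smul_comm, Finset.mul_sum]
      congr 1
      refine Finset.sum_congr rfl fun c _ => ?_
      rw [← mul_assoc, ext_ι_mul _ (ExteriorAlgebra.ι ℝ (B.dual b a) *
        ExteriorAlgebra.ι ℝ (B.dual b c) : ExteriorAlgebra ℝ 𝔤), map_mul]
      erw [CliffordAlgebra.involute_ι, CliffordAlgebra.involute_ι]
      rw [neg_mul_neg]
    simp only [this, ← Finset.smul_sum]
    have h3 : ∀ a c, ExteriorAlgebra.ι ℝ ⁅b c, ⁅b a, v⁆⁆ *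
          (ExteriorAlgebra.ι ℝ (B.dual b a) * ExteriorAlgebra.ι ℝ (B.dual b c)) =
        -(ExteriorAlgebra.ι ℝ ⁅b c, ⁅b a, v⁆⁆ *
          (ExteriorAlgebra.ι ℝ (B.dual b c) * ExteriorAlgebra.ι ℝ (B.dual b a))) := fun a c => by
      rw [ext_anticomm (B.dual b a), mul_neg]
    simp only [h3, Finset.sum_neg_distrib, hX]
    simp
  have h3 : ∀ w : 𝔤, CliffordAlgebra.involute (ExteriorAlgebra.ι ℝ w) = -ExteriorAlgebra.ι ℝ w :=
    fun v => CliffordAlgebra.involute_ι v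
  have h4 : ∀ a, extD B b (ExteriorAlgebra.ι ℝ (B.dual b a)) * ExteriorAlgebra.ι ℝ ⁅b a, v⁆ =
      ExteriorAlgebra.ι ℝ ⁅b a, v⁆ * extD B b (ExteriorAlgebra.ι ℝ (B.dual b a)) := fun a => by
    have h5 := extD_involute B b (ExteriorAlgebra.ι ℝ (B.dual b a))
    rw [h3, map_neg, neg_inj] at h5
    rw [ext_ι_mul, ← h5]
  rw [extD_ι, map_smul, map_sum]
  simp only [extD_mul, h3, h4, neg_mul, Finset.sum_add_distrib, Finset.sum_neg_distrib, h1, h2]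
  simp

theorem weilD_weilD_sym (v : 𝔤) : weilD B b (weilD B b (SymmetricAlgebra.ι ℝ 𝔤 v ⊗ₜ 1)) = 0 := by
  have h1 := sum_lie_tmul_extD B b (SymmetricAlgebra.ι ℝ 𝔤) v
  have h2 : ∑ a, ∑ c, (SymmetricAlgebra.ι ℝ 𝔤 (b c) * SymmetricAlgebra.ι ℝ 𝔤 ⁅b a, v⁆) ⊗ₜ[ℝ]
      B.extContr (B.dual b c) (ExteriorAlgebra.ι ℝ (B.dual b a)) = 0 := by
    have h3 : ∀ a, ∑ c, (SymmetricAlgebra.ι ℝ 𝔤 (b c) * SymmetricAlgebra.ι ℝ 𝔤 ⁅b a, v⁆) ⊗ₜ[ℝ]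
        B.extContr (B.dual b c) (ExteriorAlgebra.ι ℝ (B.dual b a)) =
        -(SymmetricAlgebra.ι ℝ 𝔤 (B.dual b a) * SymmetricAlgebra.ι ℝ 𝔤 ⁅v, b a⁆) ⊗ₜ[ℝ] 1 :=
      fun a => by
        conv_rhs => rw [← sum_form_dual_smul B b (B.dual b a), ← lie_skew]
        simp only [extContr_ι, Algebra.algebraMap_eq_smul_one, TensorProduct.tmul_smul, map_neg,
          mul_neg, neg_neg, map_sum, map_smul, Finset.sum_mul, smul_mul_assoc,
          TensorProduct.sum_tmul, ← TensorProduct.smul_tmul', TensorProduct.neg_tmul]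
    simp only [h3, ← TensorProduct.sum_tmul, Finset.sum_neg_distrib]
    have h4 := sum_dual_mul_lie B b (SymmetricAlgebra.ι ℝ 𝔤) (SymmetricAlgebra.ι ℝ 𝔤) v
    have h5 := sum_dual_mul_comm B b (SymmetricAlgebra.ι ℝ 𝔤)
      (SymmetricAlgebra.ι ℝ 𝔤 ∘ₗ LieAlgebra.ad ℝ 𝔤 v)
    simp only [LinearMap.comp_apply, LieAlgebra.ad_apply] at h5
    have h6 : ∑ a, SymmetricAlgebra.ι ℝ 𝔤 (B.dual b a) * SymmetricAlgebra.ι ℝ 𝔤 ⁅v, b a⁆ = 0 := by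
      have h7 : ∑ a, SymmetricAlgebra.ι ℝ 𝔤 ⁅v, B.dual b a⁆ * SymmetricAlgebra.ι ℝ 𝔤 (b a) =
          ∑ a, SymmetricAlgebra.ι ℝ 𝔤 (B.dual b a) * SymmetricAlgebra.ι ℝ 𝔤 ⁅v, b a⁆ := by
        rw [h5]
        exact Finset.sum_congr rfl fun a _ => mul_comm _ _
      rw [h7] at h4
      exact self_eq_neg_real h4
    rw [h6]
    simp
  rw [weilD_sym, map_sum]
  simp only [weilD_tmul, Finset.sum_add_distrib, symLie_ι, h1, h2]
  simp

/-- `d ^ 2 = 0`: the square of an odd derivation is a derivation, so generators suffice. -/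
theorem weilD_weilD (x : Weil 𝔤) : weilD B b (weilD B b x) = 0 := by
  have hD := weilD_isOddDer B b
  suffices h : weilD B b ∘ₗ weilD B b = 0 from LinearMap.congr_fun h x
  refine weilDer_unique (fun x y => ?_) (fun x y => by simp) (fun v => ?_) fun v => ?_
  · exact odd_sq_mul (p := (weilParity 𝔤).toLinearMap) (weilParity_weilParity 𝔤) hD.1 hD.2 x y
  · exact weilD_weilD_sym B b v
  · have h : ∀ ξ : 𝔤, symLie ξ (1 : SymmetricAlgebra ℝ 𝔤) = 0 := fun ξ => symDer_one _
    have h2 := sum_dual_tmul_lie B b (SymmetricAlgebra.ι ℝ 𝔤) (ExteriorAlgebra.ι ℝ) v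
    have h3 := sum_dual_tmul_comm B b (SymmetricAlgebra.ι ℝ 𝔤 ∘ₗ LieAlgebra.ad ℝ 𝔤 v)
      (ExteriorAlgebra.ι ℝ)
    have h4 := sum_dual_tmul_lie' B b (SymmetricAlgebra.ι ℝ 𝔤) (ExteriorAlgebra.ι ℝ) v
    rw [LinearMap.comp_apply, weilD_ext, map_add, weilD_sym, weilD_tmul]
    simp only [LinearMap.zero_apply, h, extContr_extD_ι, extD_extD_ι, TensorProduct.zero_tmul, mul_one,
      TensorProduct.tmul_zero, Finset.sum_const_zero, add_zero, zero_add]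
    have h5 : ∀ w, ⁅w, v⁆ = -⁅v, w⁆ := fun w => (lie_skew w v).symm
    simp only [h5, map_neg, TensorProduct.neg_tmul, TensorProduct.tmul_neg,
      Finset.sum_neg_distrib, h4]
    simp

theorem extContr_extContr (ξ η : 𝔤) (ω : ExteriorAlgebra ℝ 𝔤) :
    B.extContr ξ (B.extContr η ω) = -B.extContr η (B.extContr ξ ω) :=
  CliffordAlgebra.contractLeft_comm _ _ _

theorem weilContr_tmul (ξ : 𝔤) (s : SymmetricAlgebra ℝ 𝔤) (ω : ExteriorAlgebra ℝ 𝔤) :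
    weilContr B ξ (s ⊗ₜ ω) = s ⊗ₜ B.extContr ξ ω := rfl

theorem weilLie_tmul (ξ : 𝔤) (s : SymmetricAlgebra ℝ 𝔤) (ω : ExteriorAlgebra ℝ 𝔤) :
    weilLie 𝔤 ξ (s ⊗ₜ ω) = symLie ξ s ⊗ₜ ω + s ⊗ₜ extLie ξ ω := rfl

/-- Cartan's formula `[ι_ξ, d] = L_ξ` in `W𝔤`; both sides are derivations, so generators suffice. -/
theorem weil_contr_d (ξ : 𝔤) (x : Weil 𝔤) :
    weilContr B ξ (weilD B b x) + weilD B b (weilContr B ξ x) = weilLie 𝔤 ξ x := by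
  have hD := weilD_isOddDer B b
  have hp : ∀ x, weilContr B ξ (weilParity 𝔤 x) = -weilParity 𝔤 (weilContr B ξ x) := fun x => by
    have := (weil B b).contr_odd ξ x
    rwa [parity_invol, parity_invol] at this
  have hm : ∀ x y, weilContr B ξ (x * y) = weilContr B ξ x * y +
      weilParity 𝔤 x * weilContr B ξ y := fun x y => by
    have := (weil B b).contr_mul ξ x y
    rwa [parity_invol] at this
  suffices h : weilContr B ξ ∘ₗ weilD B b + weilD B b ∘ₗ weilContr B ξ = weilLie 𝔤 ξ from
    LinearMap.congr_fun h x
  have h1 : ∀ ξ : 𝔤, symLie ξ (1 : SymmetricAlgebra ℝ 𝔤) = 0 := fun ξ => symDer_one _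
  have h2 : ∀ ξ : 𝔤, extLie ξ (1 : ExteriorAlgebra ℝ 𝔤) = 0 := fun ξ => cliffordDer_one _ _
  have h3 : weilD B b (1 ⊗ₜ 1) = 0 := by
    simp [weilD_tmul, h1, extContr_one, extD_one]
  refine weilDer_unique (fun x y => ?_) ((weil B b).lie_mul ξ) (fun v => ?_) fun v => ?_
  · exact odd_anticomm_mul (p := (weilParity 𝔤).toLinearMap) (weilParity_weilParity 𝔤) hp hm
      hD.1 hD.2 x y
  · simp only [LinearMap.comp_apply, LinearMap.add_apply, weilD_sym, map_sum, weilContr_tmul,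
      extContr_ι, extContr_one, weilLie_tmul, symLie_ι, h2, Algebra.algebraMap_eq_smul_one,
      TensorProduct.tmul_smul, TensorProduct.tmul_zero, map_zero, add_zero]
    conv_rhs => rw [← sum_form_dual_smul B b ξ]
    simp [sum_lie, TensorProduct.sum_tmul, TensorProduct.smul_tmul', B.form_comm ξ]
  · simp only [LinearMap.comp_apply, LinearMap.add_apply, weilD_ext, map_add, weilContr_tmul,
      extContr_ι, extContr_one, weilLie_tmul, h1, extContr_extD_ι, extLie_ι,
      Algebra.algebraMap_eq_smul_one, TensorProduct.tmul_smul, map_smul, h3]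
    simp

end WeilRelations

/-! ### The relations of the non-commutative Weil algebra -/

section NCWeilRelations

variable {𝔤 : Type*} [LieRing 𝔤] [LieAlgebra ℝ 𝔤] (B : InvariantForm 𝔤)
  {ι : Type*} [Fintype ι] [DecidableEq ι] (b : Module.Basis ι ℝ 𝔤)

theorem cl_anticomm (u v : 𝔤) :
    CliffordAlgebra.ι B.quadratic u * CliffordAlgebra.ι B.quadratic v +
      CliffordAlgebra.ι B.quadratic v * CliffordAlgebra.ι B.quadratic u =
      algebraMap ℝ _ (B.form u v) := by
  rw [CliffordAlgebra.ι_mul_ι_add_swap, B.polar_quadratic]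

theorem clLie_ι (ξ v : 𝔤) : B.clLie ξ (CliffordAlgebra.ι B.quadratic v) =
    CliffordAlgebra.ι B.quadratic ⁅ξ, v⁆ := cliffordDer_ι _ _ _

theorem clLie_mul (ξ : 𝔤) (x y : B.Cl) :
    B.clLie ξ (x * y) = B.clLie ξ x * y + x * B.clLie ξ y := cliffordDer_mul _ _ _ _

/-- The element `γ(ξ) = ½ ∑ e^a [e_a, ξ]` of `Cl(𝔤)` that implements the adjoint action of `ξ`. -/
def cliffordGamma : 𝔤 →ₗ[ℝ] B.Cl :=
  (2⁻¹ : ℝ) • ∑ a, LinearMap.mulLeft ℝ (CliffordAlgebra.ι B.quadratic (B.dual b a)) ∘ₗ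
    CliffordAlgebra.ι B.quadratic ∘ₗ LieAlgebra.ad ℝ 𝔤 (b a)

theorem cliffordGamma_apply (ξ : 𝔤) : cliffordGamma B b ξ =
    (2⁻¹ : ℝ) • ∑ a, CliffordAlgebra.ι B.quadratic (B.dual b a) *
      CliffordAlgebra.ι B.quadratic ⁅b a, ξ⁆ := by
  simp [cliffordGamma]

/-- The adjoint action on `Cl(𝔤)` is inner: `[γ(ξ), x] = L_ξ x`. -/
theorem cliffordGamma_comm (ξ : 𝔤) (x : B.Cl) :
    cliffordGamma B b ξ * x - x * cliffordGamma B b ξ = B.clLie ξ x := by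
  suffices h : LinearMap.mulLeft ℝ (cliffordGamma B b ξ) - LinearMap.mulRight ℝ (cliffordGamma B b ξ)
      = B.clLie ξ from LinearMap.congr_fun h x
  refine cliffordDer_unique (fun x y => ?_) (clLie_mul B ξ) fun v => ?_
  · simp only [LinearMap.sub_apply, LinearMap.mulLeft_apply, LinearMap.mulRight_apply]
    noncomm_ring
  · rw [LinearMap.sub_apply, LinearMap.mulLeft_apply, LinearMap.mulRight_apply, clLie_ι,
      cliffordGamma_apply, smul_mul_assoc, mul_smul_comm, Finset.sum_mul, Finset.mul_sum,
      ← smul_sub, ← Finset.sum_sub_distrib]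
    set c := CliffordAlgebra.ι B.quadratic with hc
    have h : ∀ a, c (B.dual b a) * c ⁅b a, ξ⁆ * c v - c v * (c (B.dual b a) * c ⁅b a, ξ⁆) =
        B.form (b a) ⁅ξ, v⁆ • c (B.dual b a) - B.form (B.dual b a) v • c ⁅b a, ξ⁆ := fun a => by
      have h1 : c (B.dual b a) * (c ⁅b a, ξ⁆ * c v + c v * c ⁅b a, ξ⁆) =
          B.form (b a) ⁅ξ, v⁆ • c (B.dual b a) := by
        rw [hc, cl_anticomm, ← Algebra.commutes, ← Algebra.smul_def, ← lie_skew, map_neg,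
          LinearMap.neg_apply, B.form_lie_left, neg_neg]
      have h2 : (c (B.dual b a) * c v + c v * c (B.dual b a)) * c ⁅b a, ξ⁆ =
          B.form (B.dual b a) v • c ⁅b a, ξ⁆ := by
        rw [hc, cl_anticomm, ← Algebra.smul_def]
      rw [← h1, ← h2]
      noncomm_ring
    have h3 : ∑ a, B.form (B.dual b a) v • c ⁅b a, ξ⁆ = -c ⁅ξ, v⁆ := by
      rw [← map_neg, lie_skew]
      conv_rhs => rw [← sum_form_dual_smul B b v]
      simp [sum_lie]
    have h4 : ∑ a, B.form (b a) ⁅ξ, v⁆ • c (B.dual b a) = c ⁅ξ, v⁆ := by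
      conv_rhs => rw [← sum_form_smul_dual B b ⁅ξ, v⁆]
      simp
    simp only [h, Finset.sum_sub_distrib, h3, h4]
    module

theorem cubicElement_eq : cubicElement B b =
    (6⁻¹ : ℝ) • ∑ j, ∑ k, CliffordAlgebra.ι B.quadratic ⁅b j, b k⁆ *
      CliffordAlgebra.ι B.quadratic (B.dual b j) *
        CliffordAlgebra.ι B.quadratic (B.dual b k) := by
  rw [cubicElement, Finset.sum_comm]
  congr 1
  refine Finset.sum_congr rfl fun j _ => ?_
  rw [Finset.sum_comm]
  refine Finset.sum_congr rfl fun k _ => ?_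
  conv_rhs => rw [← sum_form_smul_dual B b ⁅b j, b k⁆]
  simp only [map_sum, map_smul, Finset.sum_mul, smul_mul_assoc]

theorem cubicElement_anticomm (ξ : 𝔤) :
    cubicElement B b * CliffordAlgebra.ι B.quadratic ξ +
      CliffordAlgebra.ι B.quadratic ξ * cubicElement B b = -cliffordGamma B b ξ := by
  rw [cubicElement_eq, cliffordGamma_apply, smul_mul_assoc, mul_smul_comm, ← smul_add,
    Finset.sum_mul, Finset.mul_sum, ← Finset.sum_add_distrib]
  simp only [Finset.sum_mul, Finset.mul_sum, ← Finset.sum_add_distrib]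
  set c := CliffordAlgebra.ι B.quadratic with hc
  have h : ∀ j k, c ⁅b j, b k⁆ * c (B.dual b j) * c (B.dual b k) * c ξ +
      c ξ * (c ⁅b j, b k⁆ * c (B.dual b j) * c (B.dual b k)) =
      B.form (b k) ⁅ξ, b j⁆ • (c (B.dual b j) * c (B.dual b k)) -
        B.form (B.dual b j) ξ • (c ⁅b j, b k⁆ * c (B.dual b k)) +
        B.form (B.dual b k) ξ • (c ⁅b j, b k⁆ * c (B.dual b j)) := fun j k => by
    have h1 : (c ⁅b j, b k⁆ * c ξ + c ξ * c ⁅b j, b k⁆) * (c (B.dual b j) * c (B.dual b k)) =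
        B.form (b k) ⁅ξ, b j⁆ • (c (B.dual b j) * c (B.dual b k)) := by
      rw [hc, cl_anticomm, ← Algebra.smul_def, B.form_comm, B.form_lie_swap, B.form_comm (b k),
        B.form_lie_left]
    have h2 : c ⁅b j, b k⁆ * (c (B.dual b j) * c ξ + c ξ * c (B.dual b j)) * c (B.dual b k) =
        B.form (B.dual b j) ξ • (c ⁅b j, b k⁆ * c (B.dual b k)) := by
      rw [hc, cl_anticomm, ← Algebra.commutes, mul_assoc, ← Algebra.smul_def]
    have h3 : c ⁅b j, b k⁆ * c (B.dual b j) * (c (B.dual b k) * c ξ + c ξ * c (B.dual b k)) =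
        B.form (B.dual b k) ξ • (c ⁅b j, b k⁆ * c (B.dual b j)) := by
      rw [hc, cl_anticomm, ← Algebra.commutes, ← Algebra.smul_def]
    rw [← h1, ← h2, ← h3]
    noncomm_ring
  have hs : -∑ k, c ⁅ξ, b k⁆ * c (B.dual b k) = ∑ k, c (B.dual b k) * c ⁅ξ, b k⁆ := by
    rw [← sum_dual_mul_lie' B b c c ξ]
    exact (sum_dual_mul_comm B b c (c ∘ₗ LieAlgebra.ad ℝ 𝔤 ξ)).symm
  have t1 : ∑ j, ∑ k, B.form (b k) ⁅ξ, b j⁆ • (c (B.dual b j) * c (B.dual b k)) =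
      ∑ k, c (B.dual b k) * c ⁅ξ, b k⁆ := by
    refine Finset.sum_congr rfl fun j _ => ?_
    conv_rhs => rw [← sum_form_smul_dual B b ⁅ξ, b j⁆]
    simp [Finset.mul_sum]
  have t2 : ∑ j, ∑ k, B.form (B.dual b j) ξ • (c ⁅b j, b k⁆ * c (B.dual b k)) =
      ∑ k, c ⁅ξ, b k⁆ * c (B.dual b k) := by
    rw [Finset.sum_comm]
    refine Finset.sum_congr rfl fun k _ => ?_
    conv_rhs => rw [← sum_form_dual_smul B b ξ]
    simp [Finset.sum_mul, sum_lie]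
  have t3 : ∑ j, ∑ k, B.form (B.dual b k) ξ • (c ⁅b j, b k⁆ * c (B.dual b j)) =
      -∑ k, c ⁅ξ, b k⁆ * c (B.dual b k) := by
    rw [← Finset.sum_neg_distrib]
    refine Finset.sum_congr rfl fun j _ => ?_
    rw [← neg_mul, ← map_neg, lie_skew]
    conv_rhs => rw [← sum_form_dual_smul B b ξ]
    simp [Finset.sum_mul, lie_sum]
  simp only [h, Finset.sum_add_distrib, Finset.sum_sub_distrib, t1, t2, t3]
  have h5 : ∀ a, c ⁅b a, ξ⁆ = -c ⁅ξ, b a⁆ := fun a => by rw [← map_neg, lie_skew]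
  simp only [h5, mul_neg, Finset.sum_neg_distrib]
  rw [sub_eq_add_neg, hs]
  module

theorem clLie_cubicElement (ξ : 𝔤) : B.clLie ξ (cubicElement B b) = 0 := by
  rw [cubicElement_eq, map_smul]
  simp only [map_sum, clLie_mul, clLie_ι]
  set c := CliffordAlgebra.ι B.quadratic with hc
  simp only [add_mul, Finset.sum_add_distrib]
  have t2 : ∑ j, ∑ k, c ⁅b j, b k⁆ * c ⁅ξ, B.dual b j⁆ * c (B.dual b k) =
      -∑ j, ∑ k, c ⁅⁅ξ, b j⁆, b k⁆ * c (B.dual b j) * c (B.dual b k) := by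
    rw [Finset.sum_comm, Finset.sum_comm (γ := ι) (f := fun j k => c ⁅⁅ξ, b j⁆, b k⁆ * _ * _),
      ← Finset.sum_neg_distrib]
    refine Finset.sum_congr rfl fun k _ => ?_
    have := sum_dual_mul_lie' B b (c ∘ₗ (-LieAlgebra.ad ℝ 𝔤 (b k)))
      (LinearMap.mulRight ℝ (c (B.dual b k)) ∘ₗ c) ξ
    simpa only [LinearMap.comp_apply, LinearMap.neg_apply, LieAlgebra.ad_apply, lie_skew,
      LinearMap.mulRight_apply, ← mul_assoc] using this
  have t3 : ∑ j, ∑ k, c ⁅b j, b k⁆ * c (B.dual b j) * c ⁅ξ, B.dual b k⁆ =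
      -∑ j, ∑ k, c ⁅b j, ⁅ξ, b k⁆⁆ * c (B.dual b j) * c (B.dual b k) := by
    rw [← Finset.sum_neg_distrib]
    refine Finset.sum_congr rfl fun j _ => ?_
    have := sum_dual_mul_lie' B b (LinearMap.mulRight ℝ (c (B.dual b j)) ∘ₗ c ∘ₗ
      LieAlgebra.ad ℝ 𝔤 (b j)) c ξ
    simpa only [LinearMap.comp_apply, LieAlgebra.ad_apply, LinearMap.mulRight_apply] using this
  simp only [mul_assoc] at t2 t3 ⊢
  rw [t2, t3]
  simp only [leibniz_lie ξ, map_add, add_mul, Finset.sum_add_distrib]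
  simp

/-- The element `ξ ⊗ 1 + 1 ⊗ γ(ξ)` of `𝒲𝔤`, the differential of the odd generator `1 ⊗ ξ`. -/
def ncCurv : 𝔤 →ₗ[ℝ] NCWeil B :=
  (TensorProduct.mk ℝ _ _).flip 1 ∘ₗ envι 𝔤 + TensorProduct.mk ℝ _ _ 1 ∘ₗ cliffordGamma B b

theorem ncCurv_apply (ξ : 𝔤) : ncCurv B b ξ = UniversalEnvelopingAlgebra.ι ℝ ξ ⊗ₜ 1 +
    1 ⊗ₜ cliffordGamma B b ξ := rfl

theorem cubicDirac_anticomm (ξ : 𝔤) :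
    cubicDirac B b * (1 ⊗ₜ CliffordAlgebra.ι B.quadratic ξ) +
      (1 ⊗ₜ CliffordAlgebra.ι B.quadratic ξ) * cubicDirac B b = ncCurv B b ξ := by
  have h1 : ∑ a, UniversalEnvelopingAlgebra.ι ℝ (b a) ⊗ₜ[ℝ]
      (CliffordAlgebra.ι B.quadratic (B.dual b a) * CliffordAlgebra.ι B.quadratic ξ) +
      ∑ a, UniversalEnvelopingAlgebra.ι ℝ (b a) ⊗ₜ[ℝ]
      (CliffordAlgebra.ι B.quadratic ξ * CliffordAlgebra.ι B.quadratic (B.dual b a)) =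
      UniversalEnvelopingAlgebra.ι ℝ ξ ⊗ₜ 1 := by
    conv_rhs => rw [← sum_form_dual_smul B b ξ]
    change _ = (envι 𝔤 (∑ a, B.form (B.dual b a) ξ • b a)) ⊗ₜ[ℝ] (1 : B.Cl)
    rw [map_sum, TensorProduct.sum_tmul, ← Finset.sum_add_distrib]
    refine Finset.sum_congr rfl fun a _ => ?_
    rw [← TensorProduct.tmul_add, cl_anticomm, Algebra.algebraMap_eq_smul_one, map_smul,
      TensorProduct.smul_tmul]
    rfl
  have h2 := cubicElement_anticomm B b ξ
  rw [ncCurv_apply, ← h1, ← neg_eq_iff_eq_neg.2 h2, cubicDirac, sub_mul, mul_sub, Finset.sum_mul,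
    Finset.mul_sum]
  simp only [Algebra.TensorProduct.tmul_mul_tmul, mul_one, one_mul, TensorProduct.tmul_neg,
    TensorProduct.tmul_add]
  abel

theorem ncCurv_comm (ξ : 𝔤) (x : NCWeil B) :
    ncCurv B b ξ * x - x * ncCurv B b ξ = ncWeilLie B ξ x := by
  induction x using TensorProduct.induction_on with
  | zero => simp
  | add x y hx hy => rw [map_add, ← hx, ← hy]; noncomm_ring
  | tmul u x =>
    rw [ncCurv_apply, add_mul, mul_add]
    simp only [Algebra.TensorProduct.tmul_mul_tmul, mul_one, one_mul]
    change _ = envLie 𝔤 ξ u ⊗ₜ x + u ⊗ₜ B.clLie ξ x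
    rw [envLie_apply, ← cliffordGamma_comm B b, TensorProduct.sub_tmul, TensorProduct.tmul_sub]
    abel

theorem ncWeilLie_tmul (ξ : 𝔤) (u : UniversalEnvelopingAlgebra ℝ 𝔤) (x : B.Cl) :
    ncWeilLie B ξ (u ⊗ₜ x) = envLie 𝔤 ξ u ⊗ₜ x + u ⊗ₜ B.clLie ξ x := rfl

theorem envLie_ι (ξ v : 𝔤) : envLie 𝔤 ξ (UniversalEnvelopingAlgebra.ι ℝ v) =
    UniversalEnvelopingAlgebra.ι ℝ ⁅ξ, v⁆ := by
  let _ : LieRing (UniversalEnvelopingAlgebra ℝ 𝔤) := LieRing.ofAssociativeRing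
  rw [envLie_apply]
  exact ((UniversalEnvelopingAlgebra.ι ℝ).map_lie ξ v).symm

theorem ncWeilLie_cubicDirac (ξ : 𝔤) : ncWeilLie B ξ (cubicDirac B b) = 0 := by
  have h1 : envLie 𝔤 ξ 1 = 0 := by rw [envLie_apply]; simp
  have h := sum_dual_tmul_lie' B b (envι 𝔤) (CliffordAlgebra.ι B.quadratic) ξ
  change ∑ a, UniversalEnvelopingAlgebra.ι ℝ (b a) ⊗ₜ[ℝ] _ =
    -∑ a, UniversalEnvelopingAlgebra.ι ℝ ⁅ξ, b a⁆ ⊗ₜ[ℝ] _ at h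
  simp only [cubicDirac, map_sub, map_sum, ncWeilLie_tmul, envLie_ι, clLie_ι, h1,
    clLie_cubicElement, Finset.sum_add_distrib, h]
  simp

theorem ncCurv_even (ξ : 𝔤) : ncWeilParity B (ncCurv B b ξ) = ncCurv B b ξ := by
  simp [ncCurv_apply, ncWeilParity, cliffordGamma_apply]

theorem ncWeil_d_ext (ξ : 𝔤) : (ncWeil B b).d (1 ⊗ₜ CliffordAlgebra.ι B.quadratic ξ) =
    ncCurv B b ξ := by
  change oddAd _ _ _ = _
  rw [oddAd_apply, parity_invol, ← cubicDirac_anticomm]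
  simp [ncWeilParity, TensorProduct.tmul_neg]

theorem ncWeil_d_ncCurv (ξ : 𝔤) : (ncWeil B b).d (ncCurv B b ξ) = 0 := by
  change oddAd _ _ _ = _
  rw [oddAd_apply, parity_invol, ncCurv_even, ← neg_eq_zero, neg_sub, ncCurv_comm,
    ncWeilLie_cubicDirac]

theorem oddAd_anticomm {A : Type*} [Ring A] [Algebra ℝ A] (𝒜 : ZMod 2 → Submodule ℝ A)
    [GradedAlgebra 𝒜] {x y : A} (hx : parity 𝒜 x = -x) (hy : parity 𝒜 y = -y) (z : A) :
    oddAd 𝒜 x (oddAd 𝒜 y z) + oddAd 𝒜 y (oddAd 𝒜 x z) =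
      (y * x + x * y) * z - z * (y * x + x * y) := by
  simp only [oddAd_apply, map_sub, parity_mul, parity_parity, hx, hy]
  noncomm_ring

/-- Cartan's formula `[ι_ξ, d] = L_ξ` in `𝒲𝔤`. Both `ι_ξ` and `d` are inner, so their commutator is
the commutator with the anticommutator of `1 ⊗ ξ` and `𝒟`, which is `ncCurv ξ`. -/
theorem ncWeil_contr_d (ξ : 𝔤) (x : NCWeil B) :
    (ncWeil B b).contr ξ ((ncWeil B b).d x) + (ncWeil B b).d ((ncWeil B b).contr ξ x) =
      (ncWeil B b).lie ξ x := by
  change oddAd _ _ _ + oddAd _ _ _ = ncWeilLie B ξ x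
  rw [← ncCurv_comm B b, ← cubicDirac_anticomm]
  refine oddAd_anticomm _ ?_ (cubicDirac_odd B b) x
  rw [parity_invol]
  simp [ncWeilParity, TensorProduct.tmul_neg]

end NCWeilRelations

/-! ### Antisymmetrization as a change of quadratic form -/

section CliffordQuantization

variable {𝔤 : Type*} [LieRing 𝔤] [LieAlgebra ℝ 𝔤] (B : InvariantForm 𝔤)

theorem halfForm_toQuadraticMap :
    ((2⁻¹ : ℝ) • B.form).toQuadraticMap = B.quadratic - 0 := by
  ext v
  simp [InvariantForm.quadratic]

/-- The linear isomorphism `Λ𝔤 → Cl(𝔤)` that maps products of pairwise orthogonal vectors to the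
same products. -/
def extToCl : ExteriorAlgebra ℝ 𝔤 ≃ₗ[ℝ] B.Cl :=
  CliffordAlgebra.changeFormEquiv (halfForm_toQuadraticMap B)

theorem extToCl_ι_mul (v : 𝔤) (ω : ExteriorAlgebra ℝ 𝔤) :
    extToCl B (ExteriorAlgebra.ι ℝ v * ω) = CliffordAlgebra.ι B.quadratic v * extToCl B ω -
      (2⁻¹ : ℝ) • CliffordAlgebra.contractLeft (B.form v) (extToCl B ω) := by
  have := CliffordAlgebra.changeForm_ι_mul (halfForm_toQuadraticMap B) v ω
  rw [LinearMap.smul_apply, map_smul, LinearMap.smul_apply] at this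
  exact this

theorem extToCl_one : extToCl B 1 = 1 :=
  CliffordAlgebra.changeForm_one (halfForm_toQuadraticMap B)

theorem extToCl_extContr (v : 𝔤) (ω : ExteriorAlgebra ℝ 𝔤) :
    extToCl B (B.extContr v ω) = CliffordAlgebra.contractLeft (B.form v) (extToCl B ω) :=
  CliffordAlgebra.changeForm_contractLeft (halfForm_toQuadraticMap B) _ ω

theorem contractLeft_prod_of_orthogonal (v : 𝔤) (l : List 𝔤) (h : ∀ w ∈ l, B.form v w = 0) :
    CliffordAlgebra.contractLeft (B.form v) (l.map (CliffordAlgebra.ι B.quadratic)).prod = 0 := by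
  induction l with
  | nil => simp
  | cons w l ih =>
    rw [List.map_cons, List.prod_cons, CliffordAlgebra.contractLeft_ι_mul, h w (by simp),
      ih fun u hu => h u (by simp [hu])]
    simp

theorem extToCl_prod_of_orthogonal (l : List 𝔤) (h : l.Pairwise fun v w => B.form v w = 0) :
    extToCl B (l.map (ExteriorAlgebra.ι ℝ)).prod =
      (l.map (CliffordAlgebra.ι B.quadratic)).prod := by
  induction l with
  | nil => simpa using extToCl_one B
  | cons w l ih =>
    rw [List.pairwise_cons] at h
    rw [List.map_cons, List.prod_cons, extToCl_ι_mul, ih h.2,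
      contractLeft_prod_of_orthogonal B w l h.1]
    simp

/-- The antisymmetrization map is the change of quadratic form: both map a product of pairwise
orthogonal vectors to the same product, since the map on the right is alternating. -/
theorem cliffordQuantization_eq [FiniteDimensional ℝ 𝔤] :
    cliffordQuantization B = (extToCl B).toLinearMap := by
  let _ : Invertible (2 : ℝ) := invertibleOfNonzero two_ne_zero
  obtain ⟨v, hv⟩ := LinearMap.BilinForm.exists_orthogonal_basis
    (B := B.form) ⟨fun x y => B.form_comm x y⟩
  refine ExteriorAlgebra.lhom_ext fun k => v.ext_alternating fun f hf => ?_
  have key : ∀ σ : Equiv.Perm (Fin k), Equiv.Perm.sign σ •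
      (List.ofFn fun i => CliffordAlgebra.ι B.quadratic (v (f (σ i)))).prod =
      extToCl B (ExteriorAlgebra.ιMulti ℝ k fun i => v (f i)) := fun σ => by
    have h1 : (List.ofFn fun i => CliffordAlgebra.ι B.quadratic (v (f (σ i)))).prod =
        extToCl B (ExteriorAlgebra.ιMulti ℝ k ((fun i => v (f i)) ∘ σ)) := by
      have h2 := extToCl_prod_of_orthogonal B (List.ofFn fun i => v (f (σ i))) (by
        rw [List.pairwise_ofFn]
        intro i j hij
        exact hv (fun h => hij.ne (σ.injective (hf h))))
      rw [List.map_ofFn, List.map_ofFn] at h2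
      rw [ExteriorAlgebra.ιMulti_apply]
      exact h2.symm
    rw [h1, AlternatingMap.map_perm]
    rcases Int.units_eq_one_or (Equiv.Perm.sign σ) with h | h <;> simp [h]
  have h := antisymmetrize_prod (CliffordAlgebra.ι B.quadratic) k fun i => v (f i)
  simp only [key, Finset.sum_const, Finset.card_univ, Fintype.card_perm, Fintype.card_fin,
    ← Nat.cast_smul_eq_nsmul ℝ, smul_smul] at h
  rw [inv_mul_cancel₀ (by positivity), one_smul] at h
  exact h

theorem cl_contract_eq (ξ : 𝔤) (x : B.Cl) :
    CliffordAlgebra.ι B.quadratic ξ * x - CliffordAlgebra.involute x * CliffordAlgebra.ι _ ξ =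
      CliffordAlgebra.contractLeft (B.form ξ) x := by
  induction x using CliffordAlgebra.left_induction with
  | algebraMap r => simp [Algebra.commutes]
  | add x y hx hy =>
    rw [map_add, map_add, ← hx, ← hy]
    noncomm_ring
  | ι_mul x v hx =>
    rw [CliffordAlgebra.contractLeft_ι_mul, ← hx, Algebra.smul_def, ← cl_anticomm, map_mul,
      CliffordAlgebra.involute_ι]
    noncomm_ring

theorem ncWeilContr_tmul (ξ : 𝔤) (u : UniversalEnvelopingAlgebra ℝ 𝔤) (x : B.Cl) :
    ncWeilContr B ξ (u ⊗ₜ x) = u ⊗ₜ CliffordAlgebra.contractLeft (B.form ξ) x := by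
  change oddAd _ _ _ = _
  rw [oddAd_apply, parity_invol, ← cl_contract_eq, TensorProduct.tmul_sub]
  simp [ncWeilParity]

end CliffordQuantization

/-! ### Restriction of power series to lines -/

section LineEval

variable {ι : Type*} [Fintype ι] [DecidableEq ι] {R : Type*} [Ring R] [Algebra ℝ R]

/-- The exponents of the monomials of degree `k`. -/
abbrev degreeSet (ι : Type*) [Fintype ι] [DecidableEq ι] (k : ℕ) : Finset (ι →₀ ℕ) :=
  Finset.finsuppAntidiag Finset.univ k

theorem mem_degreeSet {k : ℕ} {α : ι →₀ ℕ} : α ∈ degreeSet ι k ↔ α.degree = k := by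
  simp [Finset.mem_finsuppAntidiag, Finsupp.degree_eq_sum]

/-- The value `x ^ α` of a monomial. -/
def monomialValue (x : ι → ℝ) (α : ι →₀ ℕ) : ℝ := ∏ a, x a ^ α a

theorem monomialValue_add (x : ι → ℝ) (α β : ι →₀ ℕ) :
    monomialValue x (α + β) = monomialValue x α * monomialValue x β := by
  simp [monomialValue, pow_add, Finset.prod_mul_distrib]

theorem monomialValue_zero (x : ι → ℝ) : monomialValue x 0 = 1 := by simp [monomialValue]

theorem monomialValue_single (x : ι → ℝ) (a : ι) :
    monomialValue x (Finsupp.single a 1) = x a := by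
  rw [monomialValue, Finset.prod_eq_single a]
  · simp
  · intro c _ hc
    simp [Finsupp.single_eq_of_ne hc]
  · simp

theorem degreeSet_zero : degreeSet ι 0 = {0} := by
  ext α
  rw [mem_degreeSet, Finset.mem_singleton, Finsupp.degree_eq_zero_iff]

/-- The restriction `t ↦ F(t x)` of a formal power series to a line through the origin. -/
def lineEval (x : ι → ℝ) : MvPowerSeries ι R →+* PowerSeries R where
  toFun F := PowerSeries.mk fun k => ∑ α ∈ degreeSet ι k,
    monomialValue x α • MvPowerSeries.coeff α F
  map_zero' := by ext; simp
  map_add' F G := by ext; simp [Finset.sum_add_distrib]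
  map_one' := by
    ext k
    rw [PowerSeries.coeff_mk, PowerSeries.coeff_one]
    split_ifs with h
    · subst h
      rw [degreeSet_zero]
      simp [monomialValue_zero]
    · refine Finset.sum_eq_zero fun α hα => ?_
      rw [MvPowerSeries.coeff_one, if_neg, smul_zero]
      rintro rfl
      rw [mem_degreeSet] at hα
      exact h (by rw [← hα]; simp)
  map_mul' F G := by
    ext k
    rw [PowerSeries.coeff_mk, PowerSeries.coeff_mul]
    have h : ∀ p : ℕ × ℕ, (∑ α ∈ degreeSet ι p.1, monomialValue x α • MvPowerSeries.coeff α F) *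
        (∑ α ∈ degreeSet ι p.2, monomialValue x α • MvPowerSeries.coeff α G) =
        ∑ q ∈ degreeSet ι p.1 ×ˢ degreeSet ι p.2, monomialValue x q.1 • MvPowerSeries.coeff q.1 F *
          monomialValue x q.2 • MvPowerSeries.coeff q.2 G := fun p => by
      rw [Finset.sum_mul_sum, ← Finset.sum_product']
    simp only [PowerSeries.coeff_mk, MvPowerSeries.coeff_mul, Finset.smul_sum, h]
    rw [Finset.sum_sigma', Finset.sum_sigma']
    refine Finset.sum_bij' (fun p _ => ⟨(p.2.1.degree, p.2.2.degree), p.2⟩)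
      (fun p _ => ⟨p.2.1 + p.2.2, p.2⟩) ?_ ?_ ?_ ?_ ?_
    · rintro ⟨α, β, γ⟩ h
      simp only [Finset.mem_sigma, mem_degreeSet, Finset.HasAntidiagonal.mem_antidiagonal] at h
      simp only [Finset.mem_sigma, Finset.mem_product, mem_degreeSet, Finset.HasAntidiagonal.mem_antidiagonal,
        and_self, and_true]
      rw [← h.1, ← h.2, map_add]
    · rintro ⟨⟨i, j⟩, β, γ⟩ h
      simp only [Finset.mem_sigma, Finset.mem_product, mem_degreeSet,
        Finset.HasAntidiagonal.mem_antidiagonal] at h ⊢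
      rw [map_add, h.2.1, h.2.2]
      exact ⟨h.1, trivial⟩
    · rintro ⟨α, β, γ⟩ h
      simp only [Finset.mem_sigma, mem_degreeSet, Finset.HasAntidiagonal.mem_antidiagonal] at h
      rw [← h.2]
    · rintro ⟨⟨i, j⟩, β, γ⟩ h
      simp only [Finset.mem_sigma, Finset.mem_product, mem_degreeSet,
        Finset.HasAntidiagonal.mem_antidiagonal] at h
      simp only [h.2.1, h.2.2]
    · rintro ⟨α, β, γ⟩ h
      simp only [Finset.mem_sigma, mem_degreeSet, Finset.HasAntidiagonal.mem_antidiagonal] at h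
      rw [← h.2, monomialValue_add, smul_mul_smul_comm]

theorem coeff_lineEval (x : ι → ℝ) (F : MvPowerSeries ι R) (k : ℕ) :
    PowerSeries.coeff k (lineEval x F) =
      ∑ α ∈ degreeSet ι k, monomialValue x α • MvPowerSeries.coeff α F :=
  PowerSeries.coeff_mk k fun k => ∑ α ∈ degreeSet ι k, monomialValue x α • MvPowerSeries.coeff α F

theorem coeff_zero_lineEval (x : ι → ℝ) (F : MvPowerSeries ι R) :
    PowerSeries.coeff 0 (lineEval x F) = MvPowerSeries.constantCoeff F := by
  rw [coeff_lineEval, degreeSet_zero]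
  simp [monomialValue_zero]

theorem lineEval_C (x : ι → ℝ) (r : R) : lineEval x (MvPowerSeries.C r) = PowerSeries.C r := by
  ext k
  rw [coeff_lineEval, PowerSeries.coeff_C]
  split_ifs with h
  · subst h
    rw [degreeSet_zero]
    simp [monomialValue_zero]
  · refine Finset.sum_eq_zero fun α hα => ?_
    rw [MvPowerSeries.coeff_C, if_neg, smul_zero]
    rintro rfl
    rw [mem_degreeSet] at hα
    exact h (by rw [← hα]; simp)

theorem lineEval_X (x : ι → ℝ) (a : ι) :
    lineEval x (MvPowerSeries.X a : MvPowerSeries ι R) = x a • PowerSeries.X := by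
  ext k
  rw [coeff_lineEval, PowerSeries.coeff_smul, PowerSeries.coeff_X]
  split_ifs with h
  · subst h
    rw [Finset.sum_eq_single (Finsupp.single a 1)]
    · rw [monomialValue_single, MvPowerSeries.coeff_X, if_pos rfl]
    · intro α _ hα
      rw [MvPowerSeries.coeff_X, if_neg hα, smul_zero]
    · intro h
      exact absurd (mem_degreeSet.2 (by simp)) h
  · rw [smul_zero]
    refine Finset.sum_eq_zero fun α hα => ?_
    rw [MvPowerSeries.coeff_X, if_neg, smul_zero]
    rintro rfl
    rw [mem_degreeSet] at hα
    exact h (by rw [← hα]; simp)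

theorem lineEval_map (x : ι → ℝ) (F : MvPowerSeries ι ℝ) :
    lineEval x (MvPowerSeries.map (algebraMap ℝ R) F) =
      PowerSeries.map (algebraMap ℝ R) (lineEval x F) := by
  ext k
  simp [coeff_lineEval, Algebra.smul_def]

theorem lineEval_smul (x : ι → ℝ) (r : ℝ) (F : MvPowerSeries ι R) :
    lineEval x (r • F) = r • lineEval x F := by
  ext k
  simp only [coeff_lineEval, PowerSeries.coeff_smul, Finset.smul_sum]
  exact Finset.sum_congr rfl fun α _ => smul_comm _ _ _

theorem finsum_eq_sum_degreeSet {M : Type*} [AddCommMonoid M] (n : ℕ) (f : (ι →₀ ℕ) → M)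
    (hf : ∀ α, n < α.degree → f α = 0) :
    ∑ᶠ α, f α = ∑ k ∈ Finset.range (n + 1), ∑ α ∈ degreeSet ι k, f α := by
  rw [← Finset.sum_biUnion]
  · refine finsum_eq_sum_of_support_subset _ fun α hα => ?_
    simp only [Finset.coe_biUnion, Set.mem_iUnion]
    refine ⟨α.degree, ?_, mem_degreeSet.2 rfl⟩
    by_contra h
    exact hα (hf α (by simpa using h))
  · intro i _ j _ hij
    rw [Function.onFun, Finset.disjoint_left]
    intro α hi hj
    exact hij ((mem_degreeSet.1 hi).symm.trans (mem_degreeSet.1 hj))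

end LineEval

/-! ### Differential operators on divided powers -/

section Partial

variable {ι : Type*} [Fintype ι] [DecidableEq ι]

theorem polyPartial_monomial (α m : ι →₀ ℕ) (r : ℝ) : polyPartial α (MvPolynomial.monomial m r) =
    MvPolynomial.monomial (m - α) (r * ∏ a, ((m a).descFactorial (α a) : ℝ)) := by
  have h1 : MvPolynomial.monomial m r = r • MvPolynomial.basisMonomials ι ℝ m := by
    rw [MvPolynomial.coe_basisMonomials, MvPolynomial.smul_monomial, smul_eq_mul, mul_one]
  rw [h1, map_smul, polyPartial, Module.Basis.constr_basis, MvPolynomial.smul_monomial, smul_eq_mul]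

theorem polyPartial_zero (p : MvPolynomial ι ℝ) : polyPartial 0 p = p := by
  induction p using MvPolynomial.induction_on' with
  | monomial m r => rw [polyPartial_monomial]; simp
  | add p q hp hq => rw [map_add, hp, hq]

theorem polyPartial_add_single (α : ι →₀ ℕ) (a : ι) (p : MvPolynomial ι ℝ) :
    polyPartial (α + Finsupp.single a 1) p = MvPolynomial.pderiv a (polyPartial α p) := by
  induction p using MvPolynomial.induction_on' with
  | add p q hp hq => rw [map_add, hp, hq, map_add, map_add]
  | monomial m r =>
    rw [polyPartial_monomial, polyPartial_monomial, MvPolynomial.pderiv_monomial, tsub_add_eq_tsub_tsub,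
      mul_assoc]
    congr 2
    rw [← Finset.mul_prod_erase _ _ (Finset.mem_univ a),
      ← Finset.mul_prod_erase _ _ (Finset.mem_univ a)]
    have : ∏ c ∈ Finset.univ.erase a, ((m c).descFactorial ((α + Finsupp.single a 1 : ι →₀ ℕ) c) : ℝ) =
        ∏ c ∈ Finset.univ.erase a, ((m c).descFactorial (α c) : ℝ) :=
      Finset.prod_congr rfl fun c hc => by
        simp [Finsupp.single_eq_of_ne (Finset.ne_of_mem_erase hc)]
    rw [this]
    simp [Nat.descFactorial_succ]
    ring

theorem pderiv_pow_linear (x : ι → ℝ) (a : ι) (n : ℕ) :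
    MvPolynomial.pderiv a ((∑ c, x c • MvPolynomial.X c : MvPolynomial ι ℝ) ^ n) =
      (n * x a) • (∑ c, x c • MvPolynomial.X c) ^ (n - 1) := by
  rw [Derivation.leibniz_pow]
  have : MvPolynomial.pderiv a (∑ c, x c • MvPolynomial.X c : MvPolynomial ι ℝ) =
      algebraMap ℝ _ (x a) := by
    rw [map_sum, Finset.sum_eq_single a]
    · rw [Derivation.map_smul, MvPolynomial.pderiv_X_self, Algebra.algebraMap_eq_smul_one]
    · intro c _ hc
      rw [Derivation.map_smul, MvPolynomial.pderiv_X_of_ne hc, smul_zero]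
    · simp
  rw [this, smul_eq_mul, ← Algebra.commutes, ← Algebra.smul_def, ← Nat.cast_smul_eq_nsmul ℝ,
    smul_smul]

theorem polyPartial_pow_linear (x : ι → ℝ) (n : ℕ) (α : ι →₀ ℕ) :
    polyPartial α ((∑ c, x c • MvPolynomial.X c : MvPolynomial ι ℝ) ^ n) =
      (n.descFactorial α.degree * monomialValue x α) •
        (∑ c, x c • MvPolynomial.X c) ^ (n - α.degree) := by
  induction hd : α.degree generalizing α with
  | zero =>
    rw [Finsupp.degree_eq_zero_iff] at hd
    subst hd
    simp [polyPartial_zero, monomialValue_zero]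
  | succ d ih =>
    obtain ⟨a, ha⟩ : ∃ a, α a ≠ 0 := by
      by_contra! h
      have : α = 0 := Finsupp.ext h
      simp [this] at hd
    obtain ⟨β, rfl⟩ : ∃ β, α = β + Finsupp.single a 1 :=
      ⟨α - Finsupp.single a 1, (tsub_add_cancel_of_le (by
        rw [Finsupp.single_le_iff]
        exact Nat.one_le_iff_ne_zero.2 ha)).symm⟩
    have hβ : β.degree = d := by simpa using hd
    rw [polyPartial_add_single, ih β hβ, Derivation.map_smul, pderiv_pow_linear, smul_smul,
      monomialValue_add, monomialValue_single, Nat.descFactorial_succ, Nat.sub_sub]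
    congr 1
    push_cast
    ring

variable {𝔤 : Type*} [LieRing 𝔤] [LieAlgebra ℝ 𝔤] (b : Module.Basis ι ℝ 𝔤)

theorem equivMvPolynomial_ι (v : 𝔤) :
    SymmetricAlgebra.equivMvPolynomial b (SymmetricAlgebra.ι ℝ 𝔤 v) =
      ∑ c, b.repr v c • MvPolynomial.X c := by
  conv_lhs => rw [← b.sum_repr v]
  simp [-Module.Basis.sum_repr]

/-- The divided power `v ^ n / n!` in `S(𝔤)`. -/
def divPow (v : 𝔤) (n : ℕ) : SymmetricAlgebra ℝ 𝔤 :=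
  (n.factorial : ℝ)⁻¹ • SymmetricAlgebra.ι ℝ 𝔤 v ^ n

theorem symPartial_divPow (v : 𝔤) (n : ℕ) (α : ι →₀ ℕ) :
    symPartial b α (divPow v n) =
      if α.degree ≤ n then monomialValue (b.repr v) α • divPow v (n - α.degree) else 0 := by
  have h1 : symPartial b α (SymmetricAlgebra.ι ℝ 𝔤 v ^ n) =
      (n.descFactorial α.degree * monomialValue (b.repr v) α) •
        SymmetricAlgebra.ι ℝ 𝔤 v ^ (n - α.degree) := by
    simp only [symPartial, LinearMap.comp_apply, AlgEquiv.toLinearMap_apply]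
    rw [map_pow, equivMvPolynomial_ι, polyPartial_pow_linear, ← equivMvPolynomial_ι, map_smul,
      ← map_pow, AlgEquiv.symm_apply_apply]
  rw [divPow, map_smul, h1]
  split_ifs with h
  · rw [divPow, smul_smul, smul_smul]
    congr 1
    have := Nat.factorial_mul_descFactorial h
    have h2 : (n.factorial : ℝ) ≠ 0 := by positivity
    have h3 : ((n - α.degree).factorial : ℝ) ≠ 0 := by positivity
    have h4 : ((n - α.degree).factorial : ℝ) * n.descFactorial α.degree = n.factorial := by
      exact_mod_cast this
    field_simp
    linear_combination monomialValue (b.repr v) α * h4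
  · rw [Nat.descFactorial_eq_zero_iff_lt.2 (not_le.1 h)]
    simp

variable (B : InvariantForm 𝔤)

theorem weilDiffOp_divPow (F : MvPowerSeries ι (ExteriorAlgebra ℝ 𝔤)) (v : 𝔤) (n : ℕ)
    (ω : ExteriorAlgebra ℝ 𝔤) :
    weilDiffOp B b F (divPow v n ⊗ₜ ω) = ∑ p ∈ Finset.HasAntidiagonal.antidiagonal n,
      divPow v p.1 ⊗ₜ B.extContrHom (PowerSeries.coeff p.2 (lineEval (b.repr v) F)) ω := by
  change ∑ᶠ α, symPartial b α (divPow v n) ⊗ₜ[ℝ]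
    B.extContrHom (MvPowerSeries.coeff α F) ω = _
  rw [finsum_eq_sum_degreeSet n _ fun α hα => by
    rw [symPartial_divPow, if_neg (not_le.2 hα), TensorProduct.zero_tmul]]
  rw [← Finset.Nat.sum_antidiagonal_swap, Finset.Nat.sum_antidiagonal_eq_sum_range_succ_mk]
  refine Finset.sum_congr rfl fun k hk => ?_
  have hk' : k ≤ n := by simpa [Nat.lt_succ_iff] using hk
  simp only [Prod.fst_swap, Prod.snd_swap, coeff_lineEval, map_sum, map_smul, LinearMap.sum_apply,
    TensorProduct.tmul_sum, LinearMap.smul_apply]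
  refine Finset.sum_congr rfl fun α hα => ?_
  rw [mem_degreeSet] at hα
  rw [symPartial_divPow, hα, if_pos hk', TensorProduct.smul_tmul]

theorem symDiffOp_divPow (F : MvPowerSeries ι ℝ) (v : 𝔤) (n : ℕ) :
    symDiffOp b F (divPow v n) = ∑ p ∈ Finset.HasAntidiagonal.antidiagonal n,
      PowerSeries.coeff p.2 (lineEval (b.repr v) F) • divPow v p.1 := by
  change ∑ᶠ α, MvPowerSeries.coeff α F • symPartial b α (divPow v n) = _
  rw [finsum_eq_sum_degreeSet n _ fun α hα => by
    rw [symPartial_divPow, if_neg (not_le.2 hα), smul_zero]]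
  rw [← Finset.Nat.sum_antidiagonal_swap, Finset.Nat.sum_antidiagonal_eq_sum_range_succ_mk]
  refine Finset.sum_congr rfl fun k hk => ?_
  have hk' : k ≤ n := by simpa [Nat.lt_succ_iff] using hk
  simp only [Prod.fst_swap, Prod.snd_swap, coeff_lineEval, Finset.sum_smul]
  refine Finset.sum_congr rfl fun α hα => ?_
  rw [mem_degreeSet] at hα
  rw [symPartial_divPow, hα, if_pos hk', smul_smul, smul_eq_mul, mul_comm]

end Partial

/-! ### Symmetric algebras are spanned by powers -/

section Polarization

variable {V : Type*} [AddCommGroup V] [Module ℝ V]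

/-- If a polynomial function of a real variable takes its values in a subspace, its coefficients
lie in this subspace. -/
theorem coeff_mem_of_forall_sum_mem {M : Type*} [AddCommGroup M] [Module ℝ M]
    (P : Submodule ℝ M) (n : ℕ) (c : ℕ → M)
    (h : ∀ s : ℝ, ∑ k ∈ Finset.range n, s ^ k • c k ∈ P) {k : ℕ} (hk : k < n) : c k ∈ P := by
  rw [← Submodule.Quotient.mk_eq_zero, ← Module.forall_dual_apply_eq_zero_iff ℝ]
  intro φ
  set f : M →ₗ[ℝ] ℝ := φ ∘ₗ P.mkQ with hf
  have h0 : ∑ k ∈ Finset.range n, Polynomial.monomial k (f (c k)) = 0 := by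
    refine Polynomial.eq_of_infinite_eval_eq _ _ (Set.infinite_univ.mono fun s _ => ?_)
    have h1 : f (∑ k ∈ Finset.range n, s ^ k • c k) = 0 := by
      rw [hf, LinearMap.comp_apply, Submodule.mkQ_apply, (Submodule.Quotient.mk_eq_zero P).2 (h s),
        map_zero]
    simpa [Polynomial.eval_finsetSum, mul_comm] using h1
  have h2 := congrArg (fun p => Polynomial.coeff p k) h0
  have h3 : f (c k) = 0 := by
    simpa [Polynomial.finsetSum_coeff, Polynomial.coeff_monomial, hk] using h2
  exact h3

/-- The symmetric algebra is spanned by the powers of vectors. -/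
theorem span_range_pow (P : Submodule ℝ (SymmetricAlgebra ℝ V))
    (hP : ∀ v n, SymmetricAlgebra.ι ℝ V v ^ n ∈ P) (s : SymmetricAlgebra ℝ V) : s ∈ P := by
  set P' := Submodule.span ℝ (Set.range fun p : V × ℕ => SymmetricAlgebra.ι ℝ V p.1 ^ p.2)
  have hPP : P' ≤ P := Submodule.span_le.2 (by rintro _ ⟨p, rfl⟩; exact hP _ _)
  have hmem : ∀ v n, SymmetricAlgebra.ι ℝ V v ^ n ∈ P' := fun v n =>
    Submodule.subset_span ⟨(v, n), rfl⟩
  refine hPP ?_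
  -- `v w ^ n` is a coefficient of the polynomial `(w + s v) ^ (n + 1)` in `s`
  have key : ∀ v, ∀ x ∈ P', SymmetricAlgebra.ι ℝ V v * x ∈ P' := by
    intro v x hx
    induction hx using Submodule.span_induction with
    | zero => rw [mul_zero]; exact zero_mem _
    | add x y _ _ hx hy => rw [mul_add]; exact add_mem hx hy
    | smul r x _ hx => rw [mul_smul_comm]; exact P'.smul_mem r hx
    | mem x hx =>
      obtain ⟨⟨w, n⟩, rfl⟩ := hx
      have := coeff_mem_of_forall_sum_mem P' (n + 1 + 1)
        (fun k => SymmetricAlgebra.ι ℝ V v ^ k * SymmetricAlgebra.ι ℝ V w ^ (n + 1 - k) *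
          ((n + 1).choose k : SymmetricAlgebra ℝ V)) (fun s => by
            have h := hmem (s • v + w) (n + 1)
            rw [map_add, map_smul, add_pow] at h
            simpa only [smul_pow, smul_mul_assoc] using h) (k := 1) (by omega)
      rw [pow_one, Nat.add_sub_cancel, Nat.choose_one_right, mul_comm, ← nsmul_eq_mul,
        ← Nat.cast_smul_eq_nsmul ℝ] at this
      have h := P'.smul_mem ((n + 1 : ℕ) : ℝ)⁻¹ this
      rwa [smul_smul, inv_mul_cancel₀ (by positivity), one_smul] at h
  have key2 : ∀ y, ∀ x ∈ P', y * x ∈ P' := by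
    intro y
    induction y using SymmetricAlgebra.induction with
    | algebraMap r => intro x hx; rw [← Algebra.smul_def]; exact P'.smul_mem r hx
    | ι v => exact key v
    | mul a c ha hc => intro x hx; rw [mul_assoc]; exact ha _ (hc _ hx)
    | add a c ha hc => intro x hx; rw [add_mul]; exact add_mem (ha _ hx) (hc _ hx)
  have := key2 s 1 (by simpa using hmem 0 0)
  rwa [mul_one] at this

end Polarization

section Polarization

variable {𝔤 : Type*} [LieRing 𝔤] [LieAlgebra ℝ 𝔤] {M : Type*} [AddCommGroup M] [Module ℝ M]

theorem sym_lhom_ext {f g : SymmetricAlgebra ℝ 𝔤 →ₗ[ℝ] M}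
    (h : ∀ v n, f (divPow v n) = g (divPow v n)) : f = g := by
  refine LinearMap.ext fun s => LinearMap.mem_eqLocus.1 (span_range_pow (LinearMap.eqLocus f g)
    (fun v n => ?_) s)
  have h2 : (n.factorial : ℝ) ≠ 0 := by positivity
  have h3 : SymmetricAlgebra.ι ℝ 𝔤 v ^ n = (n.factorial : ℝ) • divPow v n := by
    rw [divPow, smul_smul, mul_inv_cancel₀ h2, one_smul]
  rw [LinearMap.mem_eqLocus, h3, map_smul, map_smul, h]

theorem weil_lhom_ext {f g : Weil 𝔤 →ₗ[ℝ] M}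
    (h : ∀ v n ω, f (divPow v n ⊗ₜ ω) = g (divPow v n ⊗ₜ ω)) : f = g := by
  refine TensorProduct.ext (sym_lhom_ext fun v n => LinearMap.ext fun ω => h v n ω)

theorem symmetrization_divPow (v : 𝔤) (n : ℕ) : symmetrization 𝔤 (divPow v n) =
    (n.factorial : ℝ)⁻¹ • UniversalEnvelopingAlgebra.ι ℝ v ^ n := by
  have h := symmetrize_prod (envι 𝔤) n fun _ => v
  simp only [List.ofFn_const, List.prod_replicate, Finset.sum_const, Finset.card_univ,
    Fintype.card_perm, Fintype.card_fin, ← Nat.cast_smul_eq_nsmul ℝ, smul_smul] at h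
  rw [inv_mul_cancel₀ (by positivity), one_smul] at h
  rw [divPow, map_smul, symmetrization, h]
  rfl

end Polarization

/-! ### The Riccati equation -/

section ScalarSeries

theorem coeff_zero_jSeries : PowerSeries.coeff 0 jSeries = 1 := by
  simp [jSeries]

theorem constantCoeff_jSeries : PowerSeries.constantCoeff jSeries = 1 := by
  rw [← PowerSeries.coeff_zero_eq_constantCoeff_apply, coeff_zero_jSeries]

theorem jSeries_ne_zero : jSeries ≠ 0 := fun h => by
  have := constantCoeff_jSeries
  simp [h] at this

theorem fSeries_mul_jSeries : fSeries * jSeries = PowerSeries.derivative ℝ jSeries := by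
  rw [fSeries, mul_assoc, PowerSeries.inv_mul_cancel _ (by rw [constantCoeff_jSeries]; simp),
    mul_one]

/-- The function `z j(z) = 2 sinh(z / 2)` satisfies `(z j)'' = z j / 4`. -/
theorem jSeries_ode : PowerSeries.X * PowerSeries.derivative ℝ (PowerSeries.derivative ℝ jSeries) +
    2 * PowerSeries.derivative ℝ jSeries = PowerSeries.C (4⁻¹ : ℝ) * (PowerSeries.X * jSeries) := by
  have hc : (2 : PowerSeries ℝ) = PowerSeries.C 2 := (map_ofNat PowerSeries.C 2).symm
  ext n
  rw [hc, map_add, PowerSeries.coeff_C_mul, PowerSeries.coeff_C_mul]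
  rcases n with - | n
  · simp only [PowerSeries.coeff_zero_X_mul, PowerSeries.coeff_derivative, jSeries,
      PowerSeries.coeff_mk]
    simp
  · rw [PowerSeries.coeff_succ_X_mul, PowerSeries.coeff_succ_X_mul]
    simp only [PowerSeries.coeff_derivative, jSeries, PowerSeries.coeff_mk]
    have he : Even (n + 1 + 1) ↔ Even n := by
      rw [Nat.even_add_one, Nat.even_add_one, not_not]
    simp only [he]
    split_ifs with h
    · rw [Nat.factorial_succ (n + 1 + 1), Nat.factorial_succ (n + 1)]
      have h1 : ((n + 1).factorial : ℝ) ≠ 0 := by positivity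
      push_cast
      field_simp
      ring
    · simp

/-- The Riccati equation `z f' + 2 f + z f ^ 2 = z / 4`. -/
theorem fSeries_riccati : PowerSeries.X * PowerSeries.derivative ℝ fSeries + 2 * fSeries +
    PowerSeries.X * fSeries ^ 2 = PowerSeries.C (4⁻¹ : ℝ) * PowerSeries.X := by
  have h1 := congrArg (PowerSeries.derivative ℝ) fSeries_mul_jSeries
  rw [Derivation.leibniz, smul_eq_mul, smul_eq_mul] at h1
  have h2 := jSeries_ode
  rw [← h1, ← fSeries_mul_jSeries] at h2
  refine mul_right_cancel₀ jSeries_ne_zero ?_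
  linear_combination h2

theorem coeff_fSeries_even {k : ℕ} (hk : Even k) : PowerSeries.coeff k fSeries = 0 := by
  have h1 : PowerSeries.rescale (-1 : ℝ) jSeries = jSeries := by
    ext n
    rw [PowerSeries.coeff_rescale, jSeries, PowerSeries.coeff_mk]
    split_ifs with h
    · rw [h.neg_one_pow, one_mul]
    · simp
  have h2 : PowerSeries.rescale (-1 : ℝ) (PowerSeries.derivative ℝ jSeries) =
      -PowerSeries.derivative ℝ jSeries := by
    ext n
    have := congrArg (PowerSeries.coeff (n + 1)) h1
    rw [PowerSeries.coeff_rescale] at this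
    rw [PowerSeries.coeff_rescale, map_neg, PowerSeries.coeff_derivative]
    conv_rhs => rw [← this]
    ring
  have h3 : PowerSeries.rescale (-1 : ℝ) fSeries = -fSeries := by
    refine mul_right_cancel₀ jSeries_ne_zero ?_
    rw [neg_mul, fSeries_mul_jSeries, ← h2, ← fSeries_mul_jSeries, map_mul, h1]
  have h4 := congrArg (PowerSeries.coeff k) h3
  rw [PowerSeries.coeff_rescale, hk.neg_one_pow, one_mul, map_neg] at h4
  exact self_eq_neg_real h4

end ScalarSeries

/-! ### The logarithmic derivative of `J^{1/2}` along lines -/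

section Jacobi

/-- Jacobi's formula for the derivative of a determinant. -/
theorem derivation_det {A : Type*} [CommRing A] [Algebra ℝ A] (δ : Derivation ℝ A A)
    {ι : Type*} [Fintype ι] [DecidableEq ι] (M N : Matrix ι ι A) (h : M.map δ = M * N) :
    δ M.det = M.det * N.trace := by
  let φ : A →+* TrivSqZeroExt A A :=
    { toFun := fun x => TrivSqZeroExt.inl x + TrivSqZeroExt.inr (δ x)
      map_one' := by simp
      map_zero' := by simp
      map_add' := fun x y => by ext <;> simp
      map_mul' := fun x y => by ext <;> simp [mul_comm] }
  have h1 : φ.mapMatrix M = (TrivSqZeroExt.inlHom A A).mapMatrix M *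
      (1 + (TrivSqZeroExt.inr 1 : TrivSqZeroExt A A) • (TrivSqZeroExt.inlHom A A).mapMatrix N) := by
    rw [mul_add, mul_one, Matrix.mul_smul, ← map_mul, ← h]
    ext i j <;> simp [φ]
  have h2 := congrArg Matrix.det h1
  rw [← RingHom.map_det, Matrix.det_mul, ← RingHom.map_det, Matrix.det_one_add_smul, sq,
    TrivSqZeroExt.inr_mul_inr, mul_zero, add_zero, Matrix.trace] at h2
  have h3 := congrArg TrivSqZeroExt.snd h2
  simpa [φ, Matrix.trace, TrivSqZeroExt.fst_sum] using h3

end Jacobi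

section LineSeries

variable {ι : Type*} [Fintype ι] [DecidableEq ι] {𝔤 : Type*} [LieRing 𝔤] [LieAlgebra ℝ 𝔤]
  (B : InvariantForm 𝔤) (b : Module.Basis ι ℝ 𝔤) (ξ : 𝔤)

/-- The matrix `p(t ad_ξ)` of formal power series in `t`. -/
def adSubst (p : PowerSeries ℝ) : Matrix ι ι (PowerSeries ℝ) :=
  Matrix.of fun i j => PowerSeries.mk fun k =>
    PowerSeries.coeff k p * LinearMap.toMatrix b b (LieAlgebra.ad ℝ 𝔤 ξ ^ k) i j

theorem lineEval_adMatrix : (adMatrix b).map (lineEval (b.repr ξ)) =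
    (PowerSeries.X : PowerSeries ℝ) •
      (LinearMap.toMatrix b b (LieAlgebra.ad ℝ 𝔤 ξ)).map PowerSeries.C := by
  ext1 i j
  have h : ⁅ξ, b j⁆ = ∑ c, b.repr ξ c • ⁅b c, b j⁆ := by
    conv_lhs => rw [← b.sum_repr ξ]
    simp [sum_lie, -Module.Basis.sum_repr]
  simp only [Matrix.map_apply, adMatrix, Matrix.of_apply, map_sum, map_mul, lineEval_C, lineEval_X,
    Matrix.smul_apply, LinearMap.toMatrix_apply, LieAlgebra.ad_apply, h, map_smul, Finsupp.coe_smul,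
    Finsupp.finsetSum_apply, Pi.smul_apply, smul_eq_mul, Finset.mul_sum]
  refine Finset.sum_congr rfl fun c _ => ?_
  rw [PowerSeries.smul_eq_C_mul]
  ring

theorem lineEval_matrixSubst (p : PowerSeries ℝ) :
    (matrixSubst p (adMatrix b)).map (lineEval (b.repr ξ)) = adSubst b ξ p := by
  ext i j k
  have h : ∀ m, lineEval (b.repr ξ) ((adMatrix b ^ m) i j) = PowerSeries.X ^ m *
      PowerSeries.C (LinearMap.toMatrix b b (LieAlgebra.ad ℝ 𝔤 ξ ^ m) i j) := fun m => by
    have h1 : (adMatrix b ^ m).map (lineEval (b.repr ξ)) =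
        ((adMatrix b).map (lineEval (b.repr ξ))) ^ m :=
      map_pow (lineEval (b.repr ξ)).mapMatrix (adMatrix b) m
    have h2 : ((LinearMap.toMatrix b b (LieAlgebra.ad ℝ 𝔤 ξ)).map PowerSeries.C) ^ m =
        ((LinearMap.toMatrix b b (LieAlgebra.ad ℝ 𝔤 ξ)) ^ m).map PowerSeries.C :=
      (map_pow (PowerSeries.C (R := ℝ)).mapMatrix _ m).symm
    rw [lineEval_adMatrix, smul_pow, h2, LinearMap.toMatrix_pow] at h1
    exact congrFun (congrFun h1 i) j
  rw [Matrix.map_apply, coeff_lineEval, adSubst, Matrix.of_apply, PowerSeries.coeff_mk]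
  have h3 : ∀ α ∈ degreeSet ι k, monomialValue (b.repr ξ) α •
      MvPowerSeries.coeff α (matrixSubst p (adMatrix b) i j) = ∑ m ∈ Finset.range (k + 1),
        PowerSeries.coeff m p * (monomialValue (b.repr ξ) α •
          MvPowerSeries.coeff α ((adMatrix b ^ m) i j)) := fun α hα => by
    rw [mem_degreeSet] at hα
    change _ • (∑ m ∈ Finset.range (α.degree + 1), _) = _
    rw [hα, Finset.smul_sum]
    exact Finset.sum_congr rfl fun m _ => by rw [mul_smul_comm]
  rw [Finset.sum_congr rfl h3, Finset.sum_comm]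
  simp only [← Finset.mul_sum, ← coeff_lineEval, h]
  rw [Finset.sum_eq_single k]
  · rw [mul_comm (PowerSeries.X ^ k), PowerSeries.coeff_C_mul, PowerSeries.coeff_X_pow_self, mul_one]
  · intro m _ hm
    rw [mul_comm (PowerSeries.X ^ m), PowerSeries.coeff_C_mul, PowerSeries.coeff_X_pow,
      if_neg hm.symm, mul_zero, mul_zero]
  · simp

theorem adSubst_mul (p q : PowerSeries ℝ) :
    adSubst b ξ (p * q) = adSubst b ξ p * adSubst b ξ q := by
  ext i j k
  rw [Matrix.mul_apply, map_sum]
  simp only [adSubst, Matrix.of_apply, PowerSeries.coeff_mk, PowerSeries.coeff_mul, Finset.sum_mul]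
  rw [Finset.sum_comm]
  refine Finset.sum_congr rfl fun r hr => ?_
  rw [← Finset.HasAntidiagonal.mem_antidiagonal.1 hr, pow_add, LinearMap.toMatrix_mul,
    Matrix.mul_apply, Finset.mul_sum]
  exact Finset.sum_congr rfl fun m _ => by ring

theorem derivative_adSubst (p : PowerSeries ℝ) :
    (adSubst b ξ p).map (PowerSeries.derivative ℝ) = adSubst b ξ (PowerSeries.derivative ℝ p) *
      (LinearMap.toMatrix b b (LieAlgebra.ad ℝ 𝔤 ξ)).map PowerSeries.C := by
  ext i j k
  rw [Matrix.mul_apply, map_sum, Matrix.map_apply, PowerSeries.coeff_derivative]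
  simp only [adSubst, Matrix.of_apply, PowerSeries.coeff_mk, Matrix.map_apply,
    PowerSeries.coeff_mul_C, PowerSeries.coeff_derivative]
  rw [pow_succ, LinearMap.toMatrix_mul, Matrix.mul_apply, Finset.mul_sum, Finset.sum_mul]
  exact Finset.sum_congr rfl fun m _ => by ring

/-- The series `tr(ad_ξ f(t ad_ξ))`. -/
def traceSeries : PowerSeries ℝ := PowerSeries.mk fun k =>
  PowerSeries.coeff k fSeries * ∑ a, B.form (B.dual b a) ((LieAlgebra.ad ℝ 𝔤 ξ ^ (k + 1)) (b a))

theorem repr_eq_form (v : 𝔤) (a : ι) : b.repr v a = B.form (B.dual b a) v := by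
  conv_rhs => rw [← b.sum_repr v]
  simp [form_dual_left, -Module.Basis.sum_repr]

theorem derivative_lineEval_jDet : PowerSeries.derivative ℝ (lineEval (b.repr ξ) (jDet b)) =
    lineEval (b.repr ξ) (jDet b) * traceSeries B b ξ := by
  have h1 : lineEval (b.repr ξ) (jDet b) = (adSubst b ξ jSeries).det := by
    rw [jDet, RingHom.map_det, ← lineEval_matrixSubst]
    rfl
  have h2 : (adSubst b ξ fSeries *
      (LinearMap.toMatrix b b (LieAlgebra.ad ℝ 𝔤 ξ)).map PowerSeries.C).trace =
      traceSeries B b ξ := by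
    ext k
    rw [Matrix.trace, map_sum, traceSeries, PowerSeries.coeff_mk, Finset.mul_sum]
    refine Finset.sum_congr rfl fun i _ => ?_
    rw [Matrix.diag_apply, Matrix.mul_apply, map_sum, ← repr_eq_form B b,
      ← LinearMap.toMatrix_apply b b, pow_succ, LinearMap.toMatrix_mul, Matrix.mul_apply,
      Finset.mul_sum]
    refine Finset.sum_congr rfl fun m _ => ?_
    simp only [adSubst, Matrix.of_apply, Matrix.map_apply, PowerSeries.coeff_mul_C,
      PowerSeries.coeff_mk]
    ring
  rw [h1, ← h2]
  refine derivation_det _ _ _ ?_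
  rw [derivative_adSubst, ← fSeries_mul_jSeries, mul_comm fSeries, adSubst_mul, mul_assoc]

theorem constantCoeff_jDet : MvPowerSeries.constantCoeff (jDet b) = 1 := by
  rw [jDet, RingHom.map_det]
  convert Matrix.det_one (n := ι) (R := ℝ)
  ext i j
  rw [RingHom.mapMatrix_apply, Matrix.map_apply, ← coeff_zero_lineEval (b.repr 0)]
  have := congrFun (congrFun (lineEval_matrixSubst b 0 jSeries) i) j
  rw [Matrix.map_apply] at this
  rw [this, adSubst, Matrix.of_apply, PowerSeries.coeff_mk, coeff_zero_jSeries, pow_zero, one_mul]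
  simp [LinearMap.toMatrix_one]

theorem hasSubst_jDet : PowerSeries.HasSubst (jDet b - 1) :=
  PowerSeries.HasSubst.of_constantCoeff_zero (by rw [map_sub, constantCoeff_jDet]; simp)

theorem jDetSqrt_sq : jDetSqrt b * jDetSqrt b = jDet b := by
  rw [jDetSqrt, ← PowerSeries.subst_mul (hasSubst_jDet b), ← PowerSeries.binomialSeries_add]
  have h : (2⁻¹ + 2⁻¹ : ℝ) = ((1 : ℕ) : ℝ) := by norm_num
  rw [h, PowerSeries.binomialSeries_nat, pow_one, ← PowerSeries.coe_substAlgHom (hasSubst_jDet b),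
    map_add, map_one, PowerSeries.coe_substAlgHom, PowerSeries.subst_X (hasSubst_jDet b)]
  abel

theorem constantCoeff_jDetSqrt : MvPowerSeries.constantCoeff (jDetSqrt b) = 1 := by
  rw [jDetSqrt, PowerSeries.constantCoeff_subst (hasSubst_jDet b), finsum_eq_single _ 0]
  · simp
  · intro n hn
    rw [map_pow, map_sub, constantCoeff_jDet]
    simp [hn]

/-- Since `f = (ln j)'`, the square root of `det j(ad)` satisfies `2 (J^{1/2})' = tr(ad f(ad)) J^{1/2}`
along the line through `ξ`. -/
theorem two_mul_derivative_lineEval_jDetSqrt :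
    2 * PowerSeries.derivative ℝ (lineEval (b.repr ξ) (jDetSqrt b)) =
      lineEval (b.repr ξ) (jDetSqrt b) * traceSeries B b ξ := by
  have h0 : lineEval (b.repr ξ) (jDetSqrt b) ≠ 0 := fun h => by
    have := coeff_zero_lineEval (b.repr ξ) (jDetSqrt b)
    rw [h, constantCoeff_jDetSqrt] at this
    simp at this
  have h := derivative_lineEval_jDet B b ξ
  rw [← jDetSqrt_sq, map_mul, Derivation.leibniz, smul_eq_mul] at h
  refine mul_left_cancel₀ h0 ?_
  linear_combination h

end LineSeries

theorem mul_comm_of_anticomm {P : Type*} [Ring P] {x y z : P} (h1 : x * z = -(z * x))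
    (h2 : y * z = -(z * y)) : x * y * z = z * (x * y) := by
  rw [mul_assoc, h2, mul_neg, ← mul_assoc, h1, neg_mul, neg_neg, mul_assoc]

/-! ### Power series of contractions -/

section ContractionSeries

variable {𝔤 : Type*} [LieRing 𝔤] [LieAlgebra ℝ 𝔤] (B : InvariantForm 𝔤) (ξ : 𝔤)

/-- The algebra of operators on `Λ𝔤`. -/
abbrev ExtEnd (𝔤 : Type*) [LieRing 𝔤] [LieAlgebra ℝ 𝔤] : Type _ :=
  Module.End ℝ (ExteriorAlgebra ℝ 𝔤)

variable (𝔤) in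
/-- The operators of exterior multiplication by vectors. -/
def extMul : 𝔤 →ₗ[ℝ] ExtEnd 𝔤 := LinearMap.mul ℝ (ExteriorAlgebra ℝ 𝔤) ∘ₗ ExteriorAlgebra.ι ℝ

theorem extMul_apply (v : 𝔤) (ω : ExteriorAlgebra ℝ 𝔤) :
    extMul 𝔤 v ω = ExteriorAlgebra.ι ℝ v * ω := rfl

theorem extContr_mul_anticomm (u v : 𝔤) :
    (B.extContr u : ExtEnd 𝔤) * B.extContr v = -(B.extContr v * B.extContr u) :=
  LinearMap.ext fun ω => extContr_extContr B u v ω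

theorem extContr_mul_extMul (u v : 𝔤) : (B.extContr u : ExtEnd 𝔤) * extMul 𝔤 v =
    algebraMap ℝ _ (B.form u v) - extMul 𝔤 v * B.extContr u :=
  LinearMap.ext fun ω => B.extContr_ι_mul u v ω

theorem extContrHom_ι (v : 𝔤) : B.extContrHom (ExteriorAlgebra.ι ℝ v) = B.extContr v :=
  ExteriorAlgebra.lift_ι_apply ..

/-- Scalar power series in `t`, regarded as power series of operators. -/
def scalarSeries : PowerSeries ℝ →+* PowerSeries (ExtEnd 𝔤) := PowerSeries.map (algebraMap ℝ _)

theorem coeff_scalarSeries (p : PowerSeries ℝ) (k : ℕ) :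
    PowerSeries.coeff k (scalarSeries p : PowerSeries (ExtEnd 𝔤)) =
      algebraMap ℝ _ (PowerSeries.coeff k p) := PowerSeries.coeff_map _ _ _

theorem scalarSeries_comm (p : PowerSeries ℝ) (x : PowerSeries (ExtEnd 𝔤)) :
    scalarSeries p * x = x * scalarSeries p := by
  ext1 k
  rw [PowerSeries.coeff_mul, PowerSeries.coeff_mul, ← Finset.Nat.sum_antidiagonal_swap]
  refine Finset.sum_congr rfl fun i _ => ?_
  rw [coeff_scalarSeries, Algebra.commutes]
  rfl

/-- The linear maps `v ↦ A v` with values in operators, as maps into constant power series. -/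
def constSeries (φ : 𝔤 →ₗ[ℝ] ExtEnd 𝔤) : 𝔤 →ₗ[ℝ] PowerSeries (ExtEnd 𝔤) where
  toFun v := PowerSeries.C (φ v)
  map_add' u v := by rw [map_add, map_add]
  map_smul' r v := by
    rw [map_smul]
    ext1 k
    simp only [PowerSeries.coeff_C, RingHom.id_apply, PowerSeries.coeff_smul]
    split_ifs <;> simp

variable (𝔤) in
/-- Exterior multiplication as a constant power series. -/
def mulSeries : 𝔤 →ₗ[ℝ] PowerSeries (ExtEnd 𝔤) := constSeries (extMul 𝔤)

/-- Contraction as a constant power series. -/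
def contrConst : 𝔤 →ₗ[ℝ] PowerSeries (ExtEnd 𝔤) := constSeries B.extContr

/-- The contraction by `p(t ad_ξ) v`. -/
def contrSeries (p : PowerSeries ℝ) : 𝔤 →ₗ[ℝ] PowerSeries (ExtEnd 𝔤) where
  toFun v := PowerSeries.mk fun k =>
    PowerSeries.coeff k p • B.extContr ((LieAlgebra.ad ℝ 𝔤 ξ ^ k) v)
  map_add' u v := by
    ext1 k
    simp only [PowerSeries.coeff_mk, map_add, smul_add]
  map_smul' r v := by
    ext1 k
    simp only [PowerSeries.coeff_mk, map_smul, RingHom.id_apply, PowerSeries.coeff_smul]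
    rw [smul_comm]

/-- The scalar series `B(p(t ad_ξ) u, v)`. -/
def pairSeries (p : PowerSeries ℝ) (u v : 𝔤) : PowerSeries ℝ :=
  PowerSeries.mk fun k => PowerSeries.coeff k p * B.form ((LieAlgebra.ad ℝ 𝔤 ξ ^ k) u) v

theorem coeff_contrSeries (p : PowerSeries ℝ) (v : 𝔤) (k : ℕ) :
    PowerSeries.coeff k (contrSeries B ξ p v) =
      PowerSeries.coeff k p • B.extContr ((LieAlgebra.ad ℝ 𝔤 ξ ^ k) v) :=
  PowerSeries.coeff_mk k fun k => PowerSeries.coeff k p • B.extContr ((LieAlgebra.ad ℝ 𝔤 ξ ^ k) v)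

theorem contrSeries_add (p q : PowerSeries ℝ) (v : 𝔤) :
    contrSeries B ξ (p + q) v = contrSeries B ξ p v + contrSeries B ξ q v := by
  ext1 k
  simp [coeff_contrSeries, add_smul]

theorem contrSeries_smul (r : ℝ) (p : PowerSeries ℝ) (v : 𝔤) :
    contrSeries B ξ (PowerSeries.C r * p) v = r • contrSeries B ξ p v := by
  ext1 k
  simp [coeff_contrSeries, mul_smul, PowerSeries.coeff_C_mul]

theorem contrSeries_X_mul (p : PowerSeries ℝ) (v : 𝔤) :
    contrSeries B ξ (PowerSeries.X * p) v = PowerSeries.X * contrSeries B ξ p ⁅ξ, v⁆ := by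
  ext1 k
  rcases k with - | k
  · simp [coeff_contrSeries]
  · rw [coeff_contrSeries, PowerSeries.coeff_succ_X_mul, PowerSeries.coeff_succ_X_mul,
      coeff_contrSeries, pow_succ]
    rfl

theorem contrSeries_one (v : 𝔤) : contrSeries B ξ 1 v = contrConst B v := by
  ext1 k
  change _ = PowerSeries.coeff k (PowerSeries.C (B.extContr v))
  rw [coeff_contrSeries, PowerSeries.coeff_one, PowerSeries.coeff_C]
  split_ifs with h
  · subst h
    simp
  · simp

theorem contrSeries_anticomm (p q : PowerSeries ℝ) (u v : 𝔤) :
    contrSeries B ξ p u * contrSeries B ξ q v = -(contrSeries B ξ q v * contrSeries B ξ p u) := by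
  ext1 k
  rw [map_neg, PowerSeries.coeff_mul, PowerSeries.coeff_mul, ← Finset.Nat.sum_antidiagonal_swap,
    ← Finset.sum_neg_distrib]
  refine Finset.sum_congr rfl fun i _ => ?_
  simp only [coeff_contrSeries, Prod.fst_swap, Prod.snd_swap]
  rw [smul_mul_smul_comm, smul_mul_smul_comm, extContr_mul_anticomm, smul_neg, mul_comm]

theorem contrSeries_mul_mulSeries (p : PowerSeries ℝ) (u v : 𝔤) :
    contrSeries B ξ p u * mulSeries 𝔤 v =
      scalarSeries (pairSeries B ξ p u v) - mulSeries 𝔤 v * contrSeries B ξ p u := by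
  ext1 k
  change PowerSeries.coeff k (_ * PowerSeries.C (extMul 𝔤 v)) =
    PowerSeries.coeff k (_ - PowerSeries.C (extMul 𝔤 v) * _)
  rw [map_sub, PowerSeries.coeff_mul_C, PowerSeries.coeff_C_mul, coeff_scalarSeries,
    coeff_contrSeries, smul_mul_assoc, mul_smul_comm, extContr_mul_extMul, pairSeries,
    PowerSeries.coeff_mk, map_mul, smul_sub, Algebra.smul_def (PowerSeries.coeff k p) (algebraMap _ _ _)]

theorem form_ad_pow (k : ℕ) (u v : 𝔤) : B.form ((LieAlgebra.ad ℝ 𝔤 ξ ^ k) u) v =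
    (-1) ^ k * B.form u ((LieAlgebra.ad ℝ 𝔤 ξ ^ k) v) := by
  induction k generalizing v with
  | zero => simp
  | succ k ih =>
    have h : (LieAlgebra.ad ℝ 𝔤 ξ ^ k) ⁅ξ, v⁆ = (LieAlgebra.ad ℝ 𝔤 ξ ^ (k + 1)) v := rfl
    rw [pow_succ' (LieAlgebra.ad ℝ 𝔤 ξ), Module.End.mul_apply, LieAlgebra.ad_apply, B.form_lie_left,
      ih, h, ← pow_succ' (LieAlgebra.ad ℝ 𝔤 ξ)]
    ring

variable {ι : Type*} [Fintype ι] [DecidableEq ι] (b : Module.Basis ι ℝ 𝔤)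

/-- The series `∑_c ι(p(t ad_ξ) e_c) ι(e^c)`. -/
def quadSeries (p : PowerSeries ℝ) : PowerSeries (ExtEnd 𝔤) :=
  ∑ c, contrSeries B ξ p (b c) * contrConst B (B.dual b c)

theorem quadSeries_add (p q : PowerSeries ℝ) :
    quadSeries B ξ b (p + q) = quadSeries B ξ b p + quadSeries B ξ b q := by
  simp only [quadSeries, contrSeries_add, add_mul, Finset.sum_add_distrib]

theorem quadSeries_smul (r : ℝ) (p : PowerSeries ℝ) :
    quadSeries B ξ b (PowerSeries.C r * p) = r • quadSeries B ξ b p := by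
  simp only [quadSeries, contrSeries_smul, smul_mul_assoc, Finset.smul_sum]

theorem quadSeries_comm_contrSeries (p q : PowerSeries ℝ) (v : 𝔤) :
    quadSeries B ξ b p * contrSeries B ξ q v = contrSeries B ξ q v * quadSeries B ξ b p := by
  simp only [quadSeries, Finset.sum_mul, Finset.mul_sum, ← contrSeries_one B ξ]
  exact Finset.sum_congr rfl fun c _ => mul_comm_of_anticomm (contrSeries_anticomm B ξ p q _ _)
    (contrSeries_anticomm B ξ 1 q _ _)

theorem quadSeries_comm (p q : PowerSeries ℝ) :
    quadSeries B ξ b p * quadSeries B ξ b q = quadSeries B ξ b q * quadSeries B ξ b p := by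
  have h : ∀ c, contrSeries B ξ p (b c) * contrConst B (B.dual b c) * quadSeries B ξ b q =
      quadSeries B ξ b q * (contrSeries B ξ p (b c) * contrConst B (B.dual b c)) := fun c => by
    rw [mul_assoc, ← contrSeries_one B ξ, ← quadSeries_comm_contrSeries, ← mul_assoc,
      ← quadSeries_comm_contrSeries, mul_assoc]
  rw [quadSeries, Finset.sum_mul, Finset.mul_sum]
  exact Finset.sum_congr rfl fun c _ => h c

/-- For an odd series `p`, the commutator of `∑_c ι(p(t ad_ξ) e_c) ι(e^c)` with the exterior
multiplication by `v` is twice the contraction by `p(t ad_ξ) v`. -/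
theorem quadSeries_mul_mulSeries {p : PowerSeries ℝ}
    (hp : ∀ k, Even k → PowerSeries.coeff k p = 0) (v : 𝔤) :
    quadSeries B ξ b p * mulSeries 𝔤 v =
      mulSeries 𝔤 v * quadSeries B ξ b p + (2 : ℝ) • contrSeries B ξ p v := by
  have h1 : ∑ c, scalarSeries (pairSeries B ξ p (b c) v) * contrConst B (B.dual b c) =
      -contrSeries B ξ p v := by
    ext1 k
    rw [map_neg, map_sum, coeff_contrSeries]
    have h : ∀ c, PowerSeries.coeff k (scalarSeries (pairSeries B ξ p (b c) v) *
        contrConst B (B.dual b c)) = ((-1) ^ k * PowerSeries.coeff k p) •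
          (B.form (b c) ((LieAlgebra.ad ℝ 𝔤 ξ ^ k) v) • B.extContr (B.dual b c)) := fun c => by
      change PowerSeries.coeff k (_ * PowerSeries.C (B.extContr (B.dual b c))) = _
      rw [PowerSeries.coeff_mul_C, coeff_scalarSeries, pairSeries, PowerSeries.coeff_mk,
        form_ad_pow, ← Algebra.smul_def, smul_smul]
      congr 1
      ring
    simp only [h, ← Finset.smul_sum, ← map_smul, ← map_sum, sum_form_smul_dual]
    rcases Nat.even_or_odd k with hk | hk
    · simp [hp k hk]
    · rw [hk.neg_one_pow, neg_one_mul, neg_smul, map_neg, map_neg]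
  have h2 : ∑ c, contrSeries B ξ p (b c) * scalarSeries (pairSeries B ξ 1 (B.dual b c) v) =
      contrSeries B ξ p v := by
    have h : ∀ c, contrSeries B ξ p (b c) * scalarSeries (pairSeries B ξ 1 (B.dual b c) v) =
        B.form (B.dual b c) v • contrSeries B ξ p (b c) := fun c => by
      have : pairSeries B ξ 1 (B.dual b c) v = PowerSeries.C (B.form (B.dual b c) v) := by
        ext k
        rw [pairSeries, PowerSeries.coeff_mk, PowerSeries.coeff_one, PowerSeries.coeff_C]
        split_ifs with h
        · subst h
          simp
        · simp
      rw [this, scalarSeries, PowerSeries.map_C]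
      ext1 k
      rw [PowerSeries.coeff_mul_C, PowerSeries.coeff_smul, ← Algebra.commutes, Algebra.smul_def]
    simp only [h, ← map_smul, ← map_sum, sum_form_dual_smul]
  have h3 : ∀ c, contrSeries B ξ p (b c) * contrConst B (B.dual b c) * mulSeries 𝔤 v =
      contrSeries B ξ p (b c) * scalarSeries (pairSeries B ξ 1 (B.dual b c) v) -
      scalarSeries (pairSeries B ξ p (b c) v) * contrConst B (B.dual b c) +
      mulSeries 𝔤 v * (contrSeries B ξ p (b c) * contrConst B (B.dual b c)) := fun c => by
    rw [mul_assoc, ← contrSeries_one B ξ, contrSeries_mul_mulSeries, mul_sub, ← mul_assoc _ (mulSeries 𝔤 v),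
      contrSeries_mul_mulSeries, sub_mul, ← mul_assoc]
    abel
  rw [quadSeries, Finset.sum_mul, Finset.mul_sum]
  simp only [h3, Finset.sum_add_distrib, Finset.sum_sub_distrib, h1, h2]
  rw [sub_neg_eq_add, two_smul]
  abel

end ContractionSeries

/-! ### Truncated exponentials -/

section TruncatedExp

variable {P : Type*} [Ring P] [Algebra ℝ P]

/-- The exponential series, truncated after the power `N`. -/
def truncExp (N : ℕ) (r : P) : P := ∑ k ∈ Finset.range (N + 1), (k.factorial : ℝ)⁻¹ • r ^ k

/-- A derivation acts on an exponential of a nilpotent element by the chain rule. -/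
theorem derivation_truncExp (δ : P →ₗ[ℝ] P) (hδ : ∀ x y, δ (x * y) = δ x * y + x * δ y) {N : ℕ}
    {r c : P} (hc : δ r = c) (hcr : c * r = r * c) (hN : c * r ^ N = 0) :
    δ (truncExp N r) = c * truncExp N r := by
  have h1 : δ 1 = 0 := by simpa using hδ 1 1
  have hp : ∀ k : ℕ, δ (r ^ (k + 1)) = ((k : ℝ) + 1) • (c * r ^ k) := fun k => by
    induction k with
    | zero => simp [hc]
    | succ k ih =>
      have hcomm : r * (c * r ^ k) = c * r ^ (k + 1) := by
        rw [← mul_assoc, ← hcr, mul_assoc, ← pow_succ']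
      rw [pow_succ', hδ, hc, ih, mul_smul_comm, hcomm]
      push_cast
      module
  rw [truncExp, map_sum, Finset.sum_range_succ', Finset.sum_range_succ, mul_add, mul_smul_comm, hN,
    smul_zero, add_zero, pow_zero, map_smul, h1, smul_zero, add_zero, Finset.mul_sum]
  refine Finset.sum_congr rfl fun k _ => ?_
  rw [map_smul, hp, smul_smul, mul_smul_comm, Nat.factorial_succ]
  congr 1
  have h2 : (k.factorial : ℝ) ≠ 0 := by positivity
  push_cast
  field_simp

/-- The derivation `t d/dt` of power series. -/
def eulerSeries (R : Type*) [Ring R] [Algebra ℝ R] : PowerSeries R →ₗ[ℝ] PowerSeries R where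
  toFun F := PowerSeries.mk fun k => (k : ℝ) • PowerSeries.coeff k F
  map_add' F G := by ext1; simp
  map_smul' r F := by
    ext1
    simp only [PowerSeries.coeff_mk, PowerSeries.coeff_smul, RingHom.id_apply]
    rw [smul_comm]

theorem coeff_eulerSeries {R : Type*} [Ring R] [Algebra ℝ R] (F : PowerSeries R) (k : ℕ) :
    PowerSeries.coeff k (eulerSeries R F) = (k : ℝ) • PowerSeries.coeff k F :=
  PowerSeries.coeff_mk k fun k => (k : ℝ) • PowerSeries.coeff k F

theorem eulerSeries_mul {R : Type*} [Ring R] [Algebra ℝ R] (F G : PowerSeries R) :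
    eulerSeries R (F * G) = eulerSeries R F * G + F * eulerSeries R G := by
  ext1 k
  rw [map_add, coeff_eulerSeries, PowerSeries.coeff_mul, PowerSeries.coeff_mul,
    PowerSeries.coeff_mul, ← Finset.sum_add_distrib, Finset.smul_sum]
  refine Finset.sum_congr rfl fun i hi => ?_
  rw [coeff_eulerSeries, coeff_eulerSeries, smul_mul_assoc, mul_smul_comm, ← add_smul,
    ← Nat.cast_add, Finset.HasAntidiagonal.mem_antidiagonal.1 hi]

end TruncatedExp

/-! ### The quantization series -/

section Nilpotent

variable {𝔤 : Type*} [LieRing 𝔤] [LieAlgebra ℝ 𝔤] {ι : Type*} [Fintype ι] [DecidableEq ι]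
  (b : Module.Basis ι ℝ 𝔤)

include b in
theorem exteriorPower_eq_bot {k : ℕ} (hk : Fintype.card ι < k) : (⋀[ℝ]^k 𝔤) = ⊥ := by
  have : Module.Finite ℝ 𝔤 := Module.Finite.of_basis b
  have : Module.Free ℝ 𝔤 := Module.Free.of_basis b
  rw [← Submodule.finrank_eq_zero (R := ℝ), exteriorPower.finrank_eq, Module.finrank_eq_card_basis b,
    Nat.choose_eq_zero_of_lt hk]

theorem coeff_mul_mem_exteriorPower {F G : PowerSeries (ExteriorAlgebra ℝ 𝔤)} {m n : ℕ}
    (hF : ∀ k, PowerSeries.coeff k F ∈ ⋀[ℝ]^m 𝔤) (hG : ∀ k, PowerSeries.coeff k G ∈ ⋀[ℝ]^n 𝔤)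
    (k : ℕ) : PowerSeries.coeff k (F * G) ∈ ⋀[ℝ]^(m + n) 𝔤 := by
  rw [PowerSeries.coeff_mul]
  refine Submodule.sum_mem _ fun i _ => ?_
  rw [ExteriorAlgebra.exteriorPower, pow_add]
  exact Submodule.mul_mem_mul (hF _) (hG _)

theorem coeff_pow_mem_exteriorPower {F : PowerSeries (ExteriorAlgebra ℝ 𝔤)} {m : ℕ}
    (hF : ∀ k, PowerSeries.coeff k F ∈ ⋀[ℝ]^m 𝔤) (n k : ℕ) :
    PowerSeries.coeff k (F ^ n) ∈ ⋀[ℝ]^(m * n) 𝔤 := by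
  induction n generalizing k with
  | zero =>
    rw [pow_zero, PowerSeries.coeff_one, mul_zero]
    split_ifs
    · rw [ExteriorAlgebra.exteriorPower, pow_zero]
      exact Submodule.one_le.1 le_rfl
    · exact zero_mem _
  | succ n ih =>
    rw [pow_succ, mul_add, mul_one]
    exact coeff_mul_mem_exteriorPower ih hF k

include b in
theorem mul_pow_eq_zero {F G : PowerSeries (ExteriorAlgebra ℝ 𝔤)} {m : ℕ} (hm : 0 < m)
    (hF : ∀ k, PowerSeries.coeff k F ∈ ⋀[ℝ]^m 𝔤) (hG : ∀ k, PowerSeries.coeff k G ∈ ⋀[ℝ]^2 𝔤) :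
    F * G ^ Fintype.card ι = 0 := by
  ext1 k
  have := coeff_mul_mem_exteriorPower hF (coeff_pow_mem_exteriorPower hG (Fintype.card ι)) k
  rw [exteriorPower_eq_bot b (by omega)] at this
  simpa using this

end Nilpotent

/-- The commutator with a fixed element is a derivation. -/
theorem commutator_mul {P : Type*} [Ring P] [Algebra ℝ P] (v x y : P) :
    (LinearMap.mulRight ℝ v - LinearMap.mulLeft ℝ v) (x * y) =
      (LinearMap.mulRight ℝ v - LinearMap.mulLeft ℝ v) x * y +
        x * (LinearMap.mulRight ℝ v - LinearMap.mulLeft ℝ v) y := by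
  simp only [LinearMap.sub_apply, LinearMap.mulLeft_apply, LinearMap.mulRight_apply]
  noncomm_ring

section QuantizationSeries

variable {𝔤 : Type*} [LieRing 𝔤] [LieAlgebra ℝ 𝔤] (B : InvariantForm 𝔤) (ξ : 𝔤)
  {ι : Type*} [Fintype ι] [DecidableEq ι] (b : Module.Basis ι ℝ 𝔤)

/-- The series `∑_c p(t ad_ξ) e_c ∧ e^c` with coefficients in `Λ𝔤`. -/
def extQuadSeries (p : PowerSeries ℝ) : PowerSeries (ExteriorAlgebra ℝ 𝔤) :=
  PowerSeries.mk fun k => PowerSeries.coeff k p • ∑ c,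
    ExteriorAlgebra.ι ℝ ((LieAlgebra.ad ℝ 𝔤 ξ ^ k) (b c)) * ExteriorAlgebra.ι ℝ (B.dual b c)

/-- The operators of contraction by the coefficients of a power series with values in `Λ𝔤`. -/
def contrHomSeries : PowerSeries (ExteriorAlgebra ℝ 𝔤) →+* PowerSeries (ExtEnd 𝔤) :=
  PowerSeries.map (B.extContrHom : ExteriorAlgebra ℝ 𝔤 →+* ExtEnd 𝔤)

theorem coeff_contrHomSeries (F : PowerSeries (ExteriorAlgebra ℝ 𝔤)) (k : ℕ) :
    PowerSeries.coeff k (contrHomSeries B F) = B.extContrHom (PowerSeries.coeff k F) :=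
  PowerSeries.coeff_map _ _ _

theorem contrHomSeries_smul (r : ℝ) (F : PowerSeries (ExteriorAlgebra ℝ 𝔤)) :
    contrHomSeries B (r • F) = r • contrHomSeries B F := by
  ext1 k
  rw [coeff_contrHomSeries, PowerSeries.coeff_smul, PowerSeries.coeff_smul, map_smul,
    coeff_contrHomSeries]

theorem contrHomSeries_extQuadSeries (p : PowerSeries ℝ) :
    contrHomSeries B (extQuadSeries B ξ b p) = quadSeries B ξ b p := by
  ext1 k
  rw [coeff_contrHomSeries, quadSeries, map_sum, extQuadSeries, PowerSeries.coeff_mk, map_smul,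
    map_sum, Finset.smul_sum]
  refine Finset.sum_congr rfl fun c _ => ?_
  change _ = PowerSeries.coeff k (_ * PowerSeries.C (B.extContr _))
  rw [PowerSeries.coeff_mul_C, coeff_contrSeries, map_mul, extContrHom_ι, extContrHom_ι,
    smul_mul_assoc]

theorem coeff_extQuadSeries_mem (p : PowerSeries ℝ) (k : ℕ) :
    PowerSeries.coeff k (extQuadSeries B ξ b p) ∈ ⋀[ℝ]^2 𝔤 := by
  rw [extQuadSeries, PowerSeries.coeff_mk, ExteriorAlgebra.exteriorPower, pow_two]
  exact Submodule.smul_mem _ _ (Submodule.sum_mem _ fun c _ =>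
    Submodule.mul_mem_mul ⟨_, rfl⟩ ⟨_, rfl⟩)

theorem quadSeries_mul_pow (p q : PowerSeries ℝ) :
    quadSeries B ξ b p * quadSeries B ξ b q ^ Fintype.card ι = 0 := by
  rw [← contrHomSeries_extQuadSeries, ← contrHomSeries_extQuadSeries, ← map_pow, ← map_mul,
    mul_pow_eq_zero b two_pos (coeff_extQuadSeries_mem B ξ b p) (coeff_extQuadSeries_mem B ξ b q),
    map_zero]

theorem contrSeries_mul_pow (p q : PowerSeries ℝ) (v : 𝔤) :
    contrSeries B ξ p v * quadSeries B ξ b q ^ Fintype.card ι = 0 := by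
  have h : contrSeries B ξ p v = contrHomSeries B (PowerSeries.mk fun k =>
      PowerSeries.coeff k p • ExteriorAlgebra.ι ℝ ((LieAlgebra.ad ℝ 𝔤 ξ ^ k) v)) := by
    ext1 k
    rw [coeff_contrHomSeries, PowerSeries.coeff_mk, map_smul, extContrHom_ι, coeff_contrSeries]
  rw [h, ← contrHomSeries_extQuadSeries, ← map_pow, ← map_mul, mul_pow_eq_zero b one_pos
    (fun k => ?_) (coeff_extQuadSeries_mem B ξ b q), map_zero]
  rw [PowerSeries.coeff_mk, ExteriorAlgebra.exteriorPower, pow_one]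
  exact Submodule.smul_mem _ _ ⟨_, rfl⟩

/-- Along the line through `ξ`, the exponent of `S` is half of `∑_c f(t ad_ξ) e_c ∧ e^c`. -/
theorem lineEval_rSeries : lineEval (b.repr ξ) (rSeries B b) =
    (2⁻¹ : ℝ) • extQuadSeries B ξ b fSeries := by
  ext1 k
  have h1 : ∀ a c, PowerSeries.coeff k (lineEval (b.repr ξ)
      (∑ m, MvPowerSeries.C (B.form (b a) (b m)) * matrixSubst fSeries (adMatrix b) m c)) =
      PowerSeries.coeff k fSeries * B.form (b a) ((LieAlgebra.ad ℝ 𝔤 ξ ^ k) (b c)) := fun a c => by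
    have h2 : ∀ m, lineEval (b.repr ξ) (matrixSubst fSeries (adMatrix b) m c) =
        adSubst b ξ fSeries m c := fun m =>
      congrFun (congrFun (lineEval_matrixSubst b ξ fSeries) m) c
    rw [map_sum, map_sum]
    conv_rhs => rw [← b.sum_repr ((LieAlgebra.ad ℝ 𝔤 ξ ^ k) (b c))]
    rw [map_sum, Finset.mul_sum]
    refine Finset.sum_congr rfl fun m _ => ?_
    rw [map_mul, lineEval_C, h2, PowerSeries.coeff_C_mul, adSubst, Matrix.of_apply,
      PowerSeries.coeff_mk, LinearMap.toMatrix_apply, map_smul, smul_eq_mul]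
    ring
  have h4 : ∀ a c, PowerSeries.coeff k (lineEval (b.repr ξ)
      (MvPowerSeries.map (algebraMap ℝ (ExteriorAlgebra ℝ 𝔤))
        (∑ m, MvPowerSeries.C (B.form (b a) (b m)) * matrixSubst fSeries (adMatrix b) m c) *
      MvPowerSeries.C ((2⁻¹ : ℝ) •
        (ExteriorAlgebra.ι ℝ (B.dual b a) * ExteriorAlgebra.ι ℝ (B.dual b c))))) =
      (2⁻¹ * PowerSeries.coeff k fSeries) • (ExteriorAlgebra.ι ℝ
        (B.form (b a) ((LieAlgebra.ad ℝ 𝔤 ξ ^ k) (b c)) • B.dual b a) *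
          ExteriorAlgebra.ι ℝ (B.dual b c)) := fun a c => by
    rw [map_mul, lineEval_map, lineEval_C, PowerSeries.coeff_mul_C, PowerSeries.coeff_map, h1,
      ← Algebra.smul_def, map_smul, smul_mul_assoc, smul_smul, smul_smul]
    congr 1
    ring
  rw [rSeries, PowerSeries.coeff_smul, extQuadSeries, PowerSeries.coeff_mk, smul_smul]
  simp only [map_sum (lineEval (b.repr ξ)), map_sum (PowerSeries.coeff k), h4]
  rw [Finset.sum_comm, Finset.smul_sum]
  refine Finset.sum_congr rfl fun c _ => ?_
  rw [← Finset.smul_sum, ← Finset.sum_mul, ← map_sum, sum_form_smul_dual]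

/-- The series `∑_k t^k ι(S_k(ξ))` of operators on `Λ𝔤`, where `S_k` is the homogeneous part of
degree `k` of the function `S`. -/
def quantSeries : PowerSeries (ExtEnd 𝔤) :=
  contrHomSeries B (lineEval (b.repr ξ) (sSeries B b))

/-- The exponential in `S` is truncated at the dimension of `𝔤`, beyond which the powers of the
exponent vanish. -/
theorem quantSeries_eq : quantSeries B ξ b =
    scalarSeries (lineEval (b.repr ξ) (jDetSqrt b)) *
      truncExp (Fintype.card ι) ((2⁻¹ : ℝ) • quadSeries B ξ b fSeries) := by
  have h : ∀ p : PowerSeries ℝ, contrHomSeries B (PowerSeries.map (algebraMap ℝ _) p) =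
      scalarSeries p := fun p => by
    ext1 k
    rw [coeff_contrHomSeries, PowerSeries.coeff_map, coeff_scalarSeries, AlgHom.commutes]
  rw [quantSeries, sSeries, map_mul, map_mul, lineEval_map, h, truncExp, map_sum, map_sum]
  refine congrArg (_ * ·) (Finset.sum_congr rfl fun k _ => ?_)
  rw [lineEval_smul, contrHomSeries_smul, map_pow, map_pow, lineEval_rSeries, contrHomSeries_smul,
    contrHomSeries_extQuadSeries]

/-- Conjugation by the series `Θ = ∑_k t^k ι(S_k(ξ))` turns the exterior multiplication by `v` into
`v ∧ + ι(f(t ad_ξ) v)`, because the exponent is quadratic in contractions. -/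
theorem quantSeries_mulSeries (v : 𝔤) : quantSeries B ξ b * mulSeries 𝔤 v =
    (mulSeries 𝔤 v + contrSeries B ξ fSeries v) * quantSeries B ξ b := by
  have hδ := derivation_truncExp (N := Fintype.card ι)
    (r := (2⁻¹ : ℝ) • quadSeries B ξ b fSeries) (c := contrSeries B ξ fSeries v)
    (LinearMap.mulRight ℝ (mulSeries 𝔤 v) - LinearMap.mulLeft ℝ (mulSeries 𝔤 v))
    (commutator_mul _)
    (by
      rw [map_smul, LinearMap.sub_apply, LinearMap.mulLeft_apply, LinearMap.mulRight_apply,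
        quadSeries_mul_mulSeries B ξ b fun k hk => coeff_fSeries_even hk, add_sub_cancel_left,
        smul_smul]
      norm_num)
    (by rw [mul_smul_comm, smul_mul_assoc, quadSeries_comm_contrSeries])
    (by rw [smul_pow, mul_smul_comm, contrSeries_mul_pow, smul_zero])
  rw [LinearMap.sub_apply, LinearMap.mulLeft_apply, LinearMap.mulRight_apply,
    sub_eq_iff_eq_add, add_comm, ← add_mul] at hδ
  rw [quantSeries_eq, mul_assoc, hδ, ← mul_assoc, ← mul_assoc, scalarSeries_comm]

theorem quantSeries_contrSeries (p : PowerSeries ℝ) (v : 𝔤) :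
    quantSeries B ξ b * contrSeries B ξ p v = contrSeries B ξ p v * quantSeries B ξ b := by
  have h : Commute ((2⁻¹ : ℝ) • quadSeries B ξ b fSeries) (contrSeries B ξ p v) :=
    Commute.smul_left (quadSeries_comm_contrSeries B ξ b _ _ _) _
  have h2 : Commute (truncExp (Fintype.card ι) ((2⁻¹ : ℝ) • quadSeries B ξ b fSeries))
      (contrSeries B ξ p v) :=
    Commute.sum_left _ _ _ fun k _ => Commute.smul_left (h.pow_left k) _
  rw [quantSeries_eq]
  exact Commute.mul_left (scalarSeries_comm _ _) h2

/-- The logarithmic derivative of the quantization series: the factor `J^{1/2}` contributes a trace, and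
the exponential contributes the derivative `f'` in its exponent. -/
theorem eulerSeries_quantSeries : eulerSeries _ (quantSeries B ξ b) = (2⁻¹ : ℝ) •
    ((PowerSeries.X * scalarSeries (traceSeries B b ξ) +
      quadSeries B ξ b (PowerSeries.X * PowerSeries.derivative ℝ fSeries)) *
        quantSeries B ξ b) := by
  have hX : ∀ p : PowerSeries ℝ, eulerSeries (ExtEnd 𝔤) (scalarSeries p) =
      PowerSeries.X * scalarSeries (PowerSeries.derivative ℝ p) := fun p => by
    ext1 k
    rcases k with - | k
    · simp [coeff_eulerSeries]
    · rw [coeff_eulerSeries, PowerSeries.coeff_succ_X_mul, coeff_scalarSeries, coeff_scalarSeries,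
        PowerSeries.coeff_derivative, Algebra.smul_def, ← map_mul, mul_comm]
      push_cast
      rfl
  have hq : eulerSeries _ (quadSeries B ξ b fSeries) =
      quadSeries B ξ b (PowerSeries.X * PowerSeries.derivative ℝ fSeries) := by
    ext1 k
    rw [coeff_eulerSeries, ← contrHomSeries_extQuadSeries, ← contrHomSeries_extQuadSeries,
      coeff_contrHomSeries, coeff_contrHomSeries, ← map_smul, extQuadSeries, extQuadSeries,
      PowerSeries.coeff_mk, PowerSeries.coeff_mk, smul_smul]
    congr 2
    rcases k with - | k
    · simp
    · rw [PowerSeries.coeff_succ_X_mul, PowerSeries.coeff_derivative]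
      push_cast
      ring
  have hδ := derivation_truncExp (N := Fintype.card ι)
    (r := (2⁻¹ : ℝ) • quadSeries B ξ b fSeries)
    (c := (2⁻¹ : ℝ) • quadSeries B ξ b (PowerSeries.X * PowerSeries.derivative ℝ fSeries))
    (eulerSeries _) eulerSeries_mul (by rw [map_smul, hq])
    (by rw [smul_mul_smul_comm, smul_mul_smul_comm, quadSeries_comm])
    (by rw [smul_pow, smul_mul_smul_comm, quadSeries_mul_pow, smul_zero])
  have hs : scalarSeries (PowerSeries.derivative ℝ (lineEval (b.repr ξ) (jDetSqrt b))) =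
      (2⁻¹ : ℝ) • (scalarSeries (traceSeries B b ξ) *
        scalarSeries (lineEval (b.repr ξ) (jDetSqrt b)) : PowerSeries (ExtEnd 𝔤)) := by
    rw [← map_mul, mul_comm (traceSeries B b ξ), ← two_mul_derivative_lineEval_jDetSqrt, map_mul,
      map_ofNat, two_mul, ← two_smul ℝ, smul_smul]
    norm_num
  rw [quantSeries_eq, eulerSeries_mul, hδ, hX, hs, ← mul_assoc (scalarSeries _) (_ • _),
    mul_smul_comm, mul_smul_comm, scalarSeries_comm _ (quadSeries _ _ _ _), add_mul, smul_add]
  simp only [mul_assoc, smul_mul_assoc]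

end QuantizationSeries

/-! ### The differential equation of the quantization series -/

section OperatorIdentity

variable {𝔤 : Type*} [LieRing 𝔤] [LieAlgebra ℝ 𝔤] (B : InvariantForm 𝔤) (ξ : 𝔤)
  {ι : Type*} [Fintype ι] [DecidableEq ι] (b : Module.Basis ι ℝ 𝔤)

theorem sum_dual_mul_lie_comm {A : Type*} [Ring A] [Algebra ℝ A] (f g : 𝔤 →ₗ[ℝ] A) :
    ∑ a, f (b a) * g ⁅ξ, B.dual b a⁆ = ∑ a, f (B.dual b a) * g ⁅ξ, b a⁆ :=
  (sum_dual_mul_comm B b f (g ∘ₗ LieAlgebra.ad ℝ 𝔤 ξ)).symm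

theorem sum_form_dual_lie : ∑ a, B.form (B.dual b a) ⁅ξ, b a⁆ = 0 := by
  have h1 := sum_dual_lie B b B.form ξ
  have h2 := sum_dual_comm B b (B.form ∘ₗ LieAlgebra.ad ℝ 𝔤 ξ)
  simp only [LinearMap.comp_apply, LieAlgebra.ad_apply] at h2
  rw [h2] at h1
  simp only [B.form_comm ⁅ξ, b _⁆] at h1
  exact self_eq_neg_real h1

theorem sum_pairSeries_lie {p : PowerSeries ℝ} (hp : ∀ k, Even k → PowerSeries.coeff k p = 0) :
    ∑ a, pairSeries B ξ p (B.dual b a) ⁅ξ, b a⁆ = -PowerSeries.mk fun k =>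
      PowerSeries.coeff k p *
        ∑ a, B.form (B.dual b a) ((LieAlgebra.ad ℝ 𝔤 ξ ^ (k + 1)) (b a)) := by
  ext k
  rw [map_neg, map_sum, PowerSeries.coeff_mk, Finset.mul_sum, ← Finset.sum_neg_distrib]
  refine Finset.sum_congr rfl fun a _ => ?_
  rw [pairSeries, PowerSeries.coeff_mk, form_ad_pow, pow_succ (LieAlgebra.ad ℝ 𝔤 ξ),
    Module.End.mul_apply, LieAlgebra.ad_apply]
  rcases Nat.even_or_odd k with hk | hk
  · simp [hp k hk]
  · rw [hk.neg_one_pow]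
    ring

/-- Moving the exterior multiplications to the left produces the trace that the derivative of
`J^{1/2}` has to compensate. -/
theorem sum_contrSeries_mul_mulSeries_lie {p : PowerSeries ℝ}
    (hp : ∀ k, Even k → PowerSeries.coeff k p = 0) :
    ∑ a, contrSeries B ξ p (B.dual b a) * mulSeries 𝔤 ⁅ξ, b a⁆ =
      ∑ a, mulSeries 𝔤 (B.dual b a) * contrSeries B ξ p ⁅ξ, b a⁆ -
        scalarSeries (PowerSeries.mk fun k => PowerSeries.coeff k p *
          ∑ a, B.form (B.dual b a) ((LieAlgebra.ad ℝ 𝔤 ξ ^ (k + 1)) (b a))) := by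
  have h1 := sum_dual_mul_lie' B b (mulSeries 𝔤) (contrSeries B ξ p) ξ
  rw [sum_dual_mul_lie_comm] at h1
  simp only [contrSeries_mul_mulSeries]
  rw [Finset.sum_sub_distrib, ← map_sum, sum_pairSeries_lie B ξ b hp, map_neg, h1]
  abel

theorem sum_contrConst_mul_mulSeries_lie :
    ∑ a, contrConst B (B.dual b a) * mulSeries 𝔤 ⁅ξ, b a⁆ =
      ∑ a, mulSeries 𝔤 (B.dual b a) * contrConst B ⁅ξ, b a⁆ := by
  have h1 := sum_dual_mul_lie' B b (mulSeries 𝔤) (contrConst B) ξ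
  have h2 : ∑ a, pairSeries B ξ 1 (B.dual b a) ⁅ξ, b a⁆ = 0 := by
    ext k
    rw [map_sum, map_zero]
    simp only [pairSeries, PowerSeries.coeff_mk, PowerSeries.coeff_one]
    split_ifs with h
    · subst h
      simpa using sum_form_dual_lie B ξ b
    · simp
  rw [sum_dual_mul_lie_comm] at h1
  simp only [← contrSeries_one B ξ, contrSeries_mul_mulSeries] at h1 ⊢
  rw [Finset.sum_sub_distrib, ← map_sum, h2, map_zero, h1]
  abel

theorem sum_contrConst_mul_contrConst : ∑ a, contrConst B (b a) * contrConst B (B.dual b a) = 0 := by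
  have h := sum_dual_mul_comm B b (contrConst B) (contrConst B)
  have h2 : ∀ a, contrConst B (B.dual b a) * contrConst B (b a) =
      -(contrConst B (b a) * contrConst B (B.dual b a)) := fun a => by
    rw [← contrSeries_one B 0, ← contrSeries_one B 0, contrSeries_anticomm]
  simp only [h2, Finset.sum_neg_distrib] at h
  exact self_eq_neg_real h.symm

theorem sum_dual_mul_ad_pow {A : Type*} [Ring A] [Algebra ℝ A] (f g : 𝔤 →ₗ[ℝ] A) (k : ℕ) :
    ∑ a, f ((LieAlgebra.ad ℝ 𝔤 ξ ^ k) (B.dual b a)) * g (b a) =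
      (-1 : ℝ) ^ k • ∑ a, f (B.dual b a) * g ((LieAlgebra.ad ℝ 𝔤 ξ ^ k) (b a)) := by
  have h := sum_dual_adjoint B b ((LinearMap.mul ℝ A).compl₁₂ f g)
    (T := LieAlgebra.ad ℝ 𝔤 ξ ^ k) (T' := (-1 : ℝ) ^ k • LieAlgebra.ad ℝ 𝔤 ξ ^ k)
    (fun u v => by rw [form_ad_pow, LinearMap.smul_apply, map_smul, smul_eq_mul])
  simp only [LinearMap.compl₁₂_apply, LinearMap.mul_apply', LinearMap.smul_apply, map_smul,
    ← Finset.smul_sum] at h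
  rw [h, smul_smul, ← pow_add, ← two_mul, pow_mul]
  norm_num

/-- For even `m`, the sum `∑_a ι(e_a) ι(ad_ξ^m e^a)` is both symmetric and antisymmetric. -/
theorem sum_contr_ad_pow_even {m : ℕ} (hm : Even m) :
    ∑ a, (B.extContr (b a) : ExtEnd 𝔤) * B.extContr ((LieAlgebra.ad ℝ 𝔤 ξ ^ m) (B.dual b a)) = 0 := by
  have h1 := sum_dual_mul_ad_pow (A := ExtEnd 𝔤) B ξ b B.extContr B.extContr m
  have h2 := sum_dual_mul_comm (A := ExtEnd 𝔤) B b B.extContr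
    (B.extContr ∘ₗ (LieAlgebra.ad ℝ 𝔤 ξ ^ m : 𝔤 →ₗ[ℝ] 𝔤))
  simp only [LinearMap.comp_apply] at h2
  rw [hm.neg_one_pow, one_smul, h2] at h1
  have h3 : ∀ a, (B.extContr ((LieAlgebra.ad ℝ 𝔤 ξ ^ m) (B.dual b a)) : ExtEnd 𝔤) *
      B.extContr (b a) = -((B.extContr (b a) : ExtEnd 𝔤) *
        B.extContr ((LieAlgebra.ad ℝ 𝔤 ξ ^ m) (B.dual b a))) := fun a =>
    extContr_mul_anticomm B _ _
  simp only [h3, Finset.sum_neg_distrib] at h1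
  exact self_eq_neg_real h1.symm

theorem sum_contrConst_mul_contrSeries {p : PowerSeries ℝ}
    (hp : ∀ k, Even k → PowerSeries.coeff k p = 0) :
    ∑ a, contrConst B (b a) * contrSeries B ξ p ⁅ξ, B.dual b a⁆ = 0 := by
  ext1 k
  have h : ∀ a, PowerSeries.coeff k (contrConst B (b a) * contrSeries B ξ p ⁅ξ, B.dual b a⁆) =
      PowerSeries.coeff k p • ((B.extContr (b a) : ExtEnd 𝔤) *
        B.extContr ((LieAlgebra.ad ℝ 𝔤 ξ ^ (k + 1)) (B.dual b a))) := fun a => by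
    change PowerSeries.coeff k (PowerSeries.C (B.extContr (b a)) * _) = _
    rw [PowerSeries.coeff_C_mul, coeff_contrSeries, mul_smul_comm, pow_succ]
    rfl
  rw [map_sum, map_zero]
  simp only [h, ← Finset.smul_sum]
  rcases Nat.even_or_odd k with hk | hk
  · rw [hp k hk, zero_smul]
  · rw [sum_contr_ad_pow_even B ξ b hk.add_one, smul_zero]

/-- The product of two contractions by `p(t ad_ξ)` and `q(t ad_ξ)` is the quadratic series of `p q`;
for `p = q = f` this is the term `z f ^ 2` of the Riccati equation. -/
theorem X_mul_sum_contrSeries_mul_contrSeries {p : PowerSeries ℝ}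
    (hp : ∀ k, Even k → PowerSeries.coeff k p = 0) (q : PowerSeries ℝ) :
    PowerSeries.X * ∑ a, contrSeries B ξ p (B.dual b a) * contrSeries B ξ q ⁅ξ, b a⁆ =
      quadSeries B ξ b (PowerSeries.X * (p * q)) := by
  have h2 : ∀ i j, PowerSeries.coeff i p • PowerSeries.coeff j q • ∑ a,
      (B.extContr ((LieAlgebra.ad ℝ 𝔤 ξ ^ i) (B.dual b a)) : ExtEnd 𝔤) *
        B.extContr ((LieAlgebra.ad ℝ 𝔤 ξ ^ (j + 1)) (b a)) =
      (PowerSeries.coeff i p * PowerSeries.coeff j q) • ∑ a,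
        (B.extContr ((LieAlgebra.ad ℝ 𝔤 ξ ^ (i + j + 1)) (b a)) : ExtEnd 𝔤) *
          B.extContr (B.dual b a) := fun i j => by
    rw [smul_smul]
    have h3 := sum_dual_mul_ad_pow (A := ExtEnd 𝔤) B ξ b B.extContr
      (B.extContr ∘ₗ (LieAlgebra.ad ℝ 𝔤 ξ ^ (j + 1) : 𝔤 →ₗ[ℝ] 𝔤)) i
    simp only [LinearMap.comp_apply, ← Module.End.mul_apply, ← pow_add] at h3
    rcases Nat.even_or_odd i with hi | hi
    · rw [hp i hi, zero_mul, zero_smul, zero_smul]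
    · congr 1
      refine h3.trans ?_
      rw [hi.neg_one_pow, neg_smul, one_smul, ← Finset.sum_neg_distrib]
      refine Finset.sum_congr rfl fun a _ => ?_
      rw [extContr_mul_anticomm, neg_neg, add_comm (j + 1), ← add_assoc]
  ext1 k
  rcases k with - | k
  · rw [PowerSeries.coeff_zero_X_mul, ← contrHomSeries_extQuadSeries, coeff_contrHomSeries,
      extQuadSeries, PowerSeries.coeff_mk, PowerSeries.coeff_zero_X_mul, zero_smul, map_zero]
  · have h4 : ∀ a, PowerSeries.coeff k (contrSeries B ξ p (B.dual b a) *
        contrSeries B ξ q ⁅ξ, b a⁆) = ∑ i ∈ Finset.HasAntidiagonal.antidiagonal k,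
        PowerSeries.coeff i.1 p • PowerSeries.coeff i.2 q •
        ((B.extContr ((LieAlgebra.ad ℝ 𝔤 ξ ^ i.1) (B.dual b a)) : ExtEnd 𝔤) *
          B.extContr ((LieAlgebra.ad ℝ 𝔤 ξ ^ (i.2 + 1)) (b a))) := fun a => by
      rw [PowerSeries.coeff_mul]
      refine Finset.sum_congr rfl fun i _ => ?_
      rw [coeff_contrSeries, coeff_contrSeries, smul_mul_assoc, mul_smul_comm, pow_succ _ i.2]
      rfl
    rw [PowerSeries.coeff_succ_X_mul, map_sum]
    simp only [h4]
    rw [Finset.sum_comm]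
    simp only [← Finset.smul_sum, h2]
    rw [← contrHomSeries_extQuadSeries, coeff_contrHomSeries,
      extQuadSeries, PowerSeries.coeff_mk, PowerSeries.coeff_succ_X_mul, PowerSeries.coeff_mul,
      map_smul, Finset.sum_smul]
    refine Finset.sum_congr rfl fun i hi => ?_
    rw [Finset.HasAntidiagonal.mem_antidiagonal.1 hi]
    simp only [map_sum, map_mul, extContrHom_ι]

/-- The contribution of the Clifford multiplications, which is the right-hand side `z / 4` of the Riccati
equation up to a constant. -/
theorem X_mul_sum_contrConst_lie :
    PowerSeries.X * ∑ a, contrConst B (B.dual b a) * contrConst B ⁅ξ, b a⁆ =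
      -quadSeries B ξ b PowerSeries.X := by
  have h : ∀ a, PowerSeries.X * (contrConst B (B.dual b a) * contrConst B ⁅ξ, b a⁆) =
      -(contrSeries B ξ PowerSeries.X (b a) * contrConst B (B.dual b a)) := fun a => by
    have h1 := contrSeries_X_mul B ξ 1 (b a)
    rw [mul_one] at h1
    rw [h1, contrSeries_one, mul_assoc, ← contrSeries_one B ξ, ← contrSeries_one B ξ,
      contrSeries_anticomm B ξ 1 1 (B.dual b a)]
    exact mul_neg (PowerSeries.X : PowerSeries (ExtEnd 𝔤)) _
  rw [Finset.mul_sum, quadSeries]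
  simp only [h]
  exact Finset.sum_neg_distrib _

/-- The operator of Clifford multiplication by `v`, transported to `Λ𝔤`. -/
def cliffSeries : 𝔤 →ₗ[ℝ] PowerSeries (ExtEnd 𝔤) := mulSeries 𝔤 + (2⁻¹ : ℝ) • contrConst B

theorem cliffSeries_apply (v : 𝔤) :
    cliffSeries B v = mulSeries 𝔤 v + (2⁻¹ : ℝ) • contrConst B v := rfl

theorem add_smul_mul_add {P : Type*} [Ring P] [Algebra ℝ P] (x y z w : P) :
    (x + (2⁻¹ : ℝ) • y) * (z + w) =
      x * z + x * w + (2⁻¹ : ℝ) • (y * z) + (2⁻¹ : ℝ) • (y * w) := by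
  simp only [add_mul, mul_add, smul_mul_assoc]
  abel

/-- The noncommutative algebra behind `quantSeries_ode`: the linear terms cancel, and what remains is
the Riccati expression `K₁ + 2 K₂ + X S₅ + X S₆ / 4`. -/
theorem half_smul_mul_of_riccati {P : Type*} [Ring P] [Algebra ℝ P]
    {X Θ T S₁ S₂ S₃ S₄ S₅ S₆ K₁ K₂ : P}
    (h : K₁ + (2 : ℝ) • K₂ + X * S₅ + (4⁻¹ : ℝ) • (X * S₆) = 0) :
    (2⁻¹ : ℝ) • ((X * T + K₁) * Θ) + (S₄ + K₂) * Θ +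
      (2⁻¹ : ℝ) • (X * ((S₁ + S₂ + (S₂ - T) + S₅) * Θ)) +
      (2⁻¹ : ℝ) • (X * ((S₁ + (2⁻¹ : ℝ) • S₃ + (2⁻¹ : ℝ) • S₃ + (4⁻¹ : ℝ) • S₆) * Θ)) -
      S₄ * Θ - X * ((S₁ + S₂ + (2⁻¹ : ℝ) • S₃) * Θ) = 0 := by
  have h2 := congrArg (fun x => (2⁻¹ : ℝ) • (x * Θ)) h
  simp only [zero_mul, smul_zero] at h2
  rw [← h2]
  simp only [add_mul, sub_mul, mul_add, mul_sub, smul_mul_assoc, mul_smul_comm, mul_assoc, smul_add]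
  module

/-- The differential equation satisfied by the quantization series `∑_k t^k ι(S_k(ξ))`. It is a
consequence of the Riccati equation for `f`. -/
theorem quantSeries_ode :
    eulerSeries _ (quantSeries B ξ b) +
      quantSeries B ξ b * ∑ a, mulSeries 𝔤 (b a) * contrConst B (B.dual b a) +
      (2⁻¹ : ℝ) • (PowerSeries.X *
        (quantSeries B ξ b * ∑ a, mulSeries 𝔤 (B.dual b a) * mulSeries 𝔤 ⁅ξ, b a⁆)) +
      (2⁻¹ : ℝ) • (PowerSeries.X *
        ((∑ a, cliffSeries B (B.dual b a) * cliffSeries B ⁅ξ, b a⁆) * quantSeries B ξ b)) -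
      ∑ a, cliffSeries B (b a) * quantSeries B ξ b * contrConst B (B.dual b a) -
      PowerSeries.X *
        ∑ a, cliffSeries B (b a) * quantSeries B ξ b * mulSeries 𝔤 ⁅ξ, B.dual b a⁆ = 0 := by
  set Θ := quantSeries B ξ b with hΘ
  have hodd : ∀ k, Even k → PowerSeries.coeff k fSeries = 0 := fun k hk => coeff_fSeries_even hk
  have hE : ∀ v, Θ * mulSeries 𝔤 v = (mulSeries 𝔤 v + contrSeries B ξ fSeries v) * Θ :=
    quantSeries_mulSeries B ξ b
  have hI : ∀ v, Θ * contrConst B v = contrConst B v * Θ := fun v => by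
    rw [← contrSeries_one B ξ, hΘ, quantSeries_contrSeries]
  have h1 : Θ * ∑ a, mulSeries 𝔤 (b a) * contrConst B (B.dual b a) =
      (∑ a, mulSeries 𝔤 (b a) * contrConst B (B.dual b a) + quadSeries B ξ b fSeries) * Θ := by
    rw [quadSeries, ← Finset.sum_add_distrib, Finset.mul_sum, Finset.sum_mul]
    refine Finset.sum_congr rfl fun a _ => ?_
    rw [← mul_assoc, hE, mul_assoc, hI, ← mul_assoc, add_mul]
  have h2 : Θ * ∑ a, mulSeries 𝔤 (B.dual b a) * mulSeries 𝔤 ⁅ξ, b a⁆ =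
      (∑ a, mulSeries 𝔤 (B.dual b a) * mulSeries 𝔤 ⁅ξ, b a⁆ +
        ∑ a, mulSeries 𝔤 (B.dual b a) * contrSeries B ξ fSeries ⁅ξ, b a⁆ +
        (∑ a, mulSeries 𝔤 (B.dual b a) * contrSeries B ξ fSeries ⁅ξ, b a⁆ -
          scalarSeries (traceSeries B b ξ)) +
        ∑ a, contrSeries B ξ fSeries (B.dual b a) * contrSeries B ξ fSeries ⁅ξ, b a⁆) * Θ := by
    rw [traceSeries, ← sum_contrSeries_mul_mulSeries_lie B ξ b hodd]
    simp only [← Finset.sum_add_distrib]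
    rw [Finset.mul_sum, Finset.sum_mul]
    refine Finset.sum_congr rfl fun a _ => ?_
    rw [← mul_assoc, hE, mul_assoc, hE, ← mul_assoc]
    refine congrArg (· * Θ) ?_
    rw [add_mul, mul_add, mul_add]
    abel
  have h3 : ∑ a, cliffSeries B (B.dual b a) * cliffSeries B ⁅ξ, b a⁆ =
      ∑ a, mulSeries 𝔤 (B.dual b a) * mulSeries 𝔤 ⁅ξ, b a⁆ +
        (2⁻¹ : ℝ) • ∑ a, mulSeries 𝔤 (B.dual b a) * contrConst B ⁅ξ, b a⁆ +
        (2⁻¹ : ℝ) • ∑ a, mulSeries 𝔤 (B.dual b a) * contrConst B ⁅ξ, b a⁆ +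
        (4⁻¹ : ℝ) • ∑ a, contrConst B (B.dual b a) * contrConst B ⁅ξ, b a⁆ := by
    conv_rhs =>
      enter [1, 2]
      rw [← sum_contrConst_mul_mulSeries_lie]
    simp only [Finset.smul_sum, ← Finset.sum_add_distrib]
    refine Finset.sum_congr rfl fun a _ => ?_
    refine (add_smul_mul_add _ _ _ _).trans ?_
    rw [LinearMap.smul_apply, mul_smul_comm, mul_smul_comm, smul_smul]
    norm_num
  have h4 : ∑ a, cliffSeries B (b a) * Θ * contrConst B (B.dual b a) =
      (∑ a, mulSeries 𝔤 (b a) * contrConst B (B.dual b a)) * Θ := by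
    have h : ∑ a, cliffSeries B (b a) * Θ * contrConst B (B.dual b a) =
        (∑ a, mulSeries 𝔤 (b a) * contrConst B (B.dual b a) +
          (2⁻¹ : ℝ) • ∑ a, contrConst B (b a) * contrConst B (B.dual b a)) * Θ := by
      rw [Finset.smul_sum, ← Finset.sum_add_distrib, Finset.sum_mul]
      refine Finset.sum_congr rfl fun a _ => ?_
      rw [mul_assoc, hI, ← mul_assoc, cliffSeries_apply, add_mul, smul_mul_assoc]
    rw [h, sum_contrConst_mul_contrConst, smul_zero, add_zero]
  have h5 : ∑ a, cliffSeries B (b a) * Θ * mulSeries 𝔤 ⁅ξ, B.dual b a⁆ =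
      (∑ a, mulSeries 𝔤 (B.dual b a) * mulSeries 𝔤 ⁅ξ, b a⁆ +
        ∑ a, mulSeries 𝔤 (B.dual b a) * contrSeries B ξ fSeries ⁅ξ, b a⁆ +
        (2⁻¹ : ℝ) • ∑ a, mulSeries 𝔤 (B.dual b a) * contrConst B ⁅ξ, b a⁆) * Θ := by
    have h : ∑ a, cliffSeries B (b a) * Θ * mulSeries 𝔤 ⁅ξ, B.dual b a⁆ =
        (∑ a, mulSeries 𝔤 (b a) * mulSeries 𝔤 ⁅ξ, B.dual b a⁆ +
          ∑ a, mulSeries 𝔤 (b a) * contrSeries B ξ fSeries ⁅ξ, B.dual b a⁆ +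
          (2⁻¹ : ℝ) • ∑ a, contrConst B (b a) * mulSeries 𝔤 ⁅ξ, B.dual b a⁆ +
          (2⁻¹ : ℝ) • ∑ a, contrConst B (b a) * contrSeries B ξ fSeries ⁅ξ, B.dual b a⁆) * Θ := by
      simp only [Finset.smul_sum, ← Finset.sum_add_distrib]
      rw [Finset.sum_mul]
      refine Finset.sum_congr rfl fun a _ => ?_
      rw [mul_assoc, hE, ← mul_assoc]
      exact congrArg (· * Θ) (add_smul_mul_add _ _ _ _)
    rw [h, sum_contrConst_mul_contrSeries B ξ b hodd, smul_zero, add_zero,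
      sum_dual_mul_lie_comm, sum_dual_mul_lie_comm, sum_dual_mul_lie_comm,
      sum_contrConst_mul_mulSeries_lie]
  rw [h1, h2, h3, h4, h5, hΘ, eulerSeries_quantSeries]
  -- What remains is `quadSeries` of the Riccati equation `z f' + 2 f + z f ^ 2 = z / 4`.
  refine half_smul_mul_of_riccati ?_
  rw [X_mul_sum_contrSeries_mul_contrSeries B ξ b hodd, X_mul_sum_contrConst_lie]
  have hr := congrArg (quadSeries B ξ b) fSeries_riccati
  have hc : (2 : PowerSeries ℝ) = PowerSeries.C 2 := (map_ofNat PowerSeries.C 2).symm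
  rw [hc, quadSeries_add, quadSeries_add, quadSeries_smul, quadSeries_smul, sq] at hr
  rw [hr, smul_neg]
  exact add_neg_cancel _

end OperatorIdentity

/-! ### The Euler operator of `W𝔤` -/

section Euler

variable {𝔤 : Type*} [LieRing 𝔤] [LieAlgebra ℝ 𝔤] (B : InvariantForm 𝔤)
  {ι : Type*} [Fintype ι] [DecidableEq ι] (b : Module.Basis ι ℝ 𝔤)

theorem polyPartial_single (a : ι) (p : MvPolynomial ι ℝ) :
    polyPartial (Finsupp.single a 1) p = MvPolynomial.pderiv a p := by
  have := polyPartial_add_single 0 a p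
  rwa [zero_add, polyPartial_zero] at this

theorem symPartial_single_mul (a : ι) (s s' : SymmetricAlgebra ℝ 𝔤) :
    symPartial b (Finsupp.single a 1) (s * s') = symPartial b (Finsupp.single a 1) s * s' +
      s * symPartial b (Finsupp.single a 1) s' := by
  simp only [symPartial, LinearMap.comp_apply, AlgEquiv.toLinearMap_apply, polyPartial_single,
    map_mul, Derivation.leibniz, map_add, smul_eq_mul, AlgEquiv.symm_apply_apply]
  ring

/-- The derivation `∂_v` of `S𝔤` with `∂_v w = B(v, w)` for `w ∈ 𝔤`. -/
def symDeriv : 𝔤 →ₗ[ℝ] SymmetricAlgebra ℝ 𝔤 →ₗ[ℝ] SymmetricAlgebra ℝ 𝔤 where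
  toFun v := ∑ a, B.form v (b a) • symPartial b (Finsupp.single a 1)
  map_add' u v := by simp only [map_add, LinearMap.add_apply, add_smul, Finset.sum_add_distrib]
  map_smul' r v := by
    simp only [map_smul, LinearMap.smul_apply, smul_eq_mul, mul_smul, Finset.smul_sum,
      RingHom.id_apply]

theorem symDeriv_apply (v : 𝔤) (s : SymmetricAlgebra ℝ 𝔤) :
    symDeriv B b v s = ∑ a, B.form v (b a) • symPartial b (Finsupp.single a 1) s := by
  simp [symDeriv, LinearMap.sum_apply]

theorem symDeriv_mul (v : 𝔤) (s s' : SymmetricAlgebra ℝ 𝔤) :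
    symDeriv B b v (s * s') = symDeriv B b v s * s' + s * symDeriv B b v s' := by
  simp only [symDeriv_apply, symPartial_single_mul, Finset.sum_mul, Finset.mul_sum, smul_add,
    Finset.sum_add_distrib, smul_mul_assoc, mul_smul_comm]

/-- The divided power `v ^ (n - 1) / (n - 1)!`, which is zero for `n = 0`. -/
def divPowPred (v : 𝔤) : ℕ → SymmetricAlgebra ℝ 𝔤
  | 0 => 0
  | n + 1 => divPow v n

theorem sum_form_mul_repr (u v : 𝔤) : ∑ a, B.form u (b a) * b.repr v a = B.form u v := by
  conv_rhs => rw [← b.sum_repr v]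
  simp [-Module.Basis.sum_repr, mul_comm]

theorem symDeriv_divPow (u v : 𝔤) (n : ℕ) :
    symDeriv B b u (divPow v n) = B.form u v • divPowPred v n := by
  have h : ∀ a, symPartial b (Finsupp.single a 1) (divPow v n) = b.repr v a • divPowPred v n :=
    fun a => by
      rw [symPartial_divPow, Finsupp.degree_single, monomialValue_single]
      cases n with
      | zero => simp [divPowPred]
      | succ n => simp [divPowPred]
  rw [symDeriv_apply]
  simp only [h, smul_smul, ← Finset.sum_smul, sum_form_mul_repr]

theorem divPow_zero (v : 𝔤) : divPow v 0 = 1 := by simp [divPow]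

theorem divPow_one (v : 𝔤) : divPow v 1 = SymmetricAlgebra.ι ℝ 𝔤 v := by simp [divPow]

theorem symDeriv_ι (u v : 𝔤) :
    symDeriv B b u (SymmetricAlgebra.ι ℝ 𝔤 v) = algebraMap ℝ _ (B.form u v) := by
  rw [← divPow_one, symDeriv_divPow, Algebra.algebraMap_eq_smul_one, divPowPred, divPow_zero]

theorem ι_mul_divPowPred (v : 𝔤) (n : ℕ) :
    SymmetricAlgebra.ι ℝ 𝔤 v * divPowPred v n = (n : ℝ) • divPow v n := by
  cases n with
  | zero => simp [divPowPred]
  | succ n =>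
    rw [divPowPred, divPow, divPow, mul_smul_comm, ← pow_succ', smul_smul, Nat.factorial_succ]
    congr 1
    have h : (n.factorial : ℝ) ≠ 0 := by positivity
    push_cast
    field_simp

theorem symDeriv_symLie (u v : 𝔤) (s : SymmetricAlgebra ℝ 𝔤) :
    symDeriv B b u (symLie v s) - symLie v (symDeriv B b u s) = -symDeriv B b ⁅v, u⁆ s := by
  have hm := symDeriv_mul B b
  have key : symDeriv B b u ∘ₗ symLie v - symLie v ∘ₗ symDeriv B b u = -symDeriv B b ⁅v, u⁆ := by
    refine symDer_unique (fun x y => ?_) (fun x y => ?_) fun w => ?_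
    · simp only [LinearMap.sub_apply, LinearMap.comp_apply, symLie_mul, hm, map_add]
      ring
    · simp only [LinearMap.neg_apply, hm]
      ring
    · have h1 : symLie v (1 : SymmetricAlgebra ℝ 𝔤) = 0 := symDer_one _
      simp only [LinearMap.sub_apply, LinearMap.comp_apply, LinearMap.neg_apply, symLie_ι,
        symDeriv_ι, B.form_lie_left, Algebra.algebraMap_eq_smul_one, map_smul, h1]
      simp
  exact LinearMap.congr_fun key s

/-- The derivation `∂_v ⊗ 1` of `W𝔤`. -/
def weilPartial : 𝔤 →ₗ[ℝ] Weil 𝔤 →ₗ[ℝ] Weil 𝔤 :=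
  LinearMap.rTensorHom (ExteriorAlgebra ℝ 𝔤) ∘ₗ symDeriv B b

theorem weilPartial_tmul (v : 𝔤) (s : SymmetricAlgebra ℝ 𝔤) (ω : ExteriorAlgebra ℝ 𝔤) :
    weilPartial B b v (s ⊗ₜ ω) = symDeriv B b v s ⊗ₜ ω := rfl

/-- The commutator of `∂_v` with the Weil differential. -/
def weilPartialD (v : 𝔤) : Weil 𝔤 →ₗ[ℝ] Weil 𝔤 :=
  weilPartial B b v ∘ₗ weilD B b - weilD B b ∘ₗ weilPartial B b v

theorem weilPartialD_apply (v : 𝔤) (w : Weil 𝔤) : weilPartialD B b v w =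
    weilPartial B b v (weilD B b w) - weilD B b (weilPartial B b v w) := rfl

theorem weilPartialD_tmul (v : 𝔤) (s : SymmetricAlgebra ℝ 𝔤) (ω : ExteriorAlgebra ℝ 𝔤) :
    weilPartialD B b v (s ⊗ₜ ω) = s ⊗ₜ B.extContr v ω -
      ∑ a, symDeriv B b ⁅b a, v⁆ s ⊗ₜ (ExteriorAlgebra.ι ℝ (B.dual b a) * ω) := by
  have h1 : ∑ a, symDeriv B b v (symLie (b a) s) ⊗ₜ[ℝ] (ExteriorAlgebra.ι ℝ (B.dual b a) * ω) =
      ∑ a, symLie (b a) (symDeriv B b v s) ⊗ₜ[ℝ] (ExteriorAlgebra.ι ℝ (B.dual b a) * ω) -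
        ∑ a, symDeriv B b ⁅b a, v⁆ s ⊗ₜ (ExteriorAlgebra.ι ℝ (B.dual b a) * ω) := by
    rw [← Finset.sum_sub_distrib]
    refine Finset.sum_congr rfl fun a _ => ?_
    rw [← TensorProduct.sub_tmul, sub_eq_add_neg, ← symDeriv_symLie, add_sub_cancel]
  have h2 : ∑ a, symDeriv B b v (SymmetricAlgebra.ι ℝ 𝔤 (b a) * s) ⊗ₜ[ℝ]
      B.extContr (B.dual b a) ω = s ⊗ₜ B.extContr v ω +
        ∑ a, (SymmetricAlgebra.ι ℝ 𝔤 (b a) * symDeriv B b v s) ⊗ₜ B.extContr (B.dual b a) ω := by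
    conv_rhs =>
      enter [1]
      rw [← sum_form_smul_dual B b v]
    simp only [symDeriv_mul, symDeriv_ι, TensorProduct.add_tmul, Finset.sum_add_distrib, map_sum,
      map_smul, LinearMap.sum_apply, LinearMap.smul_apply, TensorProduct.tmul_sum,
      ← Algebra.smul_def, TensorProduct.tmul_smul, TensorProduct.smul_tmul', B.form_comm v]
  rw [weilPartialD_apply, weilD_tmul, weilPartial_tmul, weilD_tmul]
  simp only [map_add, map_sum, weilPartial_tmul]
  rw [h1, h2]
  abel

/-- On divided powers, `[∂_u, d]` is the contraction `ι_u` plus a term of lower symmetric degree. -/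
theorem weilPartialD_divPow (u v : 𝔤) (n : ℕ) (ω : ExteriorAlgebra ℝ 𝔤) :
    weilPartialD B b u (divPow v n ⊗ₜ ω) = divPow v n ⊗ₜ B.extContr u ω +
      divPowPred v n ⊗ₜ (ExteriorAlgebra.ι ℝ ⁅v, u⁆ * ω) := by
  have h := sum_form_smul_dual B b ⁅v, u⁆
  rw [weilPartialD_tmul, ← h, map_sum, Finset.sum_mul, TensorProduct.tmul_sum, sub_eq_add_neg,
    ← Finset.sum_neg_distrib]
  congr 1
  refine Finset.sum_congr rfl fun a _ => ?_
  have h1 : B.form (b a) ⁅v, u⁆ = -B.form ⁅b a, u⁆ v := by rw [B.form_lie_swap, B.form_comm v]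
  rw [symDeriv_divPow, map_smul, smul_mul_assoc, TensorProduct.tmul_smul, TensorProduct.smul_tmul',
    ← TensorProduct.neg_tmul, ← neg_smul, h1]

/-- The Euler operator of `W𝔤` in the generators `1 ⊗ ξ` and `d (1 ⊗ ξ)`. It is `d h + h d` for the
homotopy `h = ∑_a (1 ⊗ e_a) ∂_{e^a}`, and hence commutes with the differential. -/
def weilEuler : Weil 𝔤 →ₗ[ℝ] Weil 𝔤 :=
  ∑ a, (LinearMap.mulLeft ℝ (weilD B b (1 ⊗ₜ ExteriorAlgebra.ι ℝ (b a))) ∘ₗ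
      weilPartial B b (B.dual b a) +
    LinearMap.mulLeft ℝ (1 ⊗ₜ ExteriorAlgebra.ι ℝ (b a)) ∘ₗ weilPartialD B b (B.dual b a))

theorem weilEuler_apply (w : Weil 𝔤) : weilEuler B b w =
    ∑ a, (weilD B b (1 ⊗ₜ ExteriorAlgebra.ι ℝ (b a)) * weilPartial B b (B.dual b a) w +
      1 ⊗ₜ ExteriorAlgebra.ι ℝ (b a) * weilPartialD B b (B.dual b a) w) := by
  simp [weilEuler, LinearMap.sum_apply]

/-- The degree operator of `Λ𝔤`. -/
def extDegree : ExtEnd 𝔤 := ∑ a, extMul 𝔤 (b a) * B.extContr (B.dual b a)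

/-- On divided powers, the Euler operator is the total degree plus a term of lower symmetric degree. -/
theorem weilEuler_divPow (v : 𝔤) (n : ℕ) (ω : ExteriorAlgebra ℝ 𝔤) :
    weilEuler B b (divPow v n ⊗ₜ ω) = (n : ℝ) • divPow v n ⊗ₜ ω +
      divPow v n ⊗ₜ extDegree B b ω -
      divPowPred v n ⊗ₜ (extD B b (ExteriorAlgebra.ι ℝ v) * ω) := by
  have h1 : ∑ a, weilD B b (1 ⊗ₜ ExteriorAlgebra.ι ℝ (b a)) *
      weilPartial B b (B.dual b a) (divPow v n ⊗ₜ ω) =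
      weilD B b (1 ⊗ₜ ExteriorAlgebra.ι ℝ v) * (divPowPred v n ⊗ₜ ω) := by
    have h := sum_form_dual_smul B b v
    conv_rhs =>
      enter [1]
      rw [← h]
    simp only [weilPartial_tmul, symDeriv_divPow, map_sum, TensorProduct.tmul_sum, map_smul,
      TensorProduct.tmul_smul, Finset.sum_mul, smul_mul_assoc, ← TensorProduct.smul_tmul',
      mul_smul_comm]
  have h2 : ∑ a, ExteriorAlgebra.ι ℝ (b a) * (ExteriorAlgebra.ι ℝ ⁅v, B.dual b a⁆ * ω) =
      -(2 : ℝ) • (extD B b (ExteriorAlgebra.ι ℝ v) * ω) := by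
    have h := sum_dual_mul_lie_comm B v b (ExteriorAlgebra.ι ℝ) (ExteriorAlgebra.ι ℝ)
    rw [extD_ι, smul_mul_assoc, smul_smul]
    simp only [← mul_assoc, ← Finset.sum_mul, h]
    simp only [← lie_skew v, map_neg]
    norm_num [Finset.sum_mul]
  rw [weilEuler_apply, Finset.sum_add_distrib, h1, weilD_ext, add_mul]
  simp only [weilPartialD_divPow, mul_add, Algebra.TensorProduct.tmul_mul_tmul, one_mul,
    Finset.sum_add_distrib, ← TensorProduct.tmul_sum, h2, ι_mul_divPowPred, extDegree,
    LinearMap.sum_apply, Module.End.mul_apply, extMul_apply, TensorProduct.tmul_smul,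
    ← TensorProduct.smul_tmul']
  module

theorem euler_commutator_identity {P : Type*} [Ring P] (e θ p q r s : P) :
    e * q + θ * (0 - r) = 0 * p + e * s + (e * (q - s) + -θ * (r - 0)) := by
  noncomm_ring

theorem weilEuler_weilD (w : Weil 𝔤) : weilEuler B b (weilD B b w) = weilD B b (weilEuler B b w) := by
  have hp : ∀ v : 𝔤, weilParity 𝔤 (1 ⊗ₜ ExteriorAlgebra.ι ℝ v) = -(1 ⊗ₜ ExteriorAlgebra.ι ℝ v) :=
    fun v => by simp [weilParity, ExteriorAlgebra.ι, TensorProduct.tmul_neg]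
  have hd := (weilD_isOddDer B b).2
  have hp2 : ∀ v : 𝔤, weilParity 𝔤 (weilD B b (1 ⊗ₜ ExteriorAlgebra.ι ℝ v)) =
      weilD B b (1 ⊗ₜ ExteriorAlgebra.ι ℝ v) := fun v => by
    rw [← neg_eq_iff_eq_neg.2 ((weilD_isOddDer B b).1 _), hp, map_neg, neg_neg]
  rw [weilEuler_apply, weilEuler_apply, map_sum]
  refine Finset.sum_congr rfl fun a _ => ?_
  rw [map_add, hd, hd, weilD_weilD, hp, hp2, weilPartialD_apply, weilPartialD_apply, weilD_weilD,
    map_zero, map_sub, weilD_weilD]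
  exact euler_commutator_identity _ _ _ _ _ _

end Euler

/-! ### The quantization map commutes with the derivations -/

section ChainMap

variable {𝔤 : Type*} [LieRing 𝔤] [LieAlgebra ℝ 𝔤] (B : InvariantForm 𝔤)
  {ι : Type*} [Fintype ι] [DecidableEq ι] (b : Module.Basis ι ℝ 𝔤)

/-- The divided power `v ^ n / n!` in `U𝔤`. -/
def envDivPow (v : 𝔤) (n : ℕ) : UniversalEnvelopingAlgebra ℝ 𝔤 :=
  (n.factorial : ℝ)⁻¹ • UniversalEnvelopingAlgebra.ι ℝ v ^ n

theorem ι_mul_envDivPow (v : 𝔤) (n : ℕ) :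
    UniversalEnvelopingAlgebra.ι ℝ v * envDivPow v n = (n + 1 : ℝ) • envDivPow v (n + 1) := by
  rw [envDivPow, envDivPow, mul_smul_comm, ← pow_succ', smul_smul, Nat.factorial_succ]
  congr 1
  have h : (n.factorial : ℝ) ≠ 0 := by positivity
  push_cast
  field_simp

/-- For a power series `F` of operators on `Λ𝔤`, the coefficient of `t ^ n` in
`exp(t v) ⊗ q(F(t) ω)`. -/
def lineTensor (v : 𝔤) (n : ℕ) (ω : ExteriorAlgebra ℝ 𝔤) :
    PowerSeries (ExtEnd 𝔤) →ₗ[ℝ] NCWeil B where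
  toFun F := ∑ p ∈ Finset.HasAntidiagonal.antidiagonal n,
    envDivPow v p.1 ⊗ₜ extToCl B (PowerSeries.coeff p.2 F ω)
  map_add' F G := by
    simp only [map_add, LinearMap.add_apply, TensorProduct.tmul_add, Finset.sum_add_distrib]
  map_smul' r F := by
    simp only [PowerSeries.coeff_smul, LinearMap.smul_apply, map_smul, TensorProduct.tmul_smul,
      Finset.smul_sum, RingHom.id_apply]

theorem lineTensor_apply (v : 𝔤) (n : ℕ) (ω : ExteriorAlgebra ℝ 𝔤) (F : PowerSeries (ExtEnd 𝔤)) :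
    lineTensor B v n ω F = ∑ p ∈ Finset.HasAntidiagonal.antidiagonal n,
      envDivPow v p.1 ⊗ₜ extToCl B (PowerSeries.coeff p.2 F ω) := rfl

theorem lineTensor_smul_right (v : 𝔤) (n : ℕ) (r : ℝ) (ω : ExteriorAlgebra ℝ 𝔤)
    (F : PowerSeries (ExtEnd 𝔤)) :
    lineTensor B v n (r • ω) F = r • lineTensor B v n ω F := by
  simp only [lineTensor_apply, map_smul, TensorProduct.tmul_smul, Finset.smul_sum]

theorem cliffSeries_eq_C (u : 𝔤) :
    cliffSeries B u = PowerSeries.C (extMul 𝔤 u + (2⁻¹ : ℝ) • B.extContr u) := by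
  ext1 k
  change PowerSeries.coeff k (PowerSeries.C (extMul 𝔤 u) +
    (2⁻¹ : ℝ) • PowerSeries.C (B.extContr u)) = _
  rw [map_add, PowerSeries.coeff_smul, PowerSeries.coeff_C, PowerSeries.coeff_C, PowerSeries.coeff_C]
  split_ifs <;> simp

theorem lineTensor_mul_C (v : 𝔤) (n : ℕ) (ω : ExteriorAlgebra ℝ 𝔤) (F : PowerSeries (ExtEnd 𝔤))
    (A : ExtEnd 𝔤) : lineTensor B v n ω (F * PowerSeries.C A) = lineTensor B v n (A ω) F := by
  simp only [lineTensor_apply, PowerSeries.coeff_mul_C, Module.End.mul_apply]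

theorem lineTensor_mul_mulSeries (v : 𝔤) (n : ℕ) (ω : ExteriorAlgebra ℝ 𝔤)
    (F : PowerSeries (ExtEnd 𝔤)) (u : 𝔤) : lineTensor B v n ω (F * mulSeries 𝔤 u) =
      lineTensor B v n (ExteriorAlgebra.ι ℝ u * ω) F := lineTensor_mul_C B v n ω F (extMul 𝔤 u)

theorem lineTensor_mul_contrConst (v : 𝔤) (n : ℕ) (ω : ExteriorAlgebra ℝ 𝔤)
    (F : PowerSeries (ExtEnd 𝔤)) (u : 𝔤) : lineTensor B v n ω (F * contrConst B u) =
      lineTensor B v n (B.extContr u ω) F := lineTensor_mul_C B v n ω F (B.extContr u)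

theorem lineTensor_cliffSeries_mul (v : 𝔤) (n : ℕ) (ω : ExteriorAlgebra ℝ 𝔤) (u : 𝔤)
    (F : PowerSeries (ExtEnd 𝔤)) : lineTensor B v n ω (cliffSeries B u * F) =
      (1 ⊗ₜ CliffordAlgebra.ι B.quadratic u) * lineTensor B v n ω F := by
  rw [lineTensor_apply, lineTensor_apply, Finset.mul_sum]
  refine Finset.sum_congr rfl fun p _ => ?_
  rw [cliffSeries_eq_C, PowerSeries.coeff_C_mul, Module.End.mul_apply, LinearMap.add_apply, LinearMap.smul_apply,
    map_add, map_smul, extMul_apply, extToCl_ι_mul, extToCl_extContr, sub_add_cancel,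
    Algebra.TensorProduct.tmul_mul_tmul, one_mul]

theorem lineTensor_eulerSeries (v : 𝔤) (n : ℕ) (ω : ExteriorAlgebra ℝ 𝔤)
    (F : PowerSeries (ExtEnd 𝔤)) : lineTensor B v n ω (eulerSeries _ F) =
      (n : ℝ) • lineTensor B v n ω F -
        (UniversalEnvelopingAlgebra.ι ℝ v ⊗ₜ 1) * lineTensor B v n ω (PowerSeries.X * F) := by
  have h1 : (UniversalEnvelopingAlgebra.ι ℝ v ⊗ₜ 1) * lineTensor B v n ω (PowerSeries.X * F) =
      ∑ p ∈ Finset.HasAntidiagonal.antidiagonal n,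
        (p.1 : ℝ) • envDivPow v p.1 ⊗ₜ extToCl B (PowerSeries.coeff p.2 F ω) := by
    rw [lineTensor_apply, Finset.mul_sum]
    cases n with
    | zero => simp
    | succ n =>
      rw [Finset.Nat.sum_antidiagonal_succ', Finset.Nat.sum_antidiagonal_succ]
      simp only [PowerSeries.coeff_zero_X_mul, PowerSeries.coeff_succ_X_mul, LinearMap.zero_apply,
        map_zero, TensorProduct.tmul_zero, mul_zero, Nat.cast_zero, zero_smul, zero_add,
        Algebra.TensorProduct.tmul_mul_tmul, ι_mul_envDivPow, one_mul, TensorProduct.smul_tmul',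
        Nat.cast_succ]
  rw [h1, lineTensor_apply, lineTensor_apply, Finset.smul_sum, ← Finset.sum_sub_distrib]
  refine Finset.sum_congr rfl fun p hp => ?_
  rw [coeff_eulerSeries, LinearMap.smul_apply, map_smul, TensorProduct.tmul_smul, ← sub_smul,
    ← Finset.HasAntidiagonal.mem_antidiagonal.1 hp]
  push_cast
  rw [add_sub_cancel_left]

/-- The quantization map on a divided power, in terms of the quantization series. -/
theorem quantization_divPow (v : 𝔤) (n : ℕ) (ω : ExteriorAlgebra ℝ 𝔤) :
    quantization B b (divPow v n ⊗ₜ ω) = lineTensor B v n ω (quantSeries B v b) := by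
  have : FiniteDimensional ℝ 𝔤 := Module.Finite.of_basis b
  rw [quantization, LinearMap.comp_apply, weilDiffOp_divPow, map_sum, lineTensor_apply]
  refine Finset.sum_congr rfl fun p _ => ?_
  rw [TensorProduct.map_tmul, cliffordQuantization_eq, symmetrization_divPow, quantSeries,
    coeff_contrHomSeries]
  rfl

theorem quantization_divPowPred (v : 𝔤) (n : ℕ) (ω : ExteriorAlgebra ℝ 𝔤) :
    quantization B b (divPowPred v n ⊗ₜ ω) =
      lineTensor B v n ω (PowerSeries.X * quantSeries B v b) := by
  cases n with
  | zero => simp [divPowPred, lineTensor_apply]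
  | succ n =>
    rw [divPowPred, quantization_divPow, lineTensor_apply, lineTensor_apply,
      Finset.Nat.sum_antidiagonal_succ']
    simp [PowerSeries.coeff_succ_X_mul]

/-- The quantization map intertwines the Euler operator with its analogue for `𝒲𝔤`. -/
theorem quantization_weilEuler (w : Weil 𝔤) : quantization B b (weilEuler B b w) =
    ∑ a, (ncCurv B b (b a) * quantization B b (weilPartial B b (B.dual b a) w) +
      (1 ⊗ₜ CliffordAlgebra.ι B.quadratic (b a)) *
        quantization B b (weilPartialD B b (B.dual b a) w)) := by
  suffices h : quantization B b ∘ₗ weilEuler B b =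
      ∑ a, (LinearMap.mulLeft ℝ (ncCurv B b (b a)) ∘ₗ quantization B b ∘ₗ
          weilPartial B b (B.dual b a) +
        LinearMap.mulLeft ℝ (1 ⊗ₜ CliffordAlgebra.ι B.quadratic (b a)) ∘ₗ quantization B b ∘ₗ
          weilPartialD B b (B.dual b a)) by
    simpa [LinearMap.sum_apply] using LinearMap.congr_fun h w
  refine weil_lhom_ext fun v n ω => ?_
  simp only [LinearMap.comp_apply, LinearMap.sum_apply, LinearMap.add_apply,
    LinearMap.mulLeft_apply]
  set L := lineTensor B v n with hL
  set Θ := quantSeries B v b with hΘ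
  have hode := congrArg (L ω) (quantSeries_ode B v b)
  have e1 := lineTensor_eulerSeries B v n ω Θ
  have e2 : L ω (Θ * ∑ a, mulSeries 𝔤 (b a) * contrConst B (B.dual b a)) =
      L (extDegree B b ω) Θ := by
    have h : ∑ a, mulSeries 𝔤 (b a) * contrConst B (B.dual b a) =
        PowerSeries.C (extDegree B b) := by
      rw [extDegree, map_sum]
      exact Finset.sum_congr rfl fun a _ => (map_mul PowerSeries.C _ _).symm
    rw [h, hL, lineTensor_mul_C]
  have e3 : L ω (PowerSeries.X *
      (Θ * ∑ a, mulSeries 𝔤 (B.dual b a) * mulSeries 𝔤 ⁅v, b a⁆)) =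
      -(2 : ℝ) • L (extD B b (ExteriorAlgebra.ι ℝ v) * ω) (PowerSeries.X * Θ) := by
    have h : ∑ a, mulSeries 𝔤 (B.dual b a) * mulSeries 𝔤 ⁅v, b a⁆ =
        PowerSeries.C (∑ a, extMul 𝔤 (B.dual b a) * extMul 𝔤 ⁅v, b a⁆) := by
      rw [map_sum]
      exact Finset.sum_congr rfl fun a _ => (map_mul PowerSeries.C _ _).symm
    have h2 : (∑ a, extMul 𝔤 (B.dual b a) * extMul 𝔤 ⁅v, b a⁆) ω =
        -(2 : ℝ) • (extD B b (ExteriorAlgebra.ι ℝ v) * ω) := by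
      rw [extD_ι, smul_mul_assoc, smul_smul]
      simp only [LinearMap.sum_apply, Module.End.mul_apply, extMul_apply, ← lie_skew v, map_neg,
        Finset.sum_mul, mul_assoc]
      norm_num
      rfl
    rw [h, ← mul_assoc, hL, lineTensor_mul_C, h2, lineTensor_smul_right]
  have e4 : L ω (PowerSeries.X *
      ((∑ a, cliffSeries B (B.dual b a) * cliffSeries B ⁅v, b a⁆) * Θ)) =
      -(2 : ℝ) • ((1 ⊗ₜ cliffordGamma B b v) * L ω (PowerSeries.X * Θ)) := by
    have h : (∑ a, cliffSeries B (B.dual b a) * cliffSeries B ⁅v, b a⁆) * Θ * PowerSeries.X =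
        ∑ a, cliffSeries B (B.dual b a) * (cliffSeries B ⁅v, b a⁆ * (PowerSeries.X * Θ)) := by
      rw [mul_assoc, Finset.sum_mul]
      exact Finset.sum_congr rfl fun a _ => by rw [PowerSeries.X_mul, mul_assoc]
    have h2 : (1 ⊗ₜ cliffordGamma B b v : NCWeil B) = (2⁻¹ : ℝ) •
        ∑ a, (1 ⊗ₜ CliffordAlgebra.ι B.quadratic (B.dual b a)) *
          (1 ⊗ₜ CliffordAlgebra.ι B.quadratic ⁅b a, v⁆) := by
      simp only [cliffordGamma_apply, TensorProduct.tmul_smul, TensorProduct.tmul_sum,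
        Algebra.TensorProduct.tmul_mul_tmul, one_mul]
    rw [PowerSeries.X_mul, h, map_sum, h2, smul_mul_assoc, smul_smul, Finset.sum_mul,
      Finset.smul_sum]
    refine Finset.sum_congr rfl fun a _ => ?_
    rw [hL, lineTensor_cliffSeries_mul, lineTensor_cliffSeries_mul, ← lie_skew v, map_neg,
      TensorProduct.tmul_neg, mul_assoc]
    norm_num
  have e5 : L ω (∑ a, cliffSeries B (b a) * Θ * contrConst B (B.dual b a)) =
      ∑ a, (1 ⊗ₜ CliffordAlgebra.ι B.quadratic (b a)) * L (B.extContr (B.dual b a) ω) Θ := by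
    rw [map_sum]
    refine Finset.sum_congr rfl fun a _ => ?_
    rw [hL, lineTensor_mul_contrConst, lineTensor_cliffSeries_mul]
  have e6 : L ω (PowerSeries.X *
      ∑ a, cliffSeries B (b a) * Θ * mulSeries 𝔤 ⁅v, B.dual b a⁆) =
      ∑ a, (1 ⊗ₜ CliffordAlgebra.ι B.quadratic (b a)) *
        L (ExteriorAlgebra.ι ℝ ⁅v, B.dual b a⁆ * ω) (PowerSeries.X * Θ) := by
    rw [Finset.mul_sum, map_sum]
    refine Finset.sum_congr rfl fun a _ => ?_
    rw [hL, ← mul_assoc, lineTensor_mul_mulSeries, ← mul_assoc, PowerSeries.X_mul, mul_assoc,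
      lineTensor_cliffSeries_mul]
  have e7 : ∑ a, ncCurv B b (b a) * quantization B b
      (weilPartial B b (B.dual b a) (divPow v n ⊗ₜ ω)) =
      (UniversalEnvelopingAlgebra.ι ℝ v ⊗ₜ 1) * L ω (PowerSeries.X * Θ) +
        (1 ⊗ₜ cliffordGamma B b v) * L ω (PowerSeries.X * Θ) := by
    rw [← add_mul, ← ncCurv_apply]
    conv_rhs =>
      enter [1]
      rw [← sum_form_dual_smul B b v]
    rw [map_sum, Finset.sum_mul]
    refine Finset.sum_congr rfl fun a _ => ?_
    rw [weilPartial_tmul, symDeriv_divPow, ← TensorProduct.smul_tmul', map_smul, map_smul,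
      mul_smul_comm, smul_mul_assoc, quantization_divPowPred]
  rw [weilEuler_divPow, Finset.sum_add_distrib, e7, map_sub, map_add, map_smul]
  simp only [weilPartialD_divPow, map_add, quantization_divPow, quantization_divPowPred, mul_add,
    Finset.sum_add_distrib]
  simp only [map_sub, map_add, map_smul, map_zero] at hode
  rw [← hΘ, e1, e2, e3, e4, e5, e6] at hode
  rw [← sub_eq_zero, ← hode]
  simp only [hL, hΘ]
  module

/-- The defect of the quantization map with respect to the differentials. -/
def quantDefect : Weil 𝔤 →ₗ[ℝ] NCWeil B :=
  (ncWeil B b).d ∘ₗ quantization B b - quantization B b ∘ₗ weilD B b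

theorem quantDefect_apply (w : Weil 𝔤) : quantDefect B b w =
    (ncWeil B b).d (quantization B b w) - quantization B b (weilD B b w) := rfl

theorem defect_euler_identity {P : Type*} [Ring P] (e θ p q r s t u : P) :
    0 * p + e * s + (e * q + -θ * r) - (e * (q + t) + θ * -u) = e * (s - t) - θ * (r - u) := by
  noncomm_ring

/-- The defect satisfies the same recursion as the quantization map. Here the differential of
`1 ⊗ e_a ∈ 𝒲𝔤` is `ncCurv e_a`, which is a cocycle. -/
theorem quantDefect_weilEuler (w : Weil 𝔤) : quantDefect B b (weilEuler B b w) =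
    ∑ a, (ncCurv B b (b a) * quantDefect B b (weilPartial B b (B.dual b a) w) -
      (1 ⊗ₜ CliffordAlgebra.ι B.quadratic (b a)) *
        quantDefect B b (weilPartialD B b (B.dual b a) w)) := by
  have hd := (ncWeil B b).d_mul
  have hp : ∀ v : 𝔤, parity (ncWeilGrading B) (1 ⊗ₜ CliffordAlgebra.ι B.quadratic v) =
      -(1 ⊗ₜ CliffordAlgebra.ι B.quadratic v) := fun v => by
    rw [parity_invol]
    simp [ncWeilParity, TensorProduct.tmul_neg]
  have hp2 : ∀ v : 𝔤, parity (ncWeilGrading B) (ncCurv B b v) = ncCurv B b v := fun v => by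
    rw [parity_invol, ncCurv_even]
  rw [quantDefect_apply, ← weilEuler_weilD, quantization_weilEuler, quantization_weilEuler, map_sum,
    ← Finset.sum_sub_distrib]
  refine Finset.sum_congr rfl fun a _ => ?_
  have h1 : weilPartial B b (B.dual b a) (weilD B b w) = weilPartialD B b (B.dual b a) w +
      weilD B b (weilPartial B b (B.dual b a) w) := by
    rw [weilPartialD_apply, sub_add_cancel]
  have h2 : weilPartialD B b (B.dual b a) (weilD B b w) =
      -weilD B b (weilPartialD B b (B.dual b a) w) := by
    rw [weilPartialD_apply, weilPartialD_apply, map_sub, weilD_weilD, weilD_weilD, map_zero,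
      zero_sub, sub_zero]
  rw [h1, h2, map_add, map_add, map_neg, hd, hd, ncWeil_d_ncCurv, ncWeil_d_ext, hp, hp2,
    quantDefect_apply, quantDefect_apply]
  exact defect_euler_identity _ _ _ _ _ _ _ _

theorem extDegree_ι_mul (v : 𝔤) (ω : ExteriorAlgebra ℝ 𝔤) :
    extDegree B b (ExteriorAlgebra.ι ℝ v * ω) =
      ExteriorAlgebra.ι ℝ v * ω + ExteriorAlgebra.ι ℝ v * extDegree B b ω := by
  have h : ∀ a, ExteriorAlgebra.ι ℝ (b a) * B.extContr (B.dual b a) (ExteriorAlgebra.ι ℝ v * ω) =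
      ExteriorAlgebra.ι ℝ (B.form (B.dual b a) v • b a) * ω + ExteriorAlgebra.ι ℝ v *
        (ExteriorAlgebra.ι ℝ (b a) * B.extContr (B.dual b a) ω) := fun a => by
    rw [B.extContr_ι_mul, mul_sub, mul_smul_comm, map_smul, smul_mul_assoc, ← mul_assoc,
      ext_anticomm (b a), neg_mul, sub_neg_eq_add, mul_assoc]
  simp only [extDegree, LinearMap.sum_apply, Module.End.mul_apply, extMul_apply, h,
    Finset.sum_add_distrib]
  rw [← Finset.sum_mul, ← map_sum, sum_form_dual_smul, Finset.mul_sum]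

theorem extDegree_mem {k : ℕ} {ω : ExteriorAlgebra ℝ 𝔤} (h : ω ∈ ⋀[ℝ]^k 𝔤) :
    extDegree B b ω = (k : ℝ) • ω := by
  induction k generalizing ω with
  | zero =>
    rw [ExteriorAlgebra.exteriorPower, pow_zero] at h
    obtain ⟨r, rfl⟩ := h
    simp [extDegree, LinearMap.sum_apply, extContr_one]
  | succ k ih =>
    rw [ExteriorAlgebra.exteriorPower, pow_succ'] at h
    induction h using Submodule.mul_induction_on' with
    | mem_mul_mem x hx y hy =>
      obtain ⟨v, rfl⟩ := hx
      rw [extDegree_ι_mul, ih hy]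
      push_cast
      rw [mul_smul_comm]
      module
    | add x _ y _ hx hy => rw [map_add, hx, hy, smul_add]

theorem extContr_mem {k : ℕ} {ω : ExteriorAlgebra ℝ 𝔤} (h : ω ∈ ⋀[ℝ]^(k + 1) 𝔤) (u : 𝔤) :
    B.extContr u ω ∈ ⋀[ℝ]^k 𝔤 := by
  induction k generalizing ω with
  | zero =>
    rw [ExteriorAlgebra.exteriorPower, zero_add, pow_one] at h
    obtain ⟨v, rfl⟩ := h
    rw [extContr_ι, ExteriorAlgebra.exteriorPower, pow_zero]
    exact ⟨B.form u v, by simp [Algebra.algebraMap_eq_smul_one]⟩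
  | succ k ih =>
    rw [ExteriorAlgebra.exteriorPower, pow_succ'] at h
    induction h using Submodule.mul_induction_on' with
    | mem_mul_mem x hx y hy =>
      obtain ⟨v, rfl⟩ := hx
      rw [B.extContr_ι_mul]
      refine sub_mem (Submodule.smul_mem _ _ hy) ?_
      rw [ExteriorAlgebra.exteriorPower, pow_succ']
      exact Submodule.mul_mem_mul ⟨v, rfl⟩ (ih hy)
    | add x _ y _ hx hy =>
      rw [map_add]
      exact add_mem hx hy

theorem coeff_zero_quantSeries (v : 𝔤) : PowerSeries.coeff 0 (quantSeries B v b) = 1 := by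
  have h0 : PowerSeries.constantCoeff (quadSeries B v b fSeries) = 0 := by
    rw [← PowerSeries.coeff_zero_eq_constantCoeff_apply, ← contrHomSeries_extQuadSeries,
      coeff_contrHomSeries, extQuadSeries, PowerSeries.coeff_mk, coeff_fSeries_even Even.zero,
      zero_smul, map_zero]
  have h1 : PowerSeries.constantCoeff ((2⁻¹ : ℝ) • quadSeries B v b fSeries) = 0 := by
    rw [← PowerSeries.coeff_zero_eq_constantCoeff_apply, PowerSeries.coeff_smul,
      PowerSeries.coeff_zero_eq_constantCoeff_apply, h0, smul_zero]
  have h2 : ∀ k : ℕ, PowerSeries.constantCoeff ((k.factorial : ℝ)⁻¹ •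
      ((2⁻¹ : ℝ) • quadSeries B v b fSeries) ^ k) = if k = 0 then 1 else 0 := fun k => by
    rw [← PowerSeries.coeff_zero_eq_constantCoeff_apply, PowerSeries.coeff_smul,
      PowerSeries.coeff_zero_eq_constantCoeff_apply, map_pow, h1]
    split_ifs with h
    · simp [h]
    · rw [zero_pow h, smul_zero]
  rw [quantSeries_eq, PowerSeries.coeff_zero_eq_constantCoeff_apply, map_mul,
    ← PowerSeries.coeff_zero_eq_constantCoeff_apply, coeff_scalarSeries, coeff_zero_lineEval,
    constantCoeff_jDetSqrt, map_one, one_mul, truncExp, map_sum]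
  simp only [h2]
  simp

theorem quantization_one : quantization B b 1 = 1 := by
  have h := quantization_divPow B b 0 0 1
  rw [divPow_zero, lineTensor_apply] at h
  refine h.trans ?_
  simp [coeff_zero_quantSeries, extToCl_one, envDivPow]
  rfl

/-- Induction on the exterior degree `k`. The recursion `quantDefect_weilEuler` multiplies the defect at
`v^n / n! ⊗ ω` by `n + k`, and its other terms have smaller `n` or smaller `k`; for `n = k = 0` the
element is a multiple of the unit. -/
theorem quantDefect_divPow_of_pred {n : ℕ}
    (hn : ∀ v ω, quantDefect B b (divPowPred v n ⊗ₜ ω) = 0) (k : ℕ) (v : 𝔤)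
    (ω : ExteriorAlgebra ℝ 𝔤) (hω : ω ∈ ⋀[ℝ]^k 𝔤) : quantDefect B b (divPow v n ⊗ₜ ω) = 0 := by
  induction k generalizing ω with
  | zero =>
    rcases Nat.eq_zero_or_pos n with rfl | hpos
    · rw [ExteriorAlgebra.exteriorPower, pow_zero] at hω
      obtain ⟨r, rfl⟩ := hω
      have h1 : quantDefect B b 1 = 0 := by
        have h2 : weilD B b 1 = 0 := (weil B b).d_one
        rw [quantDefect_apply, quantization_one, h2, map_zero, sub_zero]
        exact (ncWeil B b).d_one
      rw [divPow_zero, LinearMap.toSpanSingleton_apply, TensorProduct.tmul_smul, map_smul]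
      exact (congrArg (r • ·) h1).trans (smul_zero r)
    · have h := quantDefect_weilEuler B b (divPow v n ⊗ₜ ω)
      have h0 : ∀ u, B.extContr u ω = 0 := fun u => by
        rw [ExteriorAlgebra.exteriorPower, pow_zero] at hω
        obtain ⟨r, rfl⟩ := hω
        simp [extContr_one]
      simp only [weilEuler_divPow, extDegree_mem B b hω, weilPartial_tmul, symDeriv_divPow,
        weilPartialD_divPow, h0, map_add, map_sub, map_smul, ← TensorProduct.smul_tmul', hn,
        TensorProduct.tmul_zero, map_zero, smul_zero, mul_zero, sub_zero, add_zero, Nat.cast_zero,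
        zero_smul, Finset.sum_const_zero] at h
      exact (smul_eq_zero.1 h).resolve_left (by positivity)
  | succ k ih =>
    have h := quantDefect_weilEuler B b (divPow v n ⊗ₜ ω)
    have h0 : ∀ u, quantDefect B b (divPow v n ⊗ₜ B.extContr u ω) = 0 := fun u =>
      ih _ (extContr_mem B hω u)
    simp only [weilEuler_divPow, extDegree_mem B b hω, weilPartial_tmul, symDeriv_divPow,
      weilPartialD_divPow, h0, map_add, map_sub, map_smul, ← TensorProduct.smul_tmul', hn,
      TensorProduct.tmul_smul, smul_zero, mul_zero, sub_zero, add_zero,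
      Finset.sum_const_zero, ← add_smul] at h
    exact (smul_eq_zero.1 h).resolve_left (by positivity)

/-- The quantization map is a morphism of complexes: the defect satisfies a homogeneous equation
for the Euler operator, which determines it recursively from its value at `1`. -/
theorem quantDefect_eq_zero : quantDefect B b = 0 := by
  have hext : ∀ n, (∀ v ω, quantDefect B b (divPowPred v n ⊗ₜ ω) = 0) →
      ∀ v ω, quantDefect B b (divPow v n ⊗ₜ ω) = 0 := fun n hn v ω => by
    induction ω using DirectSum.Decomposition.inductionOn (fun k => ⋀[ℝ]^k 𝔤) with
    | zero => rw [TensorProduct.tmul_zero, map_zero]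
    | homogeneous ω => exact quantDefect_divPow_of_pred B b hn _ v _ ω.2
    | add ω ω' h h' => rw [TensorProduct.tmul_add, map_add, h, h', add_zero]
  refine weil_lhom_ext fun v n ω => ?_
  rw [LinearMap.zero_apply]
  induction n generalizing v ω with
  | zero => exact hext 0 (fun v ω => by rw [divPowPred, TensorProduct.zero_tmul, map_zero]) v ω
  | succ n ih => exact hext (n + 1) ih v ω

theorem quantization_weilD (w : Weil 𝔤) :
    quantization B b (weilD B b w) = (ncWeil B b).d (quantization B b w) := by
  have h := LinearMap.congr_fun (quantDefect_eq_zero B b) w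
  rw [quantDefect_apply, LinearMap.zero_apply, sub_eq_zero] at h
  exact h.symm

theorem quantization_contr (ξ : 𝔤) (w : Weil 𝔤) :
    quantization B b (weilContr B ξ w) = ncWeilContr B ξ (quantization B b w) := by
  suffices h : quantization B b ∘ₗ weilContr B ξ = ncWeilContr B ξ ∘ₗ quantization B b from
    LinearMap.congr_fun h w
  refine weil_lhom_ext fun v n ω => ?_
  rw [LinearMap.comp_apply, LinearMap.comp_apply, weilContr_tmul, quantization_divPow,
    quantization_divPow, ← lineTensor_mul_contrConst, ← contrSeries_one B v, quantSeries_contrSeries,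
    contrSeries_one, lineTensor_apply, lineTensor_apply, map_sum]
  refine Finset.sum_congr rfl fun p _ => ?_
  rw [ncWeilContr_tmul, ← extToCl_extContr]
  congr 2
  exact congrArg (· ω) (PowerSeries.coeff_C_mul p.2 (quantSeries B v b) (B.extContr ξ))

theorem quantization_lie (ξ : 𝔤) (w : Weil 𝔤) :
    quantization B b (weilLie 𝔤 ξ w) = ncWeilLie B ξ (quantization B b w) := by
  have h := ncWeil_contr_d B b ξ (quantization B b w)
  change ncWeilContr B ξ _ + (ncWeil B b).d (ncWeilContr B ξ _) = ncWeilLie B ξ _ at h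
  rw [← weil_contr_d B b, map_add, quantization_contr, quantization_weilD, quantization_weilD,
    quantization_contr, h]

end ChainMap

/-! ### Surjectivity of symmetrization -/

section Surjective

variable {𝔤 : Type*} [LieRing 𝔤] [LieAlgebra ℝ 𝔤]

@[elab_as_elim]
theorem env_induction {p : UniversalEnvelopingAlgebra ℝ 𝔤 → Prop}
    (halg : ∀ r : ℝ, p (algebraMap ℝ _ r)) (hι : ∀ v, p (UniversalEnvelopingAlgebra.ι ℝ v))
    (hmul : ∀ x y, p x → p y → p (x * y)) (hadd : ∀ x y, p x → p y → p (x + y))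
    (x : UniversalEnvelopingAlgebra ℝ 𝔤) : p x := by
  obtain ⟨t, rfl⟩ : ∃ t, UniversalEnvelopingAlgebra.mkAlgHom ℝ 𝔤 t = x :=
    Quot.exists_rep x
  induction t using TensorAlgebra.induction with
  | algebraMap r => rw [AlgHom.commutes]; exact halg r
  | ι v => exact hι v
  | mul a c ha hc => rw [map_mul]; exact hmul _ _ ha hc
  | add a c ha hc => rw [map_add]; exact hadd _ _ ha hc

/-- The product in `U𝔤` of a list of elements of `𝔤`. -/
def envWord (l : List 𝔤) : UniversalEnvelopingAlgebra ℝ 𝔤 := (l.map (envι 𝔤)).prod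

theorem envWord_cons (v : 𝔤) (l : List 𝔤) : envWord (v :: l) = envι 𝔤 v * envWord l := by
  simp [envWord]

variable (𝔤) in
/-- The span of the products of less than `n` elements of `𝔤`. -/
def envFiltration (n : ℕ) : Submodule ℝ (UniversalEnvelopingAlgebra ℝ 𝔤) :=
  Submodule.span ℝ {x | ∃ l : List 𝔤, l.length < n ∧ envWord l = x}

theorem envWord_mem {l : List 𝔤} {n : ℕ} (h : l.length < n) : envWord l ∈ envFiltration 𝔤 n :=
  Submodule.subset_span ⟨l, h, rfl⟩

theorem envι_mul_mem (v : 𝔤) {n : ℕ} {x : UniversalEnvelopingAlgebra ℝ 𝔤}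
    (hx : x ∈ envFiltration 𝔤 n) : envι 𝔤 v * x ∈ envFiltration 𝔤 (n + 1) := by
  induction hx using Submodule.span_induction with
  | zero => rw [mul_zero]; exact zero_mem _
  | add x y _ _ hx hy => rw [mul_add]; exact add_mem hx hy
  | smul r x _ hx => rw [mul_smul_comm]; exact Submodule.smul_mem _ r hx
  | mem x hx =>
    obtain ⟨l, hl, rfl⟩ := hx
    rw [← envWord_cons]
    exact envWord_mem (by simpa using hl)

/-- Permuting the factors changes a product in `U𝔤` by shorter products only. -/
theorem envWord_perm {l l' : List 𝔤} (h : l.Perm l') :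
    envWord l - envWord l' ∈ envFiltration 𝔤 l.length := by
  induction h with
  | nil => rw [sub_self]; exact zero_mem _
  | cons v _ ih =>
    rw [envWord_cons, envWord_cons, ← mul_sub]
    exact envι_mul_mem v ih
  | swap v w l =>
    have : envWord (w :: v :: l) - envWord (v :: w :: l) = envWord (⁅w, v⁆ :: l) := by
      simp only [envWord_cons, ← mul_assoc, ← sub_mul]
      congr 1
      let _ : LieRing (UniversalEnvelopingAlgebra ℝ 𝔤) := LieRing.ofAssociativeRing
      exact (LieHom.map_lie (UniversalEnvelopingAlgebra.ι ℝ) w v).symm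
    rw [this]
    exact envWord_mem (by simp)
  | trans h1 _ ih1 ih2 =>
    rw [← sub_add_sub_cancel]
    exact add_mem ih1 (h1.length_eq ▸ ih2)

/-- A product of `n` elements of `𝔤` differs from its symmetrization by shorter products. -/
theorem envFiltration_le_range (n : ℕ) :
    envFiltration 𝔤 n ≤ LinearMap.range (symmetrization 𝔤) := by
  induction n with
  | zero => exact Submodule.span_le.2 (by rintro _ ⟨l, hl, -⟩; simp at hl)
  | succ n ih =>
    refine Submodule.span_le.2 ?_
    rintro _ ⟨l, hl, rfl⟩
    rcases Nat.lt_succ_iff_lt_or_eq.1 hl with hl | rfl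
    · exact ih (envWord_mem hl)
    · have h1 := symmetrize_prod (envι 𝔤) l.length l.get
      have h2 : envWord l - symmetrization 𝔤
          (List.ofFn fun i => SymmetricAlgebra.ι ℝ 𝔤 (l.get i)).prod ∈
          envFiltration 𝔤 l.length := by
        have h3 : envWord l = (l.length.factorial : ℝ)⁻¹ •
            ∑ _σ : Equiv.Perm (Fin l.length), envWord l := by
          rw [Finset.sum_const, Finset.card_univ, Fintype.card_perm, Fintype.card_fin,
            ← Nat.cast_smul_eq_nsmul ℝ, smul_smul, inv_mul_cancel₀ (by positivity), one_smul]
        rw [symmetrization, h1, h3, ← smul_sub, ← Finset.sum_sub_distrib]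
        refine Submodule.smul_mem _ _ (Submodule.sum_mem _ fun σ _ => ?_)
        have h4 : (List.ofFn fun i => envι 𝔤 (l.get (σ i))).prod =
            envWord (List.ofFn fun i => l.get (σ i)) := by
          rw [envWord, List.map_ofFn]
          rfl
        rw [h4]
        refine envWord_perm ?_
        have h5 := Equiv.Perm.ofFn_comp_perm σ l.get
        rw [List.ofFn_get] at h5
        exact h5.symm
      have h6 := add_mem (ih h2) (LinearMap.mem_range_self (symmetrization 𝔤)
        (List.ofFn fun i => SymmetricAlgebra.ι ℝ 𝔤 (l.get i)).prod)
      rwa [sub_add_cancel] at h6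

theorem symmetrization_surjective : Function.Surjective (symmetrization 𝔤) := by
  intro x
  have key : ∀ x y : UniversalEnvelopingAlgebra ℝ 𝔤, (∃ n, y ∈ envFiltration 𝔤 n) →
      ∃ n, x * y ∈ envFiltration 𝔤 n := by
    intro x
    induction x using env_induction with
    | halg r =>
      rintro y ⟨n, hy⟩
      exact ⟨n, by rw [← Algebra.smul_def]; exact Submodule.smul_mem _ _ hy⟩
    | hι v =>
      rintro y ⟨n, hy⟩
      exact ⟨n + 1, envι_mul_mem v hy⟩
    | hmul a c ha hc => intro y hy; rw [mul_assoc]; exact ha _ (hc _ hy)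
    | hadd a c ha hc =>
      intro y hy
      obtain ⟨m, hm⟩ := ha _ hy
      obtain ⟨n, hn⟩ := hc _ hy
      have hmono : ∀ i j, i ≤ j → envFiltration 𝔤 i ≤ envFiltration 𝔤 j := fun i j hij =>
        Submodule.span_mono fun z ⟨l, hl, h⟩ => ⟨l, hl.trans_le hij, h⟩
      exact ⟨max m n, by
        rw [add_mul]
        exact add_mem (hmono _ _ (le_max_left m n) hm) (hmono _ _ (le_max_right m n) hn)⟩
  obtain ⟨n, hn⟩ := key x 1 ⟨1, envWord_mem (l := []) (by simp)⟩
  rw [mul_one] at hn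
  exact envFiltration_le_range n hn

end Surjective

/-! ### The Maurer-Cartan form in exponential coordinates -/

section MaurerCartan

variable {ι : Type*} [Fintype ι] [DecidableEq ι] {𝔤 : Type*} [LieRing 𝔤] [LieAlgebra ℝ 𝔤]
  (b : Module.Basis ι ℝ 𝔤)

theorem degree_add_single (α : ι →₀ ℕ) (c : ι) : (α + Finsupp.single c 1).degree = α.degree + 1 := by
  simp

/-- The entries of the powers of `ad_x` are homogeneous polynomials. -/
theorem coeff_adMatrix_pow {k : ℕ} {α : ι →₀ ℕ} (h : α.degree ≠ k) (i j : ι) :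
    MvPowerSeries.coeff α ((adMatrix b ^ k) i j) = 0 := by
  induction k generalizing α j with
  | zero =>
    rw [pow_zero, Matrix.one_apply]
    split_ifs
    · rw [MvPowerSeries.coeff_one, if_neg]
      rintro rfl
      simp at h
    · simp
  | succ k ih =>
    rw [pow_succ, Matrix.mul_apply, map_sum]
    refine Finset.sum_eq_zero fun m _ => ?_
    rw [adMatrix, Matrix.of_apply, Finset.mul_sum, map_sum]
    refine Finset.sum_eq_zero fun c _ => ?_
    rw [← mul_assoc, MvPowerSeries.X, MvPowerSeries.coeff_mul_monomial]
    split_ifs with hc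
    · rw [MvPowerSeries.coeff_mul_C, mul_one]
      change MvPowerSeries.coeff _ ((adMatrix b ^ k) i m) * _ = 0
      rw [ih, zero_mul]
      intro h2
      apply h
      rw [← tsub_add_cancel_of_le hc, degree_add_single, h2]
    · rfl

theorem coeff_matrixSubst_adMatrix (p : PowerSeries ℝ) (i j : ι) (α : ι →₀ ℕ) :
    MvPowerSeries.coeff α (matrixSubst p (adMatrix b) i j) =
      PowerSeries.coeff α.degree p * MvPowerSeries.coeff α ((adMatrix b ^ α.degree) i j) := by
  change ∑ k ∈ Finset.range (α.degree + 1), _ = _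
  rw [Finset.sum_eq_single α.degree]
  · intro k _ hk
    rw [coeff_adMatrix_pow b hk.symm, mul_zero]
  · simp

/-- The Taylor series at `0` of `(1 - exp (-z)) / z`. -/
def psiSeries : PowerSeries ℝ := PowerSeries.mk fun n => (-1) ^ n / ((n + 1).factorial : ℝ)

/-- The matrix `ψ(ad_x)` of the left-invariant Maurer-Cartan form of the group of `𝔤` in exponential
coordinates, `ψ(z) = (1 - exp (-z)) / z`. -/
def mcMatrix : Matrix ι ι (MvPowerSeries ι ℝ) := matrixSubst psiSeries (adMatrix b)

/-- The recursion of the coefficients of `ψ`, which expresses `(z ψ)' = 1 - z ψ`, in matrix form. -/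
theorem coeff_mcMatrix_succ (i j : ι) (α : ι →₀ ℕ) (hα : α ≠ 0) :
    (α.degree + 1) * MvPowerSeries.coeff α (mcMatrix b i j) =
      -MvPowerSeries.coeff α ((adMatrix b * mcMatrix b) i j) := by
  obtain ⟨n, hn⟩ : ∃ n, α.degree = n + 1 :=
    Nat.exists_eq_succ_of_ne_zero fun h => hα ((Finsupp.degree_eq_zero_iff α).1 h)
  have h1 : MvPowerSeries.coeff α ((adMatrix b * mcMatrix b) i j) =
      PowerSeries.coeff n psiSeries * MvPowerSeries.coeff α ((adMatrix b ^ (n + 1)) i j) := by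
    rw [pow_succ', Matrix.mul_apply, Matrix.mul_apply, map_sum, map_sum, Finset.mul_sum]
    refine Finset.sum_congr rfl fun m _ => ?_
    rw [MvPowerSeries.coeff_mul, MvPowerSeries.coeff_mul, Finset.mul_sum]
    refine Finset.sum_congr rfl fun p hp => ?_
    rw [Finset.HasAntidiagonal.mem_antidiagonal] at hp
    by_cases h1 : p.1.degree = 1
    · have h2 : p.2.degree = n := by
        have := congrArg Finsupp.degree hp
        rw [map_add, h1, hn] at this
        omega
      rw [mcMatrix, coeff_matrixSubst_adMatrix, h2]
      ring
    · have h2 := coeff_adMatrix_pow b h1 i m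
      rw [pow_one] at h2
      rw [h2, zero_mul, zero_mul, mul_zero]
  rw [h1, mcMatrix, coeff_matrixSubst_adMatrix, hn, psiSeries, PowerSeries.coeff_mk,
    PowerSeries.coeff_mk, Nat.factorial_succ (n + 1)]
  push_cast
  have h2 : ((n + 1).factorial : ℝ) ≠ 0 := by positivity
  field_simp
  ring

theorem coeff_zero_mcMatrix (i j : ι) :
    MvPowerSeries.constantCoeff (mcMatrix b i j) = (1 : Matrix ι ι ℝ) i j := by
  rw [← MvPowerSeries.coeff_zero_eq_constantCoeff_apply, mcMatrix, coeff_matrixSubst_adMatrix]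
  simp [psiSeries, Matrix.one_apply]

/-- The Maurer-Cartan matrix is invertible, as its value at the origin is the identity. -/
theorem isUnit_det_mcMatrix : IsUnit (mcMatrix b).det := by
  rw [MvPowerSeries.isUnit_iff_constantCoeff, RingHom.map_det]
  have : (MvPowerSeries.constantCoeff (R := ℝ)).mapMatrix (mcMatrix b) = 1 := by
    ext i j
    exact coeff_zero_mcMatrix b i j
  rw [this, Matrix.det_one]
  exact isUnit_one

end MaurerCartan

section MaurerCartan

variable {ι : Type*} [Fintype ι] [DecidableEq ι] {𝔤 : Type*} [LieRing 𝔤] [LieAlgebra ℝ 𝔤]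
  (b : Module.Basis ι ℝ 𝔤)

/-- The Lie algebra of formal power series with values in `𝔤`. -/
abbrev LieSeries (ι 𝔤 : Type*) [LieRing 𝔤] [LieAlgebra ℝ 𝔤] : Type _ := MvPowerSeries ι ℝ ⊗[ℝ] 𝔤

/-- The coordinates of a `𝔤`-valued power series. -/
def lieCoord (k : ι) : LieSeries ι 𝔤 →ₗ[ℝ] MvPowerSeries ι ℝ :=
  (TensorProduct.rid ℝ (MvPowerSeries ι ℝ)).toLinearMap ∘ₗ LinearMap.lTensor _ (b.coord k)

theorem lieCoord_tmul (k : ι) (f : MvPowerSeries ι ℝ) (v : 𝔤) :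
    lieCoord b k (f ⊗ₜ v) = b.repr v k • f := by
  simp [lieCoord]

theorem sum_lieCoord (u : LieSeries ι 𝔤) : ∑ k, lieCoord b k u ⊗ₜ b k = u := by
  induction u using TensorProduct.induction_on with
  | zero => simp
  | add u v hu hv =>
    conv_rhs => rw [← hu, ← hv]
    rw [← Finset.sum_add_distrib]
    simp [TensorProduct.add_tmul]
  | tmul f v =>
    conv_rhs => rw [← b.sum_repr v, TensorProduct.tmul_sum]
    simp [lieCoord_tmul, TensorProduct.smul_tmul]

theorem lieSeries_ext {u v : LieSeries ι 𝔤} (h : ∀ k, lieCoord b k u = lieCoord b k v) : u = v := by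
  rw [← sum_lieCoord b u, ← sum_lieCoord b v]
  simp [h]

theorem lieCoord_smul (k : ι) (f : MvPowerSeries ι ℝ) (u : LieSeries ι 𝔤) :
    lieCoord b k (f • u) = f * lieCoord b k u := by
  induction u using TensorProduct.induction_on with
  | zero => simp
  | add u v hu hv => rw [smul_add, map_add, hu, hv, map_add, mul_add]
  | tmul g v => rw [TensorProduct.smul_tmul', lieCoord_tmul, lieCoord_tmul, smul_eq_mul, mul_smul_comm]

/-- The coefficientwise extension of a derivation to `𝔤`-valued power series. -/
def lieDer (δ : Derivation ℝ (MvPowerSeries ι ℝ) (MvPowerSeries ι ℝ)) :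
    LieSeries ι 𝔤 →ₗ[ℝ] LieSeries ι 𝔤 := LinearMap.rTensor 𝔤 δ.toLinearMap

variable (δ : Derivation ℝ (MvPowerSeries ι ℝ) (MvPowerSeries ι ℝ))

theorem lieDer_tmul (f : MvPowerSeries ι ℝ) (v : 𝔤) : lieDer δ (f ⊗ₜ[ℝ] v) = δ f ⊗ₜ v := rfl

theorem lieDer_one_tmul (v : 𝔤) : lieDer δ (1 ⊗ₜ[ℝ] v) = 0 := by
  rw [lieDer_tmul, Derivation.map_one_eq_zero, TensorProduct.zero_tmul]

theorem lieCoord_lieDer (k : ι) (u : LieSeries ι 𝔤) :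
    lieCoord b k (lieDer δ u) = δ (lieCoord b k u) := by
  induction u using TensorProduct.induction_on with
  | zero => simp
  | add u v hu hv => simp only [map_add, hu, hv]
  | tmul f v => rw [lieDer_tmul, lieCoord_tmul, lieCoord_tmul, Derivation.map_smul]

theorem lieDer_smul (f : MvPowerSeries ι ℝ) (u : LieSeries ι 𝔤) :
    lieDer δ (f • u) = δ f • u + f • lieDer δ u := by
  induction u using TensorProduct.induction_on with
  | zero => simp
  | add u v hu hv =>
    simp only [smul_add, map_add, hu, hv]
    abel
  | tmul g v =>
    rw [TensorProduct.smul_tmul', lieDer_tmul, lieDer_tmul, smul_eq_mul, Derivation.leibniz,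
      TensorProduct.smul_tmul', TensorProduct.smul_tmul', ← TensorProduct.add_tmul, smul_eq_mul,
      smul_eq_mul]
    congr 1
    simp only [smul_eq_mul]
    ring

/-- The bracket of `𝔤`-valued power series, as a bilinear map. -/
def serBracket :
    LieSeries ι 𝔤 →ₗ[MvPowerSeries ι ℝ] LieSeries ι 𝔤 →ₗ[MvPowerSeries ι ℝ] LieSeries ι 𝔤 :=
  LinearMap.mk₂ _ (fun u v => ⁅u, v⁆) (fun u v w => add_lie u v w) (fun f u v => smul_lie f u v)
    (fun u v w => lie_add u v w) (fun f u v => lie_smul f u v)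

theorem serBracket_tmul (f g : MvPowerSeries ι ℝ) (v w : 𝔤) :
    serBracket (f ⊗ₜ[ℝ] v) (g ⊗ₜ w) = (f * g) ⊗ₜ ⁅v, w⁆ := rfl

theorem serBracket_skew (u v : LieSeries ι 𝔤) : serBracket u v = -serBracket v u :=
  (lie_skew u v).symm

theorem serBracket_jacobi (u v w : LieSeries ι 𝔤) : serBracket u (serBracket v w) =
    serBracket (serBracket u v) w + serBracket v (serBracket u w) := LieRing.leibniz_lie u v w

theorem lieDer_lie (u v : LieSeries ι 𝔤) : lieDer δ (serBracket u v) =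
    serBracket (lieDer δ u) v + serBracket u (lieDer δ v) := by
  induction u using TensorProduct.induction_on with
  | zero => simp
  | add u u' hu hu' =>
    simp only [LinearMap.add_apply, map_add, hu, hu']
    abel
  | tmul f x =>
    induction v using TensorProduct.induction_on with
    | zero => simp
    | add v v' hv hv' =>
      simp only [map_add, hv, hv']
      abel
    | tmul g y =>
      simp only [serBracket_tmul, lieDer_tmul]
      rw [← TensorProduct.add_tmul, Derivation.leibniz, smul_eq_mul, smul_eq_mul, add_comm,
        mul_comm g]

/-- The generic element `x = ∑_c x_c e_c`. -/
def genericElement : LieSeries ι 𝔤 := ∑ c, MvPowerSeries.X c ⊗ₜ b c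

theorem lieCoord_generic_lie (k : ι) (u : LieSeries ι 𝔤) :
    lieCoord b k (serBracket (genericElement b) u) = ∑ i, adMatrix b k i * lieCoord b i u := by
  conv_lhs => rw [← sum_lieCoord b u]
  rw [genericElement]
  simp only [map_sum, LinearMap.sum_apply, serBracket_tmul, lieCoord_tmul]
  refine Finset.sum_congr rfl fun i _ => ?_
  rw [adMatrix, Matrix.of_apply, Finset.sum_mul]
  refine Finset.sum_congr rfl fun c _ => ?_
  rw [MvPowerSeries.smul_eq_C_mul]
  ring

theorem pderiv_comm (a c : ι) (f : MvPowerSeries ι ℝ) :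
    MvPowerSeries.pderiv ℝ a (MvPowerSeries.pderiv ℝ c f) =
      MvPowerSeries.pderiv ℝ c (MvPowerSeries.pderiv ℝ a f) := by
  ext α
  simp only [MvPowerSeries.coeff_pderiv, add_right_comm α (Finsupp.single a 1)]
  rcases eq_or_ne a c with rfl | h
  · rfl
  · simp only [Finsupp.add_apply, Finsupp.single_eq_of_ne h, Finsupp.single_eq_of_ne h.symm,
      add_zero]
    ring

/-- The Euler derivation `∑_c x_c ∂_c`. -/
def mvEuler : Derivation ℝ (MvPowerSeries ι ℝ) (MvPowerSeries ι ℝ) :=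
  ∑ c, (MvPowerSeries.X c : MvPowerSeries ι ℝ) • MvPowerSeries.pderiv ℝ c

theorem sum_smul_der_apply (h : ι → MvPowerSeries ι ℝ) (f : MvPowerSeries ι ℝ) :
    (∑ c, h c • MvPowerSeries.pderiv ℝ c : Derivation ℝ _ _) f =
      ∑ c, h c * MvPowerSeries.pderiv ℝ c f := by
  rw [← Derivation.coeFnAddMonoidHom_apply, map_sum, Finset.sum_apply]
  rfl

theorem coeff_mvEuler (α : ι →₀ ℕ) (f : MvPowerSeries ι ℝ) :
    MvPowerSeries.coeff α (mvEuler f) = α.degree * MvPowerSeries.coeff α f := by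
  rw [mvEuler, sum_smul_der_apply, map_sum, Finsupp.degree_eq_sum, Nat.cast_sum, Finset.sum_mul]
  refine Finset.sum_congr rfl fun c _ => ?_
  rw [mul_comm, MvPowerSeries.X, MvPowerSeries.coeff_mul_monomial]
  split_ifs with h
  · rw [MvPowerSeries.coeff_pderiv, tsub_add_cancel_of_le h, mul_one, mul_comm]
    congr 1
    rw [Finsupp.single_le_iff] at h
    rw [Finsupp.tsub_apply, Finsupp.single_eq_same]
    push_cast [h]
    ring
  · rw [Finsupp.single_le_iff] at h
    have : α c = 0 := by omega
    simp [this]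

theorem mvEuler_pderiv (c : ι) (f : MvPowerSeries ι ℝ) :
    mvEuler (MvPowerSeries.pderiv ℝ c f) =
      MvPowerSeries.pderiv ℝ c (mvEuler f) - MvPowerSeries.pderiv ℝ c f := by
  ext α
  rw [map_sub, coeff_mvEuler, MvPowerSeries.coeff_pderiv, MvPowerSeries.coeff_pderiv, coeff_mvEuler,
    degree_add_single]
  push_cast
  ring

/-- An equation `(E + 2) u = -[x, u]` determines the coefficients of `u` recursively. -/
theorem eq_zero_of_euler (u : LieSeries ι 𝔤)
    (h : lieDer mvEuler u + (2 : ℝ) • u = -serBracket (genericElement b) u) : u = 0 := by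
  refine lieSeries_ext b fun k => ?_
  rw [map_zero]
  ext α
  rw [map_zero]
  induction hn : α.degree using Nat.strong_induction_on generalizing α k with
  | _ n ih =>
    have h1 := congrArg (fun u => MvPowerSeries.coeff α (lieCoord b k u)) h
    simp only [map_add, map_neg, map_smul, lieCoord_lieDer, coeff_mvEuler, lieCoord_generic_lie,
      map_sum, smul_eq_mul] at h1
    have h2 : ∑ i, MvPowerSeries.coeff α (adMatrix b k i * lieCoord b i u) = 0 := by
      refine Finset.sum_eq_zero fun i _ => ?_
      rw [MvPowerSeries.coeff_mul]
      refine Finset.sum_eq_zero fun p hp => ?_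
      rw [Finset.HasAntidiagonal.mem_antidiagonal] at hp
      have h3 := congrArg Finsupp.degree hp
      rw [map_add] at h3
      by_cases h1 : p.1.degree = 1
      · rw [ih p.2.degree (by omega) i p.2 rfl, mul_zero]
      · have h2 := coeff_adMatrix_pow b h1 k i
        rw [pow_one] at h2
        rw [h2, zero_mul]
    rw [h2, neg_zero, ← add_mul] at h1
    exact (mul_eq_zero.1 h1).resolve_left (by positivity)

/-- The components of the Maurer-Cartan form. -/
def mcForm (c : ι) : LieSeries ι 𝔤 := ∑ i, mcMatrix b i c ⊗ₜ b i

theorem lieCoord_mcForm (k c : ι) : lieCoord b k (mcForm b c) = mcMatrix b k c := by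
  rw [mcForm, map_sum, Finset.sum_eq_single k]
  · simp [lieCoord_tmul]
  · intro i _ hi
    simp [lieCoord_tmul, Finsupp.single_eq_of_ne hi.symm]
  · simp

/-- The radial differential equation of the Maurer-Cartan form, from `(z ψ)' = 1 - z ψ`. -/
theorem mcForm_euler (c : ι) : lieDer mvEuler (mcForm b c) =
    1 ⊗ₜ b c - serBracket (genericElement b) (mcForm b c) - mcForm b c := by
  refine lieSeries_ext b fun k => ?_
  simp only [map_sub, lieCoord_lieDer, lieCoord_mcForm, lieCoord_generic_lie, lieCoord_tmul]
  have h1 : ∑ i, adMatrix b k i * mcMatrix b i c = (adMatrix b * mcMatrix b) k c := rfl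
  rw [h1]
  ext α
  simp only [map_sub, coeff_mvEuler, map_smul, smul_eq_mul]
  by_cases hα : α = 0
  · subst hα
    have h2 : MvPowerSeries.coeff 0 ((adMatrix b * mcMatrix b) k c) = 0 := by
      rw [Matrix.mul_apply, map_sum]
      refine Finset.sum_eq_zero fun i _ => ?_
      have h2 := coeff_adMatrix_pow b (k := 1) (α := 0) (by simp) k i
      rw [pow_one] at h2
      rw [MvPowerSeries.coeff_zero_eq_constantCoeff_apply] at h2 ⊢
      rw [map_mul, h2, zero_mul]
    rw [h2, MvPowerSeries.coeff_zero_eq_constantCoeff_apply, coeff_zero_mcMatrix,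
      Matrix.one_apply]
    simp [Finsupp.single_apply, eq_comm]
  · rw [MvPowerSeries.coeff_one, if_neg hα]
    linear_combination coeff_mcMatrix_succ b k c α hα

/-- The Maurer-Cartan equation. By `mcForm_euler` the left-hand side satisfies the equation of
`eq_zero_of_euler`. -/
theorem mcForm_flat (a c : ι) : lieDer (MvPowerSeries.pderiv ℝ a) (mcForm b c) -
    lieDer (MvPowerSeries.pderiv ℝ c) (mcForm b a) + serBracket (mcForm b a) (mcForm b c) = 0 := by
  refine eq_zero_of_euler b _ ?_
  have hE : ∀ (c : ι) (u : LieSeries ι 𝔤), lieDer mvEuler (lieDer (MvPowerSeries.pderiv ℝ c) u) =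
      lieDer (MvPowerSeries.pderiv ℝ c) (lieDer mvEuler u) -
        lieDer (MvPowerSeries.pderiv ℝ c) u := fun c u => lieSeries_ext b fun k => by
    simp only [map_sub, lieCoord_lieDer, mvEuler_pderiv]
  have hx : ∀ c : ι, lieDer (MvPowerSeries.pderiv ℝ c) (genericElement b) = 1 ⊗ₜ b c := fun c => by
    rw [genericElement, map_sum, Finset.sum_eq_single c]
    · rw [lieDer_tmul, MvPowerSeries.pderiv_X_self]
    · intro i _ hi
      rw [lieDer_tmul, MvPowerSeries.pderiv_X_of_ne hi, TensorProduct.zero_tmul]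
    · simp
  simp only [map_add, map_sub, hE, mcForm_euler, lieDer_lie, hx, lieDer_one_tmul,
    LinearMap.sub_apply, serBracket_jacobi (genericElement b)]
  -- The brackets `[e_a, ω_c]` from the derivative `∂_a [x, ω_c]` cancel those from the radial derivative
  -- of `[ω_a, ω_c]`.
  rw [serBracket_skew (1 ⊗ₜ[ℝ] b c) (mcForm b a)]
  simp only [two_smul]
  abel

/-- The vector with components `ω⁻¹ v`: the coefficients of the left-invariant vector field. -/
def fieldCoeff (v : 𝔤) (c : ι) : MvPowerSeries ι ℝ :=
  ((mcMatrix b)⁻¹.mulVec fun i => MvPowerSeries.C (b.repr v i)) c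

theorem sum_smul_mcForm_injective {h h' : ι → MvPowerSeries ι ℝ}
    (e : ∑ c, h c • mcForm b c = ∑ c, h' c • mcForm b c) : h = h' := by
  have h1 : (mcMatrix b).mulVec h = (mcMatrix b).mulVec h' := by
    ext1 k
    have := congrArg (lieCoord b k) e
    simpa only [map_sum, lieCoord_smul, lieCoord_mcForm, Matrix.mulVec, dotProduct, mul_comm]
      using this
  have h2 := congrArg ((mcMatrix b)⁻¹.mulVec) h1
  rwa [Matrix.mulVec_mulVec, Matrix.mulVec_mulVec, Matrix.nonsing_inv_mul _ (isUnit_det_mcMatrix b),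
    Matrix.one_mulVec, Matrix.one_mulVec] at h2

theorem mcMatrix_mulVec_fieldCoeff (v : 𝔤) :
    (mcMatrix b).mulVec (fieldCoeff b v) = fun i => MvPowerSeries.C (b.repr v i) := by
  have : fieldCoeff b v = (mcMatrix b)⁻¹.mulVec fun i => MvPowerSeries.C (b.repr v i) := rfl
  rw [this, Matrix.mulVec_mulVec, Matrix.mul_nonsing_inv _ (isUnit_det_mcMatrix b),
    Matrix.one_mulVec]

theorem sum_fieldCoeff_smul (v : 𝔤) : ∑ c, fieldCoeff b v c • mcForm b c = 1 ⊗ₜ v := by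
  refine lieSeries_ext b fun k => ?_
  have := congrFun (mcMatrix_mulVec_fieldCoeff b v) k
  rw [lieCoord_tmul, MvPowerSeries.smul_eq_C_mul, mul_one, ← this]
  simp only [map_sum, lieCoord_smul, lieCoord_mcForm, Matrix.mulVec, dotProduct, mul_comm]

/-- The left-invariant vector field `X_v` in exponential coordinates, as a derivation of the formal
power series. -/
def leftField (v : 𝔤) : Derivation ℝ (MvPowerSeries ι ℝ) (MvPowerSeries ι ℝ) :=
  ∑ c, fieldCoeff b v c • MvPowerSeries.pderiv ℝ c

theorem leftField_apply (v : 𝔤) (f : MvPowerSeries ι ℝ) :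
    leftField b v f = ∑ c, fieldCoeff b v c * MvPowerSeries.pderiv ℝ c f :=
  sum_smul_der_apply _ _

theorem lieDer_leftField (v : 𝔤) (u : LieSeries ι 𝔤) : lieDer (leftField b v) u =
    ∑ c, fieldCoeff b v c • lieDer (MvPowerSeries.pderiv ℝ c) u := by
  refine lieSeries_ext b fun k => ?_
  simp only [map_sum, lieCoord_smul, lieCoord_lieDer, leftField_apply]

theorem bilin_sum_smul {R M : Type*} [CommRing R] [AddCommGroup M] [Module R M]
    (β : M →ₗ[R] M →ₗ[R] M) (x y : ι → R) (m : ι → M) (T : ι → ι → M)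
    (h : ∀ a c, β (m a) (m c) = T c a - T a c) :
    -∑ c, ∑ a, (x a * y c) • T a c = -∑ c, ∑ a, (y a * x c) • T a c +
      β (∑ a, x a • m a) (∑ c, y c • m c) := by
  simp only [map_sum, LinearMap.sum_apply, map_smul, LinearMap.smul_apply, h,
    Finset.sum_sub_distrib, smul_sub, Finset.smul_sum, smul_smul]
  rw [Finset.sum_comm (f := fun c a => (y a * x c) • T a c)]
  simp only [mul_comm (y _) (x _)]
  abel

/-- The bracket of left-invariant vector fields, from the Maurer-Cartan equation. -/
theorem fieldCoeff_lie (v w : 𝔤) (c : ι) : leftField b v (fieldCoeff b w c) =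
    leftField b w (fieldCoeff b v c) + fieldCoeff b ⁅v, w⁆ c := by
  have h0 : ∀ v w : 𝔤, ∑ c, leftField b v (fieldCoeff b w c) • mcForm b c =
      -∑ c, ∑ a, (fieldCoeff b v a * fieldCoeff b w c) •
        lieDer (MvPowerSeries.pderiv ℝ a) (mcForm b c) := fun v w => by
    have h1 := congrArg (lieDer (leftField b v)) (sum_fieldCoeff_smul b w)
    simp only [lieDer_one_tmul, map_sum, lieDer_smul, Finset.sum_add_distrib] at h1
    rw [add_eq_zero_iff_eq_neg] at h1
    rw [h1]
    congr 1
    refine Finset.sum_congr rfl fun c _ => ?_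
    rw [lieDer_leftField, Finset.smul_sum]
    refine Finset.sum_congr rfl fun a _ => ?_
    rw [smul_smul, mul_comm]
  have h1 : ∑ c, leftField b v (fieldCoeff b w c) • mcForm b c =
      ∑ c, (leftField b w (fieldCoeff b v c) + fieldCoeff b ⁅v, w⁆ c) • mcForm b c := by
    have h2 : (1 ⊗ₜ ⁅v, w⁆ : LieSeries ι 𝔤) =
        serBracket (1 ⊗ₜ v) (1 ⊗ₜ w) := by
      rw [serBracket_tmul, mul_one]
    have h3 : ∀ a c, serBracket (mcForm b a) (mcForm b c) = lieDer (MvPowerSeries.pderiv ℝ c) (mcForm b a) -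
        lieDer (MvPowerSeries.pderiv ℝ a) (mcForm b c) := fun a c => by
      have := mcForm_flat b a c
      rw [← sub_eq_zero, ← this]
      abel
    simp only [add_smul, Finset.sum_add_distrib]
    rw [sum_fieldCoeff_smul, h2, ← sum_fieldCoeff_smul b v, ← sum_fieldCoeff_smul b w, h0, h0]
    exact bilin_sum_smul serBracket _ _ _ _ h3
  exact congrFun (sum_smul_mcForm_injective b h1) c

theorem leftField_lie (v w : 𝔤) (f : MvPowerSeries ι ℝ) :
    leftField b ⁅v, w⁆ f = leftField b v (leftField b w f) - leftField b w (leftField b v f) := by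
  have h1 : ∀ v w : 𝔤, leftField b v (leftField b w f) =
      ∑ c, leftField b v (fieldCoeff b w c) * MvPowerSeries.pderiv ℝ c f +
      ∑ c, ∑ a, fieldCoeff b w c * fieldCoeff b v a *
        MvPowerSeries.pderiv ℝ a (MvPowerSeries.pderiv ℝ c f) := fun v w => by
    rw [leftField_apply b w, map_sum, ← Finset.sum_add_distrib]
    refine Finset.sum_congr rfl fun c _ => ?_
    rw [Derivation.leibniz, smul_eq_mul, smul_eq_mul, leftField_apply b v (MvPowerSeries.pderiv ℝ c f),
      Finset.mul_sum, add_comm, mul_comm (MvPowerSeries.pderiv ℝ c f)]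
    simp only [mul_assoc]
  have h2 : ∑ c, ∑ a, fieldCoeff b w c * fieldCoeff b v a *
        MvPowerSeries.pderiv ℝ a (MvPowerSeries.pderiv ℝ c f) =
      ∑ c, ∑ a, fieldCoeff b v c * fieldCoeff b w a *
        MvPowerSeries.pderiv ℝ a (MvPowerSeries.pderiv ℝ c f) := by
    rw [Finset.sum_comm]
    refine Finset.sum_congr rfl fun c _ => Finset.sum_congr rfl fun a _ => ?_
    rw [pderiv_comm, mul_comm (fieldCoeff b w a)]
  rw [h1 v w, h1 w v, h2, add_sub_add_right_eq_sub, leftField_apply, eq_sub_iff_add_eq',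
    ← Finset.sum_add_distrib]
  refine Finset.sum_congr rfl fun c _ => ?_
  rw [fieldCoeff_lie b v w, add_mul]

theorem fieldCoeff_add (v w : 𝔤) (c : ι) :
    fieldCoeff b (v + w) c = fieldCoeff b v c + fieldCoeff b w c := by
  simp [fieldCoeff, Matrix.mulVec, dotProduct, mul_add, Finset.sum_add_distrib]

theorem fieldCoeff_smul (r : ℝ) (v : 𝔤) (c : ι) : fieldCoeff b (r • v) c = r • fieldCoeff b v c := by
  simp [fieldCoeff, Matrix.mulVec, dotProduct, Finset.smul_sum, MvPowerSeries.smul_eq_C_mul]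
  exact Finset.sum_congr rfl fun i _ => by ring

/-- The representation of `U𝔤` on formal power series by left-invariant differential operators. -/
def envRep : UniversalEnvelopingAlgebra ℝ 𝔤 →ₐ[ℝ] Module.End ℝ (MvPowerSeries ι ℝ) :=
  letI : LieRing (Module.End ℝ (MvPowerSeries ι ℝ)) := LieRing.ofAssociativeRing
  UniversalEnvelopingAlgebra.lift ℝ
    { toFun := fun v => (leftField b v).toLinearMap
      map_add' := fun v w => LinearMap.ext fun f => by
        change leftField b (v + w) f = leftField b v f + leftField b w f
        simp only [leftField_apply, fieldCoeff_add, add_mul, Finset.sum_add_distrib]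
      map_smul' := fun r v => LinearMap.ext fun f => by
        change leftField b (r • v) f = r • leftField b v f
        simp only [leftField_apply, fieldCoeff_smul, smul_mul_assoc, Finset.smul_sum]
      map_lie' := fun {v w} => LinearMap.ext fun f => leftField_lie b v w f }

theorem envRep_ι (v : 𝔤) (f : MvPowerSeries ι ℝ) :
    envRep b (UniversalEnvelopingAlgebra.ι ℝ v) f = leftField b v f := by
  rw [envRep, UniversalEnvelopingAlgebra.lift_ι_apply]
  rfl

end MaurerCartan

/-! ### Injectivity of symmetrization -/

section Injective

variable {ι : Type*} [Fintype ι] [DecidableEq ι] {𝔤 : Type*} [LieRing 𝔤] [LieAlgebra ℝ 𝔤]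
  (b : Module.Basis ι ℝ 𝔤)

/-- On the line through `v`, the left-invariant field `X_v` is the constant vector `v`, since
`ψ(t ad_v) v = v`. -/
theorem lineEval_fieldCoeff (v : 𝔤) (c : ι) :
    lineEval (b.repr v) (fieldCoeff b v c) = PowerSeries.C (b.repr v c) := by
  have h1 : ((mcMatrix b).map (lineEval (b.repr v))).mulVec
      (fun c => lineEval (b.repr v) (fieldCoeff b v c)) = fun i => PowerSeries.C (b.repr v i) := by
    ext1 i
    have := congrArg (lineEval (b.repr v)) (congrFun (mcMatrix_mulVec_fieldCoeff b v) i)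
    rw [lineEval_C] at this
    rw [← this]
    simp [Matrix.mulVec, dotProduct]
  have h2 : ((mcMatrix b).map (lineEval (b.repr v))).mulVec
      (fun c => PowerSeries.C (b.repr v c)) = fun i => PowerSeries.C (b.repr v i) := by
    ext i k
    rw [mcMatrix, lineEval_matrixSubst, Matrix.mulVec, dotProduct, map_sum]
    simp only [adSubst, Matrix.of_apply, PowerSeries.coeff_mul_C, PowerSeries.coeff_mk, mul_assoc]
    rw [← Finset.mul_sum, PowerSeries.coeff_C]
    have h3 : ∑ c, LinearMap.toMatrix b b (LieAlgebra.ad ℝ 𝔤 v ^ k) i c * b.repr v c =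
        b.repr ((LieAlgebra.ad ℝ 𝔤 v ^ k) v) i :=
      congrFun (LinearMap.toMatrix_mulVec_repr b b (LieAlgebra.ad ℝ 𝔤 v ^ k) v) i
    rw [h3]
    rcases k with - | k
    · simp [psiSeries]
    · rw [pow_succ, Module.End.mul_apply, LieAlgebra.ad_apply, lie_self, map_zero, map_zero]
      simp
  have h3 : IsUnit ((mcMatrix b).map (lineEval (b.repr v))).det := by
    have := (isUnit_det_mcMatrix b).map (lineEval (b.repr v))
    rwa [RingHom.map_det] at this
  have h4 := congrArg (((mcMatrix b).map (lineEval (b.repr v)))⁻¹.mulVec) (h1.trans h2.symm)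
  rw [Matrix.mulVec_mulVec, Matrix.mulVec_mulVec, Matrix.nonsing_inv_mul _ h3, Matrix.one_mulVec,
    Matrix.one_mulVec] at h4
  exact congrFun h4 c

/-- The chain rule along a line through the origin. -/
theorem sum_lineEval_pderiv (x : ι → ℝ) (f : MvPowerSeries ι ℝ) :
    ∑ c, PowerSeries.C (x c) * lineEval x (MvPowerSeries.pderiv ℝ c f) =
      PowerSeries.derivative ℝ (lineEval x f) := by
  ext n
  rw [PowerSeries.coeff_derivative, coeff_lineEval, Finset.sum_mul, map_sum]
  simp only [PowerSeries.coeff_C_mul, coeff_lineEval, MvPowerSeries.coeff_pderiv, Finset.mul_sum,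
    smul_eq_mul]
  have h : ∀ α ∈ degreeSet ι (n + 1), monomialValue x α * MvPowerSeries.coeff α f * (n + 1) =
      ∑ c, monomialValue x α * MvPowerSeries.coeff α f * α c := fun α hα => by
    rw [mem_degreeSet, Finsupp.degree_eq_sum] at hα
    rw [← Finset.mul_sum, ← Nat.cast_sum, hα]
    push_cast
    rfl
  rw [Finset.sum_congr rfl h, Finset.sum_comm (s := degreeSet ι (n + 1))]
  refine Finset.sum_congr rfl fun c _ => ?_
  refine Finset.sum_of_injOn (fun α => α + Finsupp.single c 1) (fun α _ β _ h => add_right_cancel h)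
    (fun α hα => ?_) (fun β hβ h0 => ?_) fun α _ => ?_
  · rw [Finset.mem_coe, mem_degreeSet] at hα ⊢
    rw [degree_add_single, hα]
  · have : β c = 0 := by
      by_contra hc
      refine h0 ⟨β - Finsupp.single c 1, ?_, ?_⟩
      · have h1 : Finsupp.single c 1 ≤ β := Finsupp.single_le_iff.2 (by omega)
        rw [mem_degreeSet, ← tsub_add_cancel_of_le h1, degree_add_single] at hβ
        rw [Finset.mem_coe, mem_degreeSet]
        omega
      · exact tsub_add_cancel_of_le (Finsupp.single_le_iff.2 (by omega))
    rw [this]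
    simp
  · rw [monomialValue_add, monomialValue_single]
    simp
    ring

/-- The line through `v` is an integral curve of `X_v`. -/
theorem lineEval_leftField (v : 𝔤) (f : MvPowerSeries ι ℝ) :
    lineEval (b.repr v) (leftField b v f) =
      PowerSeries.derivative ℝ (lineEval (b.repr v) f) := by
  rw [leftField_apply, map_sum, ← sum_lineEval_pderiv]
  exact Finset.sum_congr rfl fun c _ => by rw [map_mul, lineEval_fieldCoeff]

/-- The value of `X_v ^ n f` at the origin is the `n`-th derivative of `f` along the line through `v`. -/
theorem constantCoeff_envRep_pow (v : 𝔤) (n : ℕ) (f : MvPowerSeries ι ℝ) :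
    MvPowerSeries.constantCoeff (envRep b (UniversalEnvelopingAlgebra.ι ℝ v ^ n) f) =
      n.factorial * PowerSeries.coeff n (lineEval (b.repr v) f) := by
  induction n generalizing f with
  | zero => simp [coeff_zero_lineEval]
  | succ n ih =>
    rw [pow_succ, map_mul, Module.End.mul_apply, envRep_ι, ih, lineEval_leftField,
      PowerSeries.coeff_derivative, Nat.factorial_succ]
    push_cast
    ring

/-- The pairing of the symmetrization of a polynomial `p` with the functions `x^β` returns the
coefficients of `p`, up to factorials. -/
theorem constantCoeff_envRep_symmetrization (β : ι →₀ ℕ) (s : SymmetricAlgebra ℝ 𝔤) :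
    MvPowerSeries.constantCoeff (envRep b (symmetrization 𝔤 s) (MvPowerSeries.monomial β 1)) =
      MvPolynomial.constantCoeff (SymmetricAlgebra.equivMvPolynomial b (symPartial b β s)) := by
  have h : (MvPowerSeries.coeff (R := ℝ) (0 : ι →₀ ℕ)) ∘ₗ
        LinearMap.applyₗ (MvPowerSeries.monomial β (1 : ℝ)) ∘ₗ
          (envRep b).toLinearMap ∘ₗ symmetrization 𝔤 =
      (MvPolynomial.lcoeff ℝ (0 : ι →₀ ℕ)) ∘ₗ
        (SymmetricAlgebra.equivMvPolynomial b).toLinearMap ∘ₗ symPartial b β := by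
    refine sym_lhom_ext fun v n => ?_
    change MvPowerSeries.constantCoeff (envRep b (symmetrization 𝔤 (divPow v n))
      (MvPowerSeries.monomial β 1)) = MvPolynomial.coeff 0
        (SymmetricAlgebra.equivMvPolynomial b (symPartial b β (divPow v n)))
    rw [symmetrization_divPow, map_smul, LinearMap.smul_apply,
      ← MvPowerSeries.coeff_zero_eq_constantCoeff_apply, map_smul,
      MvPowerSeries.coeff_zero_eq_constantCoeff_apply, constantCoeff_envRep_pow, smul_eq_mul,
      inv_mul_cancel_left₀ (by positivity), symPartial_divPow, coeff_lineEval]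
    simp only [MvPowerSeries.coeff_monomial, smul_eq_mul, mul_ite, mul_one, mul_zero,
      Finset.sum_ite_eq', mem_degreeSet]
    rcases lt_trichotomy β.degree n with h | h | h
    · rw [if_neg h.ne, if_pos h.le, divPow, map_smul, map_smul, map_pow, MvPolynomial.coeff_smul,
        MvPolynomial.coeff_smul, ← MvPolynomial.constantCoeff_eq, map_pow, equivMvPolynomial_ι]
      simp [MvPolynomial.smul_eq_C_mul, (Nat.sub_pos_of_lt h).ne']
    · rw [if_pos h, if_pos h.le, h, Nat.sub_self, divPow_zero, map_smul, map_one,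
        MvPolynomial.coeff_smul]
      simp
    · rw [if_neg h.ne', if_neg (not_le.2 h)]
      simp
  exact LinearMap.congr_fun h s

/-- Injectivity of symmetrization: a polynomial in the kernel has zero pairing with all monomials. This
is the independence part of the Poincaré-Birkhoff-Witt theorem. -/
theorem symmetrization_injective [FiniteDimensional ℝ 𝔤] :
    Function.Injective (symmetrization 𝔤) := by
  classical
  let b := Module.finBasis ℝ 𝔤
  rw [← LinearMap.ker_eq_bot, LinearMap.ker_eq_bot']
  intro s hs
  refine (SymmetricAlgebra.equivMvPolynomial b).injective ?_
  rw [map_zero]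
  ext β
  have h := constantCoeff_envRep_symmetrization b β s
  rw [hs, map_zero, LinearMap.zero_apply, map_zero] at h
  have h2 : ∀ p : MvPolynomial _ ℝ, MvPolynomial.constantCoeff (polyPartial β p) =
      (∏ a, ((β a).factorial : ℝ)) * MvPolynomial.coeff β p := fun p => by
    induction p using MvPolynomial.induction_on' with
    | add p q hp hq => rw [map_add, map_add, hp, hq, MvPolynomial.coeff_add, mul_add]
    | monomial m r =>
      rw [polyPartial_monomial, MvPolynomial.constantCoeff_monomial, MvPolynomial.coeff_monomial]
      by_cases hm : m = β
      · subst hm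
        simp [Nat.descFactorial_self, mul_comm]
      · rw [if_neg hm, mul_zero]
        split_ifs with h0
        · rw [Finset.prod_eq_zero_iff.2, mul_zero]
          obtain ⟨a, ha⟩ := DFunLike.ne_iff.1 hm
          refine ⟨a, Finset.mem_univ a, ?_⟩
          have := tsub_eq_zero_iff_le.1 h0 a
          exact_mod_cast Nat.descFactorial_eq_zero_iff_lt.2 (lt_of_le_of_ne this ha)
        · rfl
  rw [symPartial, LinearMap.comp_apply, LinearMap.comp_apply] at h
  simp only [AlgEquiv.toLinearMap_apply, AlgEquiv.apply_symm_apply] at h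
  rw [h2, eq_comm, mul_eq_zero] at h
  rw [MvPolynomial.coeff_zero]
  exact h.resolve_left (Finset.prod_ne_zero_iff.2 fun a _ => by positivity)

end Injective

/-! ### Bijectivity of the quantization map -/

section Unipotent

/-- An operator that differs from the identity by an operator lowering an exhaustive filtration is
bijective. -/
theorem bijective_of_filtration {M : Type*} [AddCommGroup M] [Module ℝ M] (T : M →ₗ[ℝ] M)
    (F : ℕ → Submodule ℝ M) (h0 : F 0 = ⊥) (hF : ∀ x, ∃ n, x ∈ F n)
    (hT : ∀ n, ∀ x ∈ F (n + 1), T x - x ∈ F n) : Function.Bijective T := by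
  constructor
  · rw [← LinearMap.ker_eq_bot, LinearMap.ker_eq_bot']
    intro x hx
    obtain ⟨n, hn⟩ := hF x
    induction n with
    | zero => rwa [h0, Submodule.mem_bot] at hn
    | succ n ih =>
      refine ih ?_
      have := hT n x hn
      rwa [hx, zero_sub, neg_mem_iff] at this
  · have key : ∀ n, F n ≤ LinearMap.range T := by
      intro n
      induction n with
      | zero => rw [h0]; exact bot_le
      | succ n ih =>
        intro x hx
        have := sub_mem (LinearMap.mem_range_self T x) (ih (hT n x hx))
        rwa [sub_sub_cancel] at this
    intro x
    obtain ⟨n, hn⟩ := hF x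
    exact key n hn

variable {ι : Type*} [Fintype ι] [DecidableEq ι] {𝔤 : Type*} [LieRing 𝔤] [LieAlgebra ℝ 𝔤]
  (B : InvariantForm 𝔤) (b : Module.Basis ι ℝ 𝔤)

/-- A span of elements `f x k`, filtered by `k`. -/
theorem mem_filtration {X M : Type*} [AddCommGroup M] [Module ℝ M] (f : X → ℕ → M)
    (h : ∀ P : Submodule ℝ M, (∀ x k, f x k ∈ P) → ∀ y, y ∈ P) (y : M) :
    ∃ n, y ∈ Submodule.span ℝ {z | ∃ x k, k < n ∧ f x k = z} := by
  have hmono : Monotone fun n => Submodule.span ℝ {z | ∃ x k, k < n ∧ f x k = z} :=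
    fun m n hmn => Submodule.span_mono fun z ⟨x, k, hk, hz⟩ => ⟨x, k, hk.trans_le hmn, hz⟩
  have h1 := h (⨆ n, Submodule.span ℝ {z | ∃ x k, k < n ∧ f x k = z}) (fun x k =>
    Submodule.mem_iSup_of_mem (k + 1) (Submodule.subset_span ⟨x, k, Nat.lt_succ_self k, rfl⟩)) y
  rwa [Submodule.mem_iSup_of_directed _ hmono.directed_le] at h1

/-- An operator that maps each `f x n` to the sum of itself and a combination of elements `f y k` with
`k < n` is bijective, if the elements `f x n` span. -/
theorem bijective_of_lowering {X M : Type*} [AddCommGroup M] [Module ℝ M] (T : M →ₗ[ℝ] M)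
    (f : X → ℕ → M) (h : ∀ P : Submodule ℝ M, (∀ x k, f x k ∈ P) → ∀ y, y ∈ P)
    (hT : ∀ n x, T (f x n) - f x n ∈ Submodule.span ℝ {z | ∃ x k, k < n ∧ f x k = z}) :
    Function.Bijective T := by
  refine bijective_of_filtration T (fun n => Submodule.span ℝ {z | ∃ x k, k < n ∧ f x k = z})
    (by simp) (mem_filtration f h) fun n y hy => ?_
  induction hy using Submodule.span_induction with
  | zero => rw [map_zero, sub_zero]; exact zero_mem _
  | add x y _ _ hx hy => rw [map_add, add_sub_add_comm]; exact add_mem hx hy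
  | smul r x _ hx => rw [map_smul, ← smul_sub]; exact Submodule.smul_mem _ r hx
  | mem y hy =>
    obtain ⟨x, k, hk, rfl⟩ := hy
    refine Submodule.span_mono ?_ (hT k x)
    rintro z ⟨x, l, hl, hz⟩
    exact ⟨x, l, by omega, hz⟩

/-- A differential operator with constant term the identity is unipotent for the filtration by the
symmetric degree. -/
theorem weilDiffOp_bijective (F : MvPowerSeries ι (ExteriorAlgebra ℝ 𝔤))
    (hF : ∀ v : 𝔤, B.extContrHom (PowerSeries.coeff 0 (lineEval (b.repr v) F)) = 1) :
    Function.Bijective (weilDiffOp B b F) := by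
  refine bijective_of_lowering _
    (fun (p : 𝔤 × ExteriorAlgebra ℝ 𝔤) n => (divPow p.1 n ⊗ₜ[ℝ] p.2 : Weil 𝔤)) (fun P hP y => ?_)
    fun n p => ?_
  · have h := weil_lhom_ext (f := P.mkQ) (g := 0) fun v n ω => by
      rw [Submodule.mkQ_apply, (Submodule.Quotient.mk_eq_zero P).2 (hP (v, ω) n)]
      rfl
    have := LinearMap.congr_fun h y
    rwa [Submodule.mkQ_apply, LinearMap.zero_apply, Submodule.Quotient.mk_eq_zero] at this
  · have hmem : (n, 0) ∈ Finset.HasAntidiagonal.antidiagonal n := by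
      simp [Finset.HasAntidiagonal.mem_antidiagonal]
    change weilDiffOp B b F (divPow p.1 n ⊗ₜ p.2) - divPow p.1 n ⊗ₜ p.2 ∈ _
    rw [weilDiffOp_divPow, ← Finset.add_sum_erase _ _ hmem, hF]
    rw [Module.End.one_apply, add_sub_cancel_left]
    refine Submodule.sum_mem _ fun q hq => Submodule.subset_span
      ⟨(p.1, B.extContrHom (PowerSeries.coeff q.2 (lineEval (b.repr p.1) F)) p.2), q.1, ?_, rfl⟩
    rw [Finset.mem_erase, Finset.HasAntidiagonal.mem_antidiagonal] at hq
    rcases Nat.eq_zero_or_pos q.2 with h | h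
    · exact absurd (Prod.ext (by omega) h) hq.1
    · omega

theorem symDiffOp_bijective (F : MvPowerSeries ι ℝ) (hF : MvPowerSeries.constantCoeff F = 1) :
    Function.Bijective (symDiffOp b F) := by
  refine bijective_of_lowering _ (fun (v : 𝔤) n => divPow v n) (fun P hP y => ?_) fun n v => ?_
  · have h := sym_lhom_ext (f := P.mkQ) (g := 0) fun v n => by
      rw [Submodule.mkQ_apply, (Submodule.Quotient.mk_eq_zero P).2 (hP v n)]
      rfl
    have := LinearMap.congr_fun h y
    rwa [Submodule.mkQ_apply, LinearMap.zero_apply, Submodule.Quotient.mk_eq_zero] at this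
  · have hmem : (n, 0) ∈ Finset.HasAntidiagonal.antidiagonal n := by
      simp [Finset.HasAntidiagonal.mem_antidiagonal]
    rw [symDiffOp_divPow, ← Finset.add_sum_erase _ _ hmem, coeff_zero_lineEval, hF, one_smul,
      add_sub_cancel_left]
    refine Submodule.sum_mem _ fun q hq => Submodule.smul_mem _ _
      (Submodule.subset_span ⟨v, q.1, ?_, rfl⟩)
    rw [Finset.mem_erase, Finset.HasAntidiagonal.mem_antidiagonal] at hq
    rcases Nat.eq_zero_or_pos q.2 with h | h
    · exact absurd (Prod.ext (by omega) h) hq.1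
    · omega

theorem symmetrization_bijective [FiniteDimensional ℝ 𝔤] :
    Function.Bijective (symmetrization 𝔤) :=
  ⟨symmetrization_injective, symmetrization_surjective⟩

/-- The quantization map is the composition of a unipotent differential operator, the symmetrization,
and the change of quadratic form. -/
theorem quantization_bijective : Function.Bijective (quantization B b) := by
  have : FiniteDimensional ℝ 𝔤 := Module.Finite.of_basis b
  have h1 : Function.Bijective (weilDiffOp B b (sSeries B b)) := by
    refine weilDiffOp_bijective B b _ fun v => ?_
    have := coeff_zero_quantSeries B b v
    rwa [quantSeries, coeff_contrHomSeries] at this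
  have h2 : Function.Bijective
      (TensorProduct.map (symmetrization 𝔤) (cliffordQuantization B)) := by
    have h3 : Function.Bijective (cliffordQuantization B) := by
      rw [cliffordQuantization_eq]
      exact (extToCl B).bijective
    exact TensorProduct.map_bijective symmetrization_bijective h3
  exact h2.comp h1

end Unipotent

/-! ### Homotopies on basic complexes -/

section Homotopy

variable {𝔤 : Type*} [LieRing 𝔤] [LieAlgebra ℝ 𝔤]
  {T : Type*} [Ring T] [Algebra ℝ T] {𝒯 : ZMod 2 → Submodule ℝ T} [GradedAlgebra 𝒯]
  {Z : Type*} [Ring Z] [Algebra ℝ Z] {𝒵 : ZMod 2 → Submodule ℝ Z} [GradedAlgebra 𝒵]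
  (F : GDerivations 𝔤 𝒯) (G : GDerivations 𝔤 𝒵)

/-- The relations `d ^ 2 = 0` and `[ι_ξ, d] = L_ξ`. -/
structure GDerivations.IsCartan : Prop where
  d_d : ∀ x, F.d (F.d x) = 0
  contr_d : ∀ ξ x, F.contr ξ (F.d x) + F.d (F.contr ξ x) = F.lie ξ x

variable {F} in
theorem GDerivations.IsCartan.lie_d (hF : F.IsCartan) (ξ : 𝔤) (x : T) :
    F.lie ξ (F.d x) = F.d (F.lie ξ x) := by
  rw [← hF.contr_d, ← hF.contr_d, hF.d_d, map_zero, zero_add, map_add, hF.d_d, add_zero]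

/-- A linear map that commutes with the differentials, the contractions and the Lie derivatives. -/
structure GDerivations.IsMorphism (K : T →ₗ[ℝ] Z) : Prop where
  d : ∀ x, K (F.d x) = G.d (K x)
  contr : ∀ ξ x, K (F.contr ξ x) = G.contr ξ (K x)
  lie : ∀ ξ x, K (F.lie ξ x) = G.lie ξ (K x)

variable {F G} in
theorem GDerivations.IsMorphism.mem_basic {K : T →ₗ[ℝ] Z} (hK : F.IsMorphism G K) {x : T}
    (hx : x ∈ F.basic) : K x ∈ G.basic := fun ξ => by
  rw [← hK.contr, ← hK.lie, (hx ξ).1, (hx ξ).2, map_zero]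
  exact ⟨rfl, rfl⟩

variable {F G} in
theorem GDerivations.IsMorphism.mem_cocycles {K : T →ₗ[ℝ] Z} (hK : F.IsMorphism G K) {x : T}
    (hx : x ∈ F.cocycles) : K x ∈ G.cocycles :=
  ⟨hK.mem_basic hx.1, by rw [← hK.d, hx.2, map_zero]⟩

variable {F G} in
theorem GDerivations.IsMorphism.sub {K K' : T →ₗ[ℝ] Z} (hK : F.IsMorphism G K)
    (hK' : F.IsMorphism G K') : F.IsMorphism G (K - K') :=
  ⟨fun x => by simp [hK.d, hK'.d], fun ξ x => by simp [hK.contr, hK'.contr],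
    fun ξ x => by simp [hK.lie, hK'.lie]⟩

variable {F G} in
theorem GDerivations.IsMorphism.comp {Y : Type*} [Ring Y] [Algebra ℝ Y]
    {𝒴 : ZMod 2 → Submodule ℝ Y} [GradedAlgebra 𝒴] {E : GDerivations 𝔤 𝒴}
    {K : T →ₗ[ℝ] Z} {K' : Y →ₗ[ℝ] T} (hK : F.IsMorphism G K)
    (hK' : E.IsMorphism F K') : E.IsMorphism G (K ∘ₗ K') :=
  ⟨fun x => by simp [hK.d, hK'.d], fun ξ x => by simp [hK.contr, hK'.contr],
    fun ξ x => by simp [hK.lie, hK'.lie]⟩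

/-- If the number operator `N` acts on `t` with nonnegative integral eigenvalues and the kernel
component in `R`, some polynomial `p` with `p(0) = 1` satisfies `p(N) t ∈ R`. -/
theorem exists_polynomial_mem (N : Module.End ℝ T) (R : Submodule ℝ T) (hR : ∀ r ∈ R, N r = 0)
    {t : T} (ht : t ∈ Submodule.span ℝ {t | t ∈ R ∨ ∃ k : ℕ, 0 < k ∧ N t = (k : ℝ) • t}) :
    ∃ p : Polynomial ℝ, p.coeff 0 = 1 ∧ Polynomial.aeval N p t ∈ R := by
  have hpR : ∀ (p : Polynomial ℝ) (r : T), r ∈ R → Polynomial.aeval N p r = p.coeff 0 • r := by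
    intro p r hr
    conv_lhs => rw [← Polynomial.divX_mul_X_add p]
    simp [hR r hr]
  induction ht using Submodule.span_induction with
  | zero => exact ⟨1, by simp, by simp⟩
  | smul c x _ hx =>
    obtain ⟨p, hp, h⟩ := hx
    exact ⟨p, hp, by rw [map_smul]; exact R.smul_mem c h⟩
  | add x y _ _ hx hy =>
    obtain ⟨p, hp, h⟩ := hx
    obtain ⟨q, hq, h'⟩ := hy
    refine ⟨p * q, by rw [Polynomial.mul_coeff_zero, hp, hq, mul_one], ?_⟩
    rw [map_add]
    refine add_mem ?_ ?_
    · rw [mul_comm, map_mul, Module.End.mul_apply, hpR _ _ h]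
      exact R.smul_mem _ h
    · rw [map_mul, Module.End.mul_apply, hpR _ _ h']
      exact R.smul_mem _ h'
  | mem x hx =>
    rcases hx with hx | ⟨k, hk, hx⟩
    · exact ⟨1, by simp, by simpa using hx⟩
    · refine ⟨1 - Polynomial.C (k : ℝ)⁻¹ * Polynomial.X, by simp, ?_⟩
      have hk' : (k : ℝ) ≠ 0 := by positivity
      simp [hx, smul_smul, hk', Algebra.algebraMap_eq_smul_one]

/-- A contracting homotopy `h` of the basic complex onto the subspace `R`, with number operator
`N = d h + h d`: a morphism that vanishes on `R` maps basic cocycles to basic coboundaries. -/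
theorem GDerivations.IsMorphism.exact_of_homotopy {K : T →ₗ[ℝ] Z} (hK : F.IsMorphism G K)
    (hF : F.IsCartan) (h : T →ₗ[ℝ] T) (hcontr : ∀ ξ x, h (F.contr ξ x) = -F.contr ξ (h x))
    (hlie : ∀ ξ x, h (F.lie ξ x) = F.lie ξ (h x)) (R : Submodule ℝ T)
    (hR : ∀ r ∈ R, F.d (h r) + h (F.d r) = 0) (hKR : ∀ r ∈ R, K r = 0)
    (hspan : ∀ t, t ∈ Submodule.span ℝ
      {t | t ∈ R ∨ ∃ k : ℕ, 0 < k ∧ F.d (h t) + h (F.d t) = (k : ℝ) • t})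
    {z : T} (hz : z ∈ F.cocycles) : ∃ y ∈ G.basic, G.d y = K z := by
  set N : Module.End ℝ T := F.d ∘ₗ h + h ∘ₗ F.d with hN
  have hNapp : ∀ t, N t = F.d (h t) + h (F.d t) := fun t => rfl
  obtain ⟨p, hp, hpz⟩ := exists_polynomial_mem N R hR (hspan z)
  have hNmem : ∀ t ∈ F.cocycles, N t ∈ F.cocycles := by
    intro t ht
    have h1 : ∀ ξ, F.contr ξ (h t) = 0 := fun ξ => by
      rw [← neg_eq_zero, ← hcontr, (ht.1 ξ).1, map_zero]
    have h2 : ∀ ξ, F.lie ξ (h t) = 0 := fun ξ => by rw [← hlie, (ht.1 ξ).2, map_zero]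
    rw [hNapp, ht.2, map_zero, add_zero]
    refine ⟨fun ξ => ⟨?_, ?_⟩, hF.d_d _⟩
    · have := hF.contr_d ξ (h t)
      rwa [h1, h2, map_zero, add_zero] at this
    · rw [hF.lie_d, h2, map_zero]
  have hpow : ∀ n, (N ^ n) z ∈ F.cocycles := by
    intro n
    induction n with
    | zero => exact hz
    | succ n ih =>
      rw [pow_succ', Module.End.mul_apply]
      exact hNmem _ ih
  have haeval : ∀ q : Polynomial ℝ, Polynomial.aeval N q z ∈ F.cocycles := by
    intro q
    induction q using Polynomial.induction_on' with
    | add q q' hq hq' =>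
      rw [map_add, LinearMap.add_apply]
      exact add_mem hq hq'
    | monomial n a =>
      rw [Polynomial.aeval_monomial, ← Algebra.smul_def, LinearMap.smul_apply]
      exact Subalgebra.smul_mem _ (hpow n) a
  -- As `p(0) = 1`, one has `p(N) z = z + N u` with `u = ((p - 1) / X)(N) z` a cocycle. Then
  -- `N u = d h u`, and applying `K` gives `K z = -d K (h u)`.
  set u := Polynomial.aeval N p.divX z with hu
  have hdecomp : Polynomial.aeval N p z = N u + z := by
    conv_lhs => rw [← Polynomial.divX_mul_X_add p, hp, mul_comm]
    simp [hu]
  have hu' := haeval p.divX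
  refine ⟨-K (h u), neg_mem (hK.mem_basic fun ξ => ⟨?_, ?_⟩), ?_⟩
  · rw [← neg_eq_zero, ← hcontr, (hu'.1 ξ).1, map_zero]
  · rw [← hlie, (hu'.1 ξ).2, map_zero]
  · have h3 := hKR _ hpz
    rw [hdecomp, map_add, hNapp, hu'.2, map_zero, add_zero, hK.d] at h3
    rw [map_neg]
    exact neg_eq_of_add_eq_zero_right h3

end Homotopy

/-! ### Morphisms of graded tensor products -/

section TensorMorphisms

open GradedTensorProduct

variable {𝔤 : Type*} [LieRing 𝔤] [LieAlgebra ℝ 𝔤]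
  {X : Type*} [Ring X] [Algebra ℝ X] {𝒳 : ZMod 2 → Submodule ℝ X} [GradedAlgebra 𝒳]
  {Y : Type*} [Ring Y] [Algebra ℝ Y] {𝒴 : ZMod 2 → Submodule ℝ Y} [GradedAlgebra 𝒴]
  {Z : Type*} [Ring Z] [Algebra ℝ Z] {𝒵 : ZMod 2 → Submodule ℝ Z} [GradedAlgebra 𝒵]
  (D : GDerivations 𝔤 𝒳) (E : GDerivations 𝔤 𝒴) (G : GDerivations 𝔤 𝒵)

theorem tensor_d_tmul (x : X) (y : Y) : (D.tensor E).d (x ᵍ⊗ₜ[ℝ] y) =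
    D.d x ᵍ⊗ₜ[ℝ] y + parity 𝒳 x ᵍ⊗ₜ[ℝ] E.d y := rfl

theorem tensor_contr_tmul (ξ : 𝔤) (x : X) (y : Y) : (D.tensor E).contr ξ (x ᵍ⊗ₜ[ℝ] y) =
    D.contr ξ x ᵍ⊗ₜ[ℝ] y + parity 𝒳 x ᵍ⊗ₜ[ℝ] E.contr ξ y := rfl

theorem tensor_lie_tmul (ξ : 𝔤) (x : X) (y : Y) : (D.tensor E).lie ξ (x ᵍ⊗ₜ[ℝ] y) =
    D.lie ξ x ᵍ⊗ₜ[ℝ] y + x ᵍ⊗ₜ[ℝ] E.lie ξ y := rfl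

theorem gtensor_lhom_ext {M : Type*} [AddCommGroup M] [Module ℝ M] {f g : 𝒳 ᵍ⊗[ℝ] 𝒴 →ₗ[ℝ] M}
    (h : ∀ x y, f (x ᵍ⊗ₜ[ℝ] y) = g (x ᵍ⊗ₜ[ℝ] y)) : f = g :=
  LinearMap.ext fun u => gtensor_induction (p := fun u => f u = g u) (fun x _ y => h x y)
    (fun x _ y => h x y) (fun u v hu hv => by rw [map_add, map_add, hu, hv]) u

theorem add_gtmul (x x' : X) (y : Y) :
    ((x + x') ᵍ⊗ₜ[ℝ] y : 𝒳 ᵍ⊗[ℝ] 𝒴) = x ᵍ⊗ₜ[ℝ] y + x' ᵍ⊗ₜ[ℝ] y := by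
  simp only [tmul, TensorProduct.add_tmul, map_add]

theorem gtmul_add (x : X) (y y' : Y) :
    (x ᵍ⊗ₜ[ℝ] (y + y') : 𝒳 ᵍ⊗[ℝ] 𝒴) = x ᵍ⊗ₜ[ℝ] y + x ᵍ⊗ₜ[ℝ] y' := by
  simp only [tmul, TensorProduct.tmul_add, map_add]

theorem neg_gtmul (x : X) (y : Y) : ((-x) ᵍ⊗ₜ[ℝ] y : 𝒳 ᵍ⊗[ℝ] 𝒴) = -(x ᵍ⊗ₜ[ℝ] y) := by
  simp only [tmul, TensorProduct.neg_tmul, map_neg]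

theorem gtmul_neg (x : X) (y : Y) : (x ᵍ⊗ₜ[ℝ] (-y) : 𝒳 ᵍ⊗[ℝ] 𝒴) = -(x ᵍ⊗ₜ[ℝ] y) := by
  simp only [tmul, TensorProduct.tmul_neg, map_neg]

theorem zero_gtmul (y : Y) : ((0 : X) ᵍ⊗ₜ[ℝ] y : 𝒳 ᵍ⊗[ℝ] 𝒴) = 0 := by
  simp only [tmul, TensorProduct.zero_tmul, map_zero]

theorem gtmul_zero (x : X) : (x ᵍ⊗ₜ[ℝ] (0 : Y) : 𝒳 ᵍ⊗[ℝ] 𝒴) = 0 := by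
  simp only [tmul, TensorProduct.tmul_zero, map_zero]

theorem smul_gtmul (r : ℝ) (x : X) (y : Y) :
    ((r • x) ᵍ⊗ₜ[ℝ] y : 𝒳 ᵍ⊗[ℝ] 𝒴) = r • x ᵍ⊗ₜ[ℝ] y := by
  simp only [tmul, ← TensorProduct.smul_tmul', map_smul]

theorem gtmul_smul (r : ℝ) (x : X) (y : Y) :
    (x ᵍ⊗ₜ[ℝ] (r • y) : 𝒳 ᵍ⊗[ℝ] 𝒴) = r • x ᵍ⊗ₜ[ℝ] y := by
  simp only [tmul, TensorProduct.tmul_smul, map_smul]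

theorem parity_gtmul (x : X) (y : Y) : parity (gtensorGrading 𝒳 𝒴) (x ᵍ⊗ₜ[ℝ] y) =
    parity 𝒳 x ᵍ⊗ₜ[ℝ] parity 𝒴 y := by
  rw [parity_invol, gparity_tmul]

theorem gone_def : (1 : 𝒳 ᵍ⊗[ℝ] 𝒴) = (1 : X) ᵍ⊗ₜ[ℝ] (1 : Y) := rfl

theorem gtmul_one_mul (x x' : X) (y' : Y) :
    ((x ᵍ⊗ₜ[ℝ] (1 : Y)) * (x' ᵍ⊗ₜ[ℝ] y') : 𝒳 ᵍ⊗[ℝ] 𝒴) = (x * x') ᵍ⊗ₜ[ℝ] y' := by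
  induction x' using super_induction 𝒳 with
  | he x' hx' => rw [gmul_even _ _ hx', one_mul]
  | ho x' hx' => rw [gmul_odd _ _ hx', parity_one, one_mul]
  | hadd a c ha hc => rw [add_gtmul, mul_add, ha, hc, mul_add, add_gtmul]

theorem gtmul_mul_one_gtmul (x : X) (y y' : Y) :
    ((x ᵍ⊗ₜ[ℝ] y) * ((1 : X) ᵍ⊗ₜ[ℝ] y') : 𝒳 ᵍ⊗[ℝ] 𝒴) = x ᵍ⊗ₜ[ℝ] (y * y') := by
  rw [gmul_even _ _ (SetLike.one_mem_graded 𝒳), mul_one]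

variable {D E} in
/-- The relations are inherited by graded tensor products, with the Koszul signs of the total
differential and contractions. -/
theorem GDerivations.IsCartan.tensor (hD : D.IsCartan) (hE : E.IsCartan) :
    (D.tensor E).IsCartan where
  d_d u := by
    suffices h : (D.tensor E).d ∘ₗ (D.tensor E).d = 0 from LinearMap.congr_fun h u
    refine gtensor_lhom_ext fun x y => ?_
    simp only [LinearMap.comp_apply, LinearMap.zero_apply, tensor_d_tmul, map_add, hD.d_d, hE.d_d,
      D.d_odd, parity_parity, neg_gtmul, zero_gtmul, gtmul_zero]
    abel
  contr_d ξ u := by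
    suffices h : (D.tensor E).contr ξ ∘ₗ (D.tensor E).d + (D.tensor E).d ∘ₗ (D.tensor E).contr ξ =
        (D.tensor E).lie ξ from LinearMap.congr_fun h u
    refine gtensor_lhom_ext fun x y => ?_
    simp only [LinearMap.comp_apply, LinearMap.add_apply, tensor_d_tmul, tensor_contr_tmul,
      tensor_lie_tmul, map_add, D.d_odd, D.contr_odd, parity_parity, neg_gtmul, ← hD.contr_d,
      ← hE.contr_d, add_gtmul, gtmul_add]
    abel

/-- The product map `x ⊗ y ↦ f(x) g(y)`. -/
def gtensorMul (f : X →ₗ[ℝ] Z) (g : Y →ₗ[ℝ] Z) : 𝒳 ᵍ⊗[ℝ] 𝒴 →ₗ[ℝ] Z :=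
  LinearMap.mul' ℝ Z ∘ₗ TensorProduct.map f g ∘ₗ (of ℝ 𝒳 𝒴).symm.toLinearMap

theorem gtensorMul_tmul (f : X →ₗ[ℝ] Z) (g : Y →ₗ[ℝ] Z) (x : X) (y : Y) :
    gtensorMul (𝒳 := 𝒳) (𝒴 := 𝒴) f g (x ᵍ⊗ₜ[ℝ] y) = f x * g y := rfl

variable {D E G} in
/-- Products of morphisms are morphisms, as `d`, `ι_ξ` and `L_ξ` are derivations; no commutativity of the
target is needed. -/
theorem GDerivations.IsMorphism.gtensorMul {f : X →ₗ[ℝ] Z} {g : Y →ₗ[ℝ] Z}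
    (hf : D.IsMorphism G f) (hfp : ∀ x, f (parity 𝒳 x) = parity 𝒵 (f x))
    (hg : E.IsMorphism G g) : (D.tensor E).IsMorphism G (gtensorMul f g) where
  d u := by
    suffices h : WeilQuant.gtensorMul f g ∘ₗ (D.tensor E).d =
        G.d ∘ₗ WeilQuant.gtensorMul f g from LinearMap.congr_fun h u
    refine gtensor_lhom_ext fun x y => ?_
    simp only [LinearMap.comp_apply, tensor_d_tmul, map_add, gtensorMul_tmul, hf.d, hg.d, hfp,
      G.d_mul]
  contr ξ u := by
    suffices h : WeilQuant.gtensorMul f g ∘ₗ (D.tensor E).contr ξ =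
        G.contr ξ ∘ₗ WeilQuant.gtensorMul f g from LinearMap.congr_fun h u
    refine gtensor_lhom_ext fun x y => ?_
    simp only [LinearMap.comp_apply, tensor_contr_tmul, map_add, gtensorMul_tmul, hf.contr,
      hg.contr, hfp, G.contr_mul]
  lie ξ u := by
    suffices h : WeilQuant.gtensorMul f g ∘ₗ (D.tensor E).lie ξ =
        G.lie ξ ∘ₗ WeilQuant.gtensorMul f g from LinearMap.congr_fun h u
    refine gtensor_lhom_ext fun x y => ?_
    simp only [LinearMap.comp_apply, tensor_lie_tmul, map_add, gtensorMul_tmul, hf.lie,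
      hg.lie, G.lie_mul]

variable (𝒳 𝒴) in
/-- The inclusion `x ↦ x ⊗ 1`. -/
def gincl : X →ₗ[ℝ] 𝒳 ᵍ⊗[ℝ] 𝒴 where
  toFun x := x ᵍ⊗ₜ[ℝ] 1
  map_add' x x' := add_gtmul x x' 1
  map_smul' r x := smul_gtmul r x 1

variable (𝒳 𝒴) in
/-- The inclusion `y ↦ 1 ⊗ y`. -/
def gincr : Y →ₗ[ℝ] 𝒳 ᵍ⊗[ℝ] 𝒴 where
  toFun y := 1 ᵍ⊗ₜ[ℝ] y
  map_add' y y' := gtmul_add 1 y y'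
  map_smul' r y := gtmul_smul r 1 y

theorem gincl_apply (x : X) : gincl 𝒳 𝒴 x = x ᵍ⊗ₜ[ℝ] 1 := rfl

theorem gincr_apply (y : Y) : gincr 𝒳 𝒴 y = 1 ᵍ⊗ₜ[ℝ] y := rfl

theorem gincl_isMorphism : D.IsMorphism (D.tensor E) (gincl 𝒳 𝒴) :=
  ⟨fun x => by rw [gincl_apply, gincl_apply, tensor_d_tmul, E.d_one, gtmul_zero, add_zero],
    fun ξ x => by
      rw [gincl_apply, gincl_apply, tensor_contr_tmul, E.contr_one, gtmul_zero, add_zero],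
    fun ξ x => by
      rw [gincl_apply, gincl_apply, tensor_lie_tmul, E.lie_one, gtmul_zero, add_zero]⟩

theorem gincr_isMorphism : E.IsMorphism (D.tensor E) (gincr 𝒳 𝒴) :=
  ⟨fun x => by
      rw [gincr_apply, gincr_apply, tensor_d_tmul, D.d_one, zero_gtmul, zero_add, parity_one],
    fun ξ x => by
      rw [gincr_apply, gincr_apply, tensor_contr_tmul, D.contr_one, zero_gtmul, zero_add,
        parity_one],
    fun ξ x => by
      rw [gincr_apply, gincr_apply, tensor_lie_tmul, D.lie_one, zero_gtmul, zero_add]⟩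

theorem id_isMorphism : D.IsMorphism D LinearMap.id :=
  ⟨fun _ => rfl, fun _ _ => rfl, fun _ _ => rfl⟩

variable {D E G} in
/-- The tensor product of two morphisms, the first of which preserves the parity. -/
theorem GDerivations.IsMorphism.gmap {W : Type*} [Ring W] [Algebra ℝ W]
    {𝒲 : ZMod 2 → Submodule ℝ W} [GradedAlgebra 𝒲] {H : GDerivations 𝔤 𝒲}
    {f : X →ₗ[ℝ] Z} {g : Y →ₗ[ℝ] W} (hf : D.IsMorphism G f)
    (hfp : ∀ x, f (parity 𝒳 x) = parity 𝒵 (f x)) (hg : E.IsMorphism H g) :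
    (D.tensor E).IsMorphism (G.tensor H) (gmap 𝒳 𝒴 𝒵 𝒲 f g) where
  d u := by
    suffices h : WeilQuant.gmap 𝒳 𝒴 𝒵 𝒲 f g ∘ₗ (D.tensor E).d =
        (G.tensor H).d ∘ₗ WeilQuant.gmap 𝒳 𝒴 𝒵 𝒲 f g from LinearMap.congr_fun h u
    refine gtensor_lhom_ext fun x y => ?_
    simp only [LinearMap.comp_apply, tensor_d_tmul, map_add, gmap_tmul, hf.d, hg.d, hfp]
  contr ξ u := by
    suffices h : WeilQuant.gmap 𝒳 𝒴 𝒵 𝒲 f g ∘ₗ (D.tensor E).contr ξ =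
        (G.tensor H).contr ξ ∘ₗ WeilQuant.gmap 𝒳 𝒴 𝒵 𝒲 f g from LinearMap.congr_fun h u
    refine gtensor_lhom_ext fun x y => ?_
    simp only [LinearMap.comp_apply, tensor_contr_tmul, map_add, gmap_tmul, hf.contr, hg.contr, hfp]
  lie ξ u := by
    suffices h : WeilQuant.gmap 𝒳 𝒴 𝒵 𝒲 f g ∘ₗ (D.tensor E).lie ξ =
        (G.tensor H).lie ξ ∘ₗ WeilQuant.gmap 𝒳 𝒴 𝒵 𝒲 f g from LinearMap.congr_fun h u
    refine gtensor_lhom_ext fun x y => ?_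
    simp only [LinearMap.comp_apply, tensor_lie_tmul, map_add, gmap_tmul, hf.lie, hg.lie]

end TensorMorphisms

/-! ### Connections and the homotopy of `W𝔤 ⊗ Y` -/

section Connection

open GradedTensorProduct

variable {𝔤 : Type*} [LieRing 𝔤] [LieAlgebra ℝ 𝔤] (B : InvariantForm 𝔤)
  {ι : Type*} [Fintype ι] [DecidableEq ι] (b : Module.Basis ι ℝ 𝔤)

theorem weilParity_tmul (s : SymmetricAlgebra ℝ 𝔤) (ω : ExteriorAlgebra ℝ 𝔤) :
    weilParity 𝔤 (s ⊗ₜ ω) = s ⊗ₜ CliffordAlgebra.involute ω := by simp [weilParity]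

theorem weil_tmul_ext {M : Type*} [AddCommGroup M] [Module ℝ M] {f g : Weil 𝔤 →ₗ[ℝ] M}
    (h : ∀ s ω, f (s ⊗ₜ ω) = g (s ⊗ₜ ω)) : f = g := TensorProduct.ext' h

theorem weil_ι_mul (v : 𝔤) (w : Weil 𝔤) : (1 ⊗ₜ ExteriorAlgebra.ι ℝ v) * w =
    weilParity 𝔤 w * (1 ⊗ₜ ExteriorAlgebra.ι ℝ v) := by
  suffices h : LinearMap.mulLeft ℝ ((1 ⊗ₜ ExteriorAlgebra.ι ℝ v : Weil 𝔤)) =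
      LinearMap.mulRight ℝ ((1 ⊗ₜ ExteriorAlgebra.ι ℝ v : Weil 𝔤)) ∘ₗ
        (weilParity 𝔤).toLinearMap from LinearMap.congr_fun h w
  refine weil_tmul_ext fun s ω => ?_
  simp only [LinearMap.mulLeft_apply, LinearMap.comp_apply, AlgHom.toLinearMap_apply,
    LinearMap.mulRight_apply, weilParity_tmul, Algebra.TensorProduct.tmul_mul_tmul, one_mul, mul_one]
  rw [ext_ι_mul]

theorem weilPartial_mul (v : 𝔤) (x y : Weil 𝔤) : weilPartial B b v (x * y) =
    weilPartial B b v x * y + x * weilPartial B b v y := by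
  induction x using TensorProduct.induction_on with
  | zero => simp
  | add x x' hx hx' =>
    simp only [add_mul, map_add, hx, hx']
    abel
  | tmul s ω =>
    induction y using TensorProduct.induction_on with
    | zero => simp
    | add y y' hy hy' =>
      simp only [mul_add, map_add, hy, hy']
      abel
    | tmul s' ω' =>
      simp only [weilPartial_tmul, Algebra.TensorProduct.tmul_mul_tmul, symDeriv_mul,
        TensorProduct.add_tmul]

theorem weilPartial_parity (v : 𝔤) (x : Weil 𝔤) :
    weilPartial B b v (weilParity 𝔤 x) = weilParity 𝔤 (weilPartial B b v x) := by
  suffices h : weilPartial B b v ∘ₗ (weilParity 𝔤).toLinearMap =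
      (weilParity 𝔤).toLinearMap ∘ₗ weilPartial B b v from LinearMap.congr_fun h x
  refine weil_tmul_ext fun s ω => ?_
  simp only [LinearMap.comp_apply, AlgHom.toLinearMap_apply, weilParity_tmul, weilPartial_tmul]

theorem weilPartial_contr (v ξ : 𝔤) (x : Weil 𝔤) :
    weilPartial B b v (weilContr B ξ x) = weilContr B ξ (weilPartial B b v x) := by
  suffices h : weilPartial B b v ∘ₗ weilContr B ξ = weilContr B ξ ∘ₗ weilPartial B b v from
    LinearMap.congr_fun h x
  exact weil_tmul_ext fun s ω => rfl

theorem weilPartial_lie (v ξ : 𝔤) (x : Weil 𝔤) : weilPartial B b v (weilLie 𝔤 ξ x) =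
    weilLie 𝔤 ξ (weilPartial B b v x) - weilPartial B b ⁅ξ, v⁆ x := by
  suffices h : weilPartial B b v ∘ₗ weilLie 𝔤 ξ = weilLie 𝔤 ξ ∘ₗ weilPartial B b v -
      weilPartial B b ⁅ξ, v⁆ from LinearMap.congr_fun h x
  refine weil_tmul_ext fun s ω => ?_
  have h := symDeriv_symLie B b v ξ s
  rw [sub_eq_iff_eq_add] at h
  simp only [LinearMap.comp_apply, LinearMap.sub_apply, weilLie_tmul, weilPartial_tmul, map_add, h,
    TensorProduct.add_tmul, TensorProduct.neg_tmul]
  abel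

theorem symDeriv_one (v : 𝔤) : symDeriv B b v 1 = 0 := by
  simpa using symDeriv_mul B b v 1 1

theorem weilPartial_ext (v : 𝔤) (ω : ExteriorAlgebra ℝ 𝔤) : weilPartial B b v (1 ⊗ₜ ω) = 0 := by
  rw [weilPartial_tmul, symDeriv_one, TensorProduct.zero_tmul]

theorem weilPartial_weilD_ext (v ξ : 𝔤) :
    weilPartial B b v (weilD B b (1 ⊗ₜ ExteriorAlgebra.ι ℝ ξ)) = B.form v ξ • 1 := by
  rw [weilD_ext, map_add, weilPartial_ext, add_zero, weilPartial_tmul, symDeriv_ι,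
    Algebra.algebraMap_eq_smul_one, ← TensorProduct.smul_tmul']
  rfl

variable {Y : Type*} [Ring Y] [Algebra ℝ Y] {𝒴 : ZMod 2 → Submodule ℝ Y} [GradedAlgebra 𝒴]

/-- A connection `θ` on an algebra with derivations: a `𝔤`-equivariant family of odd elements
`θ_ξ`, which commute with all elements in the graded sense, with `ι_η θ_ξ = B(η, ξ)`. -/
structure GDerivations.IsConnection (E : GDerivations 𝔤 𝒴) (θ : 𝔤 →ₗ[ℝ] Y) : Prop where
  odd : ∀ ξ, parity 𝒴 (θ ξ) = -θ ξ
  comm : ∀ ξ y, θ ξ * y = parity 𝒴 y * θ ξ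
  contr : ∀ η ξ, E.contr η (θ ξ) = B.form η ξ • 1
  lie : ∀ η ξ, E.lie η (θ ξ) = θ ⁅η, ξ⁆

variable (𝒴) in
/-- The difference `τ_ξ = θ_ξ ⊗ 1 - 1 ⊗ θ_ξ` of the two connections of `W𝔤 ⊗ Y`. -/
def connDiff (θ : 𝔤 →ₗ[ℝ] Y) : 𝔤 →ₗ[ℝ] weilGrading 𝔤 ᵍ⊗[ℝ] 𝒴 :=
  gincl (weilGrading 𝔤) 𝒴 ∘ₗ TensorProduct.mk ℝ _ _ 1 ∘ₗ ExteriorAlgebra.ι ℝ -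
    gincr (weilGrading 𝔤) 𝒴 ∘ₗ θ

theorem connDiff_apply (θ : 𝔤 →ₗ[ℝ] Y) (ξ : 𝔤) : connDiff 𝒴 θ ξ =
    (1 ⊗ₜ ExteriorAlgebra.ι ℝ ξ : Weil 𝔤) ᵍ⊗ₜ[ℝ] 1 - 1 ᵍ⊗ₜ[ℝ] θ ξ := rfl

variable (𝒴) in
/-- The operator `∂_v ⊗ 1` on `W𝔤 ⊗ Y`. -/
def gpartial : 𝔤 →ₗ[ℝ] weilGrading 𝔤 ᵍ⊗[ℝ] 𝒴 →ₗ[ℝ] weilGrading 𝔤 ᵍ⊗[ℝ] 𝒴 where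
  toFun v := gmap (weilGrading 𝔤) 𝒴 (weilGrading 𝔤) 𝒴 (weilPartial B b v) LinearMap.id
  map_add' v w := by
    simp only [gmap, map_add, TensorProduct.map_add_left, LinearMap.add_comp, LinearMap.comp_add]
  map_smul' r v := by
    simp only [gmap, map_smul, TensorProduct.map_smul_left, LinearMap.smul_comp,
      LinearMap.comp_smul, RingHom.id_apply]

theorem gpartial_tmul (v : 𝔤) (x : Weil 𝔤) (y : Y) :
    gpartial B b 𝒴 v (x ᵍ⊗ₜ[ℝ] y) = weilPartial B b v x ᵍ⊗ₜ[ℝ] y := rfl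

theorem gpartial_mul (v : 𝔤) (t u : weilGrading 𝔤 ᵍ⊗[ℝ] 𝒴) :
    gpartial B b 𝒴 v (t * u) = gpartial B b 𝒴 v t * u + t * gpartial B b 𝒴 v u := by
  have h : gpartial B b 𝒴 v = evenSum (weilGrading 𝔤) 𝒴 (weilPartial B b v) 0 :=
    gtensor_lhom_ext fun x y => by
      rw [gpartial_tmul, evenSum_tmul, LinearMap.zero_apply, gtmul_zero, add_zero]
  rw [h]
  exact evenSum_mul (fun x => by rw [parity_invol, parity_invol, weilPartial_parity])
    (weilPartial_mul B b v) (fun x => by simp) (fun x y => by simp) t u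

theorem gpartial_parity (v : 𝔤) (t : weilGrading 𝔤 ᵍ⊗[ℝ] 𝒴) : gpartial B b 𝒴 v
    (parity (gtensorGrading (weilGrading 𝔤) 𝒴) t) =
      parity (gtensorGrading (weilGrading 𝔤) 𝒴) (gpartial B b 𝒴 v t) := by
  suffices h : gpartial B b 𝒴 v ∘ₗ parity (gtensorGrading (weilGrading 𝔤) 𝒴) =
      parity (gtensorGrading (weilGrading 𝔤) 𝒴) ∘ₗ gpartial B b 𝒴 v from LinearMap.congr_fun h t
  refine gtensor_lhom_ext fun x y => ?_
  simp only [LinearMap.comp_apply, parity_gtmul, gpartial_tmul]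
  rw [parity_invol, parity_invol, weilPartial_parity]

variable (E : GDerivations 𝔤 𝒴)

theorem gpartial_contr (v ξ : 𝔤) (t : weilGrading 𝔤 ᵍ⊗[ℝ] 𝒴) :
    gpartial B b 𝒴 v (((weil B b).tensor E).contr ξ t) =
      ((weil B b).tensor E).contr ξ (gpartial B b 𝒴 v t) := by
  suffices h : gpartial B b 𝒴 v ∘ₗ ((weil B b).tensor E).contr ξ =
      ((weil B b).tensor E).contr ξ ∘ₗ gpartial B b 𝒴 v from LinearMap.congr_fun h t
  refine gtensor_lhom_ext fun x y => ?_
  have h : weilPartial B b v ((weil B b).contr ξ x) = (weil B b).contr ξ (weilPartial B b v x) :=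
    weilPartial_contr B b v ξ x
  simp only [LinearMap.comp_apply, tensor_contr_tmul, gpartial_tmul, map_add, h]
  rw [parity_invol, parity_invol, weilPartial_parity]

theorem gpartial_lie (v ξ : 𝔤) (t : weilGrading 𝔤 ᵍ⊗[ℝ] 𝒴) :
    gpartial B b 𝒴 v (((weil B b).tensor E).lie ξ t) =
      ((weil B b).tensor E).lie ξ (gpartial B b 𝒴 v t) - gpartial B b 𝒴 ⁅ξ, v⁆ t := by
  suffices h : gpartial B b 𝒴 v ∘ₗ ((weil B b).tensor E).lie ξ =
      ((weil B b).tensor E).lie ξ ∘ₗ gpartial B b 𝒴 v - gpartial B b 𝒴 ⁅ξ, v⁆ from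
    LinearMap.congr_fun h t
  refine gtensor_lhom_ext fun x y => ?_
  have h : weilPartial B b v ((weil B b).lie ξ x) =
      (weil B b).lie ξ (weilPartial B b v x) + -weilPartial B b ⁅ξ, v⁆ x :=
    (weilPartial_lie B b v ξ x).trans (sub_eq_add_neg _ _)
  rw [LinearMap.sub_apply]
  simp only [LinearMap.comp_apply, tensor_lie_tmul, gpartial_tmul, map_add, h, add_gtmul, neg_gtmul]
  abel

theorem gpartial_gincr (v : 𝔤) (y : Y) : gpartial B b 𝒴 v (gincr (weilGrading 𝔤) 𝒴 y) = 0 := by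
  rw [gincr_apply, gpartial_tmul]
  have h : weilPartial B b v 1 = 0 := weilPartial_ext B b v 1
  rw [h, zero_gtmul]

variable {B} {E} {θ : 𝔤 →ₗ[ℝ] Y} (hθ : E.IsConnection B θ)

include hθ

theorem connDiff_odd (ξ : 𝔤) : parity (gtensorGrading (weilGrading 𝔤) 𝒴) (connDiff 𝒴 θ ξ) =
    -connDiff 𝒴 θ ξ := by
  have h : weilParity 𝔤 (1 ⊗ₜ ExteriorAlgebra.ι ℝ ξ) = -(1 ⊗ₜ ExteriorAlgebra.ι ℝ ξ) := by
    rw [weilParity_tmul, ← TensorProduct.tmul_neg]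
    congr 1
    exact CliffordAlgebra.involute_ι ξ
  rw [connDiff_apply, map_sub, parity_gtmul, parity_gtmul, parity_one, parity_one, hθ.odd,
    parity_invol, h, neg_gtmul, gtmul_neg, neg_sub_neg, neg_sub]

theorem connDiff_mul (ξ : 𝔤) (t : weilGrading 𝔤 ᵍ⊗[ℝ] 𝒴) : connDiff 𝒴 θ ξ * t =
    parity (gtensorGrading (weilGrading 𝔤) 𝒴) t * connDiff 𝒴 θ ξ := by
  have hodd : (1 ⊗ₜ ExteriorAlgebra.ι ℝ ξ : Weil 𝔤) ∈ weilGrading 𝔤 1 := by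
    refine mem_involGrading_one.2 ?_
    rw [weilParity_tmul, ← TensorProduct.tmul_neg]
    congr 1
    exact CliffordAlgebra.involute_ι ξ
  have hθ1 : ∀ ξ, parity 𝒴 (θ ξ) = -θ ξ := hθ.odd
  induction t using gtensor_induction with
  | hadd u v hu hv => simp only [mul_add, map_add, add_mul, hu, hv]
  | he x hx y =>
    rw [connDiff_apply, sub_mul, mul_sub, parity_gtmul, gtmul_one_mul, gmul_odd _ _ hodd,
      gtmul_mul_one_gtmul, gmul_even _ _ hx, parity_parity, mul_one, one_mul, hθ.comm, weil_ι_mul,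
      parity_invol, mem_involGrading_zero.1 hx]
  | ho x hx y =>
    rw [connDiff_apply, sub_mul, mul_sub, parity_gtmul, gtmul_one_mul, gmul_odd _ _ hodd,
      gtmul_mul_one_gtmul, gmul_odd _ _ hx, parity_parity, mul_one, one_mul, hθ1, weil_ι_mul,
      neg_mul, gtmul_neg, hθ.comm, parity_odd hx, neg_gtmul, mem_involGrading_one.1 hx]

theorem contr_connDiff (η ξ : 𝔤) : ((weil B b).tensor E).contr η (connDiff 𝒴 θ ξ) = 0 := by
  have h : (weil B b).contr η (1 ⊗ₜ ExteriorAlgebra.ι ℝ ξ) = B.form η ξ • 1 := by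
    change weilContr B η (1 ⊗ₜ ExteriorAlgebra.ι ℝ ξ) = _
    rw [weilContr_tmul, extContr_ι, Algebra.algebraMap_eq_smul_one, TensorProduct.tmul_smul]
    rfl
  rw [connDiff_apply, map_sub, tensor_contr_tmul, tensor_contr_tmul, h, E.contr_one,
    (weil B b).contr_one, hθ.contr, gtmul_zero, zero_gtmul, add_zero, zero_add, parity_one,
    smul_gtmul, gtmul_smul, sub_self]

theorem lie_connDiff (η ξ : 𝔤) :
    ((weil B b).tensor E).lie η (connDiff 𝒴 θ ξ) = connDiff 𝒴 θ ⁅η, ξ⁆ := by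
  have h : (weil B b).lie η (1 ⊗ₜ ExteriorAlgebra.ι ℝ ξ) = 1 ⊗ₜ ExteriorAlgebra.ι ℝ ⁅η, ξ⁆ := by
    change weilLie 𝔤 η (1 ⊗ₜ ExteriorAlgebra.ι ℝ ξ) = _
    have h1 : symLie η (1 : SymmetricAlgebra ℝ 𝔤) = 0 := symDer_one _
    rw [weilLie_tmul, h1, TensorProduct.zero_tmul, zero_add, extLie_ι]
  rw [connDiff_apply, map_sub, tensor_lie_tmul, tensor_lie_tmul, h, E.lie_one,
    (weil B b).lie_one, hθ.lie, gtmul_zero, zero_gtmul, add_zero, zero_add, connDiff_apply]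

omit hθ in
theorem gpartial_connDiff (v ξ : 𝔤) : gpartial B b 𝒴 v (connDiff 𝒴 θ ξ) = 0 := by
  rw [connDiff_apply, map_sub, gpartial_tmul, weilPartial_ext, zero_gtmul, ← gincr_apply,
    gpartial_gincr, sub_zero]

omit hθ in
theorem gpartial_d_connDiff (v ξ : 𝔤) :
    gpartial B b 𝒴 v (((weil B b).tensor E).d (connDiff 𝒴 θ ξ)) = B.form v ξ • 1 := by
  have h : weilPartial B b v ((weil B b).d (1 ⊗ₜ ExteriorAlgebra.ι ℝ ξ)) = B.form v ξ • 1 :=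
    weilPartial_weilD_ext B b v ξ
  rw [connDiff_apply, map_sub, ← gincr_apply, ← (gincr_isMorphism (weil B b) E).d, map_sub,
    gpartial_gincr, sub_zero, tensor_d_tmul, E.d_one, gtmul_zero, add_zero, gpartial_tmul, h,
    smul_gtmul, gone_def]

variable (B) (θ)

omit hθ in
variable (𝒴) in
/-- The homotopy `h = ∑_a τ_{e_a} ∂_{e^a}` of `W𝔤 ⊗ Y`. -/
def connHomotopy : weilGrading 𝔤 ᵍ⊗[ℝ] 𝒴 →ₗ[ℝ] weilGrading 𝔤 ᵍ⊗[ℝ] 𝒴 :=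
  ∑ a, LinearMap.mulLeft ℝ (connDiff 𝒴 θ (b a)) ∘ₗ gpartial B b 𝒴 (B.dual b a)

omit hθ in
theorem connHomotopy_apply (t : weilGrading 𝔤 ᵍ⊗[ℝ] 𝒴) : connHomotopy B b 𝒴 θ t =
    ∑ a, connDiff 𝒴 θ (b a) * gpartial B b 𝒴 (B.dual b a) t := by
  simp [connHomotopy, LinearMap.sum_apply]

variable {θ}

theorem connHomotopy_mul (t u : weilGrading 𝔤 ᵍ⊗[ℝ] 𝒴) : connHomotopy B b 𝒴 θ (t * u) =
    connHomotopy B b 𝒴 θ t * u +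
      parity (gtensorGrading (weilGrading 𝔤) 𝒴) t * connHomotopy B b 𝒴 θ u := by
  simp only [connHomotopy_apply, gpartial_mul, mul_add, Finset.sum_add_distrib, Finset.sum_mul,
    Finset.mul_sum]
  congr 1
  · exact Finset.sum_congr rfl fun a _ => (mul_assoc _ _ _).symm
  · refine Finset.sum_congr rfl fun a _ => ?_
    rw [← mul_assoc, connDiff_mul hθ, mul_assoc]

theorem connHomotopy_parity (t : weilGrading 𝔤 ᵍ⊗[ℝ] 𝒴) : connHomotopy B b 𝒴 θ
    (parity (gtensorGrading (weilGrading 𝔤) 𝒴) t) =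
      -parity (gtensorGrading (weilGrading 𝔤) 𝒴) (connHomotopy B b 𝒴 θ t) := by
  simp only [connHomotopy_apply, gpartial_parity, map_sum, parity_mul, connDiff_odd hθ, neg_mul,
    Finset.sum_neg_distrib, neg_neg]

theorem connHomotopy_contr (ξ : 𝔤) (t : weilGrading 𝔤 ᵍ⊗[ℝ] 𝒴) :
    connHomotopy B b 𝒴 θ (((weil B b).tensor E).contr ξ t) =
      -((weil B b).tensor E).contr ξ (connHomotopy B b 𝒴 θ t) := by
  simp only [connHomotopy_apply, gpartial_contr, map_sum, ((weil B b).tensor E).contr_mul,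
    contr_connDiff b hθ, connDiff_odd hθ, zero_mul, zero_add, neg_mul, Finset.sum_neg_distrib,
    neg_neg]

theorem connHomotopy_lie (ξ : 𝔤) (t : weilGrading 𝔤 ᵍ⊗[ℝ] 𝒴) :
    connHomotopy B b 𝒴 θ (((weil B b).tensor E).lie ξ t) =
      ((weil B b).tensor E).lie ξ (connHomotopy B b 𝒴 θ t) := by
  have h := sum_dual_mul_lie' B b (connDiff 𝒴 θ) ((gpartial B b 𝒴).flip t) ξ
  simp only [LinearMap.flip_apply] at h
  simp only [connHomotopy_apply, gpartial_lie, map_sum, ((weil B b).tensor E).lie_mul,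
    lie_connDiff b hθ, mul_sub, Finset.sum_sub_distrib, Finset.sum_add_distrib, h]
  abel

omit hθ in
theorem connHomotopy_gincr (y : Y) :
    connHomotopy B b 𝒴 θ (gincr (weilGrading 𝔤) 𝒴 y) = 0 := by
  rw [connHomotopy_apply]
  exact Finset.sum_eq_zero fun a _ => by rw [gpartial_gincr, mul_zero]

omit hθ in
theorem connHomotopy_connDiff (ξ : 𝔤) : connHomotopy B b 𝒴 θ (connDiff 𝒴 θ ξ) = 0 := by
  rw [connHomotopy_apply]
  exact Finset.sum_eq_zero fun a _ => by rw [gpartial_connDiff, mul_zero]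

omit hθ in
/-- Together with `connHomotopy_connDiff`, this shows that `d h + h d` is the identity on the elements
`τ_ξ` and `d τ_ξ`. -/
theorem connHomotopy_d_connDiff (ξ : 𝔤) : connHomotopy B b 𝒴 θ
    (((weil B b).tensor E).d (connDiff 𝒴 θ ξ)) = connDiff 𝒴 θ ξ := by
  simp only [connHomotopy_apply, gpartial_d_connDiff, mul_smul_comm, mul_one]
  conv_rhs => rw [← sum_form_dual_smul B b ξ]
  simp only [map_sum, map_smul]

end Connection

/-! ### The number operator of the homotopy -/

section NumberOperator

open GradedTensorProduct

variable {𝔤 : Type*} [LieRing 𝔤] [LieAlgebra ℝ 𝔤] {B : InvariantForm 𝔤}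
  {ι : Type*} [Fintype ι] [DecidableEq ι] (b : Module.Basis ι ℝ 𝔤)
  {Y : Type*} [Ring Y] [Algebra ℝ Y] {𝒴 : ZMod 2 → Submodule ℝ Y} [GradedAlgebra 𝒴]
  {E : GDerivations 𝔤 𝒴} {θ : 𝔤 →ₗ[ℝ] Y}

theorem weil_isCartan : (weil B b).IsCartan :=
  ⟨weilD_weilD B b, weil_contr_d B b⟩

variable (B E θ) in
/-- The number operator `d h + h d` of the homotopy `h` on `W𝔤 ⊗ Y`. -/
def connNumber : Module.End ℝ (weilGrading 𝔤 ᵍ⊗[ℝ] 𝒴) :=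
  ((weil B b).tensor E).d ∘ₗ connHomotopy B b 𝒴 θ +
    connHomotopy B b 𝒴 θ ∘ₗ ((weil B b).tensor E).d

theorem connNumber_apply (t : weilGrading 𝔤 ᵍ⊗[ℝ] 𝒴) : connNumber B b E θ t =
    ((weil B b).tensor E).d (connHomotopy B b 𝒴 θ t) +
      connHomotopy B b 𝒴 θ (((weil B b).tensor E).d t) := rfl

theorem connNumber_mul (hθ : E.IsConnection B θ) (t u : weilGrading 𝔤 ᵍ⊗[ℝ] 𝒴) :
    connNumber B b E θ (t * u) = connNumber B b E θ t * u + t * connNumber B b E θ u :=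
  odd_anticomm_mul (p := parity (gtensorGrading (weilGrading 𝔤) 𝒴)) (parity_parity _)
    ((weil B b).tensor E).d_odd ((weil B b).tensor E).d_mul (connHomotopy_parity B b hθ)
    (connHomotopy_mul B b hθ) t u

theorem connNumber_gincr (y : Y) : connNumber B b E θ (gincr (weilGrading 𝔤) 𝒴 y) = 0 := by
  rw [connNumber_apply, connHomotopy_gincr, ← (gincr_isMorphism (weil B b) E).d,
    connHomotopy_gincr, map_zero, add_zero]

theorem connNumber_connDiff (ξ : 𝔤) :
    connNumber B b E θ (connDiff 𝒴 θ ξ) = connDiff 𝒴 θ ξ := by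
  rw [connNumber_apply, connHomotopy_connDiff, connHomotopy_d_connDiff, map_zero, zero_add]

theorem connNumber_d_connDiff (hE : E.IsCartan) (ξ : 𝔤) :
    connNumber B b E θ (((weil B b).tensor E).d (connDiff 𝒴 θ ξ)) =
      ((weil B b).tensor E).d (connDiff 𝒴 θ ξ) := by
  rw [connNumber_apply, connHomotopy_d_connDiff, ((weil_isCartan b).tensor hE).d_d, map_zero,
    add_zero]

theorem gincl_mul (x x' : Weil 𝔤) : gincl (weilGrading 𝔤) 𝒴 (x * x') =
    gincl (weilGrading 𝔤) 𝒴 x * gincl (weilGrading 𝔤) 𝒴 x' := (gtmul_one_mul x x' 1).symm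

theorem gincl_one : gincl (weilGrading 𝔤) 𝒴 1 = 1 := rfl

theorem gincr_mul (y y' : Y) : gincr (weilGrading 𝔤) 𝒴 (y * y') =
    gincr (weilGrading 𝔤) 𝒴 y * gincr (weilGrading 𝔤) 𝒴 y' :=
  (gtmul_mul_one_gtmul 1 y y').symm

theorem gincl_mul_gincr (x : Weil 𝔤) (y : Y) :
    gincl (weilGrading 𝔤) 𝒴 x * gincr (weilGrading 𝔤) 𝒴 y = x ᵍ⊗ₜ[ℝ] y := by
  rw [gincl_apply, gincr_apply, gtmul_mul_one_gtmul, one_mul]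

/-- The algebra `W𝔤 ⊗ Y` is generated by `Y`, the `τ_ξ` and the `d τ_ξ`; the number operator is the
derivation with the weights `0`, `1` and `1` on these generators. -/
theorem mem_span_connNumber (hθ : E.IsConnection B θ) (hE : E.IsCartan)
    (t : weilGrading 𝔤 ᵍ⊗[ℝ] 𝒴) : t ∈ Submodule.span ℝ
      {t | t ∈ LinearMap.range (gincr (weilGrading 𝔤) 𝒴) ∨
        ∃ k : ℕ, 0 < k ∧ connNumber B b E θ t = (k : ℝ) • t} := by
  set S := {t | t ∈ LinearMap.range (gincr (weilGrading 𝔤) 𝒴) ∨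
        ∃ k : ℕ, 0 < k ∧ connNumber B b E θ t = (k : ℝ) • t} with hS
  set M := Submodule.span ℝ S with hM
  have hmul : ∀ x ∈ M, ∀ y ∈ M, x * y ∈ M := by
    intro x hx y hy
    have h := Submodule.mul_mem_mul hx hy
    rw [hM, Submodule.span_mul_span] at h
    refine Submodule.span_mono ?_ h
    rintro _ ⟨u, hu, v, hv, rfl⟩
    rcases hu with ⟨u, rfl⟩ | ⟨k, hk, hu⟩ <;> rcases hv with ⟨v, rfl⟩ | ⟨l, hl, hv⟩
    · exact Or.inl ⟨u * v, gincr_mul u v⟩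
    · refine Or.inr ⟨l, hl, ?_⟩
      change connNumber B b E θ (_ * _) = _
      rw [connNumber_mul b hθ, connNumber_gincr, hv, zero_mul, zero_add, mul_smul_comm]
    · refine Or.inr ⟨k, hk, ?_⟩
      change connNumber B b E θ (_ * _) = _
      rw [connNumber_mul b hθ, connNumber_gincr, hu, mul_zero, add_zero, smul_mul_assoc]
    · refine Or.inr ⟨k + l, by omega, ?_⟩
      change connNumber B b E θ (_ * _) = _
      rw [connNumber_mul b hθ, hu, hv, smul_mul_assoc, mul_smul_comm, ← add_smul, Nat.cast_add]
  have hr : ∀ y, gincr (weilGrading 𝔤) 𝒴 y ∈ M := fun y => Submodule.subset_span (Or.inl ⟨y, rfl⟩)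
  have h1 : gincl (weilGrading 𝔤) 𝒴 1 ∈ M := hr 1
  have hτ : ∀ ξ, connDiff 𝒴 θ ξ ∈ M := fun ξ => Submodule.subset_span (Or.inr ⟨1, one_pos, by
    rw [connNumber_connDiff, Nat.cast_one, one_smul]⟩)
  have hdτ : ∀ ξ, ((weil B b).tensor E).d (connDiff 𝒴 θ ξ) ∈ M := fun ξ =>
    Submodule.subset_span (Or.inr ⟨1, one_pos, by
      rw [connNumber_d_connDiff b hE, Nat.cast_one, one_smul]⟩)
  have hext : ∀ ω, gincl (weilGrading 𝔤) 𝒴 (1 ⊗ₜ ω) ∈ M := by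
    intro ω
    induction ω using CliffordAlgebra.induction with
    | algebraMap r =>
      rw [Algebra.algebraMap_eq_smul_one, TensorProduct.tmul_smul, map_smul]
      exact M.smul_mem r h1
    | ι v =>
      -- `1 ⊗ v = τ_v + θ_v`.
      have h := add_mem (hτ v) (hr (θ v))
      rw [connDiff_apply, gincr_apply, sub_add_cancel] at h
      exact h
    | add x y hx hy =>
      rw [TensorProduct.tmul_add, map_add]
      exact add_mem hx hy
    | mul x y hx hy =>
      have h := hmul _ hx _ hy
      rwa [← gincl_mul, Algebra.TensorProduct.tmul_mul_tmul, one_mul] at h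
  have hsym : ∀ s, gincl (weilGrading 𝔤) 𝒴 (s ⊗ₜ 1) ∈ M := by
    intro s
    induction s using SymmetricAlgebra.induction with
    | algebraMap r =>
      rw [Algebra.algebraMap_eq_smul_one, ← TensorProduct.smul_tmul', map_smul]
      exact M.smul_mem r h1
    | ι v =>
      -- `d τ_v = v ⊗ 1 + 1 ⊗ d v - d θ_v`, which recovers the generators of `S𝔤`.
      have h := hdτ v
      have hw : (weil B b).d (1 ⊗ₜ ExteriorAlgebra.ι ℝ v) = _ := weilD_ext B b v
      rw [connDiff_apply, map_sub, ← gincl_apply, ← gincr_apply,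
        ← (gincl_isMorphism (weil B b) E).d, ← (gincr_isMorphism (weil B b) E).d, hw,
        map_add] at h
      have h2 := sub_mem (add_mem h (hr (E.d (θ v)))) (hext (extD B b (ExteriorAlgebra.ι ℝ v)))
      rwa [sub_add_cancel, add_sub_cancel_right] at h2
    | add x y hx hy =>
      rw [TensorProduct.add_tmul, map_add]
      exact add_mem hx hy
    | mul x y hx hy =>
      have h := hmul _ hx _ hy
      rwa [← gincl_mul, Algebra.TensorProduct.tmul_mul_tmul, one_mul] at h
  have hl : ∀ w, gincl (weilGrading 𝔤) 𝒴 w ∈ M := by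
    intro w
    induction w using TensorProduct.induction_on with
    | zero => rw [map_zero]; exact zero_mem _
    | add x y hx hy =>
      rw [map_add]
      exact add_mem hx hy
    | tmul s ω =>
      have h := hmul _ (hsym s) _ (hext ω)
      rwa [← gincl_mul, Algebra.TensorProduct.tmul_mul_tmul, one_mul, mul_one] at h
  induction t using gtensor_induction with
  | hadd u v hu hv => exact add_mem hu hv
  | he x hx y | ho x hx y =>
    rw [← gincl_mul_gincr]
    exact hmul _ (hl x) _ (hr y)

/-- On an algebra with a connection, the inclusion `Y → W𝔤 ⊗ Y` is a homotopy equivalence of basic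
complexes: a morphism that vanishes on `Y` is exact on basic cocycles. -/
theorem GDerivations.IsMorphism.exact_of_connection {Z : Type*} [Ring Z] [Algebra ℝ Z]
    {𝒵 : ZMod 2 → Submodule ℝ Z} [GradedAlgebra 𝒵] {G : GDerivations 𝔤 𝒵}
    (hθ : E.IsConnection B θ) (hE : E.IsCartan) {K : weilGrading 𝔤 ᵍ⊗[ℝ] 𝒴 →ₗ[ℝ] Z}
    (hK : ((weil B b).tensor E).IsMorphism G K) (hr : ∀ y, K (gincr (weilGrading 𝔤) 𝒴 y) = 0)
    {z : weilGrading 𝔤 ᵍ⊗[ℝ] 𝒴} (hz : z ∈ ((weil B b).tensor E).cocycles) :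
    ∃ y ∈ G.basic, G.d y = K z := by
  refine hK.exact_of_homotopy _ _ ((weil_isCartan b).tensor hE) (connHomotopy B b 𝒴 θ)
    (connHomotopy_contr B b hθ) (connHomotopy_lie B b hθ)
    (LinearMap.range (gincr (weilGrading 𝔤) 𝒴)) ?_ ?_ (mem_span_connNumber b hθ hE) hz
  · rintro _ ⟨y, rfl⟩
    exact connNumber_gincr b y
  · rintro _ ⟨y, rfl⟩
    exact hr y

end NumberOperator

/-! ### The quantization map preserves the parity -/

section QuantizationParity

variable {𝔤 : Type*} [LieRing 𝔤] [LieAlgebra ℝ 𝔤] (B : InvariantForm 𝔤)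
  {ι : Type*} [Fintype ι] [DecidableEq ι] (b : Module.Basis ι ℝ 𝔤)

theorem contractLeft_involute (f : Module.Dual ℝ 𝔤) (x : B.Cl) :
    CliffordAlgebra.contractLeft f (CliffordAlgebra.involute x) =
      -CliffordAlgebra.involute (CliffordAlgebra.contractLeft f x) := by
  induction x using CliffordAlgebra.left_induction with
  | algebraMap r => simp [CliffordAlgebra.contractLeft_algebraMap]
  | add x y hx hy => simp only [map_add, hx, hy, neg_add]
  | ι_mul x v hx =>
    rw [map_mul, CliffordAlgebra.involute_ι, neg_mul, map_neg, CliffordAlgebra.contractLeft_ι_mul,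
      CliffordAlgebra.contractLeft_ι_mul, hx, map_sub, map_mul, map_smul,
      CliffordAlgebra.involute_ι, mul_neg, neg_mul]

theorem extToCl_involute (ω : ExteriorAlgebra ℝ 𝔤) :
    extToCl B (CliffordAlgebra.involute ω) = CliffordAlgebra.involute (extToCl B ω) := by
  induction ω using CliffordAlgebra.left_induction with
  | algebraMap r =>
    rw [AlgHom.commutes, Algebra.algebraMap_eq_smul_one, map_smul, map_smul, extToCl_one, map_one]
  | add x y hx hy => simp only [map_add, hx, hy]
  | ι_mul x v hx =>
    have h := extToCl_ι_mul B v
    rw [map_mul, CliffordAlgebra.involute_ι, neg_mul, map_neg]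
    refine (congrArg Neg.neg (h _)).trans ?_
    refine Eq.trans ?_ (congrArg CliffordAlgebra.involute (h x)).symm
    rw [hx, contractLeft_involute, map_sub, map_mul, map_smul, CliffordAlgebra.involute_ι, smul_neg,
      sub_neg_eq_add, neg_add, neg_mul, sub_eq_add_neg]

theorem extContrHom_involute (c ω : ExteriorAlgebra ℝ 𝔤) :
    B.extContrHom c (CliffordAlgebra.involute ω) =
      CliffordAlgebra.involute (B.extContrHom (CliffordAlgebra.involute c) ω) := by
  induction c using CliffordAlgebra.induction generalizing ω with
  | algebraMap r =>
    have h : ∀ ω, B.extContrHom (algebraMap ℝ (ExteriorAlgebra ℝ 𝔤) r) ω = r • ω := fun ω => by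
      rw [AlgHom.commutes]
      rfl
    have h' : CliffordAlgebra.involute (algebraMap ℝ (ExteriorAlgebra ℝ 𝔤) r) =
        algebraMap ℝ _ r := AlgHom.commutes _ _
    rw [h']
    exact (h _).trans ((map_smul _ r ω).symm.trans (congrArg _ (h ω).symm))
  | ι v =>
    have h : B.extContrHom (CliffordAlgebra.ι 0 v) = B.extContr v :=
      ExteriorAlgebra.lift_ι_apply _ _ _ _
    rw [CliffordAlgebra.involute_ι, map_neg, h, B.extContr_involute, LinearMap.neg_apply, map_neg]
  | mul x y hx hy =>
    rw [map_mul, map_mul, map_mul, Module.End.mul_apply, Module.End.mul_apply, hy, hx]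
  | add x y hx hy =>
    rw [map_add, map_add, map_add, LinearMap.add_apply, LinearMap.add_apply, hx, hy, map_add]

/-- The coefficients of `S` are even elements of `Λ𝔤`. -/
theorem map_involute_sSeries :
    MvPowerSeries.map (CliffordAlgebra.involute :
      ExteriorAlgebra ℝ 𝔤 →ₐ[ℝ] ExteriorAlgebra ℝ 𝔤).toRingHom (sSeries B b) = sSeries B b := by
  set J : ExteriorAlgebra ℝ 𝔤 →ₐ[ℝ] ExteriorAlgebra ℝ 𝔤 := CliffordAlgebra.involute with hJ
  have hι : ∀ v, J (ExteriorAlgebra.ι ℝ v) = -ExteriorAlgebra.ι ℝ v := fun v =>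
    CliffordAlgebra.involute_ι v
  have halg : ∀ p : MvPowerSeries ι ℝ, MvPowerSeries.map J.toRingHom
      (MvPowerSeries.map (algebraMap ℝ (ExteriorAlgebra ℝ 𝔤)) p) =
        MvPowerSeries.map (algebraMap ℝ (ExteriorAlgebra ℝ 𝔤)) p := fun p => by
    ext α
    rw [MvPowerSeries.coeff_map, MvPowerSeries.coeff_map]
    exact J.commutes _
  have hsmul : ∀ (r : ℝ) (p : MvPowerSeries ι (ExteriorAlgebra ℝ 𝔤)),
      MvPowerSeries.map J.toRingHom (r • p) = r • MvPowerSeries.map J.toRingHom p := fun r p => by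
    ext α
    exact map_smul J r _
  have hr : MvPowerSeries.map J.toRingHom (rSeries B b) = rSeries B b := by
    rw [rSeries, map_sum]
    refine Finset.sum_congr rfl fun a _ => ?_
    rw [map_sum]
    refine Finset.sum_congr rfl fun c _ => ?_
    rw [map_mul, halg, MvPowerSeries.map_C]
    congr 2
    change J _ = _
    rw [map_smul, map_mul, hι, hι, neg_mul_neg]
  rw [sSeries, map_mul, halg, map_sum]
  congr 1
  refine Finset.sum_congr rfl fun k _ => ?_
  rw [hsmul, map_pow, hr]

/-- The coefficients of `S` are even, so the quantization map preserves the parity. -/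
theorem quantization_parity (w : Weil 𝔤) :
    quantization B b (weilParity 𝔤 w) = ncWeilParity B (quantization B b w) := by
  have : FiniteDimensional ℝ 𝔤 := Module.Finite.of_basis b
  have hc : ∀ α, CliffordAlgebra.involute (MvPowerSeries.coeff α (sSeries B b)) =
      MvPowerSeries.coeff α (sSeries B b) := fun α => by
    conv_rhs => rw [← map_involute_sSeries B b, MvPowerSeries.coeff_map]
    rfl
  have h1 : ∀ w, weilDiffOp B b (sSeries B b) (weilParity 𝔤 w) =
      weilParity 𝔤 (weilDiffOp B b (sSeries B b) w) := fun w => by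
    suffices h : weilDiffOp B b (sSeries B b) ∘ₗ (weilParity 𝔤).toLinearMap =
      (weilParity 𝔤).toLinearMap ∘ₗ weilDiffOp B b (sSeries B b) from LinearMap.congr_fun h w
    refine weil_tmul_ext fun s ω => ?_
    simp only [LinearMap.comp_apply, AlgHom.toLinearMap_apply, weilParity_tmul]
    change ∑ᶠ α, symPartial b α s ⊗ₜ[ℝ] B.extContrHom (MvPowerSeries.coeff α (sSeries B b)) _ =
      weilParity 𝔤 (∑ᶠ α, TensorProduct.map (symPartial b α)
        (B.extContrHom (MvPowerSeries.coeff α (sSeries B b))) (s ⊗ₜ ω))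
    refine Eq.trans (finsum_congr fun α => ?_)
      (AddMonoidHom.map_finsum (weilParity 𝔤).toLinearMap.toAddMonoidHom
        (weilDiffOp_finite b (fun α => B.extContrHom (MvPowerSeries.coeff α (sSeries B b)))
          (s ⊗ₜ ω))).symm
    rw [extContrHom_involute, hc]
    exact (weilParity_tmul _ _).symm
  rw [quantization, LinearMap.comp_apply, LinearMap.comp_apply, h1, cliffordQuantization_eq]
  generalize weilDiffOp B b (sSeries B b) w = u
  induction u using TensorProduct.induction_on with
  | zero => simp
  | add x y hx hy => simp only [map_add, hx, hy]
  | tmul s ω =>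
    rw [weilParity_tmul, TensorProduct.map_tmul, TensorProduct.map_tmul, ncWeilParity,
      Algebra.TensorProduct.map_tmul]
    congr 1
    exact extToCl_involute B ω

end QuantizationParity

/-! ### Multiplicativity of the quantization map up to coboundaries -/

section Multiplicativity

open GradedTensorProduct

variable {𝔤 : Type*} [LieRing 𝔤] [LieAlgebra ℝ 𝔤] (B : InvariantForm 𝔤)
  {ι : Type*} [Fintype ι] [DecidableEq ι] (b : Module.Basis ι ℝ 𝔤)
  {A : Type*} [Ring A] [Algebra ℝ A] {𝒜 : ZMod 2 → Submodule ℝ A} [GradedAlgebra 𝒜]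

theorem quantization_isMorphism : (weil B b).IsMorphism (ncWeil B b) (quantization B b) :=
  ⟨quantization_weilD B b, quantization_contr B b, quantization_lie B b⟩

theorem quantization_gradedParity (w : Weil 𝔤) : quantization B b (parity (weilGrading 𝔤) w) =
    parity (ncWeilGrading B) (quantization B b w) := by
  rw [parity_invol, parity_invol, quantization_parity]

variable (𝒜) in
/-- The connection `1 ⊗ ξ ⊗ 1` of `W𝔤 ⊗ A`. -/
def weilConnection : 𝔤 →ₗ[ℝ] weilGrading 𝔤 ᵍ⊗[ℝ] 𝒜 :=
  gincl (weilGrading 𝔤) 𝒜 ∘ₗ TensorProduct.mk ℝ _ _ 1 ∘ₗ ExteriorAlgebra.ι ℝ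

theorem weilConnection_apply (ξ : 𝔤) : weilConnection 𝒜 ξ =
    (1 ⊗ₜ ExteriorAlgebra.ι ℝ ξ : Weil 𝔤) ᵍ⊗ₜ[ℝ] (1 : A) := rfl

theorem weilConnection_isConnection (E : GDerivations 𝔤 𝒜) :
    ((weil B b).tensor E).IsConnection B (weilConnection 𝒜) where
  odd ξ := by
    rw [weilConnection_apply, parity_gtmul, parity_one, parity_invol, weilParity_tmul, ← neg_gtmul,
      ← TensorProduct.tmul_neg]
    exact congrArg (fun x => ((1 : SymmetricAlgebra ℝ 𝔤) ⊗ₜ[ℝ] x : Weil 𝔤) ᵍ⊗ₜ[ℝ] (1 : A))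
      (CliffordAlgebra.involute_ι ξ)
  comm ξ t := by
    have hodd : (1 ⊗ₜ ExteriorAlgebra.ι ℝ ξ : Weil 𝔤) ∈ weilGrading 𝔤 1 := by
      refine mem_involGrading_one.2 ?_
      rw [weilParity_tmul, ← TensorProduct.tmul_neg]
      congr 1
      exact CliffordAlgebra.involute_ι ξ
    suffices h : LinearMap.mulLeft ℝ (weilConnection 𝒜 ξ) =
        LinearMap.mulRight ℝ (weilConnection 𝒜 ξ) ∘ₗ
          parity (gtensorGrading (weilGrading 𝔤) 𝒜) from LinearMap.congr_fun h t
    refine gtensor_lhom_ext fun x y => ?_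
    rw [LinearMap.mulLeft_apply, LinearMap.comp_apply, LinearMap.mulRight_apply,
      weilConnection_apply, parity_gtmul, gtmul_one_mul, gmul_odd _ _ hodd, parity_parity, mul_one,
      weil_ι_mul, parity_invol]
  contr η ξ := by
    have h : (weil B b).contr η (1 ⊗ₜ ExteriorAlgebra.ι ℝ ξ) = B.form η ξ • 1 := by
      change weilContr B η (1 ⊗ₜ ExteriorAlgebra.ι ℝ ξ) = _
      rw [weilContr_tmul, extContr_ι, Algebra.algebraMap_eq_smul_one, TensorProduct.tmul_smul]
      rfl
    rw [weilConnection_apply, tensor_contr_tmul, h, E.contr_one, gtmul_zero, add_zero, smul_gtmul,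
      gone_def]
  lie η ξ := by
    have h : (weil B b).lie η (1 ⊗ₜ ExteriorAlgebra.ι ℝ ξ) = 1 ⊗ₜ ExteriorAlgebra.ι ℝ ⁅η, ξ⁆ := by
      change weilLie 𝔤 η (1 ⊗ₜ ExteriorAlgebra.ι ℝ ξ) = _
      have h1 : symLie η (1 : SymmetricAlgebra ℝ 𝔤) = 0 := symDer_one _
      rw [weilLie_tmul, h1, TensorProduct.zero_tmul, zero_add, extLie_ι]
    rw [weilConnection_apply, tensor_lie_tmul, h, E.lie_one, gtmul_zero, add_zero,
      weilConnection_apply]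

theorem quantizationTensor_tmul (w : Weil 𝔤) (a : A) :
    quantizationTensor B b 𝒜 (w ᵍ⊗ₜ[ℝ] a) = quantization B b w ᵍ⊗ₜ[ℝ] a := rfl

theorem quantizationTensor_isMorphism (E : GDerivations 𝔤 𝒜) :
    ((weil B b).tensor E).IsMorphism ((ncWeil B b).tensor E) (quantizationTensor B b 𝒜) :=
  (quantization_isMorphism B b).gmap (quantization_gradedParity B b) (id_isMorphism E)

theorem quantizationTensor_one : quantizationTensor B b 𝒜 1 = 1 := by
  rw [gone_def, quantizationTensor_tmul, quantization_one, gone_def]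

/-- `(𝒬 ⊗ 1)((1 ⊗ a) y) = (1 ⊗ a) (𝒬 ⊗ 1)(y)`. -/
theorem quantizationTensor_gincr_mul (a : A) (y : weilGrading 𝔤 ᵍ⊗[ℝ] 𝒜) :
    quantizationTensor B b 𝒜 (gincr (weilGrading 𝔤) 𝒜 a * y) =
      gincr (ncWeilGrading B) 𝒜 a * quantizationTensor B b 𝒜 y := by
  have hp := quantization_parity B b
  induction y using gtensor_induction with
  | hadd u v hu hv => simp only [mul_add, map_add, hu, hv]
  | he x hx y =>
    have hx' : quantization B b x ∈ ncWeilGrading B 0 := mem_involGrading_zero.2 (by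
      rw [← hp, mem_involGrading_zero.1 hx])
    rw [gincr_apply, gincr_apply, gmul_even _ _ hx, quantizationTensor_tmul,
      quantizationTensor_tmul, gmul_even _ _ hx', one_mul, one_mul]
  | ho x hx y =>
    have hx' : quantization B b x ∈ ncWeilGrading B 1 := mem_involGrading_one.2 (by
      rw [← hp, mem_involGrading_one.1 hx, map_neg])
    rw [gincr_apply, gincr_apply, gmul_odd _ _ hx, quantizationTensor_tmul,
      quantizationTensor_tmul, gmul_odd _ _ hx', one_mul, one_mul]

variable (𝒜) in
/-- The map `W𝔤 ⊗ A → W𝔤 ⊗ (W𝔤 ⊗ A)`, `w ⊗ a ↦ w ⊗ (1 ⊗ a)`. -/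
def weilSecond : weilGrading 𝔤 ᵍ⊗[ℝ] 𝒜 →ₗ[ℝ]
    weilGrading 𝔤 ᵍ⊗[ℝ] gtensorGrading (weilGrading 𝔤) 𝒜 :=
  gmap (weilGrading 𝔤) 𝒜 (weilGrading 𝔤) (gtensorGrading (weilGrading 𝔤) 𝒜) LinearMap.id
    (gincr (weilGrading 𝔤) 𝒜)

/-- The quantization map preserves products of basic cocycles up to basic coboundaries. The two
morphisms `w ⊗ y ↦ (𝒬 ⊗ 1)((w ⊗ 1) y)` and `w ⊗ y ↦ (𝒬(w) ⊗ 1) (𝒬 ⊗ 1)(y)` on `W𝔤 ⊗ (W𝔤 ⊗ A)`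
agree on `1 ⊗ y`, and are applied to the cocycle which is the product of `x` in the first factor
`W𝔤` and `A` with `y` in the second factor. -/
theorem quantizationTensor_mul (E : GDerivations 𝔤 𝒜) (hE : E.IsCartan)
    {x y : weilGrading 𝔤 ᵍ⊗[ℝ] 𝒜} (hx : x ∈ ((weil B b).tensor E).cocycles)
    (hy : y ∈ ((weil B b).tensor E).cocycles) :
    ∃ u ∈ ((ncWeil B b).tensor E).basic, ((ncWeil B b).tensor E).d u =
      quantizationTensor B b 𝒜 x * quantizationTensor B b 𝒜 y -
        quantizationTensor B b 𝒜 (x * y) := by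
  have hincl := gincl_isMorphism (weil B b) E
  have hp : ∀ w, gincl (weilGrading 𝔤) 𝒜 (parity (weilGrading 𝔤) w) =
      parity (gtensorGrading (weilGrading 𝔤) 𝒜) (gincl (weilGrading 𝔤) 𝒜 w) := fun w => by
    rw [gincl_apply, gincl_apply, parity_gtmul, parity_one]
  have hQ := quantizationTensor_isMorphism B b E
  have hQl := hQ.comp hincl
  have hQp : ∀ w, (quantizationTensor B b 𝒜 ∘ₗ gincl (weilGrading 𝔤) 𝒜)
      (parity (weilGrading 𝔤) w) = parity (gtensorGrading (ncWeilGrading B) 𝒜)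
        ((quantizationTensor B b 𝒜 ∘ₗ gincl (weilGrading 𝔤) 𝒜) w) := fun w => by
    rw [LinearMap.comp_apply, LinearMap.comp_apply, gincl_apply, gincl_apply,
      quantizationTensor_tmul, quantizationTensor_tmul, parity_gtmul, parity_one,
      quantization_gradedParity]
  -- The morphisms `w ⊗ y ↦ (𝒬(w) ⊗ 1) (𝒬 ⊗ 1)(y)` and `w ⊗ y ↦ (𝒬 ⊗ 1)((w ⊗ 1) y)`.
  have hK1 := hQl.gtensorMul hQp hQ
  have hK2 := hQ.comp (hincl.gtensorMul hp (id_isMorphism ((weil B b).tensor E)))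
  -- The cocycle `(w ⊗ (1 ⊗ a)) (1 ⊗ y)`, for `x = w ⊗ a`: the two morphisms map it to
  -- `(𝒬 ⊗ 1)(x) (𝒬 ⊗ 1)(y)` and to `(𝒬 ⊗ 1)(x y)`.
  have hz : weilSecond 𝒜 x * gincr (weilGrading 𝔤) (gtensorGrading (weilGrading 𝔤) 𝒜) y ∈
      ((weil B b).tensor ((weil B b).tensor E)).cocycles :=
    mul_mem (((id_isMorphism (weil B b)).gmap (fun _ => rfl)
        (gincr_isMorphism (weil B b) E)).mem_cocycles hx)
      ((gincr_isMorphism (weil B b) ((weil B b).tensor E)).mem_cocycles hy)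
  obtain ⟨u, hu, h⟩ := (hK1.sub hK2).exact_of_connection b (weilConnection_isConnection B b E)
    ((weil_isCartan b).tensor hE) (fun y => by
      rw [LinearMap.sub_apply, LinearMap.comp_apply, gincr_apply, gtensorMul_tmul, gtensorMul_tmul,
        LinearMap.comp_apply, gincl_one, one_mul, quantizationTensor_one, one_mul,
        LinearMap.id_apply, sub_self]) hz
  refine ⟨u, hu, h.trans ?_⟩
  rw [LinearMap.sub_apply]
  clear h hz hu hx
  induction x using gtensor_induction with
  | hadd x x' h h' =>
    simp only [map_add, add_mul] at h h' ⊢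
    rw [add_sub_add_comm, add_sub_add_comm, h, h']
  | he x hx a | ho x hx a =>
    all_goals
    have h1 : weilSecond 𝒜 (x ᵍ⊗ₜ[ℝ] a) *
        gincr (weilGrading 𝔤) (gtensorGrading (weilGrading 𝔤) 𝒜) y =
          x ᵍ⊗ₜ[ℝ] (gincr (weilGrading 𝔤) 𝒜 a * y) := gtmul_mul_one_gtmul _ _ _
    have h3 : (x ᵍ⊗ₜ[ℝ] (1 : A) : weilGrading 𝔤 ᵍ⊗[ℝ] 𝒜) * gincr (weilGrading 𝔤) 𝒜 a =
        x ᵍ⊗ₜ[ℝ] a := gincl_mul_gincr x a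
    have h2 : quantization B b x ᵍ⊗ₜ[ℝ] a =
        (quantization B b x ᵍ⊗ₜ[ℝ] (1 : A) : ncWeilGrading B ᵍ⊗[ℝ] 𝒜) *
          gincr (ncWeilGrading B) 𝒜 a := by
      rw [gincr_apply, gtmul_mul_one_gtmul, one_mul]
    rw [h1, LinearMap.comp_apply, gtensorMul_tmul, gtensorMul_tmul, LinearMap.id_apply,
      quantizationTensor_gincr_mul, LinearMap.comp_apply, gincl_apply, quantizationTensor_tmul,
      quantizationTensor_tmul, h2, mul_assoc, ← mul_assoc (x ᵍ⊗ₜ[ℝ] (1 : A)), h3]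

end Multiplicativity

/-! ### The isomorphism of basic cohomology algebras -/

section Cohomology

variable {𝔤 : Type*} [LieRing 𝔤] [LieAlgebra ℝ 𝔤]
  {T : Type*} [Ring T] [Algebra ℝ T] {𝒯 : ZMod 2 → Submodule ℝ T} [GradedAlgebra 𝒯]
  {Z : Type*} [Ring Z] [Algebra ℝ Z] {𝒵 : ZMod 2 → Submodule ℝ Z} [GradedAlgebra 𝒵]
  {F : GDerivations 𝔤 𝒯} {G : GDerivations 𝔤 𝒵} {K : T →ₗ[ℝ] Z}

theorem GDerivations.IsMorphism.mem_basic_iff (hK : F.IsMorphism G K)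
    (hinj : Function.Injective K) {x : T} : K x ∈ G.basic ↔ x ∈ F.basic := by
  refine ⟨fun h ξ => ⟨hinj ?_, hinj ?_⟩, hK.mem_basic⟩
  · rw [hK.contr, (h ξ).1, map_zero]
  · rw [hK.lie, (h ξ).2, map_zero]

theorem GDerivations.IsMorphism.mem_cocycles_iff (hK : F.IsMorphism G K)
    (hinj : Function.Injective K) {x : T} : K x ∈ G.cocycles ↔ x ∈ F.cocycles := by
  refine ⟨fun h => ⟨(hK.mem_basic_iff hinj).1 h.1, hinj ?_⟩, hK.mem_cocycles⟩
  rw [hK.d, h.2, map_zero]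

/-- A bijective morphism that is multiplicative on basic cocycles up to basic coboundaries induces
an isomorphism of the basic cohomology algebras. -/
theorem GDerivations.IsMorphism.exists_algEquiv (hK : F.IsMorphism G K)
    (hbij : Function.Bijective K) (hone : K 1 = 1)
    (hmul : ∀ x ∈ F.cocycles, ∀ y ∈ F.cocycles, ∃ u ∈ G.basic, G.d u = K x * K y - K (x * y)) :
    ∃ Φ : F.BasicCohomology ≃ₐ[ℝ] G.BasicCohomology, ∀ z : F.cocycles,
      ∃ h : K z ∈ G.cocycles, Φ (Ideal.Quotient.mk _ z) = Ideal.Quotient.mk _ ⟨_, h⟩ := by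
  let Kc : F.cocycles →ₗ[ℝ] G.cocycles :=
    { toFun := fun z => ⟨K z, hK.mem_cocycles z.2⟩
      map_add' := fun z z' => Subtype.ext (map_add K _ _)
      map_smul' := fun r z => Subtype.ext (map_smul K r _) }
  let f : F.cocycles →ₐ[ℝ] G.BasicCohomology :=
    AlgHom.ofLinearMap ((Ideal.Quotient.mkₐ ℝ G.coboundaries).toLinearMap ∘ₗ Kc)
      (congrArg (Ideal.Quotient.mk G.coboundaries) (Subtype.ext hone)) fun x y => by
        refine (Ideal.Quotient.eq.2 ?_ : Ideal.Quotient.mk G.coboundaries (Kc (x * y)) =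
          Ideal.Quotient.mk G.coboundaries (Kc x * Kc y))
        obtain ⟨u, hu, h⟩ := hmul x x.2 y y.2
        refine ⟨-u, neg_mem hu, ?_⟩
        rw [map_neg, h, neg_sub]
        rfl
  have hf : ∀ z, f z = Ideal.Quotient.mk G.coboundaries (Kc z) := fun z => rfl
  have hzero : ∀ z, f z = 0 ↔ z ∈ F.coboundaries := by
    intro z
    rw [hf, Ideal.Quotient.eq_zero_iff_mem]
    constructor
    · rintro ⟨y, hy, h⟩
      obtain ⟨y, rfl⟩ := hbij.2 y
      refine ⟨y, (hK.mem_basic_iff hbij.1).1 hy, hbij.1 ?_⟩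
      rw [hK.d, h]
      rfl
    · rintro ⟨y, hy, h⟩
      exact ⟨K y, hK.mem_basic hy, by rw [← hK.d, h]; rfl⟩
  let Φ : F.BasicCohomology →ₐ[ℝ] G.BasicCohomology :=
    Ideal.Quotient.liftₐ F.coboundaries f fun z hz => (hzero z).2 hz
  have hΦ : ∀ z, Φ (Ideal.Quotient.mk _ z) = Ideal.Quotient.mk G.coboundaries (Kc z) := fun z => rfl
  refine ⟨AlgEquiv.ofBijective Φ ⟨(injective_iff_map_eq_zero Φ).2 fun q hq => ?_, fun q => ?_⟩,
    fun z => ⟨(Kc z).2, hΦ z⟩⟩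
  · obtain ⟨z, rfl⟩ := Ideal.Quotient.mk_surjective q
    exact Ideal.Quotient.eq_zero_iff_mem.2 ((hzero z).1 hq)
  · obtain ⟨z, rfl⟩ := Ideal.Quotient.mk_surjective q
    obtain ⟨x, hx⟩ := hbij.2 (z : Z)
    refine ⟨Ideal.Quotient.mk _ ⟨x, (hK.mem_cocycles_iff hbij.1).1 (hx ▸ z.2)⟩, ?_⟩
    rw [hΦ]
    exact congrArg _ (Subtype.ext hx)

end Cohomology

section QuantizationTensor

open GradedTensorProduct

variable {𝔤 : Type*} [LieRing 𝔤] [LieAlgebra ℝ 𝔤] (B : InvariantForm 𝔤)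
  {ι : Type*} [Fintype ι] [DecidableEq ι] (b : Module.Basis ι ℝ 𝔤)
  {A : Type*} [Ring A] [Algebra ℝ A] {𝒜 : ZMod 2 → Submodule ℝ A} [GradedAlgebra 𝒜]

theorem quantizationTensor_bijective : Function.Bijective (quantizationTensor B b 𝒜) := by
  have h := (TensorProduct.congr (LinearEquiv.ofBijective _ (quantization_bijective B b))
    (LinearEquiv.refl ℝ A)).bijective
  exact ((of ℝ (ncWeilGrading B) 𝒜).bijective.comp h).comp
    (of ℝ (weilGrading 𝔤) 𝒜).symm.bijective

theorem GDifferentialAlgebra.isCartan (D : GDifferentialAlgebra 𝔤 𝒜) : D.toGDerivations.IsCartan :=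
  ⟨D.d_d, D.contr_d⟩

end QuantizationTensor

/-! ### The Duflo isomorphism -/

section Duflo

open GradedTensorProduct

variable {𝔤 : Type*} [LieRing 𝔤] [LieAlgebra ℝ 𝔤] (B : InvariantForm 𝔤)
  {ι : Type*} [Fintype ι] [DecidableEq ι] (b : Module.Basis ι ℝ 𝔤)

/-- The grading of `ℝ` for which all elements are even. -/
abbrev realGrading : ZMod 2 → Submodule ℝ ℝ := involGrading (AlgHom.id ℝ ℝ)

instance : GradedAlgebra realGrading := involGradedAlgebra (AlgHom.id ℝ ℝ) fun _ => rfl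

variable (𝔤) in
/-- The trivial `𝔤`-differential algebra `ℝ`. -/
def trivialDerivations : GDerivations 𝔤 realGrading where
  d := 0
  contr := 0
  lie := 0
  d_odd x := by simp
  contr_odd ξ x := by simp
  lie_even ξ x := by simp
  d_mul x y := by simp
  contr_mul ξ x y := by simp
  lie_mul ξ x y := by simp

theorem trivialDerivations_isCartan : (trivialDerivations 𝔤).IsCartan :=
  ⟨fun _ => rfl, fun _ _ => add_zero _⟩

/-- The quantization map is multiplicative on the basic cocycles of `W𝔤` up to coboundaries. -/
theorem quantization_mul {x y : Weil 𝔤} (hx : x ∈ (weil B b).cocycles)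
    (hy : y ∈ (weil B b).cocycles) : ∃ u ∈ (ncWeil B b).basic, (ncWeil B b).d u =
      quantization B b x * quantization B b y - quantization B b (x * y) := by
  have hincl := gincl_isMorphism (weil B b) (trivialDerivations 𝔤)
  obtain ⟨u, hu, h⟩ := quantizationTensor_mul B b (trivialDerivations 𝔤)
    trivialDerivations_isCartan (hincl.mem_cocycles hx) (hincl.mem_cocycles hy)
  have hunit : (trivialDerivations 𝔤).IsMorphism (ncWeil B b) (Algebra.linearMap ℝ (NCWeil B)) := by
    constructor
    · intro r
      rw [Algebra.linearMap_apply, Algebra.linearMap_apply, Algebra.algebraMap_eq_smul_one r,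
        map_smul, (ncWeil B b).d_one, smul_zero]
      exact map_zero _
    · intro ξ r
      rw [Algebra.linearMap_apply, Algebra.linearMap_apply, Algebra.algebraMap_eq_smul_one r,
        map_smul, (ncWeil B b).contr_one, smul_zero]
      exact map_zero _
    · intro ξ r
      rw [Algebra.linearMap_apply, Algebra.linearMap_apply, Algebra.algebraMap_eq_smul_one r,
        map_smul, (ncWeil B b).lie_one, smul_zero]
      exact map_zero _
  have hm := (id_isMorphism (ncWeil B b)).gtensorMul (fun _ => rfl) hunit
  have hid : ∀ v : NCWeil B, gtensorMul (𝒳 := ncWeilGrading B) (𝒴 := realGrading) LinearMap.id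
      (Algebra.linearMap ℝ (NCWeil B)) (v ᵍ⊗ₜ[ℝ] 1) = v := fun v => by
    rw [gtensorMul_tmul, Algebra.linearMap_apply, map_one, LinearMap.id_apply, mul_one]
  refine ⟨_, hm.mem_basic hu, ?_⟩
  rw [← hm.d, h, ← gincl_mul, gincl_apply, gincl_apply, gincl_apply, quantizationTensor_tmul,
    quantizationTensor_tmul, quantizationTensor_tmul, gtmul_one_mul, map_sub, hid, hid]

theorem algebraMapInv_extContrHom (c : ExteriorAlgebra ℝ 𝔤) :
    B.extContrHom c 1 = ExteriorAlgebra.algebraMapInv c • 1 := by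
  induction c using CliffordAlgebra.induction with
  | algebraMap r =>
    have h : B.extContrHom (algebraMap ℝ (ExteriorAlgebra ℝ 𝔤) r) = algebraMap ℝ _ r :=
      AlgHom.commutes _ _
    have h' : ExteriorAlgebra.algebraMapInv (algebraMap ℝ (ExteriorAlgebra ℝ 𝔤) r) = r :=
      AlgHom.commutes _ _
    exact (LinearMap.congr_fun h 1).trans (by rw [h']; rfl)
  | ι v =>
    have h : B.extContrHom (CliffordAlgebra.ι 0 v) = B.extContr v :=
      ExteriorAlgebra.lift_ι_apply _ _ _ _
    have h' : ExteriorAlgebra.algebraMapInv (CliffordAlgebra.ι (0 : QuadraticForm ℝ 𝔤) v) =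
        (0 : ℝ) := ExteriorAlgebra.lift_ι_apply _ _ _ _
    rw [h, h', extContr_one, zero_smul]
  | mul x y hx hy =>
    rw [map_mul, map_mul, Module.End.mul_apply, hy, map_smul, hx, smul_smul, mul_comm]
  | add x y hx hy => rw [map_add, map_add, LinearMap.add_apply, hx, hy, add_smul]

/-- The scalar part of `S` is `J^{1/2}`. -/
theorem algebraMapInv_coeff_sSeries (α : ι →₀ ℕ) :
    ExteriorAlgebra.algebraMapInv (MvPowerSeries.coeff α (sSeries B b)) =
      MvPowerSeries.coeff α (jDetSqrt b) := by
  set ε : ExteriorAlgebra ℝ 𝔤 →ₐ[ℝ] ℝ := ExteriorAlgebra.algebraMapInv with hε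
  have hι : ∀ v, ε (ExteriorAlgebra.ι ℝ v) = 0 := fun v => ExteriorAlgebra.lift_ι_apply _ _ _ _
  have halg : ∀ p : MvPowerSeries ι ℝ, MvPowerSeries.map ε.toRingHom
      (MvPowerSeries.map (algebraMap ℝ (ExteriorAlgebra ℝ 𝔤)) p) = p := fun p => by
    ext α
    rw [MvPowerSeries.coeff_map, MvPowerSeries.coeff_map]
    exact ε.commutes _
  have hsmul : ∀ (r : ℝ) (p : MvPowerSeries ι (ExteriorAlgebra ℝ 𝔤)),
      MvPowerSeries.map ε.toRingHom (r • p) = r • MvPowerSeries.map ε.toRingHom p := fun r p => by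
    ext α
    exact map_smul ε r _
  have hr : MvPowerSeries.map ε.toRingHom (rSeries B b) = 0 := by
    rw [rSeries, map_sum]
    refine Finset.sum_eq_zero fun a _ => ?_
    rw [map_sum]
    refine Finset.sum_eq_zero fun c _ => ?_
    have h : ε.toRingHom ((2⁻¹ : ℝ) • (ExteriorAlgebra.ι ℝ (B.dual b a) *
        ExteriorAlgebra.ι ℝ (B.dual b c))) = 0 := by
      change ε _ = 0
      rw [map_smul, map_mul, hι, zero_mul, smul_zero]
    rw [map_mul, MvPowerSeries.map_C, h, map_zero, mul_zero]
  have hS : MvPowerSeries.map ε.toRingHom (sSeries B b) = jDetSqrt b := by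
    rw [sSeries, map_mul, halg, map_sum, Finset.sum_range_succ', Finset.sum_eq_zero fun k _ => ?_]
    · rw [hsmul, pow_zero, map_one, Nat.factorial_zero, Nat.cast_one, inv_one, one_smul, zero_add,
        mul_one]
    · rw [hsmul, map_pow, hr, zero_pow (Nat.succ_ne_zero k), smul_zero]
  rw [← hS, MvPowerSeries.coeff_map]
  rfl

/-- On `S𝔤 ⊗ 1`, only the scalar part of the quantization map is seen. -/
theorem quantization_sym (s : SymmetricAlgebra ℝ 𝔤) : quantization B b (s ⊗ₜ 1) =
    symmetrization 𝔤 (symDiffOp b (jDetSqrt b) s) ⊗ₜ 1 := by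
  have : FiniteDimensional ℝ 𝔤 := Module.Finite.of_basis b
  have h1 : weilDiffOp B b (sSeries B b) (s ⊗ₜ 1) = symDiffOp b (jDetSqrt b) s ⊗ₜ 1 := by
    have hfin : (Function.support fun α =>
        MvPowerSeries.coeff α (jDetSqrt b) • symPartial b α s).Finite :=
      (symPartial_finite b s).subset fun α hα h0 => hα (by
        have h0' : symPartial b α s = 0 := h0
        simp [h0'])
    refine Eq.trans (finsum_congr fun α => ?_) (AddMonoidHom.map_finsum
      ((TensorProduct.mk ℝ (SymmetricAlgebra ℝ 𝔤) (ExteriorAlgebra ℝ 𝔤)).flip 1).toAddMonoidHom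
        hfin).symm
    rw [TensorProduct.map_tmul, algebraMapInv_extContrHom, algebraMapInv_coeff_sSeries,
      TensorProduct.tmul_smul]
    rfl
  rw [quantization, LinearMap.comp_apply, h1, TensorProduct.map_tmul, cliffordQuantization_eq]
  congr 1
  exact extToCl_one B

theorem env_tmul_one_injective :
    Function.Injective fun u : UniversalEnvelopingAlgebra ℝ 𝔤 => (u ⊗ₜ[ℝ] 1 : NCWeil B) := by
  have : Function.Injective (algebraMap ℝ B.Cl) := FaithfulSMul.algebraMap_injective ℝ _
  exact Algebra.TensorProduct.includeLeft_injective (S := ℝ) this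

/-- The augmentation of `Λ𝔤` kills the differentials of basic elements: the only part of `d` that
lowers the exterior degree is `∑_a e_a ι_{e^a}`. -/
theorem augmentation_weilD {w : Weil 𝔤} (hw : w ∈ (weil B b).basic) :
    TensorProduct.rid ℝ _ (TensorProduct.map LinearMap.id
      (ExteriorAlgebra.algebraMapInv : ExteriorAlgebra ℝ 𝔤 →ₐ[ℝ] ℝ).toLinearMap
        (weilD B b w)) = 0 := by
  set ε : ExteriorAlgebra ℝ 𝔤 →ₐ[ℝ] ℝ := ExteriorAlgebra.algebraMapInv with hε
  have hι : ∀ v, ε (ExteriorAlgebra.ι ℝ v) = 0 := fun v => ExteriorAlgebra.lift_ι_apply _ _ _ _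
  have hD : ∀ ω, ε (extD B b ω) = 0 := fun ω => by
    simp only [extD, LinearMap.smul_apply, LinearMap.sum_apply, LinearMap.comp_apply,
      LinearMap.mulLeft_apply, map_smul, map_sum, map_mul, hι, zero_mul, Finset.sum_const_zero,
      smul_zero]
  suffices h : ∀ w : Weil 𝔤, TensorProduct.map LinearMap.id ε.toLinearMap (weilD B b w) =
      ∑ a, TensorProduct.map (LinearMap.mulLeft ℝ (SymmetricAlgebra.ι ℝ 𝔤 (b a))) ε.toLinearMap
        (weilContr B (B.dual b a) w) by
    have h0 : ∀ a, weilContr B (B.dual b a) w = 0 := fun a => (hw (B.dual b a)).1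
    rw [h, Finset.sum_eq_zero fun a _ => by rw [h0, map_zero], map_zero]
  intro w
  suffices h : TensorProduct.map LinearMap.id ε.toLinearMap ∘ₗ weilD B b =
      ∑ a, TensorProduct.map (LinearMap.mulLeft ℝ (SymmetricAlgebra.ι ℝ 𝔤 (b a))) ε.toLinearMap ∘ₗ
        weilContr B (B.dual b a) by
    simpa [LinearMap.sum_apply] using LinearMap.congr_fun h w
  refine weil_tmul_ext fun s ω => ?_
  simp only [LinearMap.comp_apply, LinearMap.sum_apply, weilD_tmul, map_add, map_sum,
    TensorProduct.map_tmul, LinearMap.id_apply, AlgHom.toLinearMap_apply, map_mul, hι, zero_mul, hD,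
    TensorProduct.tmul_zero, Finset.sum_const_zero, zero_add, add_zero, weilContr_tmul,
    LinearMap.mulLeft_apply]

/-- Invariant polynomials are basic cocycles of `W𝔤`. -/
theorem sym_mem_cocycles {p : SymmetricAlgebra ℝ 𝔤} (hp : p ∈ symInvariants 𝔤) :
    (p ⊗ₜ 1 : Weil 𝔤) ∈ (weil B b).cocycles := by
  have hL : ∀ ξ : 𝔤, symLie ξ p = 0 := hp
  have h1 : ∀ ξ, extLie ξ (1 : ExteriorAlgebra ℝ 𝔤) = 0 := fun ξ => cliffordDer_one _ _
  refine ⟨fun ξ => ⟨?_, ?_⟩, ?_⟩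
  · change weilContr B ξ _ = 0
    rw [weilContr_tmul, extContr_one, TensorProduct.tmul_zero]
  · change weilLie 𝔤 ξ _ = 0
    rw [weilLie_tmul, hL, h1, TensorProduct.tmul_zero, TensorProduct.zero_tmul, add_zero]
  · change weilD B b _ = 0
    simp only [weilD_tmul, hL, extContr_one, extD_one, TensorProduct.tmul_zero,
      TensorProduct.zero_tmul, Finset.sum_const_zero, add_zero]

variable (𝔤) in
/-- The Duflo map `sym ∘ Ĵ^{1/2} : S𝔤 → U𝔤`. -/
def dufloMap : SymmetricAlgebra ℝ 𝔤 →ₗ[ℝ] UniversalEnvelopingAlgebra ℝ 𝔤 :=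
  symmetrization 𝔤 ∘ₗ symDiffOp b (jDetSqrt b)

theorem dufloMap_bijective : Function.Bijective (dufloMap 𝔤 b) := by
  have : FiniteDimensional ℝ 𝔤 := Module.Finite.of_basis b
  exact symmetrization_bijective.comp (symDiffOp_bijective b _ (constantCoeff_jDetSqrt b))

theorem dufloMap_tmul_one (p : SymmetricAlgebra ℝ 𝔤) :
    (dufloMap 𝔤 b p ⊗ₜ 1 : NCWeil B) = quantization B b (p ⊗ₜ 1) := (quantization_sym B b p).symm

include B in
theorem dufloMap_one : dufloMap 𝔤 b 1 = 1 :=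
  env_tmul_one_injective B ((dufloMap_tmul_one B b 1).trans (quantization_one B b))

include B in
/-- The Duflo map is equivariant: this is the equivariance of the quantization map on `S𝔤 ⊗ 1`. -/
theorem envLie_dufloMap (ξ : 𝔤) (p : SymmetricAlgebra ℝ 𝔤) :
    envLie 𝔤 ξ (dufloMap 𝔤 b p) = dufloMap 𝔤 b (symLie ξ p) := by
  refine env_tmul_one_injective B ?_
  have h1 : extLie ξ (1 : ExteriorAlgebra ℝ 𝔤) = 0 := cliffordDer_one _ _
  have h2 : B.clLie ξ 1 = 0 := cliffordDer_one _ _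
  have h := quantization_lie B b ξ (p ⊗ₜ 1)
  rw [weilLie_tmul, h1, TensorProduct.tmul_zero, add_zero, ← dufloMap_tmul_one,
    ← dufloMap_tmul_one, ncWeilLie_tmul, h2, TensorProduct.tmul_zero, add_zero] at h
  exact h.symm

include B in
/-- The Duflo map is multiplicative on invariants: the defect `q - p p'` is the differential of a
basic element of `W𝔤`, hence vanishes. -/
theorem dufloMap_mul {p p' : SymmetricAlgebra ℝ 𝔤} (hp : p ∈ symInvariants 𝔤)
    (hp' : p' ∈ symInvariants 𝔤) :
    dufloMap 𝔤 b (p * p') = dufloMap 𝔤 b p * dufloMap 𝔤 b p' := by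
  obtain ⟨u, hu, h⟩ := quantization_mul B b (sym_mem_cocycles B b hp) (sym_mem_cocycles B b hp')
  -- The coboundary is `𝒬 (d w)` for a basic `w`; with `q` the preimage of the product under the
  -- Duflo map, injectivity of `𝒬` gives `d w = (q - p p') ⊗ 1`, to which the augmentation applies.
  obtain ⟨w, rfl⟩ := (quantization_bijective B b).2 u
  obtain ⟨q, hq⟩ := (dufloMap_bijective b).2 (dufloMap 𝔤 b p * dufloMap 𝔤 b p')
  have hw := ((quantization_isMorphism B b).mem_basic_iff (quantization_bijective B b).1).1 hu
  rw [← (quantization_isMorphism B b).d, Algebra.TensorProduct.tmul_mul_tmul, one_mul,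
    ← dufloMap_tmul_one, ← dufloMap_tmul_one, Algebra.TensorProduct.tmul_mul_tmul, one_mul, ← hq,
    dufloMap_tmul_one, ← map_sub, ← TensorProduct.sub_tmul] at h
  have h2 : weilD B b w = (q - p * p') ⊗ₜ 1 := (quantization_bijective B b).1 h
  have h3 := augmentation_weilD B b hw
  rw [h2, TensorProduct.map_tmul, AlgHom.toLinearMap_apply, map_one, TensorProduct.rid_tmul,
    one_smul, LinearMap.id_apply, sub_eq_zero] at h3
  rw [← hq, h3]

theorem mem_center_iff_envLie {x : UniversalEnvelopingAlgebra ℝ 𝔤} :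
    x ∈ Subalgebra.center ℝ (UniversalEnvelopingAlgebra ℝ 𝔤) ↔ ∀ ξ, envLie 𝔤 ξ x = 0 := by
  rw [Subalgebra.mem_center_iff]
  refine ⟨fun h ξ => by rw [envLie_apply, h, sub_self], fun h y => ?_⟩
  induction y using env_induction with
  | halg r => exact Algebra.commutes r x
  | hι v =>
    have := h v
    rwa [envLie_apply, sub_eq_zero] at this
  | hmul y z hy hz => rw [mul_assoc, hz, ← mul_assoc, hy, mul_assoc]
  | hadd y z hy hz => rw [add_mul, hy, hz, mul_add]

include B in
/-- Duflo's theorem for a quadratic Lie algebra. -/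
theorem exists_duflo_algEquiv : ∃ Ψ : symInvariants 𝔤 ≃ₐ[ℝ]
    Subalgebra.center ℝ (UniversalEnvelopingAlgebra ℝ 𝔤), ∀ p : symInvariants 𝔤,
      (Ψ p : UniversalEnvelopingAlgebra ℝ 𝔤) =
        symmetrization 𝔤 (symDiffOp b (jDetSqrt b) p) := by
  have hmem : ∀ p, dufloMap 𝔤 b p ∈ Subalgebra.center ℝ (UniversalEnvelopingAlgebra ℝ 𝔤) ↔
      p ∈ symInvariants 𝔤 := fun p => by
    rw [mem_center_iff_envLie]
    refine forall_congr' fun ξ => ?_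
    rw [envLie_dufloMap B b, map_eq_zero_iff _ (dufloMap_bijective b).1]
  let f : symInvariants 𝔤 →ₐ[ℝ] UniversalEnvelopingAlgebra ℝ 𝔤 :=
    AlgHom.ofLinearMap (dufloMap 𝔤 b ∘ₗ (symInvariants 𝔤).val.toLinearMap) (dufloMap_one B b)
      fun p p' => dufloMap_mul B b p.2 p'.2
  have hf : ∀ p, f p = dufloMap 𝔤 b p := fun p => rfl
  refine ⟨AlgEquiv.ofBijective (f.codRestrict _ fun p => (hmem p).2 p.2)
    ⟨fun p p' h => ?_, fun x => ?_⟩, fun p => rfl⟩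
  · exact Subtype.ext ((dufloMap_bijective b).1 (congrArg Subtype.val h))
  · obtain ⟨p, hp⟩ := (dufloMap_bijective b).2 (x : UniversalEnvelopingAlgebra ℝ 𝔤)
    exact ⟨⟨p, (hmem p).1 (hp ▸ x.2)⟩, Subtype.ext hp⟩

end Duflo

end WeilQuant

end

theorem mainTheorem2 {ι 𝔤 A : Type*} [Fintype ι] [DecidableEq ι] [LieRing 𝔤] [LieAlgebra ℝ 𝔤]
    (b : Module.Basis ι ℝ 𝔤) (B : WeilQuant.InvariantForm 𝔤)
    [Ring A] [Algebra ℝ A] (𝒜 : ZMod 2 → Submodule ℝ A) [GradedAlgebra 𝒜]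
    (D : WeilQuant.GDifferentialAlgebra 𝔤 𝒜) :
    (∃ Φ : WeilQuant.EquivariantCohomology B b D ≃ₐ[ℝ] WeilQuant.NCEquivariantCohomology B b D,
      ∀ z : (WeilQuant.weilTensor B b D).cocycles,
        ∃ h : WeilQuant.quantizationTensor B b 𝒜 z ∈ (WeilQuant.ncWeilTensor B b D).cocycles,
          Φ (Ideal.Quotient.mk _ z) = Ideal.Quotient.mk _ ⟨_, h⟩) ∧
    ∃ Ψ : WeilQuant.symInvariants 𝔤 ≃ₐ[ℝ]
        Subalgebra.center ℝ (UniversalEnvelopingAlgebra ℝ 𝔤),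
      ∀ p : WeilQuant.symInvariants 𝔤,
        (Ψ p : UniversalEnvelopingAlgebra ℝ 𝔤) =
          WeilQuant.symmetrization 𝔤 (WeilQuant.symDiffOp b (WeilQuant.jDetSqrt b) p) := by
  refine ⟨?_, WeilQuant.exists_duflo_algEquiv B b⟩
  exact (WeilQuant.quantizationTensor_isMorphism B b D.toGDerivations).exists_algEquiv
    (WeilQuant.quantizationTensor_bijective B b) (WeilQuant.quantizationTensor_one B b)
    fun x hx y hy => WeilQuant.quantizationTensor_mul B b D.toGDerivations D.isCartan hx hy
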